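/- Let $k$ be an algebraically closed field. A $k$-algebra $R=\bigoplus_{n\ge 0}R_n$ with $R_iR_j\subseteq R_{i+j}$ is connected graded if $R_0=k$; write $R_{\ge 1}=\bigoplus_{n\ge1}R_n$ and $k=R/R_{\ge 1}$ for the trivial module. Such an $R$ is Artin-Schelter (AS) regular of dimension $d$ if it has (left and right) global dimension $d$; $\operatorname{Ext}^i_R({}_Rk,R)$ is $0$ for $i\ne d$ and is a shift $k(l)$ of the trivial right module for $i=d$, and the same holds with left and right exchanged; and there is $c>0$ with $\dim_k R_n<c\,n^c$ for all $n\ge 1$. Let $A$ be a graded subalgebra of a connected graded algebra $B$. Then $B$ is a double extension of $A$ if there are homogeneous $y_1,y_2\in B$ of positive degree such that $B$ is generated by $A,y_1,y_2$ and: (R) there is a homogeneous relation $y_2y_1=p_{12}y_1y_2+p_{11}y_1^2+\tau_1y_1+\tau_2y_2+\tau_0$ with $p_{12},p_{11}\in k$ and $\tau_1,\tau_2,\tau_0\in A$; the elements $y_1^{n_1}y_2^{n_2}$ $(n_1,n_2\ge0)$ form a basis of $B$ as a left $A$-module; and $y_1A+y_2A\subseteq Ay_1+Ay_2+A$; (L)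 there is a homogeneous relation $y_1y_2=p'_{12}y_2y_1+p'_{11}y_1^2+y_1\tau'_1+y_2\tau'_2+\tau'_0$ with $p'_{12},p'_{11}\in k$ and $\tau'_1,\tau'_2,\tau'_0\in A$; the elements $y_2^{n_1}y_1^{n_2}$ $(n_1,n_2\ge0)$ form a basis of $B$ as a right $A$-module; and $Ay_1+Ay_2\subseteq y_1A+y_2A+A$. **Proposition 0.3.** Let $B$ be an AS-regular domain of global dimension four that is generated as a $k$-algebra by four $k$-linearly independent elements of degree $1$. The following are equivalent: 1. $B$ is a double extension of some graded subalgebra $A$; 2. $B$ is a double extension of some graded subalgebra $A$ that is AS-regular of dimension two; 3. there are $x_1,x_2\in B_1$ such that, with $V=kx_1+kx_2$, (a) $B$ has a quadratic relation involving only $x_1,x_2$, i.e. some nonzero element of $V\otimes_kV$ is sent to $0$ by the multiplication of $B$, and (b) $B/(x_1,x_2)$ is AS-regular of dimension two. -/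

import Mathlib

open CategoryTheory TensorProduct

universe u

noncomputable section

/-- The (left) global dimension of a ring: the supremum of the projective dimensions of its
left modules.  The right global dimension of `R` is `globalDim Rᵐᵒᵖ`. -/
def globalDim (R : Type u) [Ring R] : WithBot ℕ∞ :=
  ⨆ M : ModuleCat.{u} R, projectiveDimension M

section Regular

variable {k : Type*} [Field k] {R : Type u} [Ring R] [Algebra k R]

/-- `R = ⨁ 𝒜 n` is a connected graded `k`-algebra: `𝒜 i * 𝒜 j ⊆ 𝒜 (i + j)`, `R` is the internal
direct sum of the `𝒜 n`, and `𝒜 0` is the copy of `k` in `R` (with `1 ≠ 0`). -/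
structure IsConnectedGraded (𝒜 : ℕ → Submodule k R) : Prop where
  nontrivial : Nontrivial R
  gradedMonoid : SetLike.GradedMonoid 𝒜
  isInternal : DirectSum.IsInternal 𝒜
  zero_eq : 𝒜 0 = 1

/-- The left ideal generated by the homogeneous elements of positive degree; for a connected
graded algebra it is the two-sided ideal `⨁_{n ≥ 1} 𝒜 n`. -/
def augmentationIdeal (𝒜 : ℕ → Submodule k R) : Ideal R :=
  Ideal.span {a | ∃ n, 0 < n ∧ a ∈ 𝒜 n}

/-- The trivial left module `k = R / R_{≥ 1}`. -/
def trivialModule (𝒜 : ℕ → Submodule k R) : ModuleCat.{u} R :=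
  ModuleCat.of R (R ⧸ augmentationIdeal 𝒜)

/-- Right multiplication `x ↦ x * a`, an endomorphism of the left module `R`. -/
def rightMulHom (a : R) : ModuleCat.of R R ⟶ ModuleCat.of R R :=
  ModuleCat.ofHom (LinearMap.toSpanSingleton R R a)

/-- The right action of `R` on `Ext^i_R(M, R)` induced by the right action of `R` on the second
argument. -/
def extRightMul {M : ModuleCat.{u} R} {i : ℕ} (α : Abelian.Ext M (ModuleCat.of R R) i) (a : R) :
    Abelian.Ext M (ModuleCat.of R R) i :=
  α.comp (Abelian.Ext.mk₀ (rightMulHom a)) (add_zero i)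

/-- The left half of the Gorenstein condition: `Ext^i_R(k, R)` is zero for `i ≠ d`, and for
`i = d` it is the trivial right module, i.e. it is one-dimensional over `k` and all homogeneous
elements of positive degree act on it by zero.  (A one-dimensional graded right module is
concentrated in a single degree, so it is a shift `k(l)` for some integer `l`.) -/
structure IsLeftGorenstein (𝒜 : ℕ → Submodule k R) (d : ℕ) : Prop where
  subsingleton : ∀ i : ℕ, i ≠ d →
    Subsingleton (Abelian.Ext (trivialModule 𝒜) (ModuleCat.of R R) i)
  one_dimensional : ∃ e : Abelian.Ext (trivialModule 𝒜) (ModuleCat.of R R) d ≃+ k,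
    ∀ (α : Abelian.Ext (trivialModule 𝒜) (ModuleCat.of R R) d) (c : k),
      e (extRightMul α (algebraMap k R c)) = e α * c
  trivial_action : ∀ (α : Abelian.Ext (trivialModule 𝒜) (ModuleCat.of R R) d) (n : ℕ),
    0 < n → ∀ a ∈ 𝒜 n, extRightMul α a = 0

/-- The grading of the opposite algebra. -/
def opGrading (𝒜 : ℕ → Submodule k R) : ℕ → Submodule k Rᵐᵒᵖ :=
  fun n => (𝒜 n).map (MulOpposite.opLinearEquiv k : R ≃ₗ[k] Rᵐᵒᵖ).toLinearMap

/-- `(R, 𝒜)` is an Artin-Schelter regular algebra of (global) dimension `d`: it is connected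
graded, has left and right global dimension `d`, satisfies the Gorenstein condition on both sides
(right modules are left modules over the opposite algebra), and its homogeneous components have
polynomially bounded dimension. -/
structure IsASRegular (𝒜 : ℕ → Submodule k R) (d : ℕ) : Prop where
  connected : IsConnectedGraded 𝒜
  globalDim_left : globalDim R = (d : WithBot ℕ∞)
  globalDim_right : globalDim Rᵐᵒᵖ = (d : WithBot ℕ∞)
  gorenstein_left : IsLeftGorenstein 𝒜 d
  gorenstein_right : IsLeftGorenstein (opGrading 𝒜) d
  finite_component : ∀ n, Module.Finite k (𝒜 n)
  growth : ∃ c : ℕ, 0 < c ∧ ∀ n, 0 < n → Module.finrank k (𝒜 n) < c * n ^ c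

end Regular

section DoubleExtension

variable {k : Type*} [Field k] {B : Type u} [Ring B] [Algebra k B]

/-- The grading that a subalgebra inherits. -/
def subalgebraGrading (ℬ : ℕ → Submodule k B) (A : Subalgebra k B) : ℕ → Submodule k A :=
  fun n => (ℬ n).comap A.val.toLinearMap

/-- The quotient `B / (x₁, x₂)` by the two-sided ideal generated by `x₁` and `x₂`. -/
abbrev QuotientByPair (x₁ x₂ : B) : Type u :=
  (TwoSidedIdeal.span {x₁, x₂}).ringCon.Quotient

/-- The grading that `B / (x₁, x₂)` inherits: the images of the homogeneous components. -/
def quotientGrading (k : Type*) [Field k] [Algebra k B] (ℬ : ℕ → Submodule k B) (x₁ x₂ : B) :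
    ℕ → Submodule k (QuotientByPair x₁ x₂) :=
  fun n => (ℬ n).map ((TwoSidedIdeal.span {x₁, x₂}).ringCon.mkₐ k).toLinearMap

/-- `B` has a quadratic relation involving only `x₁` and `x₂`: with `V = k x₁ + k x₂`, there is a
nonzero element of `V ⊗ V` that the multiplication of `B` sends to zero. -/
def HasQuadraticRelation (k : Type*) [Field k] [Algebra k B] (x₁ x₂ : B) : Prop :=
  ∃ f : Submodule.span k {x₁, x₂} ⊗[k] Submodule.span k {x₁, x₂}, f ≠ 0 ∧
    Submodule.mulMap (Submodule.span k {x₁, x₂}) (Submodule.span k {x₁, x₂}) f = 0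

/-- `B` is a right double extension of the subalgebra `A` by `y₁` (of degree `d₁`) and `y₂`
(of degree `d₂`). -/
structure IsRightDoubleExtension (ℬ : ℕ → Submodule k B) (A : Subalgebra k B)
    (d₁ d₂ : ℕ) (y₁ y₂ : B) : Prop where
  generated : Algebra.adjoin k ((A : Set B) ∪ {y₁, y₂}) = ⊤
  /-- `y₂ y₁ = p₁₂ y₁ y₂ + p₁₁ y₁² + τ₁ y₁ + τ₂ y₂ + τ₀`, homogeneous of degree `d₁ + d₂` -/
  relation : ∃ p₁₂ p₁₁ : k, ∃ τ₁ ∈ A, ∃ τ₂ ∈ A, ∃ τ₀ ∈ A,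
    p₁₁ • y₁ ^ 2 ∈ ℬ (d₁ + d₂) ∧ τ₁ ∈ ℬ d₂ ∧ τ₂ ∈ ℬ d₁ ∧ τ₀ ∈ ℬ (d₁ + d₂) ∧
    y₂ * y₁ = p₁₂ • (y₁ * y₂) + p₁₁ • y₁ ^ 2 + τ₁ * y₁ + τ₂ * y₂ + τ₀
  /-- the `y₁ ^ n₁ * y₂ ^ n₂` form a basis of `B` as a left `A`-module -/
  basis : ∀ b : B, ∃! c : ℕ × ℕ →₀ A, b = c.sum fun n a => (a : B) * (y₁ ^ n.1 * y₂ ^ n.2)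
  /-- `y₁ A + y₂ A ⊆ A y₁ + A y₂ + A` -/
  commutation : ∀ a ∈ A, ∀ y ∈ ({y₁, y₂} : Set B),
    ∃ a₁ ∈ A, ∃ a₂ ∈ A, ∃ a₀ ∈ A, y * a = a₁ * y₁ + a₂ * y₂ + a₀

/-- `B` is a left double extension of the subalgebra `A` by `y₁` (of degree `d₁`) and `y₂`
(of degree `d₂`). -/
structure IsLeftDoubleExtension (ℬ : ℕ → Submodule k B) (A : Subalgebra k B)
    (d₁ d₂ : ℕ) (y₁ y₂ : B) : Prop where
  generated : Algebra.adjoin k ((A : Set B) ∪ {y₁, y₂}) = ⊤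
  /-- `y₁ y₂ = p₁₂ y₂ y₁ + p₁₁ y₁² + y₁ τ₁ + y₂ τ₂ + τ₀`, homogeneous of degree `d₁ + d₂` -/
  relation : ∃ p₁₂ p₁₁ : k, ∃ τ₁ ∈ A, ∃ τ₂ ∈ A, ∃ τ₀ ∈ A,
    p₁₁ • y₁ ^ 2 ∈ ℬ (d₁ + d₂) ∧ τ₁ ∈ ℬ d₂ ∧ τ₂ ∈ ℬ d₁ ∧ τ₀ ∈ ℬ (d₁ + d₂) ∧
    y₁ * y₂ = p₁₂ • (y₂ * y₁) + p₁₁ • y₁ ^ 2 + y₁ * τ₁ + y₂ * τ₂ + τ₀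
  /-- the `y₂ ^ n₁ * y₁ ^ n₂` form a basis of `B` as a right `A`-module -/
  basis : ∀ b : B, ∃! c : ℕ × ℕ →₀ A, b = c.sum fun n a => (y₂ ^ n.1 * y₁ ^ n.2) * (a : B)
  /-- `A y₁ + A y₂ ⊆ y₁ A + y₂ A + A` -/
  commutation : ∀ a ∈ A, ∀ y ∈ ({y₁, y₂} : Set B),
    ∃ a₁ ∈ A, ∃ a₂ ∈ A, ∃ a₀ ∈ A, a * y = y₁ * a₁ + y₂ * a₂ + a₀

/-- The connected graded algebra `B` is a double extension of `A`: `A` is a graded subalgebra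
of `B`, and for some homogeneous `y₁`, `y₂` of positive degree, `B` is both a right and a left
double extension of `A` by the same `y₁`, `y₂`. -/
def IsDoubleExtension (ℬ : ℕ → Submodule k B) (A : Subalgebra k B) : Prop :=
  IsConnectedGraded ℬ ∧ IsConnectedGraded (subalgebraGrading ℬ A) ∧
  ∃ d₁ d₂ : ℕ, 0 < d₁ ∧ 0 < d₂ ∧ ∃ y₁ ∈ ℬ d₁, ∃ y₂ ∈ ℬ d₂,
    IsRightDoubleExtension ℬ A d₁ d₂ y₁ y₂ ∧ IsLeftDoubleExtension ℬ A d₁ d₂ y₁ y₂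

end DoubleExtension

end

-- Numerics. The trivial module of `B` has a minimal free resolution 0 → B(-l) → B(1-l)⁴ → ⨁ B(-e i)
-- → B(-1)⁴ → B → k → 0. Its shape comes from the Gorenstein condition: vanishing of Ext in degrees
-- 1 to 3 keeps the dual complex exact, and a one-dimensional top Ext with trivial action makes the
-- last free module have rank one, with the entries of the last differential a basis of `B₁`. The
-- resolution and its dual yield two equations for the Hilbert series. Their behaviour as `t` tends
-- to 1 forces six relations, and their sum at a point below 1 forces `l = 4`
-- (`card_eq_six_and_eq_four`). So all relations are quadratic and `B` has the Hilbert function of a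
-- polynomial ring in four variables (`finrank_four`).
--
-- Cubic relations. Let `E = B₁`, let `Q ⊆ E ⊗ E` be the space of relations and `W = (E ⊗ Q) ∩ (Q ⊗
-- E)`. The resolution gives `dim W ≤ 4`, while a functional on `E ⊗ E` that is nonzero on `Q`,
-- applied to the slices of elements of `W`, produces at least two independent vectors
-- (`two_le_finrank_map_cubicRelations`). The second fact uses that `B` is a domain, and both
-- directions below depend on it.
--
-- From (3) to (2). Put `V = k x₁ + k x₂` and complete to a basis by `y₁, y₂`. The relation of `B /
-- (x₁, x₂)` is a nondegenerate form `G`, and each relation `M` of `B` restricts on the `y`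
-- variables to `w M • G`. Nondegeneracy confines the vectors that `w` produces from `W` to the two
-- coordinates of `V`, so they fill this plane. Slicing the corresponding tensors puts every `x_a *
-- y_b` into `E * V` (`exists_quadraticRelation_eq_single`), and the opposite algebra gives the
-- reverse inclusion, hence `V * E = E * V`. Ordered monomials then span, and the Hilbert function
-- makes them a basis (`isDoubleExtension_of_commutation`).
--
-- From (1) to (3). Comparing dimensions in the free `A`-module `B` forces both adjoined elements
-- into degree one. The delicate case has only one of them in degree one; it is excluded because the
-- square of a three-dimensional space of linear forms has dimension at least six
-- (`six_le_finrank_mul_self`). Then `dim A₁ = 2` and `dim A₂ = 3`, so `A₁` carries a quadratic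
-- relation, and dividing by `A₁` leaves an algebra with basis `y₁ ^ i * y₂ ^ j` and the relation
-- `y₂ * y₁ = q • (y₁ * y₂) + p • (y₁ * y₁)`, `q ≠ 0`.
--
-- Such a quantum plane is regular of dimension two by an explicit Koszul resolution
-- (`IsQuantumPlane.isASRegular`). This is applied to `A` in one direction and to the quotient in
-- the other.

universe w

noncomputable section

/-! ### Dimension shifting for Ext along syzygies. -/

section Syzygy

open Abelian

variable {R : Type u} [Ring R]

/-- An extension class that induces, by composition, isomorphisms
`Ext^(i+1) K Y ≃ Ext^(i+1+n) X Y`, as the class of an `n`-th syzygy does. -/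
structure IsSyzygyClass {X K : ModuleCat.{u} R} {n : ℕ} (ε : Ext X K n) : Prop where
  injective : ∀ (Y : ModuleCat.{u} R) (i m : ℕ) (h : n + (i + 1) = m) (β : Ext K Y (i + 1)),
    ε.comp β h = 0 → β = 0
  surjective : ∀ (Y : ModuleCat.{u} R) (i m : ℕ) (h : n + (i + 1) = m) (α : Ext X Y m),
    ∃ β : Ext K Y (i + 1), ε.comp β h = α

lemma IsSyzygyClass.id (X : ModuleCat.{u} R) : IsSyzygyClass (Ext.mk₀ (𝟙 X)) where
  injective Y i m h β hβ := by
    obtain rfl : m = i + 1 := by omega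
    simpa using hβ
  surjective Y i m h α := by
    obtain rfl : m = i + 1 := by omega
    exact ⟨α, by simp⟩

/-- Positive Ext groups out of the projective middle term vanish, so composition with the connecting
class is bijective in positive degrees. In degree zero it is only surjective, which is why a syzygy
class is tested from degree `i + 1` on and maps are left to `syzygyConnecting`. -/
lemma IsSyzygyClass.step {X : ModuleCat.{u} R} {S : ShortComplex (ModuleCat.{u} R)}
    (hS : S.ShortExact) [Projective S.X₂] {n : ℕ} {ε : Ext X S.X₃ n} (hε : IsSyzygyClass ε) :
    IsSyzygyClass (ε.comp hS.extClass (rfl : n + 1 = n + 1)) where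
  injective Y i m h β hβ := by
    rw [Ext.comp_assoc _ _ _ rfl (show 1 + (i + 1) = (i + 1) + 1 by omega) (by omega)] at hβ
    obtain ⟨x, rfl⟩ := Ext.contravariant_sequence_exact₁ hS _ β (by omega)
      (hε.injective Y (i + 1) m (by omega) _ hβ)
    rw [x.eq_zero_of_projective, Ext.comp_zero]
  surjective Y i m h α := by
    obtain ⟨β, rfl⟩ := hε.surjective Y (i + 1) m (by omega) α
    obtain ⟨x, rfl⟩ := Ext.contravariant_sequence_exact₃ hS _ β (Ext.eq_zero_of_projective _)
      (show 1 + (i + 1) = i + 1 + 1 by omega)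
    exact ⟨x, Ext.comp_assoc _ _ _ rfl _ (by omega)⟩

/-- The connecting map `Hom(K, Y) → Ext^(n+1) X Y` attached to a syzygy class and a short exact
sequence. -/
def syzygyConnecting {X : ModuleCat.{u} R} {S : ShortComplex (ModuleCat.{u} R)}
    (hS : S.ShortExact) {n : ℕ} (ε : Ext X S.X₃ n) (Y : ModuleCat.{u} R) :
    (S.X₁ ⟶ Y) →+ Ext X Y (n + 1) where
  toFun f := (ε.comp hS.extClass (rfl : n + 1 = n + 1)).comp (Ext.mk₀ f) (add_zero _)
  map_zero' := by simp
  map_add' f g := by simp [Ext.mk₀_add, Ext.comp_add]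

/-- Naturality in the coefficients. With right multiplications as `g`, it transports the right
module structure of `R` to Ext. -/
lemma syzygyConnecting_comp {X : ModuleCat.{u} R} {S : ShortComplex (ModuleCat.{u} R)}
    (hS : S.ShortExact) {n : ℕ} (ε : Ext X S.X₃ n) {Y Z : ModuleCat.{u} R} (f : S.X₁ ⟶ Y)
    (g : Y ⟶ Z) :
    syzygyConnecting hS ε Z (f ≫ g) =
      (syzygyConnecting hS ε Y f).comp (Ext.mk₀ g) (add_zero _) := by
  simp only [syzygyConnecting, AddMonoidHom.coe_mk, ZeroHom.coe_mk]
  rw [← Ext.mk₀_comp_mk₀]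
  exact (Ext.comp_assoc_of_third_deg_zero _ _ _ _).symm

/-- Together with `syzygyConnecting_eq_zero_iff` this presents `Ext^(n+1) X Y` as the cokernel of
the restriction of maps from `S.X₂` to `S.X₁`, so that conditions on Ext become conditions on
matrices over `R`. -/
lemma syzygyConnecting_surjective {X : ModuleCat.{u} R} {S : ShortComplex (ModuleCat.{u} R)}
    (hS : S.ShortExact) [Projective S.X₂] {n : ℕ} {ε : Ext X S.X₃ n} (hε : IsSyzygyClass ε)
    (Y : ModuleCat.{u} R) : Function.Surjective (syzygyConnecting hS ε Y) := by
  intro α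
  obtain ⟨β, rfl⟩ := hε.surjective Y 0 (n + 1) rfl α
  obtain ⟨x, rfl⟩ := Ext.contravariant_sequence_exact₃ hS _ β (Ext.eq_zero_of_projective _)
    (show 1 + 0 = 0 + 1 by omega)
  obtain ⟨f, rfl⟩ := Ext.mk₀_bijective _ _ |>.2 x
  exact ⟨f, Ext.comp_assoc_of_third_deg_zero _ _ _ _⟩

lemma syzygyConnecting_eq_zero_iff {X : ModuleCat.{u} R} {S : ShortComplex (ModuleCat.{u} R)}
    (hS : S.ShortExact) {n : ℕ} {ε : Ext X S.X₃ n} (hε : IsSyzygyClass ε)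
    {Y : ModuleCat.{u} R} (f : S.X₁ ⟶ Y) :
    syzygyConnecting hS ε Y f = 0 ↔ ∃ g : S.X₂ ⟶ Y, S.f ≫ g = f := by
  have key : syzygyConnecting hS ε Y f =
      ε.comp (hS.extClass.comp (Ext.mk₀ f) (add_zero 1)) (rfl : n + 1 = n + 1) :=
    Ext.comp_assoc_of_third_deg_zero _ _ _ _
  rw [key]
  constructor
  · intro h
    have h' := hε.injective Y 0 (n + 1) rfl _ h
    obtain ⟨x, hx⟩ := Ext.contravariant_sequence_exact₁ hS _ (Ext.mk₀ f) (add_zero 1) h'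
    obtain ⟨g, rfl⟩ := Ext.mk₀_bijective _ _ |>.2 x
    rw [Ext.mk₀_comp_mk₀] at hx
    exact ⟨g, (Ext.mk₀_bijective _ _).1 hx⟩
  · rintro ⟨g, rfl⟩
    rw [← Ext.mk₀_comp_mk₀, ← Ext.comp_assoc_of_second_deg_zero, hS.extClass_comp,
      Ext.zero_comp, Ext.comp_zero]

/-- The short complex `ker g → P → M` of a linear map. -/
abbrev kernelComplex {P M : Type u} [AddCommGroup P] [Module R P] [AddCommGroup M] [Module R M]
    (g : P →ₗ[R] M) : ShortComplex (ModuleCat.{u} R) :=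
  ShortComplex.mk (ModuleCat.ofHom (LinearMap.ker g).subtype) (ModuleCat.ofHom g)
    (by ext x; exact x.2)

lemma kernelComplex_shortExact {P M : Type u} [AddCommGroup P] [Module R P] [AddCommGroup M]
    [Module R M] (g : P →ₗ[R] M) (hg : Function.Surjective g) :
    (kernelComplex g).ShortExact where
  exact := by
    rw [ShortComplex.ShortExact.moduleCat_exact_iff_function_exact]
    intro x
    simp [LinearMap.mem_ker]
  mono_f := (ModuleCat.mono_iff_injective _).2 Subtype.val_injective
  epi_g := (ModuleCat.epi_iff_surjective _).2 hg

lemma hasProjectiveDimensionLE_of_globalDim_le {n : ℕ} (h : globalDim R ≤ (n : WithBot ℕ∞))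
    (M : ModuleCat.{u} R) : HasProjectiveDimensionLE M n := by
  rw [← projectiveDimension_le_iff]
  exact (le_iSup (fun M : ModuleCat.{u} R => projectiveDimension M) M).trans h

end Syzygy

/-! ### Homogeneous components indexed by the integers, so that degree shifts never truncate. -/

section IntGrading

variable {k : Type*} [Field k] {R : Type u} [Ring R] [Algebra k R] {𝒜 : ℕ → Submodule k R}

/-- The grading of `R`, extended by zero to negative degrees. -/
def intGrading (𝒜 : ℕ → Submodule k R) (n : ℤ) : Submodule k R :=
  if 0 ≤ n then 𝒜 n.toNat else ⊥

lemma intGrading_natCast (n : ℕ) : intGrading 𝒜 n = 𝒜 n := by simp [intGrading]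

lemma intGrading_of_neg {n : ℤ} (hn : n < 0) : intGrading 𝒜 n = ⊥ := by
  simp [intGrading, not_le.2 hn]

lemma intGrading_zero : intGrading 𝒜 0 = 𝒜 0 := by simp [intGrading]

lemma intGrading_one : intGrading 𝒜 1 = 𝒜 1 := by simp [intGrading]

lemma intGrading_two : intGrading 𝒜 2 = 𝒜 2 := by simp [intGrading]

/-- The projection onto a homogeneous component. -/
def natComponent (h : DirectSum.IsInternal 𝒜) (n : ℕ) : R →ₗ[k] R :=
  letI := h.chooseDecomposition
  (𝒜 n).subtype ∘ₗ DirectSum.component k ℕ (fun i => 𝒜 i) n ∘ₗ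
    (DirectSum.decomposeLinearEquiv 𝒜).toLinearMap

/-- The projection onto a homogeneous component, indexed by the integers. -/
def intComponent (h : IsConnectedGraded 𝒜) (n : ℤ) : R →ₗ[k] R :=
  if 0 ≤ n then natComponent h.isInternal n.toNat else 0

lemma natComponent_mem (h : DirectSum.IsInternal 𝒜) (n : ℕ) (r : R) :
    natComponent h n r ∈ 𝒜 n := by
  simp only [natComponent, LinearMap.comp_apply]
  exact Subtype.property _

lemma natComponent_of_mem (h : DirectSum.IsInternal 𝒜) {n : ℕ} {r : R} (hr : r ∈ 𝒜 n) :
    natComponent h n r = r := by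
  let := h.chooseDecomposition
  exact DirectSum.decompose_of_mem_same 𝒜 hr

lemma natComponent_of_mem_ne (h : DirectSum.IsInternal 𝒜) {m n : ℕ} {r : R} (hr : r ∈ 𝒜 m)
    (hmn : m ≠ n) : natComponent h n r = 0 := by
  let := h.chooseDecomposition
  exact DirectSum.decompose_of_mem_ne 𝒜 hr hmn

lemma exists_sum_natComponent (h : DirectSum.IsInternal 𝒜) (r : R) :
    ∃ s : Finset ℕ, (∀ n ∉ s, natComponent h n r = 0) ∧ ∑ n ∈ s, natComponent h n r = r := by
  classical
  let := h.chooseDecomposition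
  refine ⟨(DirectSum.decompose 𝒜 r).support, fun n hn => ?_,
    DirectSum.sum_support_decompose 𝒜 r⟩
  rw [DFinsupp.notMem_support_iff] at hn
  exact congrArg Subtype.val hn

variable (h : IsConnectedGraded 𝒜)

lemma intComponent_natCast (n : ℕ) : intComponent h n = natComponent h.isInternal n := by
  simp [intComponent]

lemma intComponent_of_neg {n : ℤ} (hn : n < 0) : intComponent h n = 0 := by
  simp [intComponent, not_le.2 hn]

lemma intComponent_mem (n : ℤ) (r : R) : intComponent h n r ∈ intGrading 𝒜 n := by
  by_cases hn : 0 ≤ n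
  · lift n to ℕ using hn
    rw [intComponent_natCast, intGrading_natCast]
    exact natComponent_mem _ _ _
  · simp [intComponent, hn]

lemma intComponent_of_mem {n : ℤ} {r : R} (hr : r ∈ intGrading 𝒜 n) : intComponent h n r = r := by
  by_cases hn : 0 ≤ n
  · lift n to ℕ using hn
    rw [intGrading_natCast] at hr
    rw [intComponent_natCast, natComponent_of_mem _ hr]
  · rw [intGrading_of_neg (not_le.1 hn), Submodule.mem_bot] at hr
    simp [hr]

lemma intComponent_of_mem_ne {m n : ℤ} {r : R} (hr : r ∈ intGrading 𝒜 m) (hmn : m ≠ n) :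
    intComponent h n r = 0 := by
  by_cases hm : 0 ≤ m
  · by_cases hn : 0 ≤ n
    · lift n to ℕ using hn
      lift m to ℕ using hm
      rw [intGrading_natCast] at hr
      rw [intComponent_natCast, natComponent_of_mem_ne _ hr (by simpa using hmn)]
    · simp [intComponent, hn]
  · rw [intGrading_of_neg (not_le.1 hm), Submodule.mem_bot] at hr
    simp [hr]

lemma exists_sum_intComponent (r : R) :
    ∃ s : Finset ℤ, (∀ n ∉ s, intComponent h n r = 0) ∧ ∑ n ∈ s, intComponent h n r = r := by
  classical
  obtain ⟨s, hs, hr⟩ := exists_sum_natComponent h.isInternal r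
  refine ⟨s.map Nat.castEmbedding, fun n hn => ?_, ?_⟩
  · by_cases h0 : 0 ≤ n
    · lift n to ℕ using h0
      rw [intComponent_natCast]
      exact hs n fun hns => hn (by simpa using hns)
    · simp [intComponent, h0]
  · simpa [intComponent_natCast] using hr

lemma sum_intComponent {r : R} {s : Finset ℤ} (hs : ∀ n ∉ s, intComponent h n r = 0) :
    ∑ n ∈ s, intComponent h n r = r := by
  classical
  obtain ⟨t, ht, hr⟩ := exists_sum_intComponent h r
  conv_rhs => rw [← hr]
  rw [Finset.sum_subset (Finset.subset_union_left (s₁ := s) (s₂ := t)) fun n _ hn => hs n hn,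
    Finset.sum_subset (Finset.subset_union_right (s₁ := s) (s₂ := t)) fun n _ hn => ht n hn]

lemma eq_zero_of_intComponent {r : R} (hr : ∀ n, intComponent h n r = 0) : r = 0 := by
  rw [← sum_intComponent h (s := ∅) (r := r) fun n _ => hr n, Finset.sum_empty]

lemma ext_of_intComponent {r s : R} (hrs : ∀ n, intComponent h n r = intComponent h n s) :
    r = s := by
  rw [← sub_eq_zero]
  exact eq_zero_of_intComponent h fun n => by rw [map_sub, hrs, sub_self]

lemma intGrading_mul (h : IsConnectedGraded 𝒜) {i j : ℤ} {a b : R} (ha : a ∈ intGrading 𝒜 i)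
    (hb : b ∈ intGrading 𝒜 j) : a * b ∈ intGrading 𝒜 (i + j) := by
  by_cases hi : 0 ≤ i
  · by_cases hj : 0 ≤ j
    · lift i to ℕ using hi
      lift j to ℕ using hj
      rw [← Nat.cast_add]
      rw [intGrading_natCast] at *
      exact h.gradedMonoid.mul_mem ha hb
    · rw [intGrading_of_neg (not_le.1 hj), Submodule.mem_bot] at hb
      simp [hb]
  · rw [intGrading_of_neg (not_le.1 hi), Submodule.mem_bot] at ha
    simp [ha]

lemma intComponent_mul_left {i : ℤ} {a : R} (ha : a ∈ intGrading 𝒜 i) (n : ℤ) (r : R) :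
    intComponent h n (a * r) = a * intComponent h (n - i) r := by
  obtain ⟨s, hs, hr⟩ := exists_sum_intComponent h r
  have key : intComponent h n (a * r) =
      ∑ j ∈ s, if j = n - i then a * intComponent h j r else 0 := by
    conv_lhs => rw [← hr]
    rw [Finset.mul_sum, map_sum]
    refine Finset.sum_congr rfl fun j _ => ?_
    have hm := intGrading_mul h ha (intComponent_mem h j r)
    split_ifs with hj
    · exact intComponent_of_mem h (by convert hm using 2; omega)
    · exact intComponent_of_mem_ne h hm (by omega)
  rw [key, Finset.sum_ite_eq']
  split_ifs with hns
  · rfl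
  · rw [hs _ hns, mul_zero]

lemma intComponent_mul_right {i : ℤ} {a : R} (ha : a ∈ intGrading 𝒜 i) (n : ℤ) (r : R) :
    intComponent h n (r * a) = intComponent h (n - i) r * a := by
  obtain ⟨s, hs, hr⟩ := exists_sum_intComponent h r
  have key : intComponent h n (r * a) =
      ∑ j ∈ s, if j = n - i then intComponent h j r * a else 0 := by
    conv_lhs => rw [← hr]
    rw [Finset.sum_mul, map_sum]
    refine Finset.sum_congr rfl fun j _ => ?_
    have hm := intGrading_mul h (intComponent_mem h j r) ha
    split_ifs with hj
    · exact intComponent_of_mem h (by convert hm using 2; omega)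
    · exact intComponent_of_mem_ne h hm (by omega)
  rw [key, Finset.sum_ite_eq']
  split_ifs with hns
  · rfl
  · rw [hs _ hns, zero_mul]

lemma algebraMap_mem_intGrading (h : IsConnectedGraded 𝒜) (c : k) :
    algebraMap k R c ∈ intGrading 𝒜 0 := by
  rw [intGrading_zero, h.zero_eq]
  exact Submodule.algebraMap_mem c

lemma exists_algebraMap_of_mem (h : IsConnectedGraded 𝒜) {r : R} (hr : r ∈ intGrading 𝒜 0) :
    ∃ c : k, algebraMap k R c = r := by
  rw [intGrading_zero, h.zero_eq] at hr
  simpa [Submodule.mem_one] using hr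

lemma intComponent_zero_mul (r s : R) :
    intComponent h 0 (r * s) = intComponent h 0 r * intComponent h 0 s := by
  obtain ⟨t, ht, hr⟩ := exists_sum_intComponent h r
  have : ∀ i, intComponent h 0 (intComponent h i r * s) =
      if i = 0 then intComponent h 0 r * intComponent h 0 s else 0 := fun i => by
    rw [intComponent_mul_left h (intComponent_mem h i r)]
    split_ifs with hi
    · rw [hi, sub_zero]
    · rcases lt_or_gt_of_ne hi with h1 | h1
      · rw [intComponent_of_neg h h1, LinearMap.zero_apply, zero_mul]
      · rw [intComponent_of_neg h (n := 0 - i) (by omega), LinearMap.zero_apply, mul_zero]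
  conv_lhs => rw [← hr]
  rw [Finset.sum_mul, map_sum, Finset.sum_congr rfl fun i _ => this i, Finset.sum_ite_eq']
  split_ifs with h0
  · rfl
  · rw [ht 0 h0, zero_mul]

/-- The grading is nonnegative, so the degree zero projection is multiplicative and its kernel is
two-sided. Identifying the left ideal `augmentationIdeal` with this kernel gives closure under right
multiplication. -/
lemma mem_augmentationIdeal_iff {r : R} :
    r ∈ augmentationIdeal 𝒜 ↔ intComponent h 0 r = 0 := by
  constructor
  · intro hr
    induction hr using Submodule.span_induction with
    | mem x hx =>
      obtain ⟨n, hn, hx⟩ := hx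
      rw [← intGrading_natCast (𝒜 := 𝒜)] at hx
      exact intComponent_of_mem_ne h hx (by omega)
    | zero => simp
    | add x y _ _ hx hy => rw [map_add, hx, hy, add_zero]
    | smul a x _ hx => rw [smul_eq_mul, intComponent_zero_mul, hx, mul_zero]
  · intro hr
    obtain ⟨s, -, hs⟩ := exists_sum_intComponent h r
    rw [← hs]
    refine Submodule.sum_mem _ fun i _ => ?_
    have hm := intComponent_mem h i r
    rcases lt_trichotomy i 0 with hi | rfl | hi
    · rw [intComponent_of_neg h hi]; simp
    · rw [hr]; exact Submodule.zero_mem _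
    · lift i to ℕ using hi.le
      rw [intGrading_natCast] at hm
      exact Submodule.subset_span ⟨i, by omega, hm⟩

lemma mem_augmentationIdeal_of_mem (h : IsConnectedGraded 𝒜) {i : ℤ} (hi : 0 < i) {a : R}
    (ha : a ∈ intGrading 𝒜 i) : a ∈ augmentationIdeal 𝒜 :=
  (mem_augmentationIdeal_iff h).2 (intComponent_of_mem_ne h ha hi.ne')

lemma mul_mem_augmentationIdeal_right (h : IsConnectedGraded 𝒜) {a : R}
    (ha : a ∈ augmentationIdeal 𝒜) (b : R) : a * b ∈ augmentationIdeal 𝒜 := by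
  rw [mem_augmentationIdeal_iff h] at *
  rw [intComponent_zero_mul, ha, zero_mul]

lemma pos_of_mem_augmentationIdeal (h : IsConnectedGraded 𝒜) {i : ℤ} {a : R}
    (ha : a ∈ intGrading 𝒜 i) (ha' : a ∈ augmentationIdeal 𝒜) (h0 : a ≠ 0) : 0 < i := by
  by_contra hi
  rcases (not_lt.1 hi).lt_or_eq with hi | rfl
  · rw [intGrading_of_neg hi] at ha
    exact h0 ha
  · rw [mem_augmentationIdeal_iff h, intComponent_of_mem h ha] at ha'
    exact h0 ha'

lemma algebraMap_mem_augmentationIdeal_iff (h : IsConnectedGraded 𝒜) {c : k} :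
    algebraMap k R c ∈ augmentationIdeal 𝒜 ↔ c = 0 := by
  have := h.nontrivial
  rw [mem_augmentationIdeal_iff h, intComponent_of_mem h (algebraMap_mem_intGrading h c)]
  simp

lemma exists_algebraMap_sub_mem (h : IsConnectedGraded 𝒜) (r : R) :
    ∃ c : k, r - algebraMap k R c ∈ augmentationIdeal 𝒜 := by
  obtain ⟨c, hc⟩ := exists_algebraMap_of_mem h (intComponent_mem h 0 r)
  refine ⟨c, (mem_augmentationIdeal_iff h).2 ?_⟩
  rw [map_sub, hc, intComponent_of_mem h (intComponent_mem h 0 r), sub_self]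

end IntGrading

/-! ### Graded free modules, minimal covers and graded Nakayama. -/

section GradedFree

variable {k : Type*} [Field k] {R : Type u} [Ring R] [Algebra k R] {𝒜 : ℕ → Submodule k R}
variable {ι : Type*}

/-- The homogeneous elements of degree `n` of the free module on generators of degrees `e i`. -/
def gradedFree (𝒜 : ℕ → Submodule k R) (e : ι → ℤ) (n : ℤ) : Submodule k (ι →₀ R) where
  carrier := {f | ∀ i, f i ∈ intGrading 𝒜 (n - e i)}
  add_mem' hf hg i := Submodule.add_mem _ (hf i) (hg i)
  zero_mem' _ := Submodule.zero_mem _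
  smul_mem' c _ hf i := Submodule.smul_mem _ c (hf i)

/-- The projection of a graded free module onto a homogeneous component. -/
def freeComponent (h : IsConnectedGraded 𝒜) (e : ι → ℤ) (n : ℤ) : (ι →₀ R) →ₗ[k] (ι →₀ R) where
  toFun f := Finsupp.onFinset f.support (fun i => intComponent h (n - e i) (f i)) fun _ hi => by
    rw [Finsupp.mem_support_iff]
    exact fun h0 => hi (by rw [h0, map_zero])
  map_add' f g := by ext i; simp
  map_smul' c f := by ext i; simp

variable (h : IsConnectedGraded 𝒜) (e : ι → ℤ)

@[simp]
lemma freeComponent_apply (n : ℤ) (f : ι →₀ R) (i : ι) :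
    freeComponent h e n f i = intComponent h (n - e i) (f i) := rfl

lemma freeComponent_mem (n : ℤ) (f : ι →₀ R) : freeComponent h e n f ∈ gradedFree 𝒜 e n :=
  fun _ => intComponent_mem h _ _

variable {e}

lemma freeComponent_of_mem {n : ℤ} {f : ι →₀ R} (hf : f ∈ gradedFree 𝒜 e n) :
    freeComponent h e n f = f := by
  ext i
  exact intComponent_of_mem h (hf i)

lemma freeComponent_of_mem_ne {m n : ℤ} {f : ι →₀ R} (hf : f ∈ gradedFree 𝒜 e m) (hmn : m ≠ n) :
    freeComponent h e n f = 0 := by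
  ext i
  exact intComponent_of_mem_ne h (hf i) (by omega)

lemma freeComponent_ext {f g : ι →₀ R}
    (hfg : ∀ n, freeComponent h e n f = freeComponent h e n g) : f = g := by
  ext i
  refine ext_of_intComponent h fun n => ?_
  have := DFunLike.congr_fun (hfg (n + e i)) i
  simpa using this

lemma freeComponent_smul {i : ℤ} {a : R} (ha : a ∈ intGrading 𝒜 i) (n : ℤ) (f : ι →₀ R) :
    freeComponent h e n (a • f) = a • freeComponent h e (n - i) f := by
  ext j
  simp only [freeComponent_apply, Finsupp.smul_apply, smul_eq_mul]
  rw [intComponent_mul_left h ha]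
  congr 3
  omega

lemma freeComponent_smul_of_mem {d : ℤ} {m : ι →₀ R} (hm : m ∈ gradedFree 𝒜 e d) (n : ℤ) (r : R) :
    freeComponent h e n (r • m) = intComponent h (n - d) r • m := by
  ext j
  simp only [freeComponent_apply, Finsupp.smul_apply, smul_eq_mul]
  rw [intComponent_mul_right h (hm j)]
  congr 3
  omega

lemma smul_mem_gradedFree (h : IsConnectedGraded 𝒜) {i d : ℤ} {a : R} (ha : a ∈ intGrading 𝒜 i)
    {m : ι →₀ R} (hm : m ∈ gradedFree 𝒜 e d) : a • m ∈ gradedFree 𝒜 e (i + d) := by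
  intro j
  have := intGrading_mul h ha (hm j)
  rwa [show i + (d - e j) = i + d - e j by omega] at this

lemma freeComponent_of_lt {c : ℤ} (hc : ∀ i, c ≤ e i) {n : ℤ} (hn : n < c) (f : ι →₀ R) :
    freeComponent h e n f = 0 := by
  ext i
  have := hc i
  simp [intComponent_of_neg h (show n - e i < 0 by omega)]

lemma freeComponent_linearCombination {κ : Type*} {e' : κ → ℤ} {m : κ → ι →₀ R}
    (hm : ∀ j, m j ∈ gradedFree 𝒜 e (e' j)) (n : ℤ) (g : κ →₀ R) :
    freeComponent h e n (Finsupp.linearCombination R m g) =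
      Finsupp.linearCombination R m (freeComponent h e' n g) := by
  induction g using Finsupp.induction_linear with
  | zero => simp
  | add f g hf hg => simp only [map_add, hf, hg]
  | single j r =>
    have : freeComponent h e' n (Finsupp.single j r) =
        Finsupp.single j (intComponent h (n - e' j) r) := by
      classical
      ext i
      simp only [freeComponent_apply, Finsupp.single_apply]
      split_ifs with hij
      · rw [hij]
      · simp
    rw [this, Finsupp.linearCombination_single, Finsupp.linearCombination_single,
      freeComponent_smul_of_mem h (hm j)]

lemma freeComponent_smul_of_forall_lt {r : R} (hr : r ∈ augmentationIdeal 𝒜) {n : ℤ}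
    {x : ι →₀ R} (hx : ∀ n' < n, freeComponent h e n' x = 0) :
    freeComponent h e n (r • x) = 0 := by
  obtain ⟨s, -, hs⟩ := exists_sum_intComponent h r
  rw [← hs, Finset.sum_smul, map_sum]
  refine Finset.sum_eq_zero fun i _ => ?_
  rw [freeComponent_smul h (intComponent_mem h i r)]
  rcases lt_trichotomy i 0 with hi | rfl | hi
  · simp [intComponent_of_neg h hi]
  · simp [(mem_augmentationIdeal_iff h).1 hr]
  · rw [hx _ (by omega), smul_zero]

/-- Every graded submodule `N` of a free module has a homogeneous generating family that is
minimal: all relations have coefficients in the augmentation ideal. -/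
theorem exists_minimal_cover {ι : Type w} {e : ι → ℤ} {c : ℤ} (hc : ∀ i, c ≤ e i)
    (N : Submodule R (ι →₀ R)) (hN : ∀ f ∈ N, ∀ n, freeComponent h e n f ∈ N) :
    ∃ (κ : Type (max w u)) (e' : κ → ℤ) (m : κ → ι →₀ R), (∀ j, c ≤ e' j) ∧
      (∀ j, m j ∈ gradedFree 𝒜 e (e' j)) ∧
      LinearMap.range (Finsupp.linearCombination R m) = N ∧
      ∀ g : κ →₀ R, Finsupp.linearCombination R m g = 0 → ∀ j, g j ∈ augmentationIdeal 𝒜 := by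
  classical
  -- `D` is the part of `N` reached with coefficients of positive degree. Homogeneous elements of
  -- `N` forming a `k`-basis of `N` modulo `D` generate `N`, and do so minimally.
  let D : Submodule k (ι →₀ R) := Submodule.span k
    {x | ∃ i > 0, ∃ b ∈ intGrading 𝒜 i, ∃ j, ∃ f ∈ N, f ∈ gradedFree 𝒜 e j ∧ x = b • f}
  let v : {p : ℤ × (ι →₀ R) // p.2 ∈ N ∧ p.2 ∈ gradedFree 𝒜 e p.1} → (ι →₀ R) ⧸ D :=
    fun p => D.mkQ p.1.2
  obtain ⟨κ, a, -, hspan, hli⟩ := exists_linearIndependent' k v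
  let e' : κ → ℤ := fun j => (a j).1.1
  let m : κ → ι →₀ R := fun j => (a j).1.2
  have hmN : ∀ j, m j ∈ N := fun j => (a j).2.1
  have hmg : ∀ j, m j ∈ gradedFree 𝒜 e (e' j) := fun j => (a j).2.2
  have hva : v ∘ a = D.mkQ ∘ m := rfl
  set S := LinearMap.range (Finsupp.linearCombination R m) with hS
  have hmS : ∀ j, m j ∈ S := fun j => ⟨Finsupp.single j 1, by simp⟩
  have hle : S ≤ N := by
    rintro _ ⟨g, rfl⟩
    exact Submodule.sum_mem _ fun j _ => N.smul_mem _ (hmN j)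
  -- Induction on the degree, started by the absence of anything below `c`: modulo the chosen family
  -- an element lies in `D`, and the degree `n` part of `D` is built from elements of `N` of smaller
  -- degree.
  have key : ∀ t : ℕ, ∀ n < c + t, ∀ f ∈ N, f ∈ gradedFree 𝒜 e n → f ∈ S := by
    intro t
    induction t with
    | zero =>
      intro n hn f _ hf
      rw [← freeComponent_of_mem h hf, freeComponent_of_lt h hc (by simpa using hn)]
      exact S.zero_mem
    | succ t ih =>
      intro n hn f hfN hf
      have hD : ∀ x ∈ D, freeComponent h e n x ∈ S := by
        intro x hx
        induction hx using Submodule.span_induction with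
        | mem x hx =>
          obtain ⟨i, hi, b, hb, j, f', hf'N, hf', rfl⟩ := hx
          by_cases hij : i + j = n
          · rw [freeComponent_of_mem h (hij ▸ smul_mem_gradedFree h hb hf')]
            exact S.smul_mem _ (ih j (by push_cast at hn; omega) f' hf'N hf')
          · rw [freeComponent_of_mem_ne h (smul_mem_gradedFree h hb hf') hij]
            exact S.zero_mem
        | zero => rw [map_zero]; exact S.zero_mem
        | add x y _ _ hx hy => rw [map_add]; exact S.add_mem hx hy
        | smul c x _ hx =>
          rw [map_smul, ← algebraMap_smul R c]
          exact S.smul_mem _ hx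
      have hmem : D.mkQ f ∈ Submodule.span k (Set.range (D.mkQ ∘ m)) := by
        rw [← hva, hspan]
        exact Submodule.subset_span ⟨⟨(n, f), hfN, hf⟩, rfl⟩
      rw [Set.range_comp, Submodule.span_image] at hmem
      obtain ⟨s, hs, hsf⟩ := hmem
      have hsub : f - s ∈ D := by
        rw [← Submodule.Quotient.mk_eq_zero, Submodule.Quotient.mk_sub, sub_eq_zero]
        exact hsf.symm
      have h1 := hD _ hsub
      rw [map_sub, freeComponent_of_mem h hf] at h1
      have h2 : freeComponent h e n s ∈ S := by
        clear hsf hsub h1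
        induction hs using Submodule.span_induction with
        | mem x hx =>
          obtain ⟨j, rfl⟩ := hx
          by_cases hj : e' j = n
          · rw [freeComponent_of_mem h (hj ▸ hmg j)]
            exact hmS j
          · rw [freeComponent_of_mem_ne h (hmg j) hj]
            exact S.zero_mem
        | zero => rw [map_zero]; exact S.zero_mem
        | add x y _ _ hx hy => rw [map_add]; exact S.add_mem hx hy
        | smul c x _ hx =>
          rw [map_smul, ← algebraMap_smul R c]
          exact S.smul_mem _ hx
      simpa using S.add_mem h1 h2
  refine ⟨κ, e', m, fun j => ?_, hmg, le_antisymm hle ?_, ?_⟩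
  · by_contra hj
    have h0 : m j = 0 := by
      rw [← freeComponent_of_mem h (hmg j), freeComponent_of_lt h hc (not_le.1 hj)]
    exact hli.ne_zero j (by rw [hva, Function.comp_apply, h0, map_zero])
  · intro f hf
    choose s hs hs' using fun i => exists_sum_intComponent h (f i)
    let T : Finset ℤ := f.support.biUnion fun i => (s i).image (· + e i)
    have hT : ∑ n ∈ T, freeComponent h e n f = f := by
      ext i
      rw [Finsupp.finsetSum_apply]
      simp only [freeComponent_apply]
      have : ∑ x ∈ T, intComponent h (x - e i) (f i) =
          ∑ y ∈ T.image (· - e i), intComponent h y (f i) := by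
        rw [Finset.sum_image fun x _ y _ hxy => by simpa using hxy]
      rw [this]
      refine sum_intComponent h fun n hn => ?_
      by_cases hi : i ∈ f.support
      · refine hs i n fun hns => hn ?_
        simp only [Finset.mem_image, T, Finset.mem_biUnion]
        exact ⟨n + e i, ⟨i, hi, n, hns, rfl⟩, by simp⟩
      · rw [Finsupp.notMem_support_iff.1 hi, map_zero]
    rw [← hT]
    refine S.sum_mem fun n _ => key (n + 1 - c).toNat n ?_ _ (hN f hf n) (freeComponent_mem h e n f)
    have := Int.self_le_toNat (n + 1 - c)
    omega
  · intro g hg j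
    -- Modulo `D` only the constant terms `ε (g j)` of a relation survive, and these vanish by
    -- linear independence.
    choose ε hε using fun r : R => exists_algebraMap_sub_mem h r
    by_cases hj : j ∈ g.support
    swap
    · rw [Finsupp.notMem_support_iff.1 hj]; exact Submodule.zero_mem _
    have hDm : ∀ r ∈ augmentationIdeal 𝒜, ∀ j, r • m j ∈ D := by
      intro r hr j
      obtain ⟨s, -, hs⟩ := exists_sum_intComponent h r
      rw [← hs, Finset.sum_smul]
      refine D.sum_mem fun i _ => ?_
      rcases lt_trichotomy i 0 with hi | rfl | hi
      · simp [intComponent_of_neg h hi]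
      · simp [(mem_augmentationIdeal_iff h).1 hr]
      · exact Submodule.subset_span
          ⟨i, hi, _, intComponent_mem h i r, _, _, hmN j, hmg j, rfl⟩
    have hsum : ∑ j ∈ g.support, ε (g j) • (v ∘ a) j = 0 := by
      have h1 : ∑ j ∈ g.support, ε (g j) • m j ∈ D := by
        have h2 : ∑ j ∈ g.support, (g j - algebraMap k R (ε (g j))) • m j ∈ D :=
          D.sum_mem fun j _ => hDm _ (hε _) j
        have h3 : ∑ j ∈ g.support, g j • m j = 0 := hg
        simp only [sub_smul, Finset.sum_sub_distrib, h3, zero_sub, algebraMap_smul] at h2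
        simpa using D.neg_mem h2
      rw [← Submodule.Quotient.mk_eq_zero, ← Submodule.mkQ_apply, map_sum] at h1
      simpa only [hva, Function.comp_apply, map_smul] using h1
    have h0 := linearIndependent_iff'.1 hli _ _ hsum j hj
    have := hε (g j)
    rwa [h0, map_zero, sub_zero] at this

/-- A minimal cover of a projective graded module is injective. -/
theorem minimal_cover_injective (h : IsConnectedGraded 𝒜) {κ : Type*} {ι : Type*} {e' : κ → ℤ} {c : ℤ}
    (hc : ∀ j, c ≤ e' j) {m : κ → ι →₀ R}
    (hmin : ∀ g : κ →₀ R, Finsupp.linearCombination R m g = 0 →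
      ∀ j, g j ∈ augmentationIdeal 𝒜)
    [Module.Projective R (LinearMap.range (Finsupp.linearCombination R m))]
    {g : κ →₀ R} (hg : Finsupp.linearCombination R m g = 0) : g = 0 := by
  set L := Finsupp.linearCombination R m with hL
  obtain ⟨s, hs⟩ := Module.projective_lifting_property L.rangeRestrict LinearMap.id
    L.surjective_rangeRestrict
  have hs' : ∀ x, L (s x) = x := fun x => congrArg Subtype.val (LinearMap.congr_fun hs x)
  -- `ρ` projects onto the kernel of `L`. A kernel element has coefficients in the augmentation
  -- ideal, so applying `ρ` rewrites it as a combination of kernel elements with coefficients of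
  -- positive degree. Its component of lowest degree therefore vanishes.
  let ρ : (κ →₀ R) →ₗ[R] (κ →₀ R) := LinearMap.id - s ∘ₗ L.rangeRestrict
  have hρ : ∀ g, L (ρ g) = 0 := fun g => by simp [ρ, hs']
  have hρ' : ∀ g, L g = 0 → ρ g = g := fun g hg => by
    have : L.rangeRestrict g = 0 := Subtype.ext hg
    simp [ρ, this]
  have key : ∀ t : ℕ, ∀ n < c + t, ∀ g, L g = 0 → freeComponent h e' n g = 0 := by
    intro t
    induction t with
    | zero =>
      intro n hn g _
      exact freeComponent_of_lt h hc (by simpa using hn) g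
    | succ t ih =>
      intro n hn g hg
      have hexp : g = ∑ j ∈ g.support, g j • ρ (Finsupp.single j 1) := by
        conv_lhs => rw [← hρ' g hg, ← Finsupp.sum_single g, Finsupp.sum, map_sum]
        refine Finset.sum_congr rfl fun j _ => ?_
        rw [← map_smul, Finsupp.smul_single, smul_eq_mul, mul_one]
      rw [hexp, map_sum]
      refine Finset.sum_eq_zero fun j _ => ?_
      exact freeComponent_smul_of_forall_lt h (hmin g hg j)
        fun n' hn' => ih n' (by push_cast at hn; omega) _ (hρ _)
  refine freeComponent_ext h (e := e') fun n => ?_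
  rw [map_zero]
  refine key (n + 1 - c).toNat n ?_ g hg
  have := Int.self_le_toNat (n + 1 - c)
  omega

end GradedFree

/-! ### Syzygies of the trivial module and exactness of the dual complex. -/

section LeftASRegular

open Abelian

variable {k : Type*} [Field k] {R : Type u} [Ring R] [Algebra k R]

/-- The one-sided part of Artin-Schelter regularity. -/
structure IsLeftASRegular (𝒜 : ℕ → Submodule k R) (d : ℕ) : Prop where
  connected : IsConnectedGraded 𝒜
  globalDim_le : globalDim R ≤ (d : WithBot ℕ∞)
  gorenstein : IsLeftGorenstein 𝒜 d
  finite_component : ∀ n, Module.Finite k (𝒜 n)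
  growth : ∃ c : ℕ, 0 < c ∧ ∀ n, 0 < n → Module.finrank k (𝒜 n) < c * n ^ c

lemma IsASRegular.isLeftASRegular {𝒜 : ℕ → Submodule k R} {d : ℕ} (h : IsASRegular 𝒜 d) :
    IsLeftASRegular 𝒜 d :=
  ⟨h.connected, h.globalDim_left.le, h.gorenstein_left, h.finite_component, h.growth⟩

/-- The short complex `ker L → P → N` for a linear map `L : P → F` with range `N`. -/
abbrev coverComplex {P F : Type u} [AddCommGroup P] [Module R P] [AddCommGroup F] [Module R F]
    (L : P →ₗ[R] F) (N : Submodule R F) (h : LinearMap.range L = N) :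
    ShortComplex (ModuleCat.{u} R) :=
  ShortComplex.mk (X₁ := ModuleCat.of R (LinearMap.ker L)) (X₂ := ModuleCat.of R P)
    (X₃ := ModuleCat.of R N) (ModuleCat.ofHom (LinearMap.ker L).subtype)
    (ModuleCat.ofHom (L.codRestrict N fun x => h ▸ ⟨x, rfl⟩))
    (by ext x; exact x.2)

lemma coverComplex_shortExact {P F : Type u} [AddCommGroup P] [Module R P] [AddCommGroup F]
    [Module R F] (L : P →ₗ[R] F) (N : Submodule R F) (h : LinearMap.range L = N) :
    (coverComplex L N h).ShortExact where
  exact := by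
    rw [ShortComplex.ShortExact.moduleCat_exact_iff_function_exact]
    intro x
    constructor
    · intro hx
      exact ⟨⟨x, congrArg Subtype.val hx⟩, rfl⟩
    · rintro ⟨y, rfl⟩
      exact Subtype.ext y.2
  mono_f := (ModuleCat.mono_iff_injective _).2 Subtype.val_injective
  epi_g := (ModuleCat.epi_iff_surjective _).2 fun y => by
    obtain ⟨x, hx⟩ := (h ▸ y.2 : (y : F) ∈ LinearMap.range L)
    exact ⟨x, Subtype.ext hx⟩

/-- `K` is an `n`-th syzygy of `X`, of projective dimension `< m`. -/
def IsSyzygyOf (X K : ModuleCat.{u} R) (n m : ℕ) : Prop :=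
  (∃ ε : Ext X K n, IsSyzygyClass ε) ∧ HasProjectiveDimensionLT K m

variable {P F : Type u} [AddCommGroup P] [Module R P] [AddCommGroup F] [Module R F]

/-- Besides shifting the class, a projective cover lowers the strict bound on the projective
dimension by one; at the value `1` the syzygy is projective. -/
lemma IsSyzygyOf.step {X : ModuleCat.{u} R} {N : Submodule R F} {n m : ℕ}
    (h : IsSyzygyOf X (ModuleCat.of R N) n (m + 2)) [Module.Projective R P] (L : P →ₗ[R] F)
    (hL : LinearMap.range L = N) :
    IsSyzygyOf X (ModuleCat.of R (LinearMap.ker L)) (n + 1) (m + 1) := by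
  obtain ⟨⟨ε, hε⟩, hpd⟩ := h
  have hS := coverComplex_shortExact L N hL
  have : Projective (coverComplex L N hL).X₂ :=
    (IsProjective.iff_projective P).1 inferInstance
  exact ⟨⟨_, hε.step hS⟩, hS.hasProjectiveDimensionLT_X₁ (m + 1) inferInstance hpd⟩

/-- The obstruction to extending `φ` over `P` is its connecting class in `Ext^(n+1) X R`, a group
assumed to vanish. -/
lemma IsSyzygyOf.extends {X : ModuleCat.{u} R} {N : Submodule R F} {n m : ℕ}
    (h : IsSyzygyOf X (ModuleCat.of R N) n m) (L : P →ₗ[R] F)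
    (hL : LinearMap.range L = N)
    [Subsingleton (Ext X (ModuleCat.of R R) (n + 1))] (φ : LinearMap.ker L →ₗ[R] R) :
    ∃ ψ : P →ₗ[R] R, ∀ x : LinearMap.ker L, ψ x = φ x := by
  obtain ⟨⟨ε, hε⟩, -⟩ := h
  have hS := coverComplex_shortExact L N hL
  obtain ⟨g, hg⟩ := (syzygyConnecting_eq_zero_iff hS hε (ModuleCat.ofHom φ)).1
    (Subsingleton.elim _ _)
  exact ⟨g.hom, fun x => LinearMap.congr_fun (congrArg ModuleCat.Hom.hom hg) x⟩

/-- Exactness of the dual complex, where `Ext` vanishes. -/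
lemma IsSyzygyOf.dual_exact {X : ModuleCat.{u} R} {N : Submodule R F} {n m : ℕ}
    (h : IsSyzygyOf X (ModuleCat.of R N) n m) {L : P →ₗ[R] F}
    (hL : LinearMap.range L = N)
    [Subsingleton (Ext X (ModuleCat.of R R) (n + 1))] {P' : Type u} [AddCommGroup P'] [Module R P']
    {L' : P' →ₗ[R] P} (hL' : LinearMap.range L' = LinearMap.ker L) (φ : P' →ₗ[R] R)
    (hφ : ∀ x, L' x = 0 → φ x = 0) :
    ∃ ψ : P →ₗ[R] R, ∀ x, ψ (L' x) = φ x := by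
  have hle : LinearMap.ker L'.rangeRestrict ≤ LinearMap.ker φ := fun x hx =>
    hφ x (congrArg Subtype.val hx)
  let φ' : LinearMap.range L' →ₗ[R] R :=
    (Submodule.liftQ _ φ hle) ∘ₗ
      (L'.rangeRestrict.quotKerEquivOfSurjective L'.surjective_rangeRestrict).symm.toLinearMap
  have hφ' : ∀ x, φ' (L'.rangeRestrict x) = φ x := fun x => by
    have : (L'.rangeRestrict.quotKerEquivOfSurjective L'.surjective_rangeRestrict).symm
        (L'.rangeRestrict x) = Submodule.Quotient.mk x := by
      rw [LinearEquiv.symm_apply_eq]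
      rfl
    simp only [φ', LinearMap.comp_apply, LinearEquiv.coe_coe, this]
    exact Submodule.liftQ_apply _ _ _
  obtain ⟨ψ, hψ⟩ := h.extends L hL (φ' ∘ₗ (LinearEquiv.ofEq _ _ hL'.symm).toLinearMap)
  refine ⟨ψ, fun x => ?_⟩
  rw [hψ ⟨L' x, hL' ▸ ⟨x, rfl⟩⟩, ← hφ' x]
  rfl

/-- The top `Ext` group of the trivial module is the cokernel of the last dual differential. -/
lemma IsSyzygyOf.top {𝒜 : ℕ → Submodule k R} {N : Submodule R F} {n m : ℕ}
    (h : IsSyzygyOf (trivialModule 𝒜) (ModuleCat.of R N) n m) [Module.Projective R P]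
    {L : P →ₗ[R] F} (hL : LinearMap.range L = N) (hG : IsLeftGorenstein 𝒜 (n + 1))
    {P' : Type u} [AddCommGroup P'] [Module R P']
    {L' : P' →ₗ[R] P} (hL' : LinearMap.range L' = LinearMap.ker L)
    (hinj : Function.Injective L') :
    ∃ θ : (P' →ₗ[R] R) →+ k, Function.Surjective θ ∧
      (∀ φ, θ φ = 0 ↔ ∃ ψ : P →ₗ[R] R, ∀ x, ψ (L' x) = φ x) ∧
      (∀ φ c, θ (LinearMap.toSpanSingleton R R (algebraMap k R c) ∘ₗ φ) = θ φ * c) ∧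
      ∀ φ j, 0 < j → ∀ a ∈ 𝒜 j, θ (LinearMap.toSpanSingleton R R a ∘ₗ φ) = 0 := by
  obtain ⟨⟨ε, hε⟩, -⟩ := h
  have hS := coverComplex_shortExact L N hL
  have : Projective (coverComplex L N hL).X₂ :=
    (IsProjective.iff_projective P).1 inferInstance
  obtain ⟨e, he⟩ := hG.one_dimensional
  let E : P' ≃ₗ[R] LinearMap.ker L :=
    (LinearEquiv.ofInjective L' hinj).trans (LinearEquiv.ofEq _ _ hL')
  have hE : ∀ x, (E x : P) = L' x := fun x => rfl
  let toHom : (P' →ₗ[R] R) →+ ((coverComplex L N hL).X₁ ⟶ ModuleCat.of R R) :=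
    { toFun := fun φ => ModuleCat.ofHom (φ ∘ₗ E.symm.toLinearMap)
      map_zero' := rfl
      map_add' := fun _ _ => rfl }
  have hcomp : ∀ φ a, toHom (LinearMap.toSpanSingleton R R a ∘ₗ φ) =
      toHom φ ≫ rightMulHom a := fun φ a => rfl
  -- `θ` sends a functional on the last free module to its class in the top Ext group and on to `k`.
  refine ⟨e.toAddMonoidHom.comp ((syzygyConnecting hS ε (ModuleCat.of R R)).comp toHom),
    ?_, fun φ => ?_, fun φ c => ?_, fun φ j hj a ha => ?_⟩
  · refine e.surjective.comp ((syzygyConnecting_surjective hS hε _).comp fun f => ?_)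
    refine ⟨f.hom ∘ₗ E.toLinearMap, ?_⟩
    ext x
    simp [toHom]
  · simp only [AddMonoidHom.comp_apply, AddEquiv.toAddMonoidHom_eq_coe, AddMonoidHom.coe_coe,
      EmbeddingLike.map_eq_zero_iff]
    rw [syzygyConnecting_eq_zero_iff hS hε]
    constructor
    · rintro ⟨g, hg⟩
      refine ⟨g.hom, fun x => ?_⟩
      have := LinearMap.congr_fun (congrArg ModuleCat.Hom.hom hg) (E x)
      have h2 : φ (E.symm (E x)) = φ x := by simp
      rw [← h2]
      exact this
    · rintro ⟨ψ, hψ⟩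
      refine ⟨ModuleCat.ofHom ψ, ?_⟩
      ext x
      have := hψ (E.symm x)
      rw [← hE, LinearEquiv.apply_symm_apply] at this
      exact this
  · simp only [AddMonoidHom.comp_apply, AddEquiv.toAddMonoidHom_eq_coe, AddMonoidHom.coe_coe]
    rw [hcomp, syzygyConnecting_comp]
    exact he _ c
  · simp only [AddMonoidHom.comp_apply, AddEquiv.toAddMonoidHom_eq_coe, AddMonoidHom.coe_coe]
    rw [hcomp, syzygyConnecting_comp]
    exact (congrArg e (hG.trivial_action _ j hj a ha)).trans (map_zero e)

end LeftASRegular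

/-! ### Algebras generated in degree one. -/

section DegreeOne

variable {k : Type*} [Field k] {R : Type u} [Ring R] [Algebra k R] {𝒜 : ℕ → Submodule k R}
variable {ι : Type*} {z : ι → R}

/-- This splits off the last letter of a word, as `adjoin_le_right` splits off the first. Together
they show that the generators of degree one generate the augmentation ideal on either side. -/
lemma adjoin_le_left (hgen : Algebra.adjoin k (Set.range z) = ⊤) (r : R) :
    ∃ c : k, ∃ f : ι →₀ R, r = algebraMap k R c + Finsupp.linearCombination R z f := by
  have hr : r ∈ Algebra.adjoin k (Set.range z) := hgen ▸ Algebra.mem_top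
  induction hr using Algebra.adjoin_induction with
  | mem x hx =>
    obtain ⟨i, rfl⟩ := hx
    exact ⟨0, Finsupp.single i 1, by simp⟩
  | algebraMap c => exact ⟨c, 0, by simp⟩
  | add x y _ _ hx hy =>
    obtain ⟨c, f, rfl⟩ := hx
    obtain ⟨c', f', rfl⟩ := hy
    exact ⟨c + c', f + f', by simp only [map_add]; abel⟩
  | mul x y _ _ hx hy =>
    obtain ⟨c, f, hx⟩ := hx
    obtain ⟨c', f', rfl⟩ := hy
    refine ⟨c * c', c' • f + x • f', ?_⟩
    have h0 : Finsupp.linearCombination R z (x • f') =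
        x * Finsupp.linearCombination R z f' := map_smul _ x f'
    rw [map_add, h0]
    have : Finsupp.linearCombination R z (c' • f) =
        algebraMap k R c' * Finsupp.linearCombination R z f := by
      rw [← algebraMap_smul R c' f, map_smul, smul_eq_mul]
    rw [this, mul_add, map_mul]
    have h1 : x * algebraMap k R c' = algebraMap k R c * algebraMap k R c' +
        algebraMap k R c' * Finsupp.linearCombination R z f := by
      rw [hx, add_mul, Algebra.commutes c' (Finsupp.linearCombination R z f)]
    rw [h1, add_assoc]

lemma adjoin_le_right [Fintype ι] (hgen : Algebra.adjoin k (Set.range z) = ⊤) (r : R) :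
    ∃ c : k, ∃ f : ι → R, r = algebraMap k R c + ∑ i, z i * f i := by
  classical
  have hr : r ∈ Algebra.adjoin k (Set.range z) := hgen ▸ Algebra.mem_top
  induction hr using Algebra.adjoin_induction with
  | mem x hx =>
    obtain ⟨i, rfl⟩ := hx
    exact ⟨0, Pi.single i 1, by simp [Pi.single_apply]⟩
  | algebraMap c => exact ⟨c, 0, by simp⟩
  | add x y _ _ hx hy =>
    obtain ⟨c, f, rfl⟩ := hx
    obtain ⟨c', f', rfl⟩ := hy
    exact ⟨c + c', f + f', by simp only [map_add, Pi.add_apply, mul_add,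
      Finset.sum_add_distrib]; abel⟩
  | mul x y _ _ hx hy =>
    obtain ⟨c, f, rfl⟩ := hx
    obtain ⟨c', f', hy⟩ := hy
    refine ⟨c * c', fun i => f i * y + algebraMap k R c * f' i, ?_⟩
    have h1 : ∑ i, z i * (algebraMap k R c * f' i) = algebraMap k R c * ∑ i, z i * f' i := by
      rw [Finset.mul_sum]
      exact Finset.sum_congr rfl fun i _ => by
        rw [← mul_assoc, ← Algebra.commutes, mul_assoc]
    simp only [mul_add, Finset.sum_add_distrib, h1]
    simp only [← mul_assoc]
    rw [← Finset.sum_mul, add_mul, map_mul]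
    have h2 : algebraMap k R c * y = algebraMap k R c * algebraMap k R c' +
        algebraMap k R c * ∑ i, z i * f' i := by rw [hy, mul_add]
    rw [h2]
    abel

variable (h : IsConnectedGraded 𝒜) (hz : ∀ i, z i ∈ 𝒜 1)
  (hgen : Algebra.adjoin k (Set.range z) = ⊤)
include h hz

lemma mem_augmentationIdeal_of_degree_one (i : ι) : z i ∈ augmentationIdeal 𝒜 :=
  mem_augmentationIdeal_of_mem h (i := 1) one_pos (by rw [intGrading_one]; exact hz i)

include hgen

lemma range_linearCombination_eq_augmentationIdeal :
    LinearMap.range (Finsupp.linearCombination R z) = augmentationIdeal 𝒜 := by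
  have hle : LinearMap.range (Finsupp.linearCombination R z) ≤ augmentationIdeal 𝒜 := by
    rintro _ ⟨f, rfl⟩
    exact Submodule.sum_mem _ fun i _ =>
      Ideal.mul_mem_left _ _ (mem_augmentationIdeal_of_degree_one h hz i)
  refine le_antisymm hle fun r hr => ?_
  obtain ⟨c, f, hf⟩ := adjoin_le_left hgen r
  have hc : algebraMap k R c ∈ augmentationIdeal 𝒜 := by
    have := Submodule.sub_mem _ hr (hle ⟨f, rfl⟩)
    rwa [hf, add_sub_cancel_right] at this
  rw [algebraMap_mem_augmentationIdeal_iff h] at hc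
  exact ⟨f, by rw [hf, hc, map_zero, zero_add]⟩

lemma exists_sum_mul_of_mem_augmentationIdeal [Fintype ι] {r : R}
    (hr : r ∈ augmentationIdeal 𝒜) : ∃ f : ι → R, ∑ i, z i * f i = r := by
  obtain ⟨c, f, hf⟩ := adjoin_le_right hgen r
  have hc : algebraMap k R c ∈ augmentationIdeal 𝒜 := by
    have := Submodule.sub_mem _ hr (Submodule.sum_mem _ fun i (_ : i ∈ Finset.univ) =>
      mul_mem_augmentationIdeal_right h (mem_augmentationIdeal_of_degree_one h hz i) (f i))
    rwa [hf, add_sub_cancel_right] at this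
  rw [algebraMap_mem_augmentationIdeal_iff h] at hc
  exact ⟨f, by rw [hf, hc, map_zero, zero_add]⟩

lemma degree_one_eq_span : 𝒜 1 = Submodule.span k (Set.range z) := by
  refine le_antisymm (fun r hr => ?_) (Submodule.span_le.2 ?_)
  · rw [← intGrading_one (𝒜 := 𝒜)] at hr
    have hr' := mem_augmentationIdeal_of_mem h one_pos hr
    rw [← range_linearCombination_eq_augmentationIdeal h hz hgen] at hr'
    obtain ⟨f, hf⟩ := hr'
    rw [← intComponent_of_mem h hr, ← hf, Finsupp.linearCombination_apply, Finsupp.sum, map_sum]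
    refine Submodule.sum_mem _ fun i _ => ?_
    have hzi : z i ∈ intGrading 𝒜 1 := by rw [intGrading_one]; exact hz i
    rw [smul_eq_mul, intComponent_mul_right h hzi]
    obtain ⟨c, hc⟩ := exists_algebraMap_of_mem h
      (show intComponent h (1 - 1) (f i) ∈ intGrading 𝒜 0 from intComponent_mem h _ _)
    rw [← hc, ← Algebra.smul_def]
    exact Submodule.smul_mem _ _ (Submodule.subset_span ⟨i, rfl⟩)
  · rintro _ ⟨i, rfl⟩
    exact hz i

end DegreeOne

/-! ### The last differential of a minimal resolution. -/

section LastSyzygy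

variable {k : Type*} [Field k] {R : Type u} [Ring R] [Algebra k R] {𝒜 : ℕ → Submodule k R}

/-- `ψ x` is a sum of coordinates of `x` times values of `ψ`, and the augmentation ideal is
two-sided. -/
lemma map_mem_augmentationIdeal (h : IsConnectedGraded 𝒜) {ι : Type*} (ψ : (ι →₀ R) →ₗ[R] R)
    {x : ι →₀ R} (hx : ∀ i, x i ∈ augmentationIdeal 𝒜) : ψ x ∈ augmentationIdeal 𝒜 := by
  rw [← Finsupp.sum_single x, Finsupp.sum, map_sum]
  refine Submodule.sum_mem _ fun i _ => ?_
  rw [← mul_one (x i), ← smul_eq_mul, ← Finsupp.smul_single, map_smul, smul_eq_mul]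
  exact mul_mem_augmentationIdeal_right h (hx i) _

lemma one_notMem_augmentationIdeal (h : IsConnectedGraded 𝒜) : (1 : R) ∉ augmentationIdeal 𝒜 := by
  rw [← map_one (algebraMap k R), algebraMap_mem_augmentationIdeal_iff h]
  exact one_ne_zero

/-- The last free module of the minimal resolution has rank one, and the entries of the last
differential generate the augmentation ideal on the right. -/
lemma exists_unique_last_generator (h : IsConnectedGraded 𝒜) {κ κ' : Type*}
    {m : κ → κ' →₀ R} (hm : ∀ j i, m j i ∈ augmentationIdeal 𝒜)
    (θ : ((κ →₀ R) →ₗ[R] R) →+ k) (hsurj : Function.Surjective θ)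
    (hker : ∀ φ, θ φ = 0 ↔
      ∃ ψ : (κ' →₀ R) →ₗ[R] R, ∀ x, ψ (Finsupp.linearCombination R m x) = φ x)
    (hscalar : ∀ φ c,
      θ (LinearMap.toSpanSingleton R R (algebraMap k R c) ∘ₗ φ) = θ φ * c)
    (htriv : ∀ φ j, 0 < j → ∀ a ∈ 𝒜 j, θ (LinearMap.toSpanSingleton R R a ∘ₗ φ) = 0) :
    ∃ j₀ : κ, (∀ j, j = j₀) ∧ ∀ n, 0 < n → ∀ a ∈ 𝒜 n,
      ∃ f : κ' → R, Finsupp.linearCombination R f (m j₀) = a := by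
  classical
  -- A coordinate functional cannot extend over the preceding free module: evaluating an extension
  -- on a basis vector would put `1` into the augmentation ideal.
  have hne : ∀ j, θ (Finsupp.lapply j) ≠ 0 := fun j h0 => by
    obtain ⟨ψ, hψ⟩ := (hker _).1 h0
    have := hψ (Finsupp.single j 1)
    rw [Finsupp.linearCombination_single, one_smul, Finsupp.lapply_apply,
      Finsupp.single_eq_same] at this
    exact one_notMem_augmentationIdeal h (this ▸ map_mem_augmentationIdeal h ψ (hm j))
  have hnonempty : Nonempty κ := by
    by_contra hκ
    rw [not_nonempty_iff] at hκ
    obtain ⟨φ, hφ⟩ := hsurj 1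
    have : φ = 0 := LinearMap.ext fun x => by rw [Subsingleton.elim x 0, map_zero, map_zero]
    rw [this, map_zero] at hφ
    exact zero_ne_one hφ
  obtain ⟨j₀⟩ := hnonempty
  refine ⟨j₀, fun j => ?_, fun n hn a ha => ?_⟩
  · by_contra hj
    set c := θ (Finsupp.lapply j)
    set c' := θ (Finsupp.lapply j₀)
    -- `θ` takes values in a line, so a scalar combination of two coordinates, with both
    -- coefficients nonzero, dies under it. The combination then extends, which contradicts
    -- minimality as above.
    have hzero : θ (LinearMap.toSpanSingleton R R (algebraMap k R c') ∘ₗ Finsupp.lapply j -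
        LinearMap.toSpanSingleton R R (algebraMap k R c) ∘ₗ Finsupp.lapply j₀) = 0 := by
      rw [map_sub, hscalar, hscalar, mul_comm, sub_self]
    obtain ⟨ψ, hψ⟩ := (hker _).1 hzero
    have := hψ (Finsupp.single j 1)
    rw [Finsupp.linearCombination_single, one_smul] at this
    simp only [LinearMap.sub_apply, LinearMap.comp_apply, Finsupp.lapply_apply,
      Finsupp.single_eq_same, Finsupp.single_eq_of_ne (Ne.symm hj), map_zero, sub_zero,
      LinearMap.toSpanSingleton_apply, one_smul] at this
    have h1 := map_mem_augmentationIdeal h ψ (hm j)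
    rw [this, algebraMap_mem_augmentationIdeal_iff h] at h1
    exact hne j₀ h1
  -- The trivial action makes the coordinate followed by right multiplication by `a` extend to some
  -- `ψ`; evaluation on the basis vector writes `a` in terms of the entries of `m j₀`.
  · obtain ⟨ψ, hψ⟩ := (hker _).1 (htriv (Finsupp.lapply j₀) n hn a ha)
    refine ⟨fun i => ψ (Finsupp.single i 1), ?_⟩
    have := hψ (Finsupp.single j₀ 1)
    rw [Finsupp.linearCombination_single, one_smul] at this
    simp only [LinearMap.comp_apply, Finsupp.lapply_apply,
      Finsupp.single_eq_same, LinearMap.toSpanSingleton_apply, one_smul] at this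
    rw [← this]
    conv_rhs => rw [← Finsupp.sum_single (m j₀), Finsupp.sum, map_sum]
    rw [Finsupp.linearCombination_apply, Finsupp.sum]
    refine Finset.sum_congr rfl fun i _ => ?_
    rw [← map_smul, Finsupp.smul_single, smul_eq_mul, mul_one]

/-- In an algebra generated in degree one, the entries of the last differential of the minimal
resolution of a Gorenstein algebra form a basis of the component of degree one. -/
lemma last_differential_basis (h : IsConnectedGraded 𝒜) {ι : Type*} [Fintype ι] {z : ι → R}
    (hz : ∀ i, z i ∈ 𝒜 1) (hgen : Algebra.adjoin k (Set.range z) = ⊤) {κ : Type*} {e : κ → ℤ}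
    {l : ℤ} {a : κ →₀ R} (ha : a ∈ gradedFree 𝒜 e l) (haug : ∀ i, a i ∈ augmentationIdeal 𝒜)
    (hall : ∀ n, 0 < n → ∀ b ∈ 𝒜 n, ∃ f : κ → R, Finsupp.linearCombination R f a = b)
    (hrel : ∀ f : κ → R, Finsupp.linearCombination R f a = 0 → ∀ i, f i ∈ augmentationIdeal 𝒜) :
    Finite κ ∧ (∀ i, e i = l - 1) ∧ LinearIndependent k a ∧
      Submodule.span k (Set.range a) = 𝒜 1 := by
  classical
  have hne : ∀ i, a i ≠ 0 := fun i h0 => by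
    have h1 := hrel (Pi.single i 1) ?_ i
    · rw [Pi.single_eq_same] at h1
      exact one_notMem_augmentationIdeal h h1
    rw [Finsupp.linearCombination_apply, Finsupp.sum]
    refine Finset.sum_eq_zero fun j _ => ?_
    by_cases hj : j = i
    · rw [hj, h0, zero_smul]
    · rw [Pi.single_eq_of_ne hj, smul_zero]
  have hfin : Finite κ := by
    have : (a.support : Set κ) = Set.univ :=
      Set.eq_univ_of_forall fun i => Finsupp.mem_support_iff.2 (hne i)
    exact Set.finite_univ_iff.1 (this ▸ a.support.finite_toSet)
  have := Fintype.ofFinite κ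
  have hsum : ∀ f : κ → R, Finsupp.linearCombination R f a = ∑ i, a i * f i := fun f => by
    rw [Finsupp.linearCombination_apply]
    exact Finsupp.sum_fintype _ _ fun i => zero_smul _ _
  have hpos : ∀ i, 0 < l - e i := fun i =>
    pos_of_mem_augmentationIdeal h (ha i) (haug i) (hne i)
  have hone : ∀ b ∈ 𝒜 1, ∃ f : κ → R, (∀ i, f i ∈ intGrading 𝒜 (1 - (l - e i))) ∧
      ∑ i, a i * f i = b := by
    intro b hb
    obtain ⟨f, hf⟩ := hall 1 one_pos b hb
    refine ⟨fun i => intComponent h (1 - (l - e i)) (f i), fun i => intComponent_mem h _ _, ?_⟩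
    rw [← intGrading_one (𝒜 := 𝒜)] at hb
    rw [hsum] at hf
    conv_rhs => rw [← intComponent_of_mem h hb, ← hf, map_sum]
    exact Finset.sum_congr rfl fun i _ => (intComponent_mul_left h (ha i) _ _).symm
  -- Suppose the entry `a i₀` has degree at least two and write it as `∑ z t * r t`. Each `z t` has
  -- degree one, so it is a combination of the entries in which `a i₀` has coefficient zero.
  -- Substitution gives a relation among the entries with coefficient `1` at `i₀`, against `hrel`.
  have hdeg : ∀ i, e i = l - 1 := by
    intro i₀
    by_contra hi
    have hi' : 2 ≤ l - e i₀ := by have := hpos i₀; omega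
    choose f hf hfz using fun t => hone (z t) (hz t)
    obtain ⟨r, hr⟩ := exists_sum_mul_of_mem_augmentationIdeal h hz hgen (haug i₀)
    have h0 : ∀ t, f t i₀ = 0 := fun t => by
      have := hf t i₀
      rwa [intGrading_of_neg (by omega), Submodule.mem_bot] at this
    have h1 := hrel (fun i => (Pi.single i₀ 1 : κ → R) i - ∑ t, f t i * r t) (by
      rw [hsum]
      simp only [mul_sub, Finset.sum_sub_distrib, Pi.single_apply, mul_ite, mul_one, mul_zero,
        Finset.sum_ite_eq', Finset.mem_univ, if_true, Finset.mul_sum]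
      rw [Finset.sum_comm]
      simp only [← mul_assoc, ← Finset.sum_mul, hfz, hr, sub_self]) i₀
    simp only [Pi.single_eq_same, h0, zero_mul, Finset.sum_const_zero, sub_zero] at h1
    exact one_notMem_augmentationIdeal h h1
  refine ⟨hfin, hdeg, ?_, le_antisymm (Submodule.span_le.2 ?_) fun b hb => ?_⟩
  · rw [Fintype.linearIndependent_iff]
    intro c hc i
    rw [← algebraMap_mem_augmentationIdeal_iff h]
    refine hrel (fun i => algebraMap k R (c i)) ?_ i
    rw [hsum, ← hc]
    exact Finset.sum_congr rfl fun i _ => by rw [Algebra.smul_def, Algebra.commutes]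
  · rintro _ ⟨i, rfl⟩
    have := ha i
    rwa [hdeg, sub_sub_cancel, intGrading_one] at this
  · obtain ⟨f, hf, rfl⟩ := hone b hb
    refine Submodule.sum_mem _ fun i _ => ?_
    have hfi := hf i
    rw [hdeg, sub_sub_cancel, sub_self] at hfi
    obtain ⟨c, hc⟩ := exists_algebraMap_of_mem h hfi
    rw [← hc, ← Algebra.commutes, ← Algebra.smul_def]
    exact Submodule.smul_mem _ _ (Submodule.subset_span ⟨i, rfl⟩)

end LastSyzygy

/-! ### Covers of the successive kernels. -/

section Resolution

open Abelian

variable {k : Type*} [Field k] {R : Type u} [Ring R] [Algebra k R] {𝒜 : ℕ → Submodule k R}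

lemma isSyzygyOf_augmentationIdeal {m : ℕ}
    (h : HasProjectiveDimensionLT (trivialModule 𝒜) (m + 2)) :
    IsSyzygyOf (trivialModule 𝒜) (ModuleCat.of R (augmentationIdeal 𝒜)) 1 (m + 1) := by
  have hS := kernelComplex_shortExact (augmentationIdeal 𝒜).mkQ (Submodule.mkQ_surjective _)
  have : Projective (kernelComplex (augmentationIdeal 𝒜).mkQ).X₂ :=
    (IsProjective.iff_projective R).1 inferInstance
  have key : IsSyzygyOf (trivialModule 𝒜)
      (ModuleCat.of R (LinearMap.ker (augmentationIdeal 𝒜).mkQ)) 1 (m + 1) :=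
    ⟨⟨_, (IsSyzygyClass.id (trivialModule 𝒜)).step hS⟩,
      hS.hasProjectiveDimensionLT_X₁ (m + 1) inferInstance h⟩
  rwa [Submodule.ker_mkQ] at key

/-- As `Ext^1` of the trivial module vanishes, every functional on the augmentation ideal extends to
`R`, and the functionals on `R` are right multiplications. -/
lemma augmentationIdeal_dual_exact
    [Subsingleton (Ext (trivialModule 𝒜) (ModuleCat.of R R) 1)] {P : Type u} [AddCommGroup P]
    [Module R P] {L : P →ₗ[R] R} (hL : LinearMap.range L = augmentationIdeal 𝒜) (φ : P →ₗ[R] R)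
    (hφ : ∀ x, L x = 0 → φ x = 0) : ∃ g : R, ∀ x, φ x = L x * g := by
  have hle : LinearMap.ker L.rangeRestrict ≤ LinearMap.ker φ := fun x hx =>
    hφ x (congrArg Subtype.val hx)
  let φ' : LinearMap.range L →ₗ[R] R :=
    (Submodule.liftQ _ φ hle) ∘ₗ
      (L.rangeRestrict.quotKerEquivOfSurjective L.surjective_rangeRestrict).symm.toLinearMap
  have hφ' : ∀ x, φ' (L.rangeRestrict x) = φ x := fun x => by
    have : (L.rangeRestrict.quotKerEquivOfSurjective L.surjective_rangeRestrict).symm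
        (L.rangeRestrict x) = Submodule.Quotient.mk x := by
      rw [LinearEquiv.symm_apply_eq]
      rfl
    simp only [φ', LinearMap.comp_apply, LinearEquiv.coe_coe, this]
    exact Submodule.liftQ_apply _ _ _
  have hker : LinearMap.ker (augmentationIdeal 𝒜).mkQ = LinearMap.range L := by
    rw [Submodule.ker_mkQ, hL]
  have hS := kernelComplex_shortExact (augmentationIdeal 𝒜).mkQ (Submodule.mkQ_surjective _)
  obtain ⟨g, hg⟩ := (syzygyConnecting_eq_zero_iff hS (IsSyzygyClass.id (trivialModule 𝒜))
    (ModuleCat.ofHom (φ' ∘ₗ (LinearEquiv.ofEq _ _ hker).toLinearMap))).1 (Subsingleton.elim _ _)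
  refine ⟨g.hom 1, fun x => ?_⟩
  have hmem : L x ∈ LinearMap.ker (augmentationIdeal 𝒜).mkQ := hker ▸ ⟨x, rfl⟩
  have h1 : g.hom (L x) = φ' (L.rangeRestrict x) :=
    LinearMap.congr_fun (congrArg ModuleCat.Hom.hom hg) ⟨L x, hmem⟩
  rw [← hφ' x, ← h1]
  conv_lhs => rw [← mul_one (L x), ← smul_eq_mul, map_smul, smul_eq_mul]

lemma intComponent_linearCombination_degree_one (h : IsConnectedGraded 𝒜) {ι : Type*} {z : ι → R}
    (hz : ∀ i, z i ∈ 𝒜 1) (n : ℤ) (g : ι →₀ R) :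
    intComponent h n (Finsupp.linearCombination R z g) =
      Finsupp.linearCombination R z (freeComponent h (fun _ => 1) n g) := by
  induction g using Finsupp.induction_linear with
  | zero => simp
  | add f g hf hg => simp only [map_add, hf, hg]
  | single j r =>
    have : freeComponent h (fun _ : ι => 1) n (Finsupp.single j r) =
        Finsupp.single j (intComponent h (n - 1) r) := by
      classical
      ext i
      simp only [freeComponent_apply, Finsupp.single_apply]
      split_ifs with hij
      · rfl
      · simp
    rw [this, Finsupp.linearCombination_single, Finsupp.linearCombination_single, smul_eq_mul,
      smul_eq_mul, intComponent_mul_right h (by rw [intGrading_one]; exact hz j)]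

/-- The relations among homogeneous linearly independent elements of degree one have coefficients
in the augmentation ideal. -/
lemma mem_augmentationIdeal_of_linearCombination_eq_zero (h : IsConnectedGraded 𝒜) {ι : Type*}
    {z : ι → R} (hz : ∀ i, z i ∈ 𝒜 1) (hindep : LinearIndependent k z) {g : ι →₀ R}
    (hg : Finsupp.linearCombination R z g = 0) (i : ι) : g i ∈ augmentationIdeal 𝒜 := by
  have h1 := intComponent_linearCombination_degree_one h hz 1 g
  rw [hg, map_zero] at h1
  choose c hc using fun r : R => exists_algebraMap_of_mem h (intComponent_mem h 0 r)
  by_cases hi : i ∈ g.support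
  swap
  · rw [Finsupp.notMem_support_iff.1 hi]
    exact Submodule.zero_mem _
  have hsum : ∑ i ∈ g.support, c (g i) • z i = 0 := by
    rw [h1, Finsupp.linearCombination_apply, Finsupp.sum_of_support_subset (s := g.support) _ ?_
      (fun i a => a • z i) fun i _ => zero_smul R (z i)]
    · refine Finset.sum_congr rfl fun i _ => ?_
      rw [freeComponent_apply, sub_self, ← hc, algebraMap_smul]
    · intro i hi
      rw [Finsupp.mem_support_iff] at *
      exact fun h0 => hi (by rw [freeComponent_apply, h0, map_zero])
  have h0 := linearIndependent_iff'.1 hindep _ _ hsum i hi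
  rw [mem_augmentationIdeal_iff h, ← hc, h0, map_zero]

lemma exists_minimal_cover_ker (h : IsConnectedGraded 𝒜) {ι : Type*} {κ : Type u} {e : ι → ℤ} {e' : κ → ℤ}
    {c : ℤ} (hc : ∀ j, c ≤ e' j) {m : κ → ι →₀ R} (hm : ∀ j, m j ∈ gradedFree 𝒜 e (e' j)) :
    ∃ (κ' : Type u) (e'' : κ' → ℤ) (m' : κ' → κ →₀ R), (∀ j, c ≤ e'' j) ∧
      (∀ j, m' j ∈ gradedFree 𝒜 e' (e'' j)) ∧
      LinearMap.range (Finsupp.linearCombination R m') =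
        LinearMap.ker (Finsupp.linearCombination R m) ∧
      ∀ g : κ' →₀ R, Finsupp.linearCombination R m' g = 0 → ∀ j, g j ∈ augmentationIdeal 𝒜 :=
  exists_minimal_cover h hc _ fun f hf n => by
    rw [LinearMap.mem_ker] at *
    rw [← freeComponent_linearCombination h hm, hf, map_zero]

lemma exists_minimal_cover_ker_degree_one (h : IsConnectedGraded 𝒜) {ι : Type} {z : ι → R}
    (hz : ∀ i, z i ∈ 𝒜 1) :
    ∃ (κ' : Type u) (e'' : κ' → ℤ) (m' : κ' → ι →₀ R), (∀ j, 1 ≤ e'' j) ∧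
      (∀ j, m' j ∈ gradedFree 𝒜 (fun _ => 1) (e'' j)) ∧
      LinearMap.range (Finsupp.linearCombination R m') =
        LinearMap.ker (Finsupp.linearCombination R z) ∧
      ∀ g : κ' →₀ R, Finsupp.linearCombination R m' g = 0 → ∀ j, g j ∈ augmentationIdeal 𝒜 :=
  exists_minimal_cover h (fun _ => le_rfl) _ fun f hf n => by
    rw [LinearMap.mem_ker] at *
    rw [← intComponent_linearCombination_degree_one h hz, hf, map_zero]

lemma linearCombination_eq_zero_of_mem_range {ι κ κ' : Type*} {m : κ → ι →₀ R}
    {m' : κ' → κ →₀ R} (hr : LinearMap.range (Finsupp.linearCombination R m') ≤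
      LinearMap.ker (Finsupp.linearCombination R m)) (j : κ') :
    Finsupp.linearCombination R m (m' j) = 0 :=
  hr ⟨Finsupp.single j 1, by simp⟩

lemma linearMap_eq_linearCombination {ι : Type*} (ψ : (ι →₀ R) →ₗ[R] R) (x : ι →₀ R) :
    ψ x = Finsupp.linearCombination R (fun i => ψ (Finsupp.single i 1)) x := by
  conv_lhs => rw [← Finsupp.sum_single x, Finsupp.sum, map_sum]
  rw [Finsupp.linearCombination_apply, Finsupp.sum]
  refine Finset.sum_congr rfl fun i _ => ?_
  rw [← map_smul, Finsupp.smul_single, smul_eq_mul, mul_one]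

/-- A linear form killing the generators of the kernel kills the kernel. -/
lemma linearCombination_comp_eq_zero {ι κ κ' : Type*} {m : κ → ι →₀ R} {m' : κ' → κ →₀ R}
    (hr : LinearMap.range (Finsupp.linearCombination R m') =
      LinearMap.ker (Finsupp.linearCombination R m)) {f : κ → R}
    (hf : ∀ j, Finsupp.linearCombination R f (m' j) = 0) (x : κ →₀ R)
    (hx : Finsupp.linearCombination R m x = 0) : Finsupp.linearCombination R f x = 0 := by
  obtain ⟨y, rfl⟩ := (hr ▸ hx : x ∈ LinearMap.range (Finsupp.linearCombination R m'))
  rw [Finsupp.linearCombination_apply R y, Finsupp.sum, map_sum]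
  exact Finset.sum_eq_zero fun j _ => by rw [map_smul, hf, smul_zero]

end Resolution

/-! ### The minimal resolutions in dimensions two and four. -/

section MinimalResolution

open Abelian

variable {k : Type*} [Field k] {R : Type u} [Ring R] [Algebra k R] {𝒜 : ℕ → Submodule k R}

lemma IsSyzygyOf.projective {X K : ModuleCat.{u} R} {n : ℕ} (h : IsSyzygyOf X K n 1) :
    Module.Projective R K := by
  have : Projective K := projective_iff_hasProjectiveDimensionLT_one.2 h.2
  exact (IsProjective.iff_projective K).2 this

lemma IsLeftASRegular.hasProjectiveDimensionLT {d : ℕ} (h : IsLeftASRegular 𝒜 d) :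
    HasProjectiveDimensionLT (trivialModule 𝒜) (d + 1) :=
  hasProjectiveDimensionLE_of_globalDim_le h.globalDim_le _

/-- The minimal resolution `0 → R(-2) → R(-1)² → R → k → 0` in dimension two. -/
theorem IsLeftASRegular.exists_resolution_two (hR : IsLeftASRegular 𝒜 2) {z : Fin 2 → R}
    (hz : ∀ i, z i ∈ 𝒜 1) (hindep : LinearIndependent k z)
    (hgen : Algebra.adjoin k (Set.range z) = ⊤) :
    ∃ a : Fin 2 →₀ R, (∀ i, a i ∈ 𝒜 1) ∧ LinearIndependent k a ∧
      (∀ x, Finsupp.linearCombination R z x = 0 ↔ ∃ r : R, r • a = x) ∧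
      ∀ r : R, r • a = 0 → r = 0 := by
  have h := hR.connected
  have hr1 := range_linearCombination_eq_augmentationIdeal h hz hgen
  have s1 := isSyzygyOf_augmentationIdeal (𝒜 := 𝒜) (m := 1) hR.hasProjectiveDimensionLT
  have s2 := s1.step (Finsupp.linearCombination R z) hr1
  obtain ⟨κ, e, m, he, hm, hr2, hmin⟩ := exists_minimal_cover_ker_degree_one h hz
  -- In dimension two this syzygy is already projective, so its minimal cover is injective and the
  -- resolution ends here.
  have hproj : Module.Projective R (LinearMap.range (Finsupp.linearCombination R m)) := by
    rw [hr2]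
    exact s2.projective
  have hinj : Function.Injective (Finsupp.linearCombination R m) := by
    rw [← LinearMap.ker_eq_bot, LinearMap.ker_eq_bot']
    exact fun g hg => minimal_cover_injective h he hmin hg
  have haug : ∀ j i, m j i ∈ augmentationIdeal 𝒜 := fun j i =>
    mem_augmentationIdeal_of_linearCombination_eq_zero h hz hindep
      (hr2.le ⟨Finsupp.single j 1, by simp⟩ : m j ∈ LinearMap.ker (Finsupp.linearCombination R z)) i
  obtain ⟨θ, hθ1, hθ2, hθ3, hθ4⟩ := s1.top hr1 hR.gorenstein hr2 hinj
  obtain ⟨j₀, hj₀, hall⟩ := exists_unique_last_generator h haug θ hθ1 hθ2 hθ3 hθ4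
  have hext : Subsingleton (Ext (trivialModule 𝒜) (ModuleCat.of R R) 1) :=
    hR.gorenstein.subsingleton 1 (by norm_num)
  -- A right relation `f` among the entries of the last differential has the form `f i = z i * g` by
  -- the vanishing of `Ext^1`, so its coefficients lie in the augmentation ideal.
  obtain ⟨-, hdeg, hli, hspan⟩ := last_differential_basis h hz hgen (hm j₀) (haug j₀) hall (by
    intro f hf i
    obtain ⟨g, hg⟩ := augmentationIdeal_dual_exact hr1 (Finsupp.linearCombination R f) (by
      intro x hx
      obtain ⟨y, rfl⟩ := (hr2 ▸ hx : x ∈ LinearMap.range (Finsupp.linearCombination R m))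
      rw [Finsupp.linearCombination_apply R y, Finsupp.sum, map_sum]
      refine Finset.sum_eq_zero fun j _ => ?_
      rw [map_smul, hj₀ j, hf, smul_zero])
    have := hg (Finsupp.single i 1)
    simp only [Finsupp.linearCombination_single, one_smul] at this
    rw [this]
    exact mul_mem_augmentationIdeal_right h (mem_augmentationIdeal_of_degree_one h hz i) g)
  have hlc : ∀ y : κ →₀ R, Finsupp.linearCombination R m y = y j₀ • m j₀ := fun y => by
    have : y = Finsupp.single j₀ (y j₀) := by
      ext j
      rw [hj₀ j, Finsupp.single_eq_same]
    conv_lhs => rw [this, Finsupp.linearCombination_single]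
  refine ⟨m j₀, fun i => hspan ▸ Submodule.subset_span ⟨i, rfl⟩, hli, fun x => ?_, fun r hr => ?_⟩
  · constructor
    · intro hx
      obtain ⟨y, rfl⟩ := (hr2 ▸ hx : x ∈ LinearMap.range (Finsupp.linearCombination R m))
      exact ⟨y j₀, (hlc y).symm⟩
    · rintro ⟨r, rfl⟩
      exact hr2.le ⟨Finsupp.single j₀ r, by simp⟩
  · have := hinj (a₁ := Finsupp.single j₀ r) (a₂ := 0) (by simpa using hr)
    simpa using this

/-- The minimal resolution `0 → R(-l) → R(1-l)⁴ → ⨁ R(-e₂ i) → R(-1)⁴ → R → k → 0` of an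
algebra that is left Artin-Schelter regular of dimension four, together with the exactness of its
dual. -/
structure QuarticResolution (𝒜 : ℕ → Submodule k R) (z : Fin 4 → R) where
  /-- the relations -/
  κ₂ : Type u
  /-- the generators of the third syzygy -/
  κ₃ : Type u
  finite₂ : Finite κ₂
  finite₃ : Finite κ₃
  /-- the degrees of the relations -/
  e₂ : κ₂ → ℤ
  /-- the degree of the last generator -/
  l : ℤ
  /-- the second differential -/
  m₂ : κ₂ → Fin 4 →₀ R
  /-- the third differential -/
  m₃ : κ₃ → κ₂ →₀ R
  /-- the fourth differential -/
  m₄ : κ₃ →₀ R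
  m₂_mem : ∀ j, m₂ j ∈ gradedFree 𝒜 (fun _ => 1) (e₂ j)
  m₃_mem : ∀ j, m₃ j ∈ gradedFree 𝒜 e₂ (l - 1)
  m₄_mem : m₄ ∈ gradedFree 𝒜 (fun _ => l - 1) l
  exact₁ : LinearMap.range (Finsupp.linearCombination R m₂) =
    LinearMap.ker (Finsupp.linearCombination R z)
  exact₂ : LinearMap.range (Finsupp.linearCombination R m₃) =
    LinearMap.ker (Finsupp.linearCombination R m₂)
  exact₃ : LinearMap.range (LinearMap.toSpanSingleton R (κ₃ →₀ R) m₄) =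
    LinearMap.ker (Finsupp.linearCombination R m₃)
  exact₄ : Function.Injective (LinearMap.toSpanSingleton R (κ₃ →₀ R) m₄)
  dual₁ : ∀ f : Fin 4 → R, (∀ j, Finsupp.linearCombination R f (m₂ j) = 0) →
    ∃ g : R, ∀ i, f i = z i * g
  dual₂ : ∀ f : κ₂ → R, (∀ j, Finsupp.linearCombination R f (m₃ j) = 0) →
    ∃ g : Fin 4 → R, ∀ i, f i = Finsupp.linearCombination R g (m₂ i)
  dual₃ : ∀ f : κ₃ → R, Finsupp.linearCombination R f m₄ = 0 →
    ∃ g : κ₂ → R, ∀ i, f i = Finsupp.linearCombination R g (m₃ i)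
  dual₄ : ∀ n, 0 < n → ∀ b ∈ 𝒜 n, ∃ f : κ₃ → R, Finsupp.linearCombination R f m₄ = b
  two_le : ∀ i, 2 ≤ e₂ i
  le_sub_two : ∀ i, e₂ i ≤ l - 2
  indep : LinearIndependent k m₄
  span : Submodule.span k (Set.range m₄) = 𝒜 1

/-- Minimal covers are taken until the syzygy is projective, which the global dimension guarantees
at the fourth cover. The vanishing of Ext in degrees 1, 2, 3 gives `dual₁`, `dual₂`, `dual₃`. The
top Ext group gives the single last generator and `dual₄`, and thereby puts the whole third free
module in degree `l - 1`. -/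
theorem IsLeftASRegular.nonempty_quarticResolution (hR : IsLeftASRegular 𝒜 4) {z : Fin 4 → R}
    (hz : ∀ i, z i ∈ 𝒜 1) (hindep : LinearIndependent k z)
    (hgen : Algebra.adjoin k (Set.range z) = ⊤) : Nonempty (QuarticResolution 𝒜 z) := by
  classical
  have h := hR.connected
  have hr1 := range_linearCombination_eq_augmentationIdeal h hz hgen
  have s1 := isSyzygyOf_augmentationIdeal (𝒜 := 𝒜) (m := 3) hR.hasProjectiveDimensionLT
  have s2 := s1.step (Finsupp.linearCombination R z) hr1
  obtain ⟨κ₂, e₂, m₂, he₂, hm₂, hr2, hmin₂⟩ := exists_minimal_cover_ker_degree_one h hz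
  have s3 := s2.step (Finsupp.linearCombination R m₂) hr2
  obtain ⟨κ₃, e₃, m₃, he₃, hm₃, hr3, hmin₃⟩ := exists_minimal_cover_ker h he₂ hm₂
  have s4 := s3.step (Finsupp.linearCombination R m₃) hr3
  obtain ⟨κ₄, e₄, m₄, he₄, hm₄, hr4, hmin₄⟩ := exists_minimal_cover_ker h he₃ hm₃
  have hproj : Module.Projective R (LinearMap.range (Finsupp.linearCombination R m₄)) := by
    rw [hr4]
    exact s4.projective
  have hinj : Function.Injective (Finsupp.linearCombination R m₄) := by
    rw [← LinearMap.ker_eq_bot, LinearMap.ker_eq_bot']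
    exact fun g hg => minimal_cover_injective h he₄ hmin₄ hg
  have haug₂ : ∀ j i, m₂ j i ∈ augmentationIdeal 𝒜 := fun j i =>
    mem_augmentationIdeal_of_linearCombination_eq_zero h hz hindep
      (hr2.le ⟨Finsupp.single j 1, by simp⟩ :
        m₂ j ∈ LinearMap.ker (Finsupp.linearCombination R z)) i
  have haug₃ : ∀ j i, m₃ j i ∈ augmentationIdeal 𝒜 := fun j i =>
    hmin₂ _ (linearCombination_eq_zero_of_mem_range hr3.le j) i
  have haug₄ : ∀ j i, m₄ j i ∈ augmentationIdeal 𝒜 := fun j i =>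
    hmin₃ _ (linearCombination_eq_zero_of_mem_range hr4.le j) i
  obtain ⟨θ, hθ1, hθ2, hθ3, hθ4⟩ := s3.top hr3 hR.gorenstein hr4 hinj
  obtain ⟨j₀, hj₀, hall⟩ := exists_unique_last_generator h haug₄ θ hθ1 hθ2 hθ3 hθ4
  have hlc : ∀ y : κ₄ →₀ R, Finsupp.linearCombination R m₄ y = y j₀ • m₄ j₀ := fun y => by
    have : y = Finsupp.single j₀ (y j₀) := by
      ext j
      rw [hj₀ j, Finsupp.single_eq_same]
    conv_lhs => rw [this, Finsupp.linearCombination_single]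
  have hext1 : Subsingleton (Ext (trivialModule 𝒜) (ModuleCat.of R R) 1) :=
    hR.gorenstein.subsingleton 1 (by norm_num)
  have hext2 : Subsingleton (Ext (trivialModule 𝒜) (ModuleCat.of R R) (1 + 1)) :=
    hR.gorenstein.subsingleton 2 (by norm_num)
  have hext3 : Subsingleton (Ext (trivialModule 𝒜) (ModuleCat.of R R) (2 + 1)) :=
    hR.gorenstein.subsingleton 3 (by norm_num)
  have dual₁ : ∀ f : Fin 4 → R, (∀ j, Finsupp.linearCombination R f (m₂ j) = 0) →
      ∃ g : R, ∀ i, f i = z i * g := fun f hf => by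
    obtain ⟨g, hg⟩ := augmentationIdeal_dual_exact hr1 (Finsupp.linearCombination R f) (by
      intro x hx
      obtain ⟨y, rfl⟩ := (hr2 ▸ hx : x ∈ LinearMap.range (Finsupp.linearCombination R m₂))
      rw [Finsupp.linearCombination_apply R y, Finsupp.sum, map_sum]
      exact Finset.sum_eq_zero fun j _ => by rw [map_smul, hf, smul_zero])
    exact ⟨g, fun i => by simpa using hg (Finsupp.single i 1)⟩
  have dual₂ : ∀ f : κ₂ → R, (∀ j, Finsupp.linearCombination R f (m₃ j) = 0) →
      ∃ g : Fin 4 → R, ∀ i, f i = Finsupp.linearCombination R g (m₂ i) := fun f hf => by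
    obtain ⟨ψ, hψ⟩ := s1.dual_exact hr1 hr2 (Finsupp.linearCombination R f)
      (linearCombination_comp_eq_zero hr3 hf)
    refine ⟨fun i => ψ (Finsupp.single i 1), fun i => ?_⟩
    rw [← linearMap_eq_linearCombination ψ]
    simpa using (hψ (Finsupp.single i 1)).symm
  have dual₃ : ∀ f : κ₃ → R, Finsupp.linearCombination R f (m₄ j₀) = 0 →
      ∃ g : κ₂ → R, ∀ i, f i = Finsupp.linearCombination R g (m₃ i) := fun f hf => by
    obtain ⟨ψ, hψ⟩ := s2.dual_exact hr2 hr3 (Finsupp.linearCombination R f)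
      (linearCombination_comp_eq_zero hr4 fun j => by rw [hj₀ j, hf])
    refine ⟨fun i => ψ (Finsupp.single i 1), fun i => ?_⟩
    rw [← linearMap_eq_linearCombination ψ]
    simpa using (hψ (Finsupp.single i 1)).symm
  obtain ⟨hfin₃, hdeg, hli, hspan⟩ := last_differential_basis h hz hgen (hm₄ j₀) (haug₄ j₀) hall (by
    intro f hf i
    obtain ⟨g, hg⟩ := dual₃ f hf
    rw [hg]
    exact map_mem_augmentationIdeal h _ (haug₃ i))
  -- A zero column would make a unit covector a cocycle; `dual₂` would then express `1` by the
  -- entries of `m₂`, which lie in the augmentation ideal. Nonzero columns yield both the finiteness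
  -- of `κ₂` and the bound `e₂ i ≤ l - 2`, since an entry of positive degree has degree `l - 1 - e₂
  -- i`.
  have hcol : ∀ i, ∃ j, m₃ j i ≠ 0 := fun i => by
    by_contra! hi
    obtain ⟨g, hg⟩ := dual₂ (Pi.single i 1) fun j => by
      rw [Finsupp.linearCombination_apply, Finsupp.sum]
      refine Finset.sum_eq_zero fun i' _ => ?_
      by_cases hi' : i' = i
      · rw [hi', hi j, zero_smul]
      · rw [Pi.single_eq_of_ne hi', smul_zero]
    have h1 := hg i
    rw [Pi.single_eq_same] at h1
    exact one_notMem_augmentationIdeal h (h1 ▸ map_mem_augmentationIdeal h _ (haug₂ i))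
  have hfin₂ : Finite κ₂ := by
    have : (⋃ j : κ₃, ((m₃ j).support : Set κ₂)) = Set.univ :=
      Set.eq_univ_of_forall fun i => Set.mem_iUnion.2 <| by
        obtain ⟨j, hj⟩ := hcol i
        exact ⟨j, Finsupp.mem_support_iff.2 hj⟩
    exact Set.finite_univ_iff.1 (this ▸ Set.finite_iUnion fun j => (m₃ j).support.finite_toSet)
  have he₃' : e₃ = fun _ => e₄ j₀ - 1 := funext hdeg
  subst he₃'
  have hm₂ne : ∀ j, m₂ j ≠ 0 := fun j h0 => by
    have := hmin₂ (Finsupp.single j 1) (by simp [h0]) j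
    rw [Finsupp.single_eq_same] at this
    exact one_notMem_augmentationIdeal h this
  refine ⟨⟨κ₂, κ₃, hfin₂, hfin₃, e₂, e₄ j₀, m₂, m₃, m₄ j₀, hm₂, hm₃, hm₄ j₀, hr2, hr3, ?_, ?_,
    dual₁, dual₂, dual₃, hall, fun i => ?_, fun i => ?_, hli, hspan⟩⟩
  · rw [← hr4]
    ext x
    constructor
    · rintro ⟨r, rfl⟩
      exact ⟨Finsupp.single j₀ r, by simp⟩
    · rintro ⟨y, rfl⟩
      exact ⟨y j₀, by rw [hlc, LinearMap.toSpanSingleton_apply]⟩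
  · intro r s hrs
    simp only [LinearMap.toSpanSingleton_apply] at hrs
    have := hinj (a₁ := Finsupp.single j₀ r) (a₂ := Finsupp.single j₀ s) (by simpa using hrs)
    exact Finsupp.single_injective _ this
  · obtain ⟨t, ht⟩ := Finsupp.ne_iff.1 (hm₂ne i)
    have := pos_of_mem_augmentationIdeal h (hm₂ i t) (haug₂ i t) ht
    dsimp only at this
    omega
  · obtain ⟨j, hj⟩ := hcol i
    have := pos_of_mem_augmentationIdeal h (hm₃ j i) (haug₃ j i) hj
    dsimp only at this
    omega

end MinimalResolution

/-! ### Hilbert functions computed from the resolution and from its dual. -/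

section Counting

open Module

/-- Rank-nullity in a single degree. `pV` and `pW` play the role of projections onto the homogeneous
components `A` and `B`; their compatibility with `f` ensures that a homogeneous element of the image
`K` comes from a homogeneous element. -/
lemma finrank_eq_add_of_exact {k V W : Type*} [Field k] [AddCommGroup V] [Module k V]
    [AddCommGroup W] [Module k W] (f : V →ₗ[k] W) (A : Submodule k V) (B K : Submodule k W)
    [FiniteDimensional k A] (pV : V → V) (pW : W → W) (hf : ∀ v ∈ A, f v ∈ B)
    (hpV : ∀ v, pV v ∈ A) (hpW : ∀ w ∈ B, pW w = w) (hcomm : ∀ v, pW (f v) = f (pV v))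
    (hK : ∀ w, w ∈ K ↔ ∃ v, f v = w) :
    (finrank k A : ℤ) =
      finrank k (K ⊓ B : Submodule k W) + finrank k (LinearMap.ker f ⊓ A : Submodule k V) := by
  have h1 : A.map f = K ⊓ B := by
    ext w
    constructor
    · rintro ⟨v, hv, rfl⟩
      exact ⟨(hK _).2 ⟨v, rfl⟩, hf v hv⟩
    · rintro ⟨hwK, hwB⟩
      obtain ⟨v, rfl⟩ := (hK _).1 hwK
      exact ⟨pV v, hpV v, by rw [← hcomm, hpW _ hwB]⟩
  have h2 := LinearMap.finrank_range_add_finrank_ker (f.domRestrict A)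
  rw [LinearMap.range_domRestrict, h1] at h2
  have h3 : finrank k (LinearMap.ker (f.domRestrict A)) =
      finrank k (LinearMap.ker f ⊓ A : Submodule k V) := by
    have h4 : (LinearMap.ker (f.domRestrict A)).map A.subtype = LinearMap.ker f ⊓ A := ?_
    · rw [LinearEquiv.finrank_eq (Submodule.equivMapOfInjective A.subtype
        A.injective_subtype (LinearMap.ker (f.domRestrict A))), h4]
    ext v
    simp only [Submodule.mem_map, LinearMap.mem_ker, Submodule.mem_inf]
    constructor
    · rintro ⟨w, hw, rfl⟩
      exact ⟨hw, w.2⟩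
    · rintro ⟨hv, hvA⟩
      exact ⟨⟨v, hvA⟩, hv, rfl⟩
  rw [← h2, h3]
  push_cast
  ring

variable {k : Type*} [Field k] {R : Type u} [Ring R] [Algebra k R] {𝒜 : ℕ → Submodule k R}

/-- The Hilbert function, extended by zero to negative degrees. -/
def hilbertFun (𝒜 : ℕ → Submodule k R) (n : ℤ) : ℤ := finrank k (intGrading 𝒜 n)

lemma hilbertFun_natCast (n : ℕ) : hilbertFun 𝒜 n = finrank k (𝒜 n) := by
  rw [hilbertFun, intGrading_natCast]

lemma hilbertFun_of_neg {n : ℤ} (hn : n < 0) : hilbertFun 𝒜 n = 0 := by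
  rw [hilbertFun, intGrading_of_neg hn, finrank_bot, Nat.cast_zero]

lemma finite_intGrading (hfin : ∀ n, Module.Finite k (𝒜 n)) (n : ℤ) :
    Module.Finite k (intGrading 𝒜 n) := by
  by_cases hn : 0 ≤ n
  · lift n to ℕ using hn
    rw [intGrading_natCast]
    exact hfin n
  · rw [intGrading_of_neg (not_le.1 hn)]
    infer_instance

lemma hilbertFun_zero (h : IsConnectedGraded 𝒜) : hilbertFun 𝒜 0 = 1 := by
  have := h.nontrivial
  rw [hilbertFun, intGrading_zero, h.zero_eq, Submodule.one_eq_span,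
    finrank_span_singleton one_ne_zero, Nat.cast_one]

lemma finrank_augmentationIdeal_inf (h : IsConnectedGraded 𝒜) (n : ℤ) :
    (finrank k ((augmentationIdeal 𝒜).restrictScalars k ⊓ intGrading 𝒜 n : Submodule k R) : ℤ) =
      hilbertFun 𝒜 n - if n = 0 then 1 else 0 := by
  split_ifs with hn
  · subst hn
    have : (augmentationIdeal 𝒜).restrictScalars k ⊓ intGrading 𝒜 0 = ⊥ := by
      rw [eq_bot_iff]
      rintro x ⟨h1, h2⟩
      have h1' := (mem_augmentationIdeal_iff h).1 h1
      rwa [intComponent_of_mem h h2] at h1'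
    rw [this, finrank_bot, hilbertFun_zero h]
    rfl
  · rw [sub_zero, inf_eq_right.2, hilbertFun]
    intro x hx
    exact (mem_augmentationIdeal_iff h).2 (intComponent_of_mem_ne h hx hn)

/-- The homogeneous pieces of a free module of finite rank, written with functions. -/
def gradedPi (𝒜 : ℕ → Submodule k R) {κ : Type*} (e : κ → ℤ) (n : ℤ) : Submodule k (κ → R) :=
  Submodule.pi Set.univ fun i => intGrading 𝒜 (n + e i)

lemma mem_gradedPi {κ : Type*} {e : κ → ℤ} {n : ℤ} {f : κ → R} :
    f ∈ gradedPi 𝒜 e n ↔ ∀ i, f i ∈ intGrading 𝒜 (n + e i) := by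
  simp [gradedPi]

/-- A product of submodules is the module of sections. -/
def gradedPiEquiv (𝒜 : ℕ → Submodule k R) {κ : Type*} (e : κ → ℤ) (n : ℤ) :
    gradedPi 𝒜 e n ≃ₗ[k] ∀ i, intGrading 𝒜 (n + e i) where
  toFun f i := ⟨f.1 i, mem_gradedPi.1 f.2 i⟩
  invFun f := ⟨fun i => f i, mem_gradedPi.2 fun i => (f i).2⟩
  map_add' _ _ := rfl
  map_smul' _ _ := rfl

/-- For a finite index set, finitely supported functions are all functions. -/
def gradedFreeEquiv (𝒜 : ℕ → Submodule k R) {κ : Type*} [Finite κ] (e : κ → ℤ) (n : ℤ) :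
    gradedFree 𝒜 e n ≃ₗ[k] ∀ i, intGrading 𝒜 (n - e i) where
  toFun f i := ⟨f.1 i, f.2 i⟩
  invFun f := ⟨Finsupp.equivFunOnFinite.symm fun i => f i, fun i => (f i).2⟩
  map_add' _ _ := rfl
  map_smul' _ _ := rfl
  left_inv f := Subtype.ext (Finsupp.ext fun _ => rfl)

variable (hfin : ∀ n, Module.Finite k (𝒜 n))
include hfin

lemma finite_gradedPi {κ : Type*} [Finite κ] (e : κ → ℤ) (n : ℤ) :
    Module.Finite k (gradedPi 𝒜 e n) := by
  have := finite_intGrading hfin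
  exact Module.Finite.equiv (gradedPiEquiv 𝒜 e n).symm

lemma finrank_gradedPi {κ : Type*} [Fintype κ] (e : κ → ℤ) (n : ℤ) :
    (finrank k (gradedPi 𝒜 e n) : ℤ) = ∑ i, hilbertFun 𝒜 (n + e i) := by
  have := finite_intGrading hfin
  rw [(gradedPiEquiv 𝒜 e n).finrank_eq, Module.finrank_pi_fintype, Nat.cast_sum]
  rfl

lemma finite_gradedFree {κ : Type*} [Finite κ] (e : κ → ℤ) (n : ℤ) :
    Module.Finite k (gradedFree 𝒜 e n) := by
  have := finite_intGrading hfin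
  exact Module.Finite.equiv (gradedFreeEquiv 𝒜 e n).symm

lemma finrank_gradedFree {κ : Type*} [Fintype κ] (e : κ → ℤ) (n : ℤ) :
    (finrank k (gradedFree 𝒜 e n) : ℤ) = ∑ i, hilbertFun 𝒜 (n - e i) := by
  have := finite_intGrading hfin
  rw [(gradedFreeEquiv 𝒜 e n).finrank_eq, Module.finrank_pi_fintype, Nat.cast_sum]
  rfl

lemma finrank_gradedFree_eq_add (h : IsConnectedGraded 𝒜) {ι κ : Type*} [Finite κ] {e : ι → ℤ}
    {e' : κ → ℤ} {m : κ → ι →₀ R} (hm : ∀ j, m j ∈ gradedFree 𝒜 e (e' j)) {N : Submodule R (ι →₀ R)}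
    (hN : LinearMap.range (Finsupp.linearCombination R m) = N) (n : ℤ) :
    (finrank k (gradedFree 𝒜 e' n) : ℤ) =
      finrank k (N.restrictScalars k ⊓ gradedFree 𝒜 e n : Submodule k (ι →₀ R)) +
      finrank k ((LinearMap.ker (Finsupp.linearCombination R m)).restrictScalars k ⊓
        gradedFree 𝒜 e' n : Submodule k (κ →₀ R)) := by
  have := finite_gradedFree hfin e' n
  refine finrank_eq_add_of_exact ((Finsupp.linearCombination R m).restrictScalars k) _ _ _
    (freeComponent h e' n) (freeComponent h e n) (fun v hv => ?_) (freeComponent_mem h e' n)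
    (fun w hw => freeComponent_of_mem h hw) (freeComponent_linearCombination h hm n)
    fun w => by rw [← hN]; rfl
  rw [← freeComponent_of_mem h hv, LinearMap.restrictScalars_apply,
    ← freeComponent_linearCombination h hm n]
  exact freeComponent_mem h e n _

lemma finrank_gradedFree_eq_add_degree_one (h : IsConnectedGraded 𝒜) {κ : Type*} [Finite κ]
    {z : κ → R} (hz : ∀ i, z i ∈ 𝒜 1) {N : Submodule R R}
    (hN : LinearMap.range (Finsupp.linearCombination R z) = N) (n : ℤ) :
    (finrank k (gradedFree 𝒜 (fun _ : κ => 1) n) : ℤ) =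
      finrank k (N.restrictScalars k ⊓ intGrading 𝒜 n : Submodule k R) +
      finrank k ((LinearMap.ker (Finsupp.linearCombination R z)).restrictScalars k ⊓
        gradedFree 𝒜 (fun _ => 1) n : Submodule k (κ →₀ R)) := by
  have := finite_gradedFree hfin (fun _ : κ => 1) n
  refine finrank_eq_add_of_exact ((Finsupp.linearCombination R z).restrictScalars k) _ _ _
    (freeComponent h (fun _ => 1) n) (intComponent h n) (fun v hv => ?_)
    (freeComponent_mem h _ n) (fun w hw => intComponent_of_mem h hw)
    (intComponent_linearCombination_degree_one h hz n) fun w => by rw [← hN]; rfl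
  rw [← freeComponent_of_mem h hv, LinearMap.restrictScalars_apply,
    ← intComponent_linearCombination_degree_one h hz n]
  exact intComponent_mem h n _

lemma hilbertFun_eq_of_toSpanSingleton (h : IsConnectedGraded 𝒜) {κ : Type*}
    {e : κ → ℤ} {l : ℤ} {a : κ →₀ R} (ha : a ∈ gradedFree 𝒜 e l) {N : Submodule R (κ →₀ R)}
    (hN : LinearMap.range (LinearMap.toSpanSingleton R (κ →₀ R) a) = N)
    (hinj : Function.Injective (LinearMap.toSpanSingleton R (κ →₀ R) a)) (n : ℤ) :
    hilbertFun 𝒜 (n - l) =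
      finrank k (N.restrictScalars k ⊓ gradedFree 𝒜 e n : Submodule k (κ →₀ R)) := by
  have := finite_intGrading hfin (n - l)
  have key := finrank_eq_add_of_exact ((LinearMap.toSpanSingleton R (κ →₀ R) a).restrictScalars k)
    (intGrading 𝒜 (n - l)) (gradedFree 𝒜 e n) (N.restrictScalars k)
    (intComponent h (n - l)) (freeComponent h e n) (fun v hv => ?_)
    (intComponent_mem h _) (fun w hw => freeComponent_of_mem h hw)
    (freeComponent_smul_of_mem h ha n) fun w => by rw [← hN]; rfl
  · have hker : LinearMap.ker
        ((LinearMap.toSpanSingleton R (κ →₀ R) a).restrictScalars k) = ⊥ :=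
      LinearMap.ker_eq_bot.2 hinj
    rw [hker, bot_inf_eq, finrank_bot, Nat.cast_zero, add_zero] at key
    exact key
  · have := smul_mem_gradedFree h hv ha
    rwa [sub_add_cancel] at this

end Counting

section CountingFour

open Module

variable {k : Type*} [Field k] {R : Type u} [Ring R] [Algebra k R] {𝒜 : ℕ → Submodule k R}
  {z : Fin 4 → R}

lemma QuarticResolution.card_eq (h : IsConnectedGraded 𝒜) (Q : QuarticResolution 𝒜 z)
    (hz : ∀ i, z i ∈ 𝒜 1) (hindep : LinearIndependent k z)
    (hgen : Algebra.adjoin k (Set.range z) = ⊤) [Fintype Q.κ₃] : Fintype.card Q.κ₃ = 4 := by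
  rw [← finrank_span_eq_card Q.indep, Q.span, degree_one_eq_span h hz hgen,
    finrank_span_eq_card hindep, Fintype.card_fin]

/-- The alternating sum of dimensions along the resolution in degree `n`; the right side is the
trivial module. -/
lemma QuarticResolution.hilbertFun_left (Q : QuarticResolution 𝒜 z) [Fintype Q.κ₂]
    (h : IsConnectedGraded 𝒜) (hfin : ∀ n, Module.Finite k (𝒜 n))
    (hz : ∀ i, z i ∈ 𝒜 1) (hindep : LinearIndependent k z)
    (hgen : Algebra.adjoin k (Set.range z) = ⊤) (n : ℤ) :
    hilbertFun 𝒜 n - 4 * hilbertFun 𝒜 (n - 1) + ∑ i, hilbertFun 𝒜 (n - Q.e₂ i) -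
      4 * hilbertFun 𝒜 (n - (Q.l - 1)) + hilbertFun 𝒜 (n - Q.l) = if n = 0 then 1 else 0 := by
  have := Q.finite₃
  have := Fintype.ofFinite Q.κ₃
  have hcard := Q.card_eq h hz hindep hgen
  have e1 := finrank_gradedFree_eq_add_degree_one hfin h hz
    (range_linearCombination_eq_augmentationIdeal h hz hgen) n
  have e2 := finrank_gradedFree_eq_add hfin h Q.m₂_mem Q.exact₁ n
  have e3 := finrank_gradedFree_eq_add hfin h Q.m₃_mem Q.exact₂ n
  have e4 := hilbertFun_eq_of_toSpanSingleton hfin h Q.m₄_mem Q.exact₃ Q.exact₄ n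
  rw [finrank_augmentationIdeal_inf h, finrank_gradedFree hfin] at e1
  rw [finrank_gradedFree hfin] at e2 e3
  simp only [Finset.sum_const, Finset.card_univ, Fintype.card_fin, nsmul_eq_mul,
    Nat.cast_ofNat, hcard] at e1 e3
  linarith

/-- The transpose of a matrix of right multiplications, acting on columns. -/
def colMap (k : Type*) [Field k] [Algebra k R] {ι κ : Type*} (m : κ → ι →₀ R) :
    (ι → R) →ₗ[k] (κ → R) where
  toFun f j := Finsupp.linearCombination R f (m j)
  map_add' f g := by
    ext j
    simp [Finsupp.linearCombination_apply, Finsupp.sum, mul_add, Finset.sum_add_distrib]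
  map_smul' c f := by
    ext j
    simp [Finsupp.linearCombination_apply, Finsupp.sum, Finset.smul_sum]

/-- Componentwise projection onto homogeneous components of a space of columns. -/
def piComponent (h : IsConnectedGraded 𝒜) {κ : Type*} (e : κ → ℤ) (n : ℤ) (f : κ → R) : κ → R :=
  fun i => intComponent h (n + e i) (f i)

lemma piComponent_mem (h : IsConnectedGraded 𝒜) {κ : Type*} (e : κ → ℤ) (n : ℤ) (f : κ → R) :
    piComponent h e n f ∈ gradedPi 𝒜 e n :=
  mem_gradedPi.2 fun _ => intComponent_mem h _ _

lemma piComponent_of_mem (h : IsConnectedGraded 𝒜) {κ : Type*} {e : κ → ℤ} {n : ℤ} {f : κ → R}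
    (hf : f ∈ gradedPi 𝒜 e n) : piComponent h e n f = f :=
  funext fun i => intComponent_of_mem h (mem_gradedPi.1 hf i)

lemma intComponent_linearCombination (h : IsConnectedGraded 𝒜) {ι : Type*} {e : ι → ℤ} {d : ℤ}
    {m : ι →₀ R} (hm : m ∈ gradedFree 𝒜 e d) (n : ℤ) (f : ι → R) :
    intComponent h (n + d) (Finsupp.linearCombination R f m) =
      Finsupp.linearCombination R (piComponent h e n f) m := by
  rw [Finsupp.linearCombination_apply, Finsupp.linearCombination_apply, Finsupp.sum, Finsupp.sum,
    map_sum]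
  refine Finset.sum_congr rfl fun i _ => ?_
  rw [smul_eq_mul, intComponent_mul_left h (hm i), smul_eq_mul, piComponent]
  congr 3
  omega

lemma piComponent_colMap (h : IsConnectedGraded 𝒜) {ι κ : Type*} {e : ι → ℤ}
    {e' : κ → ℤ} {m : κ → ι →₀ R} (hm : ∀ j, m j ∈ gradedFree 𝒜 e (e' j)) (n : ℤ) (f : ι → R) :
    piComponent h e' n (colMap k m f) = colMap k m (piComponent h e n f) :=
  funext fun j => intComponent_linearCombination h (hm j) n f

variable (hfin : ∀ n, Module.Finite k (𝒜 n))
include hfin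

lemma finrank_gradedPi_eq_add (h : IsConnectedGraded 𝒜) {ι κ : Type*} [Finite ι] {e : ι → ℤ}
    {e' : κ → ℤ} {m : κ → ι →₀ R} (hm : ∀ j, m j ∈ gradedFree 𝒜 e (e' j))
    {N : Submodule k (κ → R)} (hN : ∀ w, w ∈ N ↔ ∃ v, colMap k m v = w) (n : ℤ) :
    (finrank k (gradedPi 𝒜 e n) : ℤ) =
      finrank k (N ⊓ gradedPi 𝒜 e' n : Submodule k (κ → R)) +
      finrank k (LinearMap.ker (colMap k m) ⊓ gradedPi 𝒜 e n : Submodule k (ι → R)) := by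
  have := finite_gradedPi hfin e n
  refine finrank_eq_add_of_exact (colMap k m) _ _ _
    (piComponent h e n) (piComponent h e' n) (fun v hv => ?_) (piComponent_mem h e n)
    (fun w hw => piComponent_of_mem h hw) (piComponent_colMap h hm n) hN
  rw [← piComponent_of_mem h hv, ← piComponent_colMap h hm n]
  exact piComponent_mem h e' n _

omit hfin in
lemma linearCombination_linearCombination_apply {ι κ : Type*} (f : ι → R) (m : κ → ι →₀ R)
    (x : κ →₀ R) : Finsupp.linearCombination R (fun i => Finsupp.linearCombination R f (m i)) x =
      Finsupp.linearCombination R f (Finsupp.linearCombination R m x) := by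
  rw [Finsupp.linearCombination_apply R x, Finsupp.linearCombination_apply R x, Finsupp.sum,
    Finsupp.sum, map_sum]
  exact Finset.sum_congr rfl fun i _ => (map_smul _ _ _).symm

/-- The same count along the dual complex, which resolves the trivial right module. There the
relations sit in degrees `l - e₂ i`; injectivity at the start holds because `R` is a domain. -/
lemma QuarticResolution.hilbertFun_right [IsDomain R] (Q : QuarticResolution 𝒜 z) [Fintype Q.κ₂]
    (h : IsConnectedGraded 𝒜)
    (hz : ∀ i, z i ∈ 𝒜 1) (hindep : LinearIndependent k z)
    (hgen : Algebra.adjoin k (Set.range z) = ⊤) (n : ℤ) :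
    hilbertFun 𝒜 n - 4 * hilbertFun 𝒜 (n - 1) + ∑ i, hilbertFun 𝒜 (n - (Q.l - Q.e₂ i)) -
      4 * hilbertFun 𝒜 (n - (Q.l - 1)) + hilbertFun 𝒜 (n - Q.l) = if n = 0 then 1 else 0 := by
  have := Q.finite₃
  have := Fintype.ofFinite Q.κ₃
  have hcard := Q.card_eq h hz hindep hgen
  have hz1 : ∀ i, z i ∈ intGrading 𝒜 1 := fun i => by rw [intGrading_one]; exact hz i
  -- the column of generators
  let f₁ : R →ₗ[k] (Fin 4 → R) :=
    { toFun := fun g i => z i * g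
      map_add' := fun g g' => by ext i; simp [mul_add]
      map_smul' := fun c g => by ext i; simp }
  let f₄ : (Q.κ₃ → R) →ₗ[k] R :=
    { toFun := fun f => Finsupp.linearCombination R f Q.m₄
      map_add' := fun f g => by
        simp [Finsupp.linearCombination_apply, Finsupp.sum, mul_add, Finset.sum_add_distrib]
      map_smul' := fun c f => by
        simp [Finsupp.linearCombination_apply, Finsupp.sum, Finset.smul_sum] }
  have hf₁ : ∀ v p, piComponent h (fun _ => (1 : ℤ)) p (f₁ v) = f₁ (intComponent h p v) :=
    fun v p => funext fun i => by
      change intComponent h (p + 1) (z i * v) = z i * intComponent h p v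
      rw [intComponent_mul_left h (hz1 i), add_sub_cancel_right]
  -- Dualizing reverses the shifts: degree `p` at the start of the dual complex corresponds to
  -- degree `n` at its end.
  set p := n - Q.l with hp
  have e1 : hilbertFun 𝒜 p = finrank k (LinearMap.ker (colMap k Q.m₂) ⊓
      gradedPi 𝒜 (fun _ => 1) p : Submodule k (Fin 4 → R)) := by
    have := finite_intGrading hfin p
    have key := finrank_eq_add_of_exact f₁ (intGrading 𝒜 p) (gradedPi 𝒜 (fun _ => 1) p)
      (LinearMap.ker (colMap k Q.m₂)) (intComponent h p) (piComponent h (fun _ => 1) p)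
      (fun v hv => ?_) (intComponent_mem h p) (fun w hw => piComponent_of_mem h hw)
      (fun v => hf₁ v p) fun w => ?_
    · have hker : LinearMap.ker f₁ = ⊥ := LinearMap.ker_eq_bot'.2 fun g hg => by
        have := congrFun hg 0
        exact (mul_eq_zero.1 this).resolve_left (hindep.ne_zero 0)
      rw [hker, bot_inf_eq, finrank_bot, Nat.cast_zero, add_zero] at key
      exact key
    · rw [← intComponent_of_mem h hv, ← hf₁]
      exact piComponent_mem h _ p _
    · constructor
      · intro hw
        obtain ⟨g, hg⟩ := Q.dual₁ w fun j => congrFun hw j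
        exact ⟨g, funext fun i => (hg i).symm⟩
      · rintro ⟨g, rfl⟩
        refine LinearMap.mem_ker.2 (funext fun j => ?_)
        have h0 : Finsupp.linearCombination R z (Q.m₂ j) = 0 :=
          Q.exact₁.le ⟨Finsupp.single j 1, by simp⟩
        change Finsupp.linearCombination R (fun i => z i * g) (Q.m₂ j) = 0
        rw [Finsupp.linearCombination_apply, Finsupp.sum] at h0 ⊢
        simp only [smul_eq_mul, ← mul_assoc, ← Finset.sum_mul] at h0 ⊢
        rw [h0, zero_mul]
  have e2 := finrank_gradedPi_eq_add hfin h Q.m₂_mem (N := LinearMap.ker (colMap k Q.m₃))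
    (fun w => by
      constructor
      · intro hw
        obtain ⟨g, hg⟩ := Q.dual₂ w fun j => congrFun hw j
        exact ⟨g, funext fun i => (hg i).symm⟩
      · rintro ⟨g, rfl⟩
        refine LinearMap.mem_ker.2 (funext fun j => ?_)
        change Finsupp.linearCombination R (fun i => Finsupp.linearCombination R g (Q.m₂ i))
          (Q.m₃ j) = 0
        rw [linearCombination_linearCombination_apply,
          linearCombination_eq_zero_of_mem_range Q.exact₂.le, map_zero]) p
  have e3 := finrank_gradedPi_eq_add hfin h Q.m₃_mem (N := LinearMap.ker f₄)
    (fun w => by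
      constructor
      · intro hw
        obtain ⟨g, hg⟩ := Q.dual₃ w hw
        exact ⟨g, funext fun i => (hg i).symm⟩
      · rintro ⟨g, rfl⟩
        change Finsupp.linearCombination R (fun i => Finsupp.linearCombination R g (Q.m₃ i))
          Q.m₄ = 0
        have h0 : Finsupp.linearCombination R Q.m₃ Q.m₄ = 0 :=
          Q.exact₃.le ⟨1, by simp⟩
        rw [linearCombination_linearCombination_apply, h0, map_zero]) p
  have e4 : (finrank k (gradedPi 𝒜 (fun _ : Q.κ₃ => Q.l - 1) p) : ℤ) =
      finrank k ((augmentationIdeal 𝒜).restrictScalars k ⊓ intGrading 𝒜 n : Submodule k R) +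
      finrank k (LinearMap.ker f₄ ⊓ gradedPi 𝒜 (fun _ => Q.l - 1) p :
        Submodule k (Q.κ₃ → R)) := by
    have := finite_gradedPi hfin (fun _ : Q.κ₃ => Q.l - 1) p
    have hcomm : ∀ v, intComponent h n (f₄ v) = f₄ (piComponent h (fun _ => Q.l - 1) p v) :=
      fun v => by
        have := intComponent_linearCombination h Q.m₄_mem p v
        rw [hp, sub_add_cancel] at this
        exact this
    refine finrank_eq_add_of_exact f₄ _ _ _ (piComponent h _ p) (intComponent h n)
      (fun v hv => ?_) (piComponent_mem h _ p) (fun w hw => intComponent_of_mem h hw) hcomm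
      fun w => ?_
    · rw [← piComponent_of_mem h hv, ← hcomm]
      exact intComponent_mem h n _
    · constructor
      · intro hw
        obtain ⟨s, -, hs⟩ := exists_sum_intComponent h w
        rw [← hs]
        change _ ∈ LinearMap.range f₄
        refine Submodule.sum_mem _ fun i _ => ?_
        rcases lt_trichotomy i 0 with hi | rfl | hi
        · rw [intComponent_of_neg h hi]
          exact Submodule.zero_mem _
        · rw [(mem_augmentationIdeal_iff h).1 hw]
          exact Submodule.zero_mem _
        · have hm := intComponent_mem h i w
          lift i to ℕ using hi.le
          rw [intGrading_natCast] at hm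
          obtain ⟨f, hf⟩ := Q.dual₄ i (by omega) _ hm
          exact ⟨f, hf⟩
      · rintro ⟨f, rfl⟩
        change Finsupp.linearCombination R f Q.m₄ ∈ augmentationIdeal 𝒜
        refine map_mem_augmentationIdeal h _ fun i => ?_
        have := Q.m₄_mem i
        exact mem_augmentationIdeal_of_mem h (i := Q.l - (Q.l - 1)) (by omega) this
  rw [finrank_augmentationIdeal_inf h, finrank_gradedPi hfin] at e4
  rw [finrank_gradedPi hfin] at e2 e3
  simp only [Finset.sum_const, Finset.card_univ, Fintype.card_fin, nsmul_eq_mul,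
    Nat.cast_ofNat, hcard] at e2 e4
  have s1 : ∀ i, p + Q.e₂ i = n - (Q.l - Q.e₂ i) := fun i => by omega
  have s2 : p + (Q.l - 1) = n - 1 := by omega
  have s3 : p + 1 = n - (Q.l - 1) := by omega
  simp only [s1] at e3
  rw [s2] at e4
  rw [s3] at e2
  linarith

end CountingFour

/-! ### Numerical constraints on the number and the degrees of the relations. -/

section Numerics

lemma hasSum_shift {h : ℤ → ℝ} (hneg : ∀ n < 0, h n = 0) {t S : ℝ}
    (hS : HasSum (fun n : ℕ => h n * t ^ n) S) (d : ℕ) :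
    HasSum (fun n : ℕ => h ((n : ℤ) - d) * t ^ n) (t ^ d * S) := by
  have h1 : HasSum (fun n : ℕ => h (((n + d : ℕ) : ℤ) - d) * t ^ (n + d)) (t ^ d * S) := by
    refine (hS.mul_left (t ^ d)).congr_fun fun n => ?_
    push_cast
    rw [add_sub_cancel_right, pow_add]
    ring
  have h2 := (hasSum_nat_add_iff (f := fun n : ℕ => h ((n : ℤ) - d) * t ^ n) d).1 h1
  rwa [Finset.sum_eq_zero, add_zero] at h2
  intro i hi
  rw [hneg _ (by have := Finset.mem_range.1 hi; omega), zero_mul]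

/-- The polynomial `1 - 4 t + ∑ t ^ e i - 4 t ^ (l - 1) + t ^ l`. -/
def quarticPoly {κ : Type*} [Fintype κ] (e : κ → ℕ) (l : ℕ) (t : ℝ) : ℝ :=
  1 - 4 * t + ∑ i, t ^ e i - 4 * t ^ (l - 1) + t ^ l

/-- The recurrence, read as an identity of generating functions, says that the polynomial is the
inverse of the series. -/
lemma quarticPoly_mul_eq_one {κ : Type*} [Fintype κ] {e : κ → ℕ} {l : ℕ} {h : ℤ → ℝ}
    (hneg : ∀ n < 0, h n = 0)
    (heq : ∀ n : ℤ, h n - 4 * h (n - 1) + ∑ i, h (n - e i) - 4 * h (n - (l - 1 : ℕ)) + h (n - l) =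
      if n = 0 then 1 else 0) {t S : ℝ} (hS : HasSum (fun n : ℕ => h n * t ^ n) S) :
    quarticPoly e l t * S = 1 := by
  have s0 := hasSum_shift hneg hS 0
  have s1 := (hasSum_shift hneg hS 1).mul_left 4
  have s2 := hasSum_sum (s := Finset.univ) fun i _ => hasSum_shift hneg hS (e i)
  have s3 := (hasSum_shift hneg hS (l - 1)).mul_left 4
  have s4 := hasSum_shift hneg hS l
  have key := (((s0.sub s1).add s2).sub s3).add s4
  have key2 : HasSum (fun n : ℕ => if n = 0 then (1 : ℝ) else 0) 1 := hasSum_ite_eq 0 1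
  have key3 := key.unique (key2.congr_fun fun n => ?_)
  · rw [← key3, quarticPoly]
    simp only [← Finset.sum_mul]
    ring
  · have := congrArg (· * t ^ n) (heq n)
    simp only [add_mul, sub_mul, Finset.sum_mul] at this
    simp only [Nat.cast_zero, sub_zero, Nat.cast_one, ← mul_assoc]
    rw [this]
    rcases n with _ | n
    · simp
    · rw [if_neg (by omega), if_neg n.succ_ne_zero, zero_mul]

lemma continuous_quarticPoly {κ : Type*} [Fintype κ] (e : κ → ℕ) (l : ℕ) :
    Continuous (quarticPoly e l) := by
  unfold quarticPoly
  fun_prop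

/-- With `m = 2 + a` and `l = m + 2 + b`, the difference of the two sides is `t ^ 2 * (1 - t ^ a) *
(1 - t ^ b)`: a pair of complementary exponents contributes most at the extremes `2` and `l - 2`. -/
lemma pow_add_pow_le_of_two_le {t : ℝ} (h0 : 0 ≤ t) (h1 : t ≤ 1) {m l : ℕ} (hm : 2 ≤ m) (hl : m + 2 ≤ l) :
    t ^ m + t ^ (l - m) ≤ t ^ 2 + t ^ (l - 2) := by
  obtain ⟨a, rfl⟩ := Nat.exists_eq_add_of_le hm
  obtain ⟨b, rfl⟩ := Nat.exists_eq_add_of_le hl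
  rw [show 2 + a + 2 + b - (2 + a) = 2 + b by omega,
    show 2 + a + 2 + b - 2 = 2 + a + b by omega]
  have ha := pow_le_one₀ h0 h1 (n := a)
  have hb := pow_le_one₀ h0 h1 (n := b)
  have h2 : 0 ≤ t ^ 2 * ((1 - t ^ a) * (1 - t ^ b)) :=
    mul_nonneg (by positivity) (mul_nonneg (by linarith) (by linarith))
  have h3 : t ^ (2 + a) = t ^ 2 * t ^ a := pow_add _ _ _
  have h4 : t ^ (2 + b) = t ^ 2 * t ^ b := pow_add _ _ _
  have h5 : t ^ (2 + a + b) = t ^ 2 * t ^ a * t ^ b := by rw [pow_add, pow_add]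
  rw [h3, h4, h5]
  nlinarith

/-- The numerical constraints on the shape of the minimal resolution in dimension four. -/
theorem card_eq_six_and_eq_four {κ : Type*} [Fintype κ] [Nonempty κ] {e : κ → ℕ} {l : ℕ}
    (he : ∀ i, 2 ≤ e i) (hl : ∀ i, e i + 2 ≤ l) {h : ℤ → ℝ}
    (hneg : ∀ n < 0, h n = 0) (hone : ∀ n : ℕ, 1 ≤ h n)
    (hsum : ∀ t : ℝ, 0 < t → t < 1 → Summable fun n : ℕ => h n * t ^ n)
    (heq : ∀ n : ℤ, h n - 4 * h (n - 1) + ∑ i, h (n - e i) - 4 * h (n - (l - 1 : ℕ)) + h (n - l) =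
      if n = 0 then 1 else 0)
    (heq' : ∀ n : ℤ, h n - 4 * h (n - 1) + ∑ i, h (n - (l - e i : ℕ)) -
      4 * h (n - (l - 1 : ℕ)) + h (n - l) = if n = 0 then 1 else 0) :
    Fintype.card κ = 6 ∧ l = 4 := by
  obtain ⟨i₀⟩ := ‹Nonempty κ›
  have hl4 : 4 ≤ l := (Nat.add_le_add_right (he i₀) 2).trans (hl i₀)
  -- All coefficients of the series are at least one, so its first two terms already give `1 + t ≤
  -- S`.
  have hSge : ∀ t : ℝ, 0 < t → t < 1 → ∃ S, 1 + t ≤ S ∧ quarticPoly e l t * S = 1 ∧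
      quarticPoly (fun i => l - e i) l t * S = 1 := by
    intro t h0 h1
    obtain ⟨S, hS⟩ := hsum t h0 h1
    refine ⟨S, ?_, quarticPoly_mul_eq_one hneg heq hS, quarticPoly_mul_eq_one hneg heq' hS⟩
    have h2 := sum_le_hasSum (Finset.range 2) (fun n _ =>
      mul_nonneg (zero_le_one.trans (hone n)) (pow_nonneg h0.le n)) hS
    rw [Finset.sum_range_succ, Finset.sum_range_one] at h2
    have h3 := hone 0
    have h4 := hone 1
    norm_num at h2 h3 h4
    nlinarith
  have hcont := (continuous_quarticPoly e l).continuousAt (x := 1)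
  have hq1 : quarticPoly e l 1 = (Fintype.card κ : ℝ) - 6 := by
    simp [quarticPoly]
    ring
  have hev : ∀ᶠ t : ℝ in nhdsWithin 1 (Set.Iio 1), 0 < t ∧ t < 1 :=
    Filter.Eventually.and (eventually_nhdsWithin_of_eventually_nhds
      (lt_mem_nhds zero_lt_one)) self_mem_nhdsWithin
  have hlim : Filter.Tendsto (quarticPoly e l) (nhdsWithin 1 (Set.Iio 1))
      (nhds (quarticPoly e l 1)) := hcont.tendsto.mono_left nhdsWithin_le_nhds
  have hge : 0 ≤ quarticPoly e l 1 := by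
    refine ge_of_tendsto hlim (hev.mono fun t ht => ?_)
    obtain ⟨S, hS, hq, -⟩ := hSge t ht.1 ht.2
    by_contra hlt
    nlinarith [ht.1]
  -- The polynomial is positive on `(0, 1)` and its product with `1 + t` is at most one there. At
  -- the limit `t = 1` its value, the number of relations minus six, lies between `0` and `1 / 2`,
  -- so it is zero.
  have hle : quarticPoly e l 1 * 2 ≤ 1 := by
    have hlim2 : Filter.Tendsto (fun t => quarticPoly e l t * (1 + t)) (nhdsWithin 1 (Set.Iio 1))
        (nhds (quarticPoly e l 1 * (1 + 1))) := by
      refine hlim.mul ?_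
      exact ((continuous_const.add continuous_id).tendsto (1 : ℝ)).mono_left nhdsWithin_le_nhds
    have := le_of_tendsto hlim2 (b := 1) (hev.mono fun t ht => by
      obtain ⟨S, hS, hq, -⟩ := hSge t ht.1 ht.2
      have hpos : 0 ≤ quarticPoly e l t := by
        by_contra hlt
        nlinarith [ht.1]
      nlinarith)
    linarith
  rw [hq1] at hge hle
  have hcard : Fintype.card κ = 6 := by
    have h1 : (6 : ℝ) ≤ Fintype.card κ := by linarith
    have h2 : (Fintype.card κ : ℝ) < 7 := by linarith
    have h1' : 6 ≤ Fintype.card κ := by exact_mod_cast h1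
    have h2' : Fintype.card κ < 7 := by exact_mod_cast h2
    omega
  refine ⟨hcard, ?_⟩
  by_contra hne
  have hl5 : 5 ≤ l := by omega
  -- Both polynomials are positive at every `t` in `(0, 1)`, but for six relations their sum is at
  -- most `2 (1 - t) ((1 - 3 t) + t ^ (l - 2) (3 - t))`. If `l ≥ 5` then `t ^ (l - 2) ≤ t ^ 3`, and
  -- at `t = 9 / 10` the last factor is at most `-1.7 + 1.5309 < 0`. For `l = 4` it would be
  -- positive.
  obtain ⟨S, hS, hq, hq'⟩ := hSge (9 / 10) (by norm_num) (by norm_num)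
  have hpos : 0 < quarticPoly e l (9 / 10) := by
    by_contra hlt
    nlinarith
  have hpos' : 0 < quarticPoly (fun i => l - e i) l (9 / 10) := by
    by_contra hlt
    nlinarith
  have hsum2 : ∑ i, ((9 / 10 : ℝ) ^ e i + (9 / 10) ^ (l - e i)) ≤
      6 * ((9 / 10) ^ 2 + (9 / 10) ^ (l - 2)) := by
    refine (Finset.sum_le_card_nsmul _ _ _ fun i _ =>
      pow_add_pow_le_of_two_le (by norm_num) (by norm_num) (he i) (hl i)).trans ?_
    rw [Finset.card_univ, hcard, nsmul_eq_mul, Nat.cast_ofNat]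
  rw [Finset.sum_add_distrib] at hsum2
  unfold quarticPoly at hpos hpos'
  have e1 : (9 / 10 : ℝ) ^ (l - 1) = (9 / 10) ^ (l - 2) * (9 / 10) := by
    rw [← pow_succ]
    congr 1
    omega
  have e2 : (9 / 10 : ℝ) ^ l = (9 / 10) ^ (l - 2) * (9 / 10) ^ 2 := by
    rw [← pow_add]
    congr 1
    omega
  have e3 : (9 / 10 : ℝ) ^ (l - 2) ≤ (9 / 10) ^ 3 :=
    pow_le_pow_of_le_one (by norm_num) (by norm_num) (by omega)
  rw [e1, e2] at hpos hpos'
  norm_num at *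
  linarith

lemma summable_of_lt_mul_pow {a : ℕ → ℕ} {c : ℕ} (hc : ∀ n, 0 < n → a n < c * n ^ c) {t : ℝ}
    (h0 : 0 < t) (h1 : t < 1) : Summable fun n : ℕ => (a n : ℝ) * t ^ n := by
  have ht : ‖t‖ < 1 := by rwa [Real.norm_eq_abs, abs_of_pos h0]
  have hs0 : Summable fun n : ℕ => (n : ℝ) ^ c * t ^ n :=
    summable_pow_mul_geometric_of_norm_lt_one c ht
  have hs : Summable fun n : ℕ => (c : ℝ) * ((n : ℝ) ^ c * t ^ n) := hs0.mul_left _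
  have hs' := (summable_nat_add_iff 1).2 hs
  have hb : ∀ n : ℕ, (a (n + 1) : ℝ) ≤ (c : ℝ) * ((n + 1 : ℕ) : ℝ) ^ c := fun n => by
    rw [← Nat.cast_pow, ← Nat.cast_mul, Nat.cast_le]
    exact (hc (n + 1) n.succ_pos).le
  refine (summable_nat_add_iff (f := fun n : ℕ => (a n : ℝ) * t ^ n) 1).1
    (Summable.of_nonneg_of_le (fun n => ?_) (fun n => ?_) hs')
  · exact mul_nonneg (Nat.cast_nonneg _) (pow_nonneg h0.le _)
  · rw [← mul_assoc]
    exact mul_le_mul_of_nonneg_right (hb n) (pow_nonneg h0.le _)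

end Numerics

/-! ### The Hilbert function in dimension four. -/

section HilbertFour

open Module

variable {k : Type*} [Field k] {R : Type u} [Ring R] [Algebra k R] {𝒜 : ℕ → Submodule k R}
  {z : Fin 4 → R}

lemma pow_mem_grading (h : IsConnectedGraded 𝒜) {x : R} (hx : x ∈ 𝒜 1) (n : ℕ) : x ^ n ∈ 𝒜 n := by
  have := h.gradedMonoid
  simpa using SetLike.pow_mem_graded n hx

lemma IsLeftASRegular.summable_hilbertFun {d : ℕ} (hR : IsLeftASRegular 𝒜 d) {t : ℝ}
    (h0 : 0 < t) (h1 : t < 1) : Summable fun n : ℕ => (hilbertFun 𝒜 n : ℝ) * t ^ n := by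
  obtain ⟨c, -, hc⟩ := hR.growth
  simp only [hilbertFun_natCast, Int.cast_natCast]
  exact summable_of_lt_mul_pow hc h0 h1

/-- Once `l = 4` is known, the bounds `2 ≤ e₂ i ≤ l - 2` leave only quadratic relations. The lower
bound `1` on the Hilbert function required by the numerics comes from the powers of one generator,
nonzero in a domain. -/
lemma IsLeftASRegular.quarticResolution_shape [IsDomain R] (hR : IsLeftASRegular 𝒜 4)
    (hz : ∀ i, z i ∈ 𝒜 1) (hindep : LinearIndependent k z)
    (hgen : Algebra.adjoin k (Set.range z) = ⊤) (Q : QuarticResolution 𝒜 z) [Fintype Q.κ₂] :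
    Fintype.card Q.κ₂ = 6 ∧ Q.l = 4 ∧ ∀ i, Q.e₂ i = 2 := by
  have h := hR.connected
  have hfin := hR.finite_component
  -- Without relations `dual₁` would apply to the constant vector `1` and give `1 = z 0 * g`.
  have hne : Nonempty Q.κ₂ := by
    by_contra hemp
    rw [not_nonempty_iff] at hemp
    obtain ⟨g, hg⟩ := Q.dual₁ 1 fun j => isEmptyElim j
    have h0 := hg 0
    rw [Pi.one_apply] at h0
    exact one_notMem_augmentationIdeal h (h0 ▸ mul_mem_augmentationIdeal_right h
      (mem_augmentationIdeal_of_degree_one h hz 0) g)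
  have hl4 : 4 ≤ Q.l := by
    obtain ⟨i⟩ := hne
    have := Q.two_le i
    have := Q.le_sub_two i
    omega
  obtain ⟨l, hl⟩ : ∃ l : ℕ, Q.l = l := ⟨Q.l.toNat, by omega⟩
  have hex : ∀ i, ∃ e : ℕ, Q.e₂ i = e := fun i => ⟨(Q.e₂ i).toNat, by
    have := Q.two_le i
    omega⟩
  choose e he using hex
  have h2 : ∀ i, 2 ≤ e i := fun i => by have := Q.two_le i; rw [he] at this; omega
  have hle : ∀ i, e i + 2 ≤ l := fun i => by
    have := Q.le_sub_two i
    rw [he, hl] at this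
    omega
  have key := card_eq_six_and_eq_four h2 hle (h := fun n => (hilbertFun 𝒜 n : ℝ)) (fun n hn => by
      rw [hilbertFun_of_neg hn, Int.cast_zero]) (fun n => ?_) (fun t h0 h1 => ?_) (fun n => ?_)
      (fun n => ?_)
  · refine ⟨key.1, by rw [hl, key.2]; rfl, fun i => ?_⟩
    have := h2 i
    have := hle i
    rw [he i]
    omega
  · have hmem := pow_mem_grading h (hz 0) n
    have hne0 : z 0 ^ n ≠ 0 := pow_ne_zero _ (hindep.ne_zero 0)
    have := hfin n
    have hpos : 0 < finrank k (𝒜 n) := by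
      have : Nontrivial (𝒜 n) := ⟨⟨⟨_, hmem⟩, 0, fun h0 => hne0 (congrArg Subtype.val h0)⟩⟩
      exact finrank_pos
    rw [hilbertFun_natCast]
    exact_mod_cast hpos
  · exact hR.summable_hilbertFun h0 h1
  · have := Q.hilbertFun_left h hfin hz hindep hgen n
    simp only [he, hl] at this
    rw [show (l : ℤ) - 1 = ((l - 1 : ℕ) : ℤ) by omega] at this
    exact_mod_cast this
  · have := Q.hilbertFun_right hfin h hz hindep hgen n
    simp only [he, hl] at this
    rw [show (l : ℤ) - 1 = ((l - 1 : ℕ) : ℤ) by omega] at this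
    simp only [fun i => show (l : ℤ) - e i = ((l - e i : ℕ) : ℤ) from by have := hle i; omega] at this
    exact_mod_cast this

/-- The Hilbert function of a four-dimensional regular domain with four generators of degree one
is that of a polynomial ring in four variables. -/
theorem IsLeftASRegular.finrank_four [IsDomain R] (hR : IsLeftASRegular 𝒜 4)
    (hz : ∀ i, z i ∈ 𝒜 1) (hindep : LinearIndependent k z)
    (hgen : Algebra.adjoin k (Set.range z) = ⊤) (n : ℕ) :
    finrank k (𝒜 n) = (n + 3).choose 3 := by
  have h := hR.connected
  obtain ⟨Q⟩ := hR.nonempty_quarticResolution hz hindep hgen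
  have := Q.finite₂
  have := Fintype.ofFinite Q.κ₂
  obtain ⟨hcard, hl, he⟩ := hR.quarticResolution_shape hz hindep hgen Q
  -- The coefficients are those of `(1 - t) ^ 4`. The cubic `(n + 1)(n + 2)(n + 3)` satisfies the
  -- homogeneous recurrence; the first four degrees are separate because the recurrence there
  -- reaches negative degrees, where the Hilbert function is zero.
  have hrec : ∀ n : ℤ, hilbertFun 𝒜 n - 4 * hilbertFun 𝒜 (n - 1) + 6 * hilbertFun 𝒜 (n - 2) -
      4 * hilbertFun 𝒜 (n - 3) + hilbertFun 𝒜 (n - 4) = if n = 0 then 1 else 0 := by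
    intro n
    have := Q.hilbertFun_left h hR.finite_component hz hindep hgen n
    simp only [he, hl, Finset.sum_const, Finset.card_univ, hcard, nsmul_eq_mul] at this
    norm_num at this
    exact this
  have hchoose : ∀ n : ℕ, (6 : ℤ) * ((n + 3).choose 3 : ℕ) = (n + 1) * (n + 2) * (n + 3) := by
    intro n
    have h2 := Nat.add_one_mul_choose_eq (n + 2) 2
    have h3 := Nat.add_one_mul_choose_eq (n + 1) 1
    simp only [Nat.choose_one_right] at h2 h3
    norm_num at h2 h3
    zify at h2 h3
    nlinarith
  have key : ∀ n : ℕ, 6 * hilbertFun 𝒜 n = (n + 1) * (n + 2) * (n + 3) := by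
    intro n
    induction n using Nat.strong_induction_on with
    | _ n ih =>
      have hr := hrec n
      rcases n with _ | _ | _ | _ | n
      · simp [hilbertFun_of_neg] at hr
        simp [hr]
      · have h0 := ih 0 (by norm_num)
        simp [hilbertFun_of_neg] at hr h0
        simp
        linarith
      · have h0 := ih 0 (by norm_num)
        have h1 := ih 1 (by norm_num)
        simp [hilbertFun_of_neg] at hr h0 h1
        simp
        linarith
      · have h0 := ih 0 (by norm_num)
        have h1 := ih 1 (by norm_num)
        have h2 := ih 2 (by norm_num)
        simp [hilbertFun_of_neg] at hr h0 h1 h2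
        simp
        linarith
      · have h0 := ih n (by omega)
        have h1 := ih (n + 1) (by omega)
        have h2 := ih (n + 2) (by omega)
        have h3 := ih (n + 3) (by omega)
        rw [if_neg (by omega), show ((n + 1 + 1 + 1 + 1 : ℕ) : ℤ) - 1 = (n + 3 : ℕ) by push_cast; ring,
          show ((n + 1 + 1 + 1 + 1 : ℕ) : ℤ) - 2 = (n + 2 : ℕ) by push_cast; ring,
          show ((n + 1 + 1 + 1 + 1 : ℕ) : ℤ) - 3 = (n + 1 : ℕ) by push_cast; ring,
          show ((n + 1 + 1 + 1 + 1 : ℕ) : ℤ) - 4 = (n : ℕ) by push_cast; ring] at hr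
        push_cast at *
        linarith
  have h1 := key n
  rw [← hchoose n, hilbertFun_natCast] at h1
  have h2 : (finrank k (𝒜 n) : ℤ) = ((n + 3).choose 3 : ℕ) := by linarith
  exact_mod_cast h2

end HilbertFour

/-! ### Spaces of quadratic and cubic relations, as tensors. -/

section RelationSpaces

open Module

variable {k : Type*} [Field k] {R : Type u} [Ring R] [Algebra k R] {ι : Type*} [Fintype ι]

/-- The multiplication of noncommutative quadratic forms in the elements `z i`. -/
def quadraticEval (k : Type*) [Field k] [Algebra k R] (z : ι → R) : (ι → ι → k) →ₗ[k] R :=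
  ∑ i, ∑ j, (LinearMap.proj j ∘ₗ LinearMap.proj i : (ι → ι → k) →ₗ[k] k).smulRight (z i * z j)

lemma quadraticEval_apply (z : ι → R) (M : ι → ι → k) :
    quadraticEval k z M = ∑ i, ∑ j, M i j • (z i * z j) := by
  simp [quadraticEval]

lemma quadraticEval_eq_sum_mul (z : ι → R) (M : ι → ι → k) :
    quadraticEval k z M = ∑ j, (∑ i, M i j • z i) * z j := by
  rw [quadraticEval_apply, Finset.sum_comm]
  refine Finset.sum_congr rfl fun j _ => ?_
  rw [Finset.sum_mul]
  exact Finset.sum_congr rfl fun i _ => (smul_mul_assoc _ _ _).symm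

/-- The quadratic relations between the elements `z i`. -/
def quadraticRelations (k : Type*) [Field k] [Algebra k R] (z : ι → R) : Submodule k (ι → ι → k) :=
  LinearMap.ker (quadraticEval k z)

lemma mem_quadraticRelations {z : ι → R} {M : ι → ι → k} :
    M ∈ quadraticRelations k z ↔ ∑ i, ∑ j, M i j • (z i * z j) = 0 := by
  rw [quadraticRelations, LinearMap.mem_ker, quadraticEval_apply]

lemma mem_quadraticRelations_iff_sum_mul {z : ι → R} {M : ι → ι → k} :
    M ∈ quadraticRelations k z ↔ ∑ j, (∑ i, M i j • z i) * z j = 0 := by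
  rw [quadraticRelations, LinearMap.mem_ker, quadraticEval_eq_sum_mul]

/-- The cubic tensors that are relations both in the first two and in the last two variables. -/
def cubicRelations (k : Type*) [Field k] [Algebra k R] (z : ι → R) :
    Submodule k (ι → ι → ι → k) where
  carrier := {T | (∀ i, T i ∈ quadraticRelations k z) ∧
    ∀ l, (fun i j => T i j l) ∈ quadraticRelations k z}
  add_mem' hS hT := ⟨fun i => add_mem (hS.1 i) (hT.1 i), fun l => add_mem (hS.2 l) (hT.2 l)⟩
  zero_mem' := ⟨fun _ => zero_mem _, fun _ => zero_mem _⟩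
  smul_mem' c _ hT := ⟨fun i => Submodule.smul_mem _ c (hT.1 i),
    fun l => Submodule.smul_mem _ c (hT.2 l)⟩

lemma mem_cubicRelations {z : ι → R} {T : ι → ι → ι → k} :
    T ∈ cubicRelations k z ↔ (∀ i, T i ∈ quadraticRelations k z) ∧
      ∀ l, (fun i j => T i j l) ∈ quadraticRelations k z := Iff.rfl

end RelationSpaces

/-! ### What the minimal resolution says about these spaces. -/

section LinearStrand

open Module

variable {k : Type*} [Field k] {R : Type u} [Ring R] [Algebra k R] {𝒜 : ℕ → Submodule k R}

lemma linearCombination_eq_sum {κ M : Type*} [Fintype κ] [AddCommGroup M] [Module R M] (v : κ → M)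
    (x : κ →₀ R) : Finsupp.linearCombination R v x = ∑ j, x j • v j := by
  rw [Finsupp.linearCombination_apply, Finsupp.sum_fintype]
  exact fun _ => zero_smul _ _

lemma linearCombination_apply_eq_sum {ι κ : Type*} [Fintype κ] (m : κ → ι →₀ R) (x : κ →₀ R)
    (i : ι) : Finsupp.linearCombination R m x i = ∑ j, x j * m j i := by
  rw [linearCombination_eq_sum, Finsupp.finsetSum_apply]
  rfl

/-- `x` and all the generators have the same degree `d`, so the coefficients can be taken in degree
zero, that is, in `k`. -/
lemma exists_eq_sum_smul_of_mem_range (h : IsConnectedGraded 𝒜) {ι κ : Type*} [Fintype κ]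
    {e : ι → ℤ} {d : ℤ} {m : κ → ι →₀ R} (hm : ∀ j, m j ∈ gradedFree 𝒜 e d) {x : ι →₀ R}
    (hx : x ∈ gradedFree 𝒜 e d) (hxr : x ∈ LinearMap.range (Finsupp.linearCombination R m)) :
    ∃ γ : κ → k, ∀ i, x i = ∑ j, γ j • m j i := by
  obtain ⟨g, rfl⟩ := hxr
  have key := freeComponent_linearCombination h (e' := fun _ => d) hm d g
  rw [freeComponent_of_mem h hx] at key
  have hγ : ∀ j, ∃ c : k, algebraMap k R c = freeComponent h (fun _ => d) d g j := fun j => by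
    refine exists_algebraMap_of_mem h ?_
    have := freeComponent_mem h (e := fun _ : κ => d) d g j
    rwa [sub_self] at this
  choose γ hγ using hγ
  refine ⟨γ, fun i => ?_⟩
  rw [key, linearCombination_apply_eq_sum]
  refine Finset.sum_congr rfl fun j _ => ?_
  rw [Algebra.smul_def, hγ]

variable {z : Fin 4 → R}

lemma QuarticResolution.sum_mul_eq_zero (Q : QuarticResolution 𝒜 z) [Fintype Q.κ₂] (s : Q.κ₃)
    (l : Fin 4) : ∑ j : Q.κ₂, Q.m₃ s j * Q.m₂ j l = 0 := by
  have h0 : Finsupp.linearCombination R Q.m₂ (Q.m₃ s) = 0 :=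
    linearCombination_eq_zero_of_mem_range (m := Q.m₂) (m' := Q.m₃) Q.exact₂.le s
  rw [← linearCombination_apply_eq_sum Q.m₂ (Q.m₃ s) l, h0, Finsupp.zero_apply]

/-- The linear strand of the minimal resolution: the matrices `M j` span the quadratic relations
and the coefficient tensors `c s` of the third differential span the cubic relations. -/
theorem IsLeftASRegular.exists_linear_strand [IsDomain R] (hR : IsLeftASRegular 𝒜 4)
    (hz : ∀ i, z i ∈ 𝒜 1) (hindep : LinearIndependent k z)
    (hgen : Algebra.adjoin k (Set.range z) = ⊤) :
    ∃ (κ κ' : Type u) (_ : Fintype κ) (_ : Fintype κ') (M : κ → Fin 4 → Fin 4 → k)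
      (c : κ' → Fin 4 → κ → k), Fintype.card κ' = 4 ∧
      quadraticRelations k z ≤ Submodule.span k (Set.range M) ∧
      (∀ x : Fin 4 → κ → k, (∀ l, (fun i a => ∑ j, x i j * M j a l) ∈ quadraticRelations k z) →
        ∃ g : κ' → k, x = ∑ s, g s • c s) ∧
      (∀ s, (fun i a b => ∑ j, c s i j * M j a b) ∈ cubicRelations k z) ∧
      ∀ (w : κ → k) (b : Fin 4 → k) (β : κ' → k), (∀ s i, ∑ j, c s i j * w j = β s * b i) →
        w = 0 := by
  have h := hR.connected
  obtain ⟨Q⟩ := hR.nonempty_quarticResolution hz hindep hgen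
  have := Q.finite₂
  have := Fintype.ofFinite Q.κ₂
  have := Q.finite₃
  have := Fintype.ofFinite Q.κ₃
  obtain ⟨-, hl, he⟩ := hR.quarticResolution_shape hz hindep hgen Q
  have hcoeff : ∀ r ∈ 𝒜 1, ∃ c : Fin 4 → k, ∑ i, c i • z i = r := fun r hr => by
    rw [degree_one_eq_span h hz hgen] at hr
    exact (Submodule.mem_span_range_iff_exists_fun k).1 hr
  have hm₂ : ∀ j, Q.m₂ j ∈ gradedFree 𝒜 (fun _ => 1) 2 := fun j => he j ▸ Q.m₂_mem j
  have hm₃ : ∀ j, Q.m₃ j ∈ gradedFree 𝒜 (fun _ => 2) 3 := fun j i => by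
    have := Q.m₃_mem j i
    rw [hl, he] at this
    exact this
  have hM : ∀ j a, ∃ c : Fin 4 → k, ∑ i, c i • z i = Q.m₂ j a := fun j a => hcoeff _ (by
    rw [← intGrading_one (𝒜 := 𝒜)]
    exact hm₂ j a)
  have hc : ∀ s j, ∃ c : Fin 4 → k, ∑ i, c i • z i = Q.m₃ s j := fun s j => hcoeff _ (by
    rw [← intGrading_one (𝒜 := 𝒜)]
    exact hm₃ s j)
  choose M hM using hM
  choose c hc using hc
  have hlin : ∀ x : Fin 4 → Q.κ₂ → k, ∀ l,
      ((fun i a => ∑ j, x i j * M j l a) ∈ quadraticRelations k z ↔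
        ∑ j, (∑ i, x i j • z i) * Q.m₂ j l = 0) := fun x l => by
    rw [mem_quadraticRelations]
    refine Eq.congr ?_ rfl
    simp only [← hM, Finset.sum_smul, Finset.sum_mul, Finset.mul_sum, smul_mul_smul_comm]
    trans ∑ i, ∑ j, ∑ a, (x i j * M j l a) • (z i * z a)
    · exact Finset.sum_congr rfl fun i _ => Finset.sum_comm
    · rw [Finset.sum_comm]
      exact Finset.sum_congr rfl fun j _ => Finset.sum_comm
  have hrel : ∀ j, (fun a b => M j b a) ∈ quadraticRelations k z := fun j => by
    rw [mem_quadraticRelations_iff_sum_mul]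
    simp only [hM]
    have h0 : Finsupp.linearCombination R z (Q.m₂ j) = 0 :=
      Q.exact₁.le ⟨Finsupp.single j 1, by simp⟩
    rwa [linearCombination_eq_sum] at h0
  have hrel₃ := Q.sum_mul_eq_zero
  -- The resolution records a relation as `∑ a, m₂ j a * z a`, with `M j a` the coordinates of the
  -- left factor `m₂ j a`. Its tensor therefore has the indices exchanged, and likewise for `c`.
  refine ⟨Q.κ₂, Q.κ₃, inferInstance, inferInstance, fun j a b => M j b a, fun s i j => c s j i,
    Q.card_eq h hz hindep hgen, fun N hN => ?_, fun x hx => ?_, fun s => ?_, fun w b β hw => ?_⟩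
  · let x : Fin 4 →₀ R := Finsupp.equivFunOnFinite.symm fun a => ∑ i, N i a • z i
    obtain ⟨γ, hγ⟩ := exists_eq_sum_smul_of_mem_range h hm₂ (x := x) (fun a => by
      rw [show (2 : ℤ) - 1 = 1 by norm_num, intGrading_one]
      change ∑ i, N i a • z i ∈ 𝒜 1
      exact Submodule.sum_mem _ fun i _ => Submodule.smul_mem _ _ (hz i)) (by
      rw [Q.exact₁, LinearMap.mem_ker,
        linearCombination_eq_sum]
      exact mem_quadraticRelations_iff_sum_mul.1 hN)
    refine (Submodule.mem_span_range_iff_exists_fun k).2 ⟨γ, ?_⟩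
    ext i a
    have h1 := hγ a
    simp only [x, Finsupp.equivFunOnFinite_symm_apply_apply, ← hM, Finset.smul_sum, smul_smul] at h1
    rw [Finset.sum_comm] at h1
    simp only [← Finset.sum_smul] at h1
    have h2 := (Fintype.linearIndependent_iff.1 hindep) (fun i => N i a - ∑ j, γ j * M j a i) (by
      simp only [sub_smul, Finset.sum_sub_distrib, h1, sub_self]) i
    simp only [Finset.sum_apply, Pi.smul_apply, smul_eq_mul]
    exact (sub_eq_zero.1 h2).symm
  · let y : Q.κ₂ →₀ R := Finsupp.equivFunOnFinite.symm fun j => ∑ i, x i j • z i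
    obtain ⟨g, hg⟩ := exists_eq_sum_smul_of_mem_range h hm₃ (x := y) (fun a => by
      rw [show (3 : ℤ) - 2 = 1 by norm_num, intGrading_one]
      change ∑ i, x i a • z i ∈ 𝒜 1
      exact Submodule.sum_mem _ fun i _ => Submodule.smul_mem _ _ (hz i)) (by
      rw [Q.exact₂, LinearMap.mem_ker]
      ext l
      rw [linearCombination_apply_eq_sum]
      exact (hlin x l).1 (hx l))
    refine ⟨g, ?_⟩
    ext i j
    have h1 := hg j
    simp only [y, Finsupp.equivFunOnFinite_symm_apply_apply, ← hc, Finset.smul_sum, smul_smul] at h1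
    rw [Finset.sum_comm] at h1
    simp only [← Finset.sum_smul] at h1
    have h2 := (Fintype.linearIndependent_iff.1 hindep) (fun i => x i j - ∑ s, g s * c s j i) (by
      simp only [sub_smul, Finset.sum_sub_distrib, h1, sub_self]) i
    simp only [Finset.sum_apply, Pi.smul_apply, smul_eq_mul]
    exact sub_eq_zero.1 h2
  · refine ⟨fun i => ?_, fun l => ?_⟩
    · have : (fun a b => ∑ j, c s j i * M j b a) = ∑ j, c s j i • fun a b => M j b a := by
        ext a b
        simp
      change (fun a b => ∑ j, c s j i * M j b a) ∈ quadraticRelations k z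
      rw [this]
      exact Submodule.sum_mem _ fun j _ => Submodule.smul_mem _ _ (hrel j)
    · rw [hlin (fun i j => c s j i) l]
      simp only [hc]
      exact hrel₃ s l
  · have hf : ∀ s, Finsupp.linearCombination R (fun j => algebraMap k R (w j)) (Q.m₃ s) =
        β s • ∑ i, b i • z i := fun s => by
      rw [linearCombination_eq_sum]
      simp only [smul_eq_mul, ← hc, ← Algebra.commutes, ← Algebra.smul_def,
        smul_smul, Finset.smul_sum]
      rw [Finset.sum_comm]
      simp only [← Finset.sum_smul, ← hw]
      refine Finset.sum_congr rfl fun i _ => ?_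
      congr 1
      exact Finset.sum_congr rfl fun j _ => mul_comm _ _
    -- The values are `β s` times one fixed linear form. Composing with `m₄` gives `(∑ s, m₄ s * β
    -- s)` times this form, equal to zero. In a domain one factor vanishes; if it is the first, the
    -- independence of the entries of `m₄` gives `β = 0`. Hence `w` is a cocycle, and `dual₂` writes
    -- its constant entries through elements of degree one, so they are zero.
    have hzero : ∀ s, Finsupp.linearCombination R (fun j => algebraMap k R (w j)) (Q.m₃ s) = 0 := by
      have h1 := linearCombination_linearCombination_apply (fun j => algebraMap k R (w j)) Q.m₃ Q.m₄
      have h2 : Finsupp.linearCombination R Q.m₃ Q.m₄ = 0 :=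
        Q.exact₃.le ⟨1, by simp⟩
      rw [h2, map_zero, linearCombination_eq_sum] at h1
      simp only [hf, smul_eq_mul, mul_smul_comm, ← smul_mul_assoc] at h1
      rw [← Finset.sum_mul, mul_eq_zero] at h1
      intro s
      rw [hf]
      rcases h1 with h1 | h1
      · rw [(Fintype.linearIndependent_iff.1 Q.indep) β h1 s, zero_smul]
      · rw [h1, smul_zero]
    obtain ⟨g, hg⟩ := Q.dual₂ _ hzero
    ext j
    rw [Pi.zero_apply, ← algebraMap_mem_augmentationIdeal_iff h, hg j,
      Finsupp.linearCombination_apply]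
    refine Submodule.sum_mem _ fun a _ => mul_mem_augmentationIdeal_right h ?_ _
    exact mem_augmentationIdeal_of_mem h one_pos (hm₂ j a)

/-- The space of cubic relations is at most four-dimensional. -/
theorem IsLeftASRegular.finrank_cubicRelations_le [IsDomain R] (hR : IsLeftASRegular 𝒜 4)
    (hz : ∀ i, z i ∈ 𝒜 1) (hindep : LinearIndependent k z)
    (hgen : Algebra.adjoin k (Set.range z) = ⊤) : finrank k (cubicRelations k z) ≤ 4 := by
  obtain ⟨κ, κ', _, _, M, c, hcard, hM, hx, -, -⟩ := hR.exists_linear_strand hz hindep hgen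
  refine (Submodule.finrank_mono (t := Submodule.span k (Set.range fun (s : κ') (i a b : Fin 4) =>
    ∑ j, c s i j * M j a b)) fun T hT => ?_).trans ((finrank_range_le_card _).trans hcard.le)
  -- The slices with fixed first index are expanded in the relations `M j`; the condition on slices
  -- with fixed last index is then exactly a linear syzygy of the relations.
  have h1 : ∀ i, ∃ x : κ → k, ∑ j, x j • M j = T i := fun i =>
    (Submodule.mem_span_range_iff_exists_fun k).1 (hM (hT.1 i))
  choose x hx1 using h1
  have hT' : ∀ i a b, T i a b = ∑ j, x i j * M j a b := fun i a b => by
    rw [← hx1]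
    simp
  obtain ⟨g, hg⟩ := hx x fun l => by
    have := hT.2 l
    simp only [hT'] at this
    exact this
  refine (Submodule.mem_span_range_iff_exists_fun k).2 ⟨g, ?_⟩
  ext i a b
  rw [hT', hg]
  simp only [Finset.sum_apply, Pi.smul_apply, smul_eq_mul, Finset.mul_sum, Finset.sum_mul, mul_assoc]
  exact Finset.sum_comm

/-- A nonzero functional on the quadratic relations takes at least a two-dimensional space of
values on the slices of cubic relations. -/
theorem IsLeftASRegular.two_le_finrank_map_cubicRelations [IsDomain R] (hR : IsLeftASRegular 𝒜 4)
    (hz : ∀ i, z i ∈ 𝒜 1) (hindep : LinearIndependent k z)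
    (hgen : Algebra.adjoin k (Set.range z) = ⊤) (w : (Fin 4 → Fin 4 → k) →ₗ[k] k)
    (hw : ∃ N ∈ quadraticRelations k z, w N ≠ 0) :
    2 ≤ finrank k ((cubicRelations k z).map (w.compLeft (Fin 4))) := by
  obtain ⟨κ, κ', _, _, M, c, hcard, hM, -, hT, hE⟩ := hR.exists_linear_strand hz hindep hgen
  -- If the image is at most a line, the functional has the form `β s * b i` on the syzygies, a case
  -- in which the linear strand forces it to vanish on every `M j`.
  by_contra hlt
  obtain ⟨b, hb⟩ := finrank_le_one_iff.1 (Nat.lt_succ_iff.1 (not_le.1 hlt))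
  have hval : ∀ s, ∃ β : k, ∀ i, ∑ j, c s i j * w (M j) = β * (b : Fin 4 → k) i := fun s => by
    obtain ⟨β, hβ⟩ := hb ⟨_, Submodule.mem_map_of_mem (hT s)⟩
    refine ⟨β, fun i => ?_⟩
    have h1 := congrFun (congrArg Subtype.val hβ) i
    simp only [SetLike.val_smul, Pi.smul_apply, smul_eq_mul, LinearMap.compLeft_apply,
      Function.comp_apply] at h1
    rw [h1]
    have : (fun a b => ∑ j, c s i j * M j a b) = ∑ j, c s i j • M j := by
      ext a b
      simp
    rw [this, map_sum]
    simp
  choose β hβ using hval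
  have h0 := hE _ _ β hβ
  obtain ⟨N, hN, hwN⟩ := hw
  obtain ⟨γ, rfl⟩ := (Submodule.mem_span_range_iff_exists_fun k).1 (hM hN)
  refine hwN ?_
  rw [map_sum]
  refine Finset.sum_eq_zero fun j _ => ?_
  rw [map_smul, show w (M j) = 0 from congrFun h0 j, smul_zero]

end LinearStrand

/-! ### Products of spaces of linear forms in a domain. -/

section DegreeSucc

variable {k : Type*} [Field k] {R : Type u} [Ring R] [Algebra k R] {𝒜 : ℕ → Submodule k R}

lemma degree_succ_eq_mul (h : IsConnectedGraded 𝒜) {ι : Type*} [Fintype ι] {z : ι → R}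
    (hz : ∀ i, z i ∈ 𝒜 1) (hgen : Algebra.adjoin k (Set.range z) = ⊤) (n : ℕ) :
    𝒜 (n + 1) = 𝒜 1 * 𝒜 n := by
  have := h.gradedMonoid
  refine le_antisymm (fun r hr => ?_) (Submodule.mul_le.2 fun a ha b hb => ?_)
  · rw [← intGrading_natCast (𝒜 := 𝒜)] at hr
    obtain ⟨f, hf⟩ := exists_sum_mul_of_mem_augmentationIdeal h hz hgen
      (mem_augmentationIdeal_of_mem h (by positivity) hr)
    rw [← intComponent_of_mem h hr, ← hf, map_sum]
    refine Submodule.sum_mem _ fun i _ => ?_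
    have hzi : z i ∈ intGrading 𝒜 1 := by rw [intGrading_one]; exact hz i
    rw [intComponent_mul_left h hzi, Nat.cast_add, Nat.cast_one, add_sub_cancel_right]
    refine Submodule.mul_mem_mul (hz i) ?_
    rw [← intGrading_natCast (𝒜 := 𝒜)]
    exact intComponent_mem h _ _
  · rw [add_comm]
    exact SetLike.mul_mem_graded ha hb

lemma degree_eq_pow (h : IsConnectedGraded 𝒜) {ι : Type*} [Fintype ι] {z : ι → R}
    (hz : ∀ i, z i ∈ 𝒜 1) (hgen : Algebra.adjoin k (Set.range z) = ⊤) (n : ℕ) :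
    𝒜 n = 𝒜 1 ^ n := by
  induction n with
  | zero => rw [pow_zero, h.zero_eq]
  | succ n ih => rw [degree_succ_eq_mul h hz hgen, ih, pow_succ']

end DegreeSucc

section Pencil

open Module

variable {k : Type*} [Field k] {R : Type u} [Ring R] [Algebra k R] [IsDomain R]

/-- Over an algebraically closed field, two independent elements of a domain multiply a
finite-dimensional subspace onto a strictly larger one. -/
theorem finrank_add_one_le_of_mul_mem [IsAlgClosed k] {a b : R}
    (hab : LinearIndependent k ![a, b]) {U W : Submodule k R} [FiniteDimensional k U]
    [FiniteDimensional k W] (hU : U ≠ ⊥) (ha : ∀ u ∈ U, a * u ∈ W) (hb : ∀ u ∈ U, b * u ∈ W) :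
    finrank k U + 1 ≤ finrank k W := by
  by_contra hlt
  have hle : finrank k W ≤ finrank k U := by omega
  let fa : U →ₗ[k] W := (LinearMap.mulLeft k a).restrict ha
  let fb : U →ₗ[k] W := (LinearMap.mulLeft k b).restrict hb
  have ha0 : a ≠ 0 := by simpa using hab.ne_zero 0
  have hinj : Function.Injective fa := fun u v huv =>
    Subtype.ext (mul_left_cancel₀ ha0 (congrArg Subtype.val huv))
  have hdim : finrank k U = finrank k W := le_antisymm
    (LinearMap.finrank_le_finrank_of_injective hinj) hle
  -- If `W` were not larger than `U`, left multiplication by `a` would be an isomorphism `U ≃ W`.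
  -- Its inverse followed after multiplication by `b` has an eigenvector `u`, so `(b - c • a) * u =
  -- 0`, impossible in a domain for independent `a` and `b`.
  let e := LinearMap.linearEquivOfInjective fa hinj hdim
  have : Nontrivial U := Submodule.nontrivial_iff_ne_bot.2 hU
  obtain ⟨c, hc⟩ := Module.End.exists_eigenvalue (e.symm.toLinearMap ∘ₗ fb)
  obtain ⟨u, hu⟩ := hc.exists_hasEigenvector
  have h1 : e.symm (fb u) = c • u := hu.apply_eq_smul
  have h2 : fb u = c • fa u := by
    rw [LinearEquiv.symm_apply_eq, map_smul] at h1
    exact h1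
  have h3 : (b - c • a) * (u : R) = 0 := by
    have : b * (u : R) = c • (a * u) := congrArg Subtype.val h2
    rw [sub_mul, this, smul_mul_assoc, sub_self]
  rcases mul_eq_zero.1 h3 with h4 | h4
  · have := (LinearIndependent.pair_iff.1 hab) (-c) 1 (by
      rw [neg_smul, one_smul, neg_add_eq_sub, h4])
    exact one_ne_zero this.2
  · exact hu.2 (Subtype.ext h4)

end Pencil

section CubicCount

open Module

variable {k : Type*} [Field k] {R : Type u} [Ring R] [Algebra k R] {ι : Type*} [Fintype ι]

lemma range_quadraticEval (z : ι → R) : LinearMap.range (quadraticEval k z) =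
    Submodule.span k (Set.range z) * Submodule.span k (Set.range z) := by
  classical
  apply le_antisymm
  · rintro _ ⟨M, rfl⟩
    rw [quadraticEval_apply]
    exact Submodule.sum_mem _ fun i _ => Submodule.sum_mem _ fun j _ => Submodule.smul_mem _ _
      (Submodule.mul_mem_mul (Submodule.subset_span ⟨i, rfl⟩) (Submodule.subset_span ⟨j, rfl⟩))
  · rw [Submodule.span_mul_span, Submodule.span_le]
    rintro _ ⟨_, ⟨i, rfl⟩, _, ⟨j, rfl⟩, rfl⟩
    refine ⟨Pi.single i (Pi.single j 1), ?_⟩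
    rw [quadraticEval_apply, Finset.sum_eq_single i, Finset.sum_eq_single j]
    · simp
    · intro b _ hb
      simp [hb]
    · simp
    · intro b _ hb
      simp [hb]
    · simp

lemma finrank_mul_self_add (z : ι → R) :
    finrank k (Submodule.span k (Set.range z) * Submodule.span k (Set.range z) : Submodule k R) +
      finrank k (quadraticRelations k z) = Fintype.card ι * Fintype.card ι := by
  rw [← range_quadraticEval, quadraticRelations, LinearMap.finrank_range_add_finrank_ker]
  simp [Module.finrank_pi_fintype]

/-- The multiplication of noncommutative cubic forms in the elements `z i`. -/
def cubicEval (k : Type*) [Field k] [Algebra k R] (z : ι → R) : (ι → ι → ι → k) →ₗ[k] R :=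
  ∑ i, LinearMap.mulLeft k (z i) ∘ₗ quadraticEval k z ∘ₗ LinearMap.proj i

lemma cubicEval_apply (z : ι → R) (T : ι → ι → ι → k) :
    cubicEval k z T = ∑ i, z i * quadraticEval k z (T i) := by
  simp [cubicEval]

lemma cubicEval_apply' (z : ι → R) (T : ι → ι → ι → k) :
    cubicEval k z T = ∑ l, quadraticEval k z (fun i j => T i j l) * z l := by
  simp only [cubicEval_apply, quadraticEval_apply, Finset.mul_sum, Finset.sum_mul]
  have : ∀ i, ∑ j, ∑ l, z i * T i j l • (z j * z l) = ∑ l, ∑ j, T i j l • (z i * z j) * z l := by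
    intro i
    rw [Finset.sum_comm]
    simp only [mul_smul_comm, smul_mul_assoc, mul_assoc]
  simp only [this]
  exact Finset.sum_comm

lemma range_cubicEval (z : ι → R) : LinearMap.range (cubicEval k z) =
    Submodule.span k (Set.range z) *
      (Submodule.span k (Set.range z) * Submodule.span k (Set.range z)) := by
  classical
  rw [← range_quadraticEval]
  apply le_antisymm
  · rintro _ ⟨T, rfl⟩
    rw [cubicEval_apply]
    exact Submodule.sum_mem _ fun i _ =>
      Submodule.mul_mem_mul (Submodule.subset_span ⟨i, rfl⟩) ⟨_, rfl⟩
  · rw [Submodule.mul_le]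
    rintro m hm _ ⟨N, rfl⟩
    obtain ⟨c, rfl⟩ := (Submodule.mem_span_range_iff_exists_fun k).1 hm
    refine ⟨fun i => c i • N, ?_⟩
    rw [cubicEval_apply, Finset.sum_mul]
    simp

/-- The kernel of cubic multiplication contains `E ⊗ Q + Q ⊗ E`, where `E` is the space of variables
and `Q` the space of quadratic relations. The two summands have equal dimension and meet in the
cubic relations. -/
lemma finrank_mul_mul_self_add_le (z : ι → R) :
    finrank k (Submodule.span k (Set.range z) *
      (Submodule.span k (Set.range z) * Submodule.span k (Set.range z)) : Submodule k R) +
      2 * (Fintype.card ι * finrank k (quadraticRelations k z)) ≤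
      Fintype.card ι * (Fintype.card ι * Fintype.card ι) + finrank k (cubicRelations k z) := by
  let L₁ : Submodule k (ι → ι → ι → k) := Submodule.pi Set.univ fun _ => quadraticRelations k z
  -- Moving the last index to the front identifies the relations in the first two variables with
  -- those in the last two.
  let e : (ι → ι → ι → k) ≃ₗ[k] (ι → ι → ι → k) :=
    { toFun := fun T l i j => T i j l
      map_add' := fun _ _ => rfl
      map_smul' := fun _ _ => rfl
      invFun := fun T i j l => T l i j
      left_inv := fun _ => rfl
      right_inv := fun _ => rfl }
  let L₂ : Submodule k (ι → ι → ι → k) := L₁.comap e.toLinearMap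
  have hL₁ : ∀ T, T ∈ L₁ ↔ ∀ i, T i ∈ quadraticRelations k z := fun T => by simp [L₁]
  have hL₂ : ∀ T, T ∈ L₂ ↔ ∀ l, (fun i j => T i j l) ∈ quadraticRelations k z := fun T => hL₁ _
  have hd₁ : finrank k L₁ = Fintype.card ι * finrank k (quadraticRelations k z) := by
    have e₁ : L₁ ≃ₗ[k] (ι → quadraticRelations k z) :=
      { toFun := fun T i => ⟨T.1 i, (hL₁ _).1 T.2 i⟩
        map_add' := fun _ _ => rfl
        map_smul' := fun _ _ => rfl
        invFun := fun T => ⟨fun i => T i, (hL₁ _).2 fun i => (T i).2⟩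
        left_inv := fun _ => rfl
        right_inv := fun _ => rfl }
    rw [e₁.finrank_eq, Module.finrank_pi_fintype]
    simp
  have hd₂ : finrank k L₂ = finrank k L₁ := (e.submoduleMap L₂).finrank_eq.trans (by
    rw [show L₂.map e.toLinearMap = L₁ from Submodule.map_comap_eq_of_surjective e.surjective _])
  have hker : L₁ ⊔ L₂ ≤ LinearMap.ker (cubicEval k z) := by
    refine sup_le (fun T hT => ?_) fun T hT => ?_
    · rw [LinearMap.mem_ker, cubicEval_apply]
      exact Finset.sum_eq_zero fun i _ => by
        rw [show quadraticEval k z (T i) = 0 from (hL₁ T).1 hT i, mul_zero]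
    · rw [LinearMap.mem_ker, cubicEval_apply']
      exact Finset.sum_eq_zero fun l _ => by
        rw [show quadraticEval k z (fun i j => T i j l) = 0 from (hL₂ T).1 hT l, zero_mul]
  have hinf : L₁ ⊓ L₂ = cubicRelations k z := by
    ext T
    rw [Submodule.mem_inf, hL₁, hL₂, mem_cubicRelations]
  have h1 := Submodule.finrank_sup_add_finrank_inf_eq L₁ L₂
  have h2 := Submodule.finrank_mono hker
  have h3 := LinearMap.finrank_range_add_finrank_ker (cubicEval k z)
  rw [range_cubicEval] at h3
  have h4 : finrank k (ι → ι → ι → k) = Fintype.card ι * (Fintype.card ι * Fintype.card ι) := by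
    simp [Module.finrank_pi_fintype]
  rw [hinf, hd₂, hd₁] at h1
  omega

end CubicCount

/-! ### Tensors in fewer variables, extended by zero. -/

section ExtendByZero

variable {k : Type*} [Field k] {V : Type*} [AddCommGroup V] [Module k V] {n : ℕ}

/-- Extension of a vector by a zero coordinate. -/
def snocZero (k : Type*) [Field k] (V : Type*) [AddCommGroup V] [Module k V] (n : ℕ) :
    (Fin n → V) →ₗ[k] (Fin (n + 1) → V) where
  toFun f := Fin.snoc (α := fun _ => V) f 0
  map_add' f g := by
    ext i
    refine Fin.lastCases ?_ (fun j => ?_) i <;> simp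
  map_smul' c f := by
    ext i
    refine Fin.lastCases ?_ (fun j => ?_) i <;> simp

@[simp]
lemma snocZero_castSucc (f : Fin n → V) (i : Fin n) : snocZero k V n f i.castSucc = f i := by
  simp [snocZero]

@[simp]
lemma snocZero_last (f : Fin n → V) : snocZero k V n f (Fin.last n) = 0 := by
  simp [snocZero]

/-- Extension of a square matrix by a zero row and a zero column. -/
def snocZero₂ (k : Type*) [Field k] (n : ℕ) :
    (Fin n → Fin n → k) →ₗ[k] (Fin (n + 1) → Fin (n + 1) → k) :=
  snocZero k _ n ∘ₗ (snocZero k k n).compLeft (Fin n)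

/-- Extension of a cubic tensor by zero. -/
def snocZero₃ (k : Type*) [Field k] (n : ℕ) : (Fin n → Fin n → Fin n → k) →ₗ[k]
    (Fin (n + 1) → Fin (n + 1) → Fin (n + 1) → k) :=
  snocZero k _ n ∘ₗ (snocZero₂ k n).compLeft (Fin n)

@[simp]
lemma snocZero₂_castSucc (M : Fin n → Fin n → k) (i j : Fin n) :
    snocZero₂ k n M i.castSucc j.castSucc = M i j := by simp [snocZero₂]

@[simp]
lemma snocZero₂_last_left (M : Fin n → Fin n → k) (j : Fin (n + 1)) :
    snocZero₂ k n M (Fin.last n) j = 0 := by simp [snocZero₂]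

@[simp]
lemma snocZero₂_last_right (M : Fin n → Fin n → k) (i : Fin (n + 1)) :
    snocZero₂ k n M i (Fin.last n) = 0 := by
  refine Fin.lastCases ?_ (fun j => ?_) i <;> simp [snocZero₂]

@[simp]
lemma snocZero₃_castSucc (T : Fin n → Fin n → Fin n → k) (i : Fin n) :
    snocZero₃ k n T i.castSucc = snocZero₂ k n (T i) := by simp [snocZero₃]

@[simp]
lemma snocZero₃_last (T : Fin n → Fin n → Fin n → k) :
    snocZero₃ k n T (Fin.last n) = 0 := by simp [snocZero₃]

lemma snocZero₃_slice_castSucc (T : Fin n → Fin n → Fin n → k) (l : Fin n) :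
    (fun i j => snocZero₃ k n T i j l.castSucc) = snocZero₂ k n fun i j => T i j l := by
  ext i j
  refine Fin.lastCases ?_ (fun i' => ?_) i
  · simp
  · refine Fin.lastCases ?_ (fun j' => ?_) j <;> simp

lemma snocZero₃_slice_last (T : Fin n → Fin n → Fin n → k) :
    (fun i j => snocZero₃ k n T i j (Fin.last n)) = 0 := by
  ext i j
  refine Fin.lastCases ?_ (fun i' => ?_) i <;> simp

lemma snocZero₂_injective : Function.Injective (snocZero₂ k n) := fun M N h => by
  ext i j
  have := congrFun (congrFun h i.castSucc) j.castSucc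
  simpa using this

lemma snocZero₃_injective : Function.Injective (snocZero₃ k n) := fun S T h => by
  ext1 i
  have := congrFun h i.castSucc
  rw [snocZero₃_castSucc, snocZero₃_castSucc] at this
  exact snocZero₂_injective this

variable {R : Type u} [Ring R] [Algebra k R]

lemma snocZero₂_mem_quadraticRelations {z : Fin (n + 1) → R} {M : Fin n → Fin n → k} :
    snocZero₂ k n M ∈ quadraticRelations k z ↔
      M ∈ quadraticRelations k fun i : Fin n => z i.castSucc := by
  rw [mem_quadraticRelations, mem_quadraticRelations]
  simp [Fin.sum_univ_castSucc]

lemma snocZero₃_mem_cubicRelations {z : Fin (n + 1) → R} {T : Fin n → Fin n → Fin n → k}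
    (hT : T ∈ cubicRelations k fun i : Fin n => z i.castSucc) :
    snocZero₃ k n T ∈ cubicRelations k z := by
  refine ⟨fun i => ?_, fun l => ?_⟩
  · refine Fin.lastCases ?_ (fun j => ?_) i
    · rw [snocZero₃_last]
      exact zero_mem _
    · rw [snocZero₃_castSucc]
      exact snocZero₂_mem_quadraticRelations.2 (hT.1 j)
  · refine Fin.lastCases ?_ (fun j => ?_) l
    · rw [snocZero₃_slice_last]
      exact zero_mem _
    · rw [snocZero₃_slice_castSucc]
      exact snocZero₂_mem_quadraticRelations.2 (hT.2 j)

end ExtendByZero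

/-! ### The square of a three-dimensional space of linear forms. -/

section Hyperplane

open Module

variable {k : Type*} [Field k] {R : Type u} [Ring R] [Algebra k R] {𝒜 : ℕ → Submodule k R}
  {z : Fin 4 → R}

lemma IsLeftASRegular.finrank_quadraticRelations [IsDomain R] (hR : IsLeftASRegular 𝒜 4)
    (hz : ∀ i, z i ∈ 𝒜 1) (hindep : LinearIndependent k z)
    (hgen : Algebra.adjoin k (Set.range z) = ⊤) :
    finrank k (quadraticRelations k z) = 6 := by
  have h := hR.connected
  have h1 := finrank_mul_self_add (k := k) z
  rw [← degree_one_eq_span h hz hgen, ← degree_succ_eq_mul h hz hgen, hR.finrank_four hz hindep hgen, Fintype.card_fin] at h1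
  norm_num [Nat.choose] at h1
  omega

/-- The square of a three-dimensional space of linear forms is at least six-dimensional. -/
theorem IsLeftASRegular.six_le_finrank_mul_self [IsAlgClosed k] [IsDomain R]
    (hR : IsLeftASRegular 𝒜 4) (hz : ∀ i, z i ∈ 𝒜 1) (hindep : LinearIndependent k z)
    (hgen : Algebra.adjoin k (Set.range z) = ⊤) {U : Submodule k R}
    (hU : U = Submodule.span k (Set.range fun i : Fin 3 => z i.castSucc)) :
    6 ≤ finrank k (U * U : Submodule k R) := by
  have hmem : ∀ i : Fin 3, z i.castSucc ∈ U := fun i => hU ▸ Submodule.subset_span ⟨i, rfl⟩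
  have hindep' : LinearIndependent k fun i : Fin 3 => z i.castSucc :=
    hindep.comp _ (Fin.castSucc_injective 3)
  have hUfin : FiniteDimensional k U := by
    rw [hU]
    exact FiniteDimensional.span_of_finite k (Set.finite_range _)
  have hU3 : finrank k U = 3 := by
    rw [hU, finrank_span_eq_card hindep', Fintype.card_fin]
  have hpair : LinearIndependent k ![z 0, z 1] := by
    have := hindep.comp ![0, 1] (by decide)
    convert this using 1
    ext i
    fin_cases i <;> rfl
  have hfin2 : FiniteDimensional k (U * U : Submodule k R) := by
    rw [FiniteDimensional, Module.finite_def, Submodule.fg_top] at *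
    exact hUfin.mul hUfin
  have hfin3 : FiniteDimensional k (U * (U * U) : Submodule k R) := by
    rw [FiniteDimensional, Module.finite_def, Submodule.fg_top] at *
    exact hUfin.mul hfin2
  have hbot : U ≠ ⊥ := fun h0 => by
    rw [h0, finrank_bot] at hU3
    omega
  have hp2 := finrank_add_one_le_of_mul_mem hpair hbot
    (fun u hu => Submodule.mul_mem_mul (hmem 0) hu) (fun u hu => Submodule.mul_mem_mul (hmem 1) hu)
  have hbot2 : (U * U : Submodule k R) ≠ ⊥ := fun h0 => by
    rw [h0, finrank_bot] at hp2
    omega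
  have hp3 := finrank_add_one_le_of_mul_mem hpair hbot2
    (fun u hu => Submodule.mul_mem_mul (hmem 0) hu) (fun u hu => Submodule.mul_mem_mul (hmem 1) hu)
  have hq := finrank_mul_self_add (k := k) fun i : Fin 3 => z i.castSucc
  have hc := finrank_mul_mul_self_add_le (k := k) fun i : Fin 3 => z i.castSucc
  rw [← hU, Fintype.card_fin] at hq hc
  -- Cubic relations in the three variables embed into the kernel of a suitable functional on all
  -- cubic relations. That kernel has dimension at most `4 - 2`.
  have hW : finrank k (cubicRelations k fun i : Fin 3 => z i.castSucc) ≤ 2 := by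
    -- Since `dim U² ≥ 4`, there are at most five relations in the three variables, but six in all.
    -- So some relation involves the last variable, and `w` can be the coefficient of such a
    -- monomial.
    have hw : ∃ w : (Fin 4 → Fin 4 → k) →ₗ[k] k, (∃ N ∈ quadraticRelations k z, w N ≠ 0) ∧
        ∀ M, w (snocZero₂ k 3 M) = 0 := by
      by_contra hcon
      push Not at hcon
      have hsub : quadraticRelations k z ≤
          (quadraticRelations k fun i : Fin 3 => z i.castSucc).map (snocZero₂ k 3) := by
        intro M hM
        have hrow : ∀ j, M (Fin.last 3) j = 0 := fun j => by
          by_contra hne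
          obtain ⟨N, hN⟩ := hcon (LinearMap.proj j ∘ₗ LinearMap.proj (Fin.last 3)) ⟨M, hM, hne⟩
          exact hN (snocZero₂_last_left N j)
        have hcol : ∀ i, M i (Fin.last 3) = 0 := fun i => by
          by_contra hne
          obtain ⟨N, hN⟩ := hcon (LinearMap.proj (Fin.last 3) ∘ₗ LinearMap.proj i) ⟨M, hM, hne⟩
          exact hN (snocZero₂_last_right N i)
        have hMe : snocZero₂ k 3 (fun i j => M i.castSucc j.castSucc) = M := by
          ext i j
          refine Fin.lastCases ?_ (fun i' => ?_) i
          · rw [snocZero₂_last_left, hrow]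
          · refine Fin.lastCases ?_ (fun j' => ?_) j
            · rw [snocZero₂_last_right, hcol]
            · rw [snocZero₂_castSucc]
        exact ⟨_, snocZero₂_mem_quadraticRelations.1 (by rwa [hMe]), hMe⟩
      have h1 := (Submodule.finrank_mono hsub).trans (Submodule.finrank_map_le (snocZero₂ k 3) _)
      rw [hR.finrank_quadraticRelations hz hindep hgen] at h1
      omega
    obtain ⟨w, hw, hw0⟩ := hw
    have h4 := hR.finrank_cubicRelations_le hz hindep hgen
    have h2 := hR.two_le_finrank_map_cubicRelations hz hindep hgen w hw
    have hrn := LinearMap.finrank_range_add_finrank_ker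
      ((w.compLeft (Fin 4)).domRestrict (cubicRelations k z))
    rw [LinearMap.range_domRestrict] at hrn
    have hle : finrank k (cubicRelations k fun i : Fin 3 => z i.castSucc) ≤
        finrank k (LinearMap.ker ((w.compLeft (Fin 4)).domRestrict (cubicRelations k z))) := by
      let f : (cubicRelations k fun i : Fin 3 => z i.castSucc) →ₗ[k]
          LinearMap.ker ((w.compLeft (Fin 4)).domRestrict (cubicRelations k z)) :=
        { toFun := fun T => ⟨⟨snocZero₃ k 3 T, snocZero₃_mem_cubicRelations T.2⟩, by
            rw [LinearMap.mem_ker]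
            ext i
            refine Fin.lastCases ?_ (fun j => ?_) i
            · exact (congrArg w (snocZero₃_last (k := k) T.1)).trans (map_zero w)
            · exact (congrArg w (snocZero₃_castSucc (k := k) T.1 j)).trans (hw0 _)⟩
          map_add' := fun S T => by
            ext1
            ext1
            exact map_add _ _ _
          map_smul' := fun c T => by
            ext1
            ext1
            exact map_smul _ _ _ }
      refine LinearMap.finrank_le_finrank_of_injective (f := f) fun S T hST => ?_
      exact Subtype.ext (snocZero₃_injective (congrArg (fun x => x.1.1) hST))
    omega
  -- With `r` the number of relations in `U`, one has `dim U² = 9 - r` and `dim U³ ≥ 10 - r` from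
  -- the pencil, while `dim U³ ≤ 27 - 6 r + 2` from the cubic count. Hence `r ≤ 3`.
  omega

end Hyperplane

/-! ### Moving the first two variables past the last two. -/

section Block

open Module

variable {k : Type*} [Field k] {R : Type u} [Ring R] [Algebra k R] {𝒜 : ℕ → Submodule k R}
  {z : Fin (2 + 2) → R}

/-- If the quadratic relations restrict to multiples of one nondegenerate form in the last two
variables, the products `z i * z j` with `i` among the first two variables and `j` among the last
two can be rewritten with a factor from the first two variables on the right. -/
theorem IsLeftASRegular.exists_quadraticRelation_eq_single [IsDomain R]
    (hR : IsLeftASRegular 𝒜 4)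
    (hz : ∀ i, z i ∈ 𝒜 1) (hindep : LinearIndependent k z)
    (hgen : Algebra.adjoin k (Set.range z) = ⊤) (w : (Fin 4 → Fin 4 → k) →ₗ[k] k)
    (hw : ∃ N ∈ quadraticRelations k z, w N ≠ 0) {G : Matrix (Fin 2) (Fin 2) k} (hG : G.det ≠ 0)
    (hblock : ∀ M ∈ quadraticRelations k z, ∀ i j : Fin 2,
      M (Fin.natAdd 2 i) (Fin.natAdd 2 j) = w M * G i j) (a b : Fin 2) :
    ∃ M ∈ quadraticRelations k z, ∀ (i : Fin (2 + 2)) (j : Fin 2), M i (Fin.natAdd 2 j) =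
      (Pi.single (Fin.castAdd 2 a) (Pi.single b 1) : Fin (2 + 2) → Fin 2 → k) i j := by
  -- For `i` among the last two variables, the block of `T i` can be read off from either pair of
  -- adjacent slots. This equates a multiple of `G` with a matrix of rank at most one; as `det G ≠
  -- 0`, the multiple is zero.
  have hsupp : ∀ T ∈ cubicRelations k z, ∀ i : Fin 2, w (T (Fin.natAdd 2 i)) = 0 := by
    intro T hT i
    have key : ∀ j l : Fin 2, w (T (Fin.natAdd 2 i)) * G j l =
        w (fun i j => T i j (Fin.natAdd 2 l)) * G i j := fun j l => by
      rw [← hblock _ (hT.1 _), ← hblock _ (hT.2 _)]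
    by_contra hne
    refine hG ?_
    rw [Matrix.det_fin_two]
    have h2 : w (T (Fin.natAdd 2 i)) ^ 2 * (G 0 0 * G 1 1 - G 0 1 * G 1 0) = 0 := by
      linear_combination (w (T (Fin.natAdd 2 i)) * G 1 1) * key 0 0 +
        (w (fun i j => T i j (Fin.natAdd 2 0)) * G i 0) * key 1 1 -
        (w (T (Fin.natAdd 2 i)) * G 1 0) * key 0 1 -
        (w (fun i j => T i j (Fin.natAdd 2 1)) * G i 0) * key 1 0
    exact (mul_eq_zero.1 h2).resolve_left (pow_ne_zero _ hne)
  -- The image has dimension at least two and lies in the plane of the first two coordinates, so it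
  -- is this plane.
  have hmap : (cubicRelations k z).map (w.compLeft (Fin 4)) = Submodule.span k
      (Set.range fun a : Fin 2 => (Pi.single (Fin.castAdd 2 a) 1 : Fin (2 + 2) → k)) := by
    refine Submodule.eq_of_le_of_finrank_le ?_ (((finrank_range_le_card _).trans_eq
      (Fintype.card_fin 2)).trans (hR.two_le_finrank_map_cubicRelations hz hindep hgen w hw))
    rintro _ ⟨T, hT, rfl⟩
    refine (Submodule.mem_span_range_iff_exists_fun k).2 ⟨fun a => w (T (Fin.castAdd 2 a)), ?_⟩
    ext i
    refine Fin.addCases (m := 2) (n := 2) (fun i' => ?_) (fun i' => ?_) i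
    · rw [Finset.sum_apply, Finset.sum_eq_single i']
      · rw [Pi.smul_apply, Pi.single_eq_same, smul_eq_mul, mul_one]
        rfl
      · intro b _ hb
        rw [Pi.smul_apply, Pi.single_eq_of_ne, smul_zero]
        exact fun h => hb (Fin.castAdd_injective 2 2 h).symm
      · simp
    · rw [Finset.sum_apply, Finset.sum_eq_zero]
      · exact (hsupp T hT i').symm
      · intro b _
        rw [Pi.smul_apply, Pi.single_eq_of_ne, smul_zero]
        intro h
        have := congrArg Fin.val h
        simp only [Fin.val_natAdd, Fin.val_castAdd] at this
        omega
  -- `T` is chosen with `w (T i)` equal to `1` for `i = a` and `0` otherwise. Its slice at a last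
  -- index `l` among the final two is a relation whose right columns are zero except for row `a`,
  -- which holds column `l` of `G`.
  obtain ⟨T, hT, hTa⟩ : (Pi.single (Fin.castAdd 2 a) 1 : Fin (2 + 2) → k) ∈
      (cubicRelations k z).map (w.compLeft (Fin 4)) := hmap ▸ Submodule.subset_span ⟨a, rfl⟩
  let π : (Fin (2 + 2) → Fin (2 + 2) → k) →ₗ[k] (Fin (2 + 2) → Fin 2 → k) :=
    { toFun := fun M i j => M i (Fin.natAdd 2 j)
      map_add' := fun _ _ => rfl
      map_smul' := fun _ _ => rfl }
  suffices (Pi.single (Fin.castAdd 2 a) (Pi.single b 1) : Fin (2 + 2) → Fin 2 → k) ∈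
      (quadraticRelations k z).map π by
    obtain ⟨M, hM, hM'⟩ := this
    exact ⟨M, hM, fun i j => congrFun (congrFun hM' i) j⟩
  -- In place of inverting `G`, a functional separating the desired matrix from the relations is
  -- taken. It kills every slice of `T`, so its values on row `a` form a vector annihilated by `G`.
  by_contra hnot
  obtain ⟨f, hf0, hf⟩ := Submodule.exists_le_ker_of_notMem hnot
  have hfexp : ∀ N : Fin (2 + 2) → Fin 2 → k,
      f N = ∑ i, ∑ j, N i j * f (Pi.single i (Pi.single j 1)) := fun N => by
    conv_lhs => rw [← Finset.univ_sum_single N, map_sum]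
    refine Finset.sum_congr rfl fun i _ => ?_
    have : N i = ∑ j, N i j • (Pi.single j 1 : Fin 2 → k) := by
      ext j
      simp [Pi.single_apply]
    conv_lhs => rw [this]
    have h2 := map_sum (LinearMap.single k (fun _ : Fin (2 + 2) => Fin 2 → k) i)
      (fun j => N i j • (Pi.single j 1 : Fin 2 → k)) Finset.univ
    simp only [map_smul, LinearMap.single_apply] at h2
    rw [h2, map_sum]
    simp only [map_smul, smul_eq_mul]
  have hvec : Matrix.vecMul (fun j => f (Pi.single (Fin.castAdd 2 a) (Pi.single j 1))) G = 0 := by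
    ext l
    have h1 : f (π fun i j => T i j (Fin.natAdd 2 l)) = 0 := hf ⟨_, hT.2 _, rfl⟩
    rw [hfexp] at h1
    have h2 : ∀ i j, π (fun i j => T i j (Fin.natAdd 2 l)) i j =
        (if i = Fin.castAdd 2 a then 1 else 0) * G j l := fun i j => by
      have h3 : w (T i) = (Pi.single (Fin.castAdd 2 a) 1 : Fin (2 + 2) → k) i := congrFun hTa i
      rw [Pi.single_apply] at h3
      rw [← h3]
      exact hblock _ (hT.1 i) j l
    simp only [h2, ite_mul, one_mul, zero_mul] at h1
    rw [Finset.sum_eq_single (Fin.castAdd 2 a)] at h1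
    · simp only [if_true] at h1
      simp only [Matrix.vecMul, dotProduct, Pi.zero_apply]
      rw [← h1]
      exact Finset.sum_congr rfl fun j _ => mul_comm _ _
    · intro i _ hi
      simp [hi]
    · simp
  have := congrFun (Matrix.eq_zero_of_vecMul_eq_zero hG hvec) b
  exact hf0 this

end Block

/-! ### Ordered monomials as spanning sets. -/

section MonomialSpan

open Module

variable {k : Type*} [Field k] {S : Type*} [Ring S] [Algebra k S]

/-- The span of the monomials `a ^ i * b ^ j` with `i + j = n`. -/
def monomialSpan (k : Type*) [Field k] [Algebra k S] (a b : S) (n : ℕ) : Submodule k S :=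
  Submodule.span k ((fun m : ℕ × ℕ => a ^ m.1 * b ^ m.2) '' {m | m.1 + m.2 = n})

lemma pow_mul_pow_mem_monomialSpan (a b : S) {i j n : ℕ} (h : i + j = n) :
    a ^ i * b ^ j ∈ monomialSpan k a b n :=
  Submodule.subset_span ⟨(i, j), h, rfl⟩

lemma monomialSpan_le {a b : S} {n : ℕ} {W : Submodule k S}
    (h : ∀ i j, i + j = n → a ^ i * b ^ j ∈ W) : monomialSpan k a b n ≤ W :=
  Submodule.span_le.2 fun _ ⟨m, hm, hx⟩ => hx ▸ h m.1 m.2 hm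

lemma monomialSpan_le_pow {a b : S} {E : Submodule k S} (ha : a ∈ E) (hb : b ∈ E) (n : ℕ) :
    monomialSpan k a b n ≤ E ^ n := monomialSpan_le fun i j h => by
  rw [← h, pow_add]
  exact Submodule.mul_mem_mul (Submodule.pow_mem_pow E ha i) (Submodule.pow_mem_pow E hb j)

lemma mul_mem_monomialSpan {a b x : S} {n : ℕ} (hx : x ∈ monomialSpan k a b n) :
    a * x ∈ monomialSpan k a b (n + 1) := by
  have : monomialSpan k a b n ≤ (monomialSpan k a b (n + 1)).comap (LinearMap.mulLeft k a) :=
    monomialSpan_le fun i j h => by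
      rw [Submodule.mem_comap, LinearMap.mulLeft_apply, ← mul_assoc, ← pow_succ']
      exact pow_mul_pow_mem_monomialSpan a b (by omega)
  exact this hx

/-- Reordering of monomials modulo a normal space `V` of linear forms. -/
theorem pow_succ_le_monomialSpan_sup {a b : S} {V E : Submodule k S}
    (hE : E = V ⊔ Submodule.span k {a, b}) (hEV : E * V ≤ V * E)
    (hrel : b * a ∈ Submodule.span k {a * b, a * a} ⊔ V * E) (n : ℕ) :
    E ^ (n + 1) ≤ monomialSpan k a b (n + 1) ⊔ V * E ^ n := by
  have hVE : V ≤ E := hE ▸ le_sup_left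
  have ha : a ∈ E := hE ▸ Submodule.mem_sup_right (Submodule.subset_span (by simp))
  have hb : b ∈ E := hE ▸ Submodule.mem_sup_right (Submodule.subset_span (by simp))
  induction n with
  | zero =>
    rw [zero_add, pow_one, pow_zero, mul_one, hE]
    refine sup_le le_sup_right ((Submodule.span_le.2 ?_).trans le_sup_left)
    rintro x (rfl | rfl)
    · simpa using pow_mul_pow_mem_monomialSpan (k := k) x b (i := 1) (j := 0) (n := 1) rfl
    · simpa using pow_mul_pow_mem_monomialSpan (k := k) a x (i := 0) (j := 1) (n := 1) rfl
  | succ n ih =>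
    have hEVE : E * (V * E ^ n) ≤ V * E ^ (n + 1) := by
      rw [← mul_assoc, pow_succ', ← mul_assoc]
      exact mul_le_mul_left hEV _
    have haE : ∀ x ∈ E ^ (n + 1), a * x ∈ monomialSpan k a b (n + 2) ⊔ V * E ^ (n + 1) := by
      intro x hx
      obtain ⟨y, hy, v, hv, rfl⟩ := Submodule.mem_sup.1 (ih hx)
      rw [mul_add]
      exact add_mem (Submodule.mem_sup_left (mul_mem_monomialSpan hy))
        (Submodule.mem_sup_right (hEVE (Submodule.mul_mem_mul ha hv)))
    -- The only words out of order start with `b * a`. The relation replaces this by `a * b` and `a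
    -- * a`, plus terms beginning in `V`; a leading `a` then leaves a word of length `n + 1`, to
    -- which the induction hypothesis applies.
    have hbY : monomialSpan k a b (n + 1) ≤
        (monomialSpan k a b (n + 2) ⊔ V * E ^ (n + 1)).comap (LinearMap.mulLeft k b) := by
      refine monomialSpan_le fun i j hij => ?_
      rw [Submodule.mem_comap, LinearMap.mulLeft_apply]
      rcases i with _ | i
      · rw [pow_zero, one_mul, ← pow_succ']
        exact Submodule.mem_sup_left (by
          simpa using pow_mul_pow_mem_monomialSpan (k := k) a b (i := 0) (j := j + 1) (by omega))
      · have hw : a ^ i * b ^ j ∈ monomialSpan k a b n :=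
          pow_mul_pow_mem_monomialSpan a b (by omega)
        have hwE : a ^ i * b ^ j ∈ E ^ n := monomialSpan_le_pow ha hb n hw
        obtain ⟨x, hx, v, hv, hxv⟩ := Submodule.mem_sup.1 hrel
        obtain ⟨c, d, rfl⟩ := Submodule.mem_span_pair.1 hx
        rw [pow_succ' a i, mul_assoc, ← mul_assoc b a, ← hxv, add_mul, add_mul, smul_mul_assoc,
          smul_mul_assoc, mul_assoc a b, mul_assoc a a]
        refine add_mem (add_mem (Submodule.smul_mem _ _ (haE _ ?_)) (Submodule.smul_mem _ _
          (haE _ ?_))) (Submodule.mem_sup_right ?_)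
        · rw [pow_succ']
          exact Submodule.mul_mem_mul hb hwE
        · rw [pow_succ']
          exact Submodule.mul_mem_mul ha hwE
        · rw [pow_succ', ← mul_assoc]
          exact Submodule.mul_mem_mul hv hwE
    rw [pow_succ', Submodule.mul_le]
    intro e he x hx
    rw [hE] at he
    obtain ⟨v, hv, y, hy, rfl⟩ := Submodule.mem_sup.1 he
    obtain ⟨c, d, rfl⟩ := Submodule.mem_span_pair.1 hy
    rw [add_mul, add_mul, smul_mul_assoc, smul_mul_assoc]
    refine add_mem (Submodule.mem_sup_right (Submodule.mul_mem_mul hv hx))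
      (add_mem (Submodule.smul_mem _ _ (haE x hx)) (Submodule.smul_mem _ _ ?_))
    obtain ⟨y, hy, v, hv, rfl⟩ := Submodule.mem_sup.1 (ih hx)
    rw [mul_add]
    exact add_mem (hbY hy) (Submodule.mem_sup_right (hEVE (Submodule.mul_mem_mul hb hv)))

/-- Each use of `pow_succ_le_monomialSpan_sup` either reaches ordered monomials or splits off one
factor from `V`, leaving a shorter power of `E`. -/
theorem pow_le_iSup_mul_monomialSpan {a b : S} {V E : Submodule k S}
    (hE : E = V ⊔ Submodule.span k {a, b}) (hEV : E * V ≤ V * E)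
    (hrel : b * a ∈ Submodule.span k {a * b, a * a} ⊔ V * E) (n : ℕ) :
    E ^ n ≤ ⨆ m ∈ {m : ℕ × ℕ | m.1 + m.2 = n}, V ^ m.1 * monomialSpan k a b m.2 := by
  have hY : ∀ n, monomialSpan k a b n ≤
      ⨆ m ∈ {m : ℕ × ℕ | m.1 + m.2 = n}, V ^ m.1 * monomialSpan k a b m.2 := fun n =>
    le_iSup₂_of_le (0, n) (zero_add n) (by rw [pow_zero, one_mul])
  induction n with
  | zero =>
    refine le_trans ?_ (hY 0)
    rw [pow_zero, Submodule.one_le]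
    simpa using pow_mul_pow_mem_monomialSpan (k := k) a b (i := 0) (j := 0) rfl
  | succ n ih =>
    refine (pow_succ_le_monomialSpan_sup hE hEV hrel n).trans (sup_le (hY _) ?_)
    refine (mul_le_mul_right ih V).trans ?_
    simp only [Submodule.mul_iSup]
    refine iSup₂_le fun m hm => le_iSup₂_of_le (m.1 + 1, m.2) ?_ ?_
    · have : m.1 + m.2 = n := hm
      change m.1 + 1 + m.2 = n + 1
      omega
    · rw [pow_succ', mul_assoc]

lemma pow_eq_monomialSpan {a b : S}
    (hrel : b * a ∈ Submodule.span k {a * b, a * a}) (n : ℕ) :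
    Submodule.span k {a, b} ^ n = monomialSpan k a b n := by
  refine le_antisymm ?_ (monomialSpan_le_pow (Submodule.subset_span (by simp))
    (Submodule.subset_span (by simp)) n)
  rcases n with _ | n
  · rw [pow_zero, Submodule.one_le]
    simpa using pow_mul_pow_mem_monomialSpan (k := k) a b (i := 0) (j := 0) rfl
  · have := pow_succ_le_monomialSpan_sup (a := a) (b := b) (V := (⊥ : Submodule k S))
      (E := Submodule.span k {a, b}) (by rw [bot_sup_eq]) (by simp) (by simpa using hrel) n
    simpa using this

end MonomialSpan

/-! ### Linear independence by counting in each degree. -/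

section GradedIndependence

open Module

variable {k : Type*} [Field k] {S : Type*} [Ring S] [Algebra k S]

lemma linearIndepOn_of_card_le_finrank {ι : Type*} {w : ι → S} {D : Set ι} (hD : D.Finite)
    (h : D.ncard ≤ finrank k (Submodule.span k (w '' D))) : LinearIndepOn k w D := by
  have := hD.fintype
  refine linearIndependent_iff_card_le_finrank_span.2 ?_
  rw [Set.finrank, Set.range_comp', Subtype.range_coe, ← Nat.card_eq_fintype_card,
    Nat.card_coe_set_eq]
  exact h

lemma linearIndependent_of_graded {ι : Type*} {𝒜 : ℕ → Submodule k S}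
    (h : DirectSum.IsInternal 𝒜) {w : ι → S} {d : ι → ℕ} (hw : ∀ i, w i ∈ 𝒜 (d i))
    (hind : ∀ n, LinearIndepOn k w {i | d i = n}) : LinearIndependent k w := by
  classical
  rw [linearIndependent_iff']
  intro s g hg i hi
  have h1 := congrArg (natComponent h (d i)) hg
  rw [map_sum, map_zero] at h1
  have h2 : ∑ j ∈ s with d j = d i, g j • w j = 0 := by
    rw [← h1, Finset.sum_filter]
    refine Finset.sum_congr rfl fun j _ => ?_
    rw [map_smul]
    split_ifs with hj
    · rw [natComponent_of_mem h (hj ▸ hw j)]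
    · rw [natComponent_of_mem_ne h (hw j) hj, smul_zero]
  exact linearIndepOn_iff'.1 (hind (d i)) (s.filter fun j => d j = d i) g
    (fun j hj => (Finset.mem_filter.1 hj).2) h2 i (Finset.mem_filter.2 ⟨hi, rfl⟩)

end GradedIndependence

/-! ### Quantum planes and their opposites. -/

section QuantumPlane

open Module MulOpposite

variable {k : Type*} [Field k] {S : Type*} [Ring S] [Algebra k S]

/-- The elements `a`, `b` generate an algebra with the one relation
`b * a = q • (a * b) + p • (a * a)`, where `q ≠ 0`, and with basis the monomials `a ^ i * b ^ j`. -/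
structure IsQuantumPlane (a b : S) (q p : k) : Prop where
  ne_zero : q ≠ 0
  rel : b * a = q • (a * b) + p • (a * a)
  indep : LinearIndependent k fun m : ℕ × ℕ => a ^ m.1 * b ^ m.2
  adjoin_eq_top : Algebra.adjoin k {a, b} = ⊤

lemma setOf_add_eq (n : ℕ) :
    {m : ℕ × ℕ | m.1 + m.2 = n} = (Finset.HasAntidiagonal.antidiagonal n : Finset (ℕ × ℕ)) := by
  ext m
  simp

lemma ncard_setOf_add_eq (n : ℕ) : {m : ℕ × ℕ | m.1 + m.2 = n}.ncard = n + 1 := by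
  rw [setOf_add_eq, Set.ncard_coe_finset, Finset.Nat.card_antidiagonal]

instance finite_monomialSpan (a b : S) (n : ℕ) : Module.Finite k (monomialSpan k a b n) := by
  rw [monomialSpan, setOf_add_eq]
  exact FiniteDimensional.span_of_finite k ((Finset.finite_toSet _).image _)

lemma iSup_monomialSpan_eq_top {a b : S} (hrel : b * a ∈ Submodule.span k {a * b, a * a})
    (hgen : Algebra.adjoin k {a, b} = ⊤) : ⨆ n, monomialSpan k a b n = ⊤ := by
  simp only [← pow_eq_monomialSpan hrel]
  rw [eq_top_iff]
  rintro x -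
  have key : ∀ y ∈ ⨆ n, Submodule.span k {a, b} ^ n,
      x * y ∈ ⨆ n, Submodule.span k {a, b} ^ n := by
    have hx : x ∈ Algebra.adjoin k {a, b} := hgen ▸ Algebra.mem_top
    induction hx using Algebra.adjoin_induction with
    | mem x hx =>
      intro y hy
      have : (⨆ n, Submodule.span k {a, b} ^ n) ≤
          (⨆ n, Submodule.span k {a, b} ^ n).comap (LinearMap.mulLeft k x) :=
        iSup_le fun n y hy => Submodule.mem_iSup_of_mem (n + 1) (by
          rw [pow_succ']
          exact Submodule.mul_mem_mul (Submodule.subset_span hx) hy)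
      exact this hy
    | algebraMap c =>
      intro y hy
      rw [← Algebra.smul_def]
      exact Submodule.smul_mem _ _ hy
    | add x₁ x₂ _ _ h₁ h₂ =>
      intro y hy
      rw [add_mul]
      exact add_mem (h₁ y hy) (h₂ y hy)
    | mul x₁ x₂ _ _ h₁ h₂ =>
      intro y hy
      rw [mul_assoc]
      exact h₁ _ (h₂ y hy)
  rw [← mul_one x]
  exact key 1 (Submodule.mem_iSup_of_mem 0 (by
    rw [pow_zero]
    exact Submodule.one_le.1 le_rfl))

lemma iSup_monomialSpan (a b : S) : ⨆ n, monomialSpan k a b n =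
    Submodule.span k (Set.range fun m : ℕ × ℕ => a ^ m.1 * b ^ m.2) := by
  simp only [monomialSpan]
  rw [← Submodule.span_iUnion, ← Set.image_iUnion, ← Set.image_univ]
  congr 2
  ext m
  simp

variable {a b : S} {q p : k}

namespace IsQuantumPlane

variable (h : IsQuantumPlane a b q p)

include h

lemma mul_mem_span : b * a ∈ Submodule.span k {a * b, a * a} :=
  Submodule.mem_span_pair.2 ⟨q, p, h.rel.symm⟩

lemma iSup_eq_top : ⨆ n, monomialSpan k a b n = ⊤ :=
  iSup_monomialSpan_eq_top h.mul_mem_span h.adjoin_eq_top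

lemma finrank_eq (n : ℕ) : finrank k (monomialSpan k a b n) = n + 1 := by
  have hind := h.indep.comp (Subtype.val : {m : ℕ × ℕ | m.1 + m.2 = n} → ℕ × ℕ)
    Subtype.val_injective
  have hfin : {m : ℕ × ℕ | m.1 + m.2 = n}.Finite := by
    rw [setOf_add_eq]
    exact Finset.finite_toSet _
  have := hfin.fintype
  have h1 := finrank_span_eq_card hind
  rw [Set.range_comp, Subtype.range_coe, ← Nat.card_eq_fintype_card, Nat.card_coe_set_eq,
    ncard_setOf_add_eq] at h1
  exact h1

lemma isInternal : DirectSum.IsInternal (monomialSpan k a b) := by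
  refine DirectSum.isInternal_submodule_of_iSupIndep_of_iSup_eq_top (fun n => ?_) h.iSup_eq_top
  simp only [monomialSpan]
  rw [← Submodule.span_iUnion₂, ← Set.image_iUnion₂]
  refine h.indep.disjoint_span_image (Set.disjoint_left.2 fun m hm hm' => ?_)
  obtain ⟨j, hj, hmj⟩ := Set.mem_iUnion₂.1 hm'
  exact hj (hmj.symm.trans hm)

lemma connected : IsConnectedGraded (monomialSpan k a b) where
  nontrivial := ⟨1, 0, by simpa using h.indep.ne_zero (0, 0)⟩
  gradedMonoid :=
    { one_mem := by simpa using pow_mul_pow_mem_monomialSpan (k := k) a b (i := 0) (j := 0) rfl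
      mul_mem := fun {i j} x y hx hy => by
        rw [← pow_eq_monomialSpan h.mul_mem_span] at *
        rw [pow_add]
        exact Submodule.mul_mem_mul hx hy }
  isInternal := h.isInternal
  zero_eq := by rw [← pow_eq_monomialSpan h.mul_mem_span, pow_zero]

/-- The relation is solved for `a * b`, which requires `q ≠ 0`. -/
lemma rel_op : op b * op a = q⁻¹ • (op a * op b) + (-(q⁻¹ * p)) • (op a * op a) := by
  rw [← MulOpposite.op_mul, ← MulOpposite.op_mul, ← MulOpposite.op_mul, h.rel, MulOpposite.op_add,
    MulOpposite.op_smul, MulOpposite.op_smul, smul_add, smul_smul, smul_smul,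
    inv_mul_cancel₀ h.ne_zero, one_smul, add_assoc, ← add_smul, add_neg_cancel, zero_smul, add_zero]

lemma adjoin_op_eq_top : Algebra.adjoin k {op a, op b} = ⊤ := by
  rw [eq_top_iff]
  rintro x -
  induction x using MulOpposite.rec' with
  | _ x =>
    have hx : x ∈ Algebra.adjoin k {a, b} := h.adjoin_eq_top ▸ Algebra.mem_top
    induction hx using Algebra.adjoin_induction with
    | mem x hx =>
      refine Algebra.subset_adjoin ?_
      rcases hx with rfl | rfl <;> simp
    | algebraMap c => exact Subalgebra.algebraMap_mem _ c
    | add x₁ x₂ _ _ h₁ h₂ => exact add_mem h₁ h₂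
    | mul x₁ x₂ _ _ h₁ h₂ => exact mul_mem h₂ h₁

lemma mul_mem_span_op : op b * op a ∈ Submodule.span k {op a * op b, op a * op a} :=
  Submodule.mem_span_pair.2 ⟨q⁻¹, _, h.rel_op.symm⟩

lemma opGrading_eq : opGrading (monomialSpan k a b) = monomialSpan k (op a) (op b) := by
  ext1 n
  rw [opGrading, ← pow_eq_monomialSpan h.mul_mem_span, ← pow_eq_monomialSpan h.mul_mem_span_op,
    Submodule.map_op_pow, Submodule.map_span]
  congr 2
  simp [Set.image_pair]

/-- The opposite relation has the same shape, so the reversed monomials span each component; there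
are `n + 1` of them in degree `n`, which is its dimension. -/
lemma indep_op : LinearIndependent k fun m : ℕ × ℕ => op a ^ m.1 * op b ^ m.2 := by
  have hind : LinearIndependent k fun m : ℕ × ℕ => b ^ m.2 * a ^ m.1 := by
    refine linearIndependent_of_graded h.isInternal (d := fun m => m.1 + m.2) (fun m => ?_)
      fun n => ?_
    · rw [← pow_eq_monomialSpan h.mul_mem_span, add_comm, pow_add]
      exact Submodule.mul_mem_mul (Submodule.pow_mem_pow _ (Submodule.subset_span (by simp)) _)
        (Submodule.pow_mem_pow _ (Submodule.subset_span (by simp)) _)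
    · refine linearIndepOn_of_card_le_finrank ?_ ?_
      · rw [setOf_add_eq]
        exact Finset.finite_toSet _
      · rw [ncard_setOf_add_eq, ← h.finrank_eq n]
        have h1 : finrank k (opGrading (monomialSpan k a b) n) = finrank k (monomialSpan k a b n) :=
          LinearEquiv.finrank_map_eq (opLinearEquiv k : S ≃ₗ[k] Sᵐᵒᵖ) _
        have h2 : finrank k ((Submodule.span k ((fun m : ℕ × ℕ => b ^ m.2 * a ^ m.1) ''
            {m | m.1 + m.2 = n})).map (opLinearEquiv k : S ≃ₗ[k] Sᵐᵒᵖ).toLinearMap) =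
            finrank k (Submodule.span k ((fun m : ℕ × ℕ => b ^ m.2 * a ^ m.1) ''
            {m | m.1 + m.2 = n})) :=
          LinearEquiv.finrank_map_eq (opLinearEquiv k : S ≃ₗ[k] Sᵐᵒᵖ) _
        rw [← h1, ← h2, h.opGrading_eq, Submodule.map_span, Set.image_image]
        exact le_of_eq rfl
  have := hind.map' (opLinearEquiv k : S ≃ₗ[k] Sᵐᵒᵖ).toLinearMap (LinearEquiv.ker _)
  exact this

/-- The opposite algebra of a quantum plane is a quantum plane. -/
protected theorem op : IsQuantumPlane (op a) (op b) q⁻¹ (-(q⁻¹ * p)) :=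
  ⟨inv_ne_zero h.ne_zero, h.rel_op, h.indep_op, h.adjoin_op_eq_top⟩

lemma span_eq_top : Submodule.span k (Set.range fun m : ℕ × ℕ => a ^ m.1 * b ^ m.2) = ⊤ := by
  rw [← iSup_monomialSpan, h.iSup_eq_top]

lemma indep' : LinearIndependent k fun m : ℕ × ℕ => b ^ m.1 * a ^ m.2 := by
  have := (h.indep_op.map' (opLinearEquiv k : S ≃ₗ[k] Sᵐᵒᵖ).symm.toLinearMap
    (LinearEquiv.ker _)).comp Prod.swap Prod.swap_injective
  exact this

lemma span_eq_top' : Submodule.span k (Set.range fun m : ℕ × ℕ => b ^ m.1 * a ^ m.2) = ⊤ := by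
  have h1 := congrArg (Submodule.map (opLinearEquiv k : S ≃ₗ[k] Sᵐᵒᵖ).symm.toLinearMap)
    h.op.span_eq_top
  rw [Submodule.map_top, LinearEquiv.range, Submodule.map_span, ← Set.range_comp] at h1
  rw [← h1, ← (Prod.swap_surjective (α := ℕ) (β := ℕ)).range_comp]
  rfl

end IsQuantumPlane

end QuantumPlane

/-! ### The Gorenstein condition from an explicit resolution of length two. -/

section GorensteinTwo

open Abelian

variable {k : Type*} [Field k] {R : Type u} [Ring R] [Algebra k R]

lemma subsingleton_ext_of_extends {X : ModuleCat.{u} R} {S : ShortComplex (ModuleCat.{u} R)}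
    (hS : S.ShortExact) [Projective S.X₂] {n : ℕ} {ε : Ext X S.X₃ n} (hε : IsSyzygyClass ε)
    (Y : ModuleCat.{u} R) (h : ∀ f : S.X₁ ⟶ Y, ∃ g : S.X₂ ⟶ Y, S.f ≫ g = f) :
    Subsingleton (Ext X Y (n + 1)) := by
  refine subsingleton_of_forall_eq 0 fun α => ?_
  obtain ⟨f, rfl⟩ := syzygyConnecting_surjective hS hε Y α
  exact (syzygyConnecting_eq_zero_iff hS hε f).2 (h f)

lemma exists_addEquiv_of_ker_eq {G H K : Type*} [AddCommGroup G] [AddCommGroup H] [AddCommGroup K]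
    (φ : G →+ H) (hφ : Function.Surjective φ) (ψ : G →+ K) (hψ : Function.Surjective ψ)
    (h : ∀ g, φ g = 0 ↔ ψ g = 0) : ∃ e : H ≃+ K, ∀ g, e (φ g) = ψ g := by
  have hk : φ.ker = ψ.ker := by
    ext g
    exact h g
  let e₁ := QuotientAddGroup.quotientKerEquivOfSurjective φ hφ
  let e₂ := QuotientAddGroup.quotientKerEquivOfSurjective ψ hψ
  refine ⟨(e₁.symm.trans (QuotientAddGroup.quotientAddEquivOfEq hk)).trans e₂, fun g => ?_⟩
  have h1 : e₁.symm (φ g) = QuotientAddGroup.mk g := by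
    rw [AddEquiv.symm_apply_eq]
    rfl
  rw [AddEquiv.trans_apply, AddEquiv.trans_apply, h1]
  rfl

variable {𝒜 : ℕ → Submodule k R}

/-- The augmentation of a connected graded algebra. -/
lemma exists_augmentation (h : IsConnectedGraded 𝒜) : ∃ ε : R →+ k,
    Function.Surjective ε ∧ (∀ r, ε r = 0 ↔ r ∈ augmentationIdeal 𝒜) ∧
      ∀ r c, ε (r * algebraMap k R c) = ε r * c := by
  choose ε hε using exists_algebraMap_sub_mem h
  have huniq : ∀ r c, r - algebraMap k R c ∈ augmentationIdeal 𝒜 → ε r = c := fun r c hc => by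
    have := Submodule.sub_mem _ hc (hε r)
    rw [sub_sub_sub_cancel_left, ← map_sub, algebraMap_mem_augmentationIdeal_iff h] at this
    exact sub_eq_zero.1 this
  refine ⟨⟨⟨ε, huniq _ _ (by simp)⟩, fun r s => huniq _ _ ?_⟩, fun c => ⟨algebraMap k R c,
    huniq _ _ (by simp)⟩, fun r => ⟨fun h0 => ?_, fun hr => huniq _ _ (by simpa using hr)⟩,
    fun r c => huniq _ _ ?_⟩
  · have := Submodule.add_mem _ (hε r) (hε s)
    rwa [map_add, add_sub_add_comm]
  · have := hε r
    rwa [show ε r = 0 from h0, map_zero, sub_zero] at this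
  · rw [map_mul, ← sub_mul]
    exact mul_mem_augmentationIdeal_right h (hε r) _

variable {z : Fin 2 → R} {c : Fin 2 →₀ R}

/-- The Gorenstein condition in dimension two from a self-dual resolution of the trivial module. -/
theorem isLeftGorenstein_of_resolution_two (h : IsConnectedGraded 𝒜)
    (hpd : HasProjectiveDimensionLT (trivialModule 𝒜) 3)
    (hr : LinearMap.range (Finsupp.linearCombination R z) = augmentationIdeal 𝒜)
    (hc : LinearMap.range (LinearMap.toSpanSingleton R (Fin 2 →₀ R) c) =
      LinearMap.ker (Finsupp.linearCombination R z))
    (hinj : Function.Injective (LinearMap.toSpanSingleton R (Fin 2 →₀ R) c))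
    (dual₀ : ∀ s : R, (∀ i, z i * s = 0) → s = 0)
    (dual₁ : ∀ f : Fin 2 → R, Finsupp.linearCombination R f c = 0 → ∃ g, ∀ i, f i = z i * g)
    (dual₂ : ∀ s, s ∈ augmentationIdeal 𝒜 ↔ ∃ f : Fin 2 → R, Finsupp.linearCombination R f c = s) :
    IsLeftGorenstein 𝒜 2 := by
  have hzmem : ∀ i, z i ∈ augmentationIdeal 𝒜 := fun i =>
    hr.le ⟨Finsupp.single i 1, by simp⟩
  have hz0 : Finsupp.linearCombination R z c = 0 := hc.le ⟨1, by simp⟩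
  have hext0 : Subsingleton (Ext (trivialModule 𝒜) (ModuleCat.of R R) 0) := by
    refine subsingleton_of_forall_eq 0 fun α => ?_
    obtain ⟨f, rfl⟩ := (Ext.mk₀_bijective _ _).2 α
    suffices f = 0 by rw [this, Ext.mk₀_zero]
    let F : (R ⧸ augmentationIdeal 𝒜) →ₗ[R] R := f.hom
    have hF : ∀ r : R, F (Submodule.Quotient.mk r) = r * F (Submodule.Quotient.mk 1) := fun r => by
      rw [← smul_eq_mul, ← map_smul, ← Submodule.Quotient.mk_smul, smul_eq_mul, mul_one]
    have h1 : F (Submodule.Quotient.mk 1) = 0 := dual₀ _ fun i => by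
      rw [← hF, (Submodule.Quotient.mk_eq_zero _).2 (hzmem i), map_zero]
    ext x
    obtain ⟨r, rfl⟩ := Submodule.Quotient.mk_surjective _ x
    exact (hF r).trans (by rw [h1, mul_zero]; rfl)
  have hext1 : Subsingleton (Ext (trivialModule 𝒜) (ModuleCat.of R R) (0 + 1)) := by
    have hS := kernelComplex_shortExact (augmentationIdeal 𝒜).mkQ (Submodule.mkQ_surjective _)
    have : Projective (kernelComplex (augmentationIdeal 𝒜).mkQ).X₂ :=
      (IsProjective.iff_projective R).1 inferInstance
    refine subsingleton_ext_of_extends hS (IsSyzygyClass.id (trivialModule 𝒜)) _ fun f => ?_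
    have hm : ∀ i, z i ∈ LinearMap.ker (augmentationIdeal 𝒜).mkQ := fun i => by
      rw [Submodule.ker_mkQ]
      exact hzmem i
    let F : LinearMap.ker (augmentationIdeal 𝒜).mkQ →ₗ[R] R := f.hom
    have hF : ∀ (x : Fin 2 →₀ R) (y : LinearMap.ker (augmentationIdeal 𝒜).mkQ),
        (y : R) = Finsupp.linearCombination R z x →
        F y = Finsupp.linearCombination R (fun i => F ⟨z i, hm i⟩) x := fun x y hy => by
      have : y = ∑ i, x i • (⟨z i, hm i⟩ : LinearMap.ker (augmentationIdeal 𝒜).mkQ) := by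
        ext
        rw [hy, linearCombination_eq_sum]
        simp
      rw [this, map_sum, linearCombination_eq_sum]
      simp only [map_smul]
    obtain ⟨g, hg⟩ := dual₁ (fun i => F ⟨z i, hm i⟩) (by
      rw [← hF c 0 (by rw [hz0]; rfl), map_zero])
    refine ⟨ModuleCat.ofHom (LinearMap.toSpanSingleton R R g), ?_⟩
    ext y
    have hy : (y : R) ∈ LinearMap.range (Finsupp.linearCombination R z) :=
      hr.symm.le ((Submodule.ker_mkQ _).le y.2)
    obtain ⟨x, hx⟩ := hy
    change (y : R) * g = F y
    rw [hF x y hx.symm, ← hx, linearCombination_eq_sum, linearCombination_eq_sum, Finset.sum_mul]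
    exact Finset.sum_congr rfl fun i _ => by
      rw [hg i, smul_eq_mul, smul_eq_mul, mul_assoc]
  obtain ⟨⟨ε₁, hε₁⟩, -⟩ := isSyzygyOf_augmentationIdeal (𝒜 := 𝒜) (m := 1) hpd
  have hS := coverComplex_shortExact _ _ hr
  have hproj : Projective (coverComplex _ _ hr).X₂ :=
    (IsProjective.iff_projective (Fin 2 →₀ R)).1 inferInstance
  let E : R ≃ₗ[R] LinearMap.ker (Finsupp.linearCombination R z) :=
    (LinearEquiv.ofInjective _ hinj).trans (LinearEquiv.ofEq _ _ hc)
  have hE : ∀ x, (E x : Fin 2 →₀ R) = x • c := fun x => rfl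
  -- The last module of the resolution is free on `c`, so its functionals are the right
  -- multiplications by elements of `R`. Top Ext becomes the quotient of `R` by those `s` that
  -- extend, and `dual₂` identifies them with the augmentation ideal.
  let toHom : R →+ ((coverComplex _ _ hr).X₁ ⟶ ModuleCat.of R R) :=
    { toFun := fun s => ModuleCat.ofHom (LinearMap.toSpanSingleton R R s ∘ₗ E.symm.toLinearMap)
      map_zero' := by
        ext x
        simp
      map_add' := fun s t => by
        ext x
        simp [mul_add] }
  have hcomp : ∀ s t, toHom (s * t) = toHom s ≫ rightMulHom t := fun s t => by
    ext x
    exact (mul_assoc _ _ _).symm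
  let Φ : R →+ Ext (trivialModule 𝒜) (ModuleCat.of R R) (1 + 1) :=
    (syzygyConnecting hS ε₁ (ModuleCat.of R R)).comp toHom
  have hΦmul : ∀ s t, Φ (s * t) = extRightMul (Φ s) t := fun s t => by
    simp only [Φ, AddMonoidHom.comp_apply]
    rw [hcomp, syzygyConnecting_comp]
    rfl
  have hΦsurj : Function.Surjective Φ := by
    refine (syzygyConnecting_surjective hS hε₁ _).comp fun f => ?_
    refine ⟨f.hom (E 1), ?_⟩
    ext x
    change E.symm x * f.hom (E 1) = f.hom x
    rw [← smul_eq_mul, ← map_smul, ← map_smul, smul_eq_mul, mul_one, LinearEquiv.apply_symm_apply]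
  have hΦzero : ∀ s, Φ s = 0 ↔ s ∈ augmentationIdeal 𝒜 := fun s => by
    simp only [Φ, AddMonoidHom.comp_apply]
    rw [syzygyConnecting_eq_zero_iff hS hε₁, dual₂]
    constructor
    · rintro ⟨g, hg⟩
      refine ⟨fun i => g.hom (Finsupp.single i 1), ?_⟩
      rw [← linearMap_eq_linearCombination g.hom]
      have := LinearMap.congr_fun (congrArg ModuleCat.Hom.hom hg) (E 1)
      change g.hom (E 1 : Fin 2 →₀ R) = E.symm (E 1) * s at this
      rwa [hE, one_smul, LinearEquiv.symm_apply_apply, one_mul] at this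
    · rintro ⟨f, hf⟩
      refine ⟨ModuleCat.ofHom (Finsupp.linearCombination R f), ?_⟩
      ext x
      change Finsupp.linearCombination R f (x : Fin 2 →₀ R) = E.symm x * s
      conv_lhs => rw [← LinearEquiv.apply_symm_apply E x, hE, map_smul, hf, smul_eq_mul]
  obtain ⟨ε, hε, hε0, hεmul⟩ := exists_augmentation h
  obtain ⟨e, he⟩ := exists_addEquiv_of_ker_eq Φ hΦsurj ε hε fun s => by rw [hΦzero, hε0]
  refine ⟨fun i hi => ?_, ⟨e, fun α t => ?_⟩, fun α n hn a ha => ?_⟩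
  · rcases i with _ | _ | _ | i
    · exact hext0
    · exact hext1
    · exact absurd rfl hi
    · exact HasProjectiveDimensionLT.subsingleton _ 3 _ (by omega) _
  · obtain ⟨s, rfl⟩ := hΦsurj α
    rw [← hΦmul, he, he, hεmul]
  · obtain ⟨s, rfl⟩ := hΦsurj α
    rw [← hΦmul, hΦzero]
    exact Ideal.mul_mem_left _ _ (Ideal.subset_span ⟨n, hn, ha⟩)

end GorensteinTwo

/-! ### The Koszul resolution of a module over a quantum plane. -/

section ProjectiveDimension

variable {R : Type u} [Ring R]

lemma hasProjectiveDimensionLT_three_of_exact {P₀ P₁ P₂ M : Type u} [AddCommGroup P₀] [Module R P₀]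
    [AddCommGroup P₁] [Module R P₁] [AddCommGroup P₂] [Module R P₂] [AddCommGroup M] [Module R M]
    [Module.Projective R P₀] [Module.Projective R P₁] [Module.Projective R P₂]
    (d₀ : P₀ →ₗ[R] M) (d₁ : P₁ →ₗ[R] P₀) (d₂ : P₂ →ₗ[R] P₁) (h₀ : Function.Surjective d₀)
    (h₁ : LinearMap.range d₁ = LinearMap.ker d₀) (h₂ : LinearMap.range d₂ = LinearMap.ker d₁)
    (hinj : Function.Injective d₂) : HasProjectiveDimensionLT (ModuleCat.of R M) 3 := by
  have p₀ : Projective (ModuleCat.of R P₀) := (IsProjective.iff_projective P₀).1 inferInstance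
  have p₁ : Projective (ModuleCat.of R P₁) := (IsProjective.iff_projective P₁).1 inferInstance
  have p₂ : Projective (ModuleCat.of R (LinearMap.ker d₁)) := by
    refine (IsProjective.iff_projective _).1 ?_
    exact Module.Projective.of_equiv
      ((LinearEquiv.ofInjective d₂ hinj).trans (LinearEquiv.ofEq _ _ h₂))
  have q₂ : HasProjectiveDimensionLT (coverComplex d₁ _ h₁).X₁ 1 :=
    projective_iff_hasProjectiveDimensionLT_one.1 p₂
  have q₁ : HasProjectiveDimensionLT (coverComplex d₁ _ h₁).X₂ 1 :=
    projective_iff_hasProjectiveDimensionLT_one.1 p₁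
  have q₀ : HasProjectiveDimensionLT (kernelComplex d₀).X₂ 1 :=
    projective_iff_hasProjectiveDimensionLT_one.1 p₀
  have h3 := (coverComplex_shortExact d₁ _ h₁).hasProjectiveDimensionLT_X₃ 1 q₂
    (hasProjectiveDimensionLT_of_ge _ 1 2 (by norm_num))
  exact (kernelComplex_shortExact d₀ h₀).hasProjectiveDimensionLT_X₃ 2 h3
    (hasProjectiveDimensionLT_of_ge _ 1 3 (by norm_num))

end ProjectiveDimension

section Koszul

open Module

variable {k : Type*} [Field k] {S : Type u} [Ring S] [Algebra k S]
  (M : Type u) [AddCommGroup M] [Module k M] [Module S M] [IsScalarTower k S M]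

/-- Right multiplication on the left factor of `S ⊗ M`. -/
def tensorMulRight (x : S) : S ⊗[k] M →ₗ[S] S ⊗[k] M :=
  TensorProduct.AlgebraTensorModule.map (LinearMap.toSpanSingleton S S x) LinearMap.id

/-- The action of `S` on the right factor of `S ⊗ M`. -/
def tensorAct (x : S) : S ⊗[k] M →ₗ[S] S ⊗[k] M :=
  TensorProduct.AlgebraTensorModule.map LinearMap.id (Algebra.lsmul k k M x)

/-- The action map `S ⊗ M → M`. -/
def tensorAction (k : Type*) [Field k] (S : Type u) [Ring S] [Algebra k S]
    (M : Type u) [AddCommGroup M] [Module k M] [Module S M] [IsScalarTower k S M] :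
    S ⊗[k] M →ₗ[S] M :=
  TensorProduct.AlgebraTensorModule.lift
    { toFun := fun s => Algebra.lsmul k k M s
      map_add' := fun s t => map_add _ s t
      map_smul' := fun s t => by
        ext m
        simp }

variable {M}

@[simp]
lemma tensorMulRight_tmul (x s : S) (m : M) :
    tensorMulRight M x (s ⊗ₜ[k] m) = (s * x) ⊗ₜ m := rfl

@[simp]
lemma tensorAct_tmul (x s : S) (m : M) : tensorAct M x (s ⊗ₜ[k] m) = s ⊗ₜ (x • m) := rfl

@[simp]
lemma tensorAction_tmul (s : S) (m : M) : tensorAction k S M (s ⊗ₜ m) = s • m := rfl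

lemma tensorAction_mulRight (x : S) (t : S ⊗[k] M) :
    tensorAction k S M (tensorMulRight M x t) = tensorAction k S M (tensorAct M x t) := by
  induction t with
  | zero => simp
  | tmul s m => simp [mul_smul]
  | add s t hs ht => rw [map_add, map_add, hs, ht, map_add, map_add]

variable (M) in
/-- The first Koszul differential. -/
def koszul₁ (k : Type*) [Field k] [Algebra k S] [Module k M] [IsScalarTower k S M] (a b : S) :
    (S ⊗[k] M) × (S ⊗[k] M) →ₗ[S] S ⊗[k] M :=
  (tensorMulRight M a - tensorAct M a).coprod (tensorMulRight M b - tensorAct M b)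

variable (M) in
/-- The second Koszul differential of the relation `b * a = q • (a * b) + p • (a * a)`. -/
def koszul₂ (a b : S) (q p : k) : S ⊗[k] M →ₗ[S] (S ⊗[k] M) × (S ⊗[k] M) :=
  (tensorMulRight M b - q • tensorAct M b - p • (tensorMulRight M a + tensorAct M a)).prod
    (tensorAct M a - q • tensorMulRight M a)

lemma koszul₁_apply (a b : S) (x y : S ⊗[k] M) : koszul₁ M k a b (x, y) =
    (tensorMulRight M a x - tensorAct M a x) + (tensorMulRight M b y - tensorAct M b y) := rfl

lemma koszul₂_apply (a b : S) (q p : k) (x : S ⊗[k] M) : koszul₂ M a b q p x =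
    (tensorMulRight M b x - q • tensorAct M b x - p • (tensorMulRight M a x + tensorAct M a x),
      tensorAct M a x - q • tensorMulRight M a x) := rfl

lemma tensorAction_surjective : Function.Surjective (tensorAction k S M) := fun m =>
  ⟨1 ⊗ₜ m, by simp⟩

/-- Modulo the image, generators move across the tensor sign, so `s ⊗ m` becomes `1 ⊗ (s • m)` and
every tensor is determined by its image under the action map. -/
lemma range_koszul₁ {a b : S} (hgen : Algebra.adjoin k {a, b} = ⊤) :
    LinearMap.range (koszul₁ M k a b) = LinearMap.ker (tensorAction k S M) := by
  apply le_antisymm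
  · rintro _ ⟨⟨x, y⟩, rfl⟩
    rw [LinearMap.mem_ker, koszul₁_apply, map_add, map_sub, map_sub, tensorAction_mulRight,
      tensorAction_mulRight, sub_self, sub_self, add_zero]
  · have key : ∀ (s : S) (m : M), s ⊗ₜ[k] m - 1 ⊗ₜ (s • m) ∈
        LinearMap.range (koszul₁ M k a b) := by
      intro s
      have hs : s ∈ Algebra.adjoin k {a, b} := hgen ▸ Algebra.mem_top
      induction hs using Algebra.adjoin_induction with
      | mem x hx =>
        intro m
        rcases hx with rfl | rfl
        · exact ⟨(1 ⊗ₜ m, 0), by simp [koszul₁_apply]⟩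
        · exact ⟨(0, 1 ⊗ₜ m), by simp [koszul₁_apply]⟩
      | algebraMap c =>
        intro m
        rw [algebraMap_smul, Algebra.algebraMap_eq_smul_one, TensorProduct.smul_tmul, sub_self]
        exact zero_mem _
      | add x₁ x₂ _ _ h₁ h₂ =>
        intro m
        rw [TensorProduct.add_tmul, add_smul, TensorProduct.tmul_add, add_sub_add_comm]
        exact add_mem (h₁ m) (h₂ m)
      | mul x₁ x₂ _ _ h₁ h₂ =>
        intro m
        have := add_mem (Submodule.smul_mem _ x₁ (h₂ m)) (h₁ (x₂ • m))
        rwa [smul_sub, TensorProduct.smul_tmul', TensorProduct.smul_tmul', smul_eq_mul, smul_eq_mul,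
          mul_one, sub_add_sub_cancel, ← mul_smul] at this
    have key2 : ∀ t : S ⊗[k] M, t - 1 ⊗ₜ (tensorAction k S M t) ∈
        LinearMap.range (koszul₁ M k a b) := by
      intro t
      induction t with
      | zero => simp
      | tmul s m => exact key s m
      | add s t hs ht =>
        rw [map_add, TensorProduct.tmul_add, add_sub_add_comm]
        exact add_mem hs ht
    intro t ht
    have := key2 t
    rwa [LinearMap.mem_ker.1 ht, TensorProduct.tmul_zero, sub_zero] at this

lemma koszul₁_koszul₂ {a b : S} {q p : k} (hrel : b * a = q • (a * b) + p • (a * a))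
    (t : S ⊗[k] M) : koszul₁ M k a b (koszul₂ M a b q p t) = 0 := by
  induction t with
  | zero => rw [map_zero, map_zero]
  | tmul s m =>
    have hs : s * b * a = q • (s * a * b) + p • (s * a * a) := by
      rw [mul_assoc, hrel, mul_add, mul_smul_comm, mul_smul_comm, mul_assoc, mul_assoc]
    have hm : b • a • m = q • a • b • m + p • a • a • m := by
      rw [← mul_smul, hrel, add_smul, smul_assoc, smul_assoc, mul_smul, mul_smul]
    simp only [koszul₂_apply, koszul₁_apply, tensorMulRight_tmul, tensorAct_tmul, map_sub, map_add,
      LinearMap.map_smul_of_tower, hs, hm, TensorProduct.add_tmul, TensorProduct.tmul_add,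
      TensorProduct.tmul_smul, ← TensorProduct.smul_tmul']
    module
  | add s t hs ht => rw [map_add, map_add, hs, ht, add_zero]

/-- Exactness is checked on coordinates along the monomials `b ^ i * a ^ j`, where right
multiplication by `a` raises `j`. Coordinates vanish for large index, and vanishing descends one
step at a time. -/
lemma eq_zero_of_succ {M : Type*} [Zero M] {f : ℕ → M} {N : ℕ} (hN : ∀ j, N ≤ j → f j = 0)
    (hf : ∀ j, f (j + 1) = 0 → f j = 0) (j : ℕ) : f j = 0 := by
  have key : ∀ d j, N ≤ j + d → f j = 0 := by
    intro d
    induction d with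
    | zero => exact hN
    | succ d ih => exact fun j hj => hf j (ih (j + 1) (by omega))
  exact key N j (by omega)

namespace IsQuantumPlane

variable {a b : S} {q p : k} (h : IsQuantumPlane a b q p)

/-- The basis of monomials `b ^ i * a ^ j`. -/
def basis : Basis (ℕ × ℕ) k S := Basis.mk h.indep' h.span_eq_top'.ge

lemma basis_apply (n : ℕ × ℕ) : h.basis n = b ^ n.1 * a ^ n.2 := by
  rw [basis, Basis.mk_apply]

variable (M) in
/-- The coordinates of an element of `S ⊗ M` with respect to the monomials `b ^ i * a ^ j`. -/
def coord : S ⊗[k] M ≃ₗ[k] (ℕ × ℕ →₀ M) := TensorProduct.equivFinsuppOfBasisLeft h.basis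

lemma coord_tmul (s : S) (m : M) (n : ℕ × ℕ) : h.coord M (s ⊗ₜ m) n = h.basis.repr s n • m :=
  TensorProduct.equivFinsuppOfBasisLeft_apply_tmul_apply h.basis s m n

lemma repr_mul_succ (s : S) (i j : ℕ) : h.basis.repr (s * a) (i, j + 1) = h.basis.repr s (i, j) := by
  have : h.basis.coord (i, j + 1) ∘ₗ LinearMap.mulRight k a = h.basis.coord (i, j) := by
    refine h.basis.ext fun n => ?_
    have h1 : LinearMap.mulRight k a (h.basis n) = h.basis (n.1, n.2 + 1) := by
      rw [basis_apply, basis_apply, LinearMap.mulRight_apply, mul_assoc, ← pow_succ]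
    rw [LinearMap.comp_apply, h1]
    simp only [Basis.coord_apply, Basis.repr_self, Finsupp.single_apply, Prod.ext_iff,
      add_left_inj]
  exact LinearMap.congr_fun this s

lemma coord_mulRight (t : S ⊗[k] M) (i j : ℕ) :
    h.coord M (tensorMulRight M a t) (i, j + 1) = h.coord M t (i, j) := by
  induction t with
  | zero => simp
  | tmul s m => rw [tensorMulRight_tmul, coord_tmul, coord_tmul, repr_mul_succ]
  | add s t hs ht => simp only [map_add, Finsupp.add_apply, hs, ht]

lemma coord_act (x : S) (t : S ⊗[k] M) (n : ℕ × ℕ) :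
    h.coord M (tensorAct M x t) n = x • h.coord M t n := by
  induction t with
  | zero => simp
  | tmul s m => rw [tensorAct_tmul, coord_tmul, coord_tmul, smul_comm]
  | add s t hs ht => simp only [map_add, Finsupp.add_apply, hs, ht, smul_add]

lemma exists_bound (t : S ⊗[k] M) :
    ∃ N, ∀ n : ℕ × ℕ, N ≤ n.1 ∨ N ≤ n.2 → h.coord M t n = 0 := by
  refine ⟨(h.coord M t).support.sup (fun n => n.1 + n.2) + 1, fun n hn => ?_⟩
  by_contra h0
  have : n.1 + n.2 ≤ (h.coord M t).support.sup fun n => n.1 + n.2 :=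
    Finset.le_sup (f := fun n : ℕ × ℕ => n.1 + n.2) (Finsupp.mem_support_iff.2 h0)
  omega

variable (M k) in
/-- The span of the elements `b ^ i ⊗ m`. -/
def pureSpan (b : S) : Submodule k (S ⊗[k] M) :=
  Submodule.span k (Set.range fun x : ℕ × M => (b ^ x.1) ⊗ₜ[k] x.2)

lemma pureSpan_induction {P : S ⊗[k] M → Prop} (h0 : P 0) (hadd : ∀ x y, P x → P y → P (x + y))
    (hsmul : ∀ (c : k) x, P x → P (c • x)) (hpow : ∀ i (m : M), P ((b ^ i) ⊗ₜ m))
    {t : S ⊗[k] M} (ht : t ∈ pureSpan k M b) : P t :=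
  Submodule.span_induction (fun _ ⟨x, hx⟩ => hx ▸ hpow x.1 x.2) h0 (fun x y _ _ => hadd x y)
    (fun c x _ => hsmul c x) ht

lemma repr_pow (i : ℕ) (n : ℕ × ℕ) :
    h.basis.repr (b ^ i) n = if n = (i, 0) then 1 else 0 := by
  have : b ^ i = h.basis (i, 0) := by rw [basis_apply, pow_zero, mul_one]
  rw [this, Basis.repr_self, Finsupp.single_apply]
  simp only [eq_comm]

lemma coord_pureSpan {t : S ⊗[k] M} (ht : t ∈ pureSpan k M b) (i j : ℕ) :
    h.coord M t (i, j + 1) = 0 := by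
  refine pureSpan_induction (P := fun t => h.coord M t (i, j + 1) = 0) (by simp)
    (fun x y hx hy => ?_) (fun c x hx => ?_) (fun l m => ?_) ht
  · simp only [map_add, Finsupp.add_apply, hx, hy, add_zero]
  · simp only [map_smul, Finsupp.smul_apply, hx, smul_zero]
  · rw [coord_tmul, repr_pow, if_neg (by simp), zero_smul]

lemma act_mem_pureSpan (x : S) {t : S ⊗[k] M} (ht : t ∈ pureSpan k M b) :
    tensorAct M x t ∈ pureSpan k M b := by
  refine pureSpan_induction (P := fun t => tensorAct M x t ∈ pureSpan k M b) (by simp)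
    (fun x y hx hy => ?_) (fun c x hx => ?_) (fun l m => ?_) ht
  · rw [map_add]
    exact add_mem hx hy
  · rw [LinearMap.map_smul_of_tower]
    exact Submodule.smul_mem _ _ hx
  · exact Submodule.subset_span ⟨(l, x • m), rfl⟩

lemma mulRight_mem_pureSpan {t : S ⊗[k] M} (ht : t ∈ pureSpan k M b) :
    tensorMulRight M b t ∈ pureSpan k M b := by
  refine pureSpan_induction (P := fun t => tensorMulRight M b t ∈ pureSpan k M b) (by simp)
    (fun x y hx hy => ?_) (fun c x hx => ?_) (fun l m => ?_) ht
  · rw [map_add]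
    exact add_mem hx hy
  · rw [LinearMap.map_smul_of_tower]
    exact Submodule.smul_mem _ _ hx
  · rw [tensorMulRight_tmul, ← pow_succ]
    exact Submodule.subset_span ⟨(l + 1, m), rfl⟩

lemma coord_mulRight_pureSpan {t : S ⊗[k] M} (ht : t ∈ pureSpan k M b) (i : ℕ) :
    h.coord M (tensorMulRight M b t) (i + 1, 0) = h.coord M t (i, 0) := by
  refine pureSpan_induction
    (P := fun t => h.coord M (tensorMulRight M b t) (i + 1, 0) = h.coord M t (i, 0)) (by simp)
    (fun x y hx hy => ?_) (fun c x hx => ?_) (fun l m => ?_) ht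
  · simp only [map_add, Finsupp.add_apply, hx, hy]
  · rw [LinearMap.map_smul_of_tower]
    simp only [map_smul, Finsupp.smul_apply, hx]
  · rw [tensorMulRight_tmul, ← pow_succ, coord_tmul, coord_tmul, repr_pow, repr_pow]
    simp

-- The second component of `koszul₂` identifies `(s * a) ⊗ m` with `q⁻¹ • (s ⊗ (a • m))`, so all
-- powers of `a` on the left factor can be pushed to `M`.
include h in
lemma exists_sub_mem_pureSpan (t : S ⊗[k] M) :
    ∃ u : S ⊗[k] M, t - (tensorAct M a u - q • tensorMulRight M a u) ∈ pureSpan k M b := by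
  have key : ∀ (i j : ℕ) (m : M), ∃ u : S ⊗[k] M, (b ^ i * a ^ j) ⊗ₜ[k] m -
      (tensorAct M a u - q • tensorMulRight M a u) ∈ pureSpan k M b := by
    intro i j
    induction j with
    | zero =>
      intro m
      refine ⟨0, ?_⟩
      rw [map_zero, map_zero, smul_zero, sub_zero, sub_zero, pow_zero, mul_one]
      exact Submodule.subset_span ⟨(i, m), rfl⟩
    | succ j ih =>
      intro m
      obtain ⟨u, hu⟩ := ih (q⁻¹ • a • m)
      refine ⟨u - q⁻¹ • ((b ^ i * a ^ j) ⊗ₜ m), ?_⟩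
      have e : (b ^ i * a ^ j) ⊗ₜ[k] (q⁻¹ • a • m) = q⁻¹ • ((b ^ i * a ^ j) ⊗ₜ[k] (a • m)) :=
        TensorProduct.tmul_smul _ _ _
      rw [e] at hu
      convert hu using 1
      rw [map_sub, map_sub, LinearMap.map_smul_of_tower, LinearMap.map_smul_of_tower, smul_sub,
        smul_smul, mul_inv_cancel₀ h.ne_zero, one_smul, tensorAct_tmul, tensorMulRight_tmul,
        mul_assoc, ← pow_succ]
      abel
  induction t with
  | zero => exact ⟨0, by simp⟩
  | add s t hs ht =>
    obtain ⟨u, hu⟩ := hs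
    obtain ⟨v, hv⟩ := ht
    refine ⟨u + v, ?_⟩
    convert add_mem hu hv using 1
    rw [map_add, map_add, smul_add]
    abel
  | tmul s m =>
    have hs : s ∈ Submodule.span k (Set.range fun n : ℕ × ℕ => b ^ n.1 * a ^ n.2) :=
      h.span_eq_top' ▸ Submodule.mem_top
    induction hs using Submodule.span_induction with
    | mem x hx =>
      obtain ⟨n, rfl⟩ := hx
      exact key n.1 n.2 m
    | zero => exact ⟨0, by simp⟩
    | add s t _ _ hs ht =>
      obtain ⟨u, hu⟩ := hs
      obtain ⟨v, hv⟩ := ht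
      refine ⟨u + v, ?_⟩
      convert add_mem hu hv using 1
      rw [map_add, map_add, smul_add, TensorProduct.add_tmul]
      abel
    | smul c s _ hs =>
      obtain ⟨u, hu⟩ := hs
      refine ⟨c • u, ?_⟩
      convert Submodule.smul_mem _ c hu using 1
      rw [LinearMap.map_smul_of_tower, LinearMap.map_smul_of_tower, ← TensorProduct.smul_tmul',
        smul_sub, smul_sub, smul_comm q c]

lemma eq_zero_of_coord {t : S ⊗[k] M} (ht : ∀ i j, h.coord M t (i, j) = 0) : t = 0 := by
  rw [← (h.coord M).map_eq_zero_iff]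
  ext n
  exact ht n.1 n.2

-- In the coordinate of `b ^ i * a ^ (j + 1)` the second component of `koszul₂` says that `a` times
-- the coordinate at `j + 1` is `q` times the coordinate at `j`, so vanishing descends.
include h in
lemma koszul₂_injective : Function.Injective (koszul₂ M a b q p) := by
  rw [← LinearMap.ker_eq_bot, LinearMap.ker_eq_bot']
  intro t ht
  rw [koszul₂_apply] at ht
  have h1 : tensorAct M a t - q • tensorMulRight M a t = 0 := congrArg Prod.snd ht
  obtain ⟨N, hN⟩ := h.exists_bound t
  refine h.eq_zero_of_coord fun i => eq_zero_of_succ (fun j hj => hN (i, j) (Or.inr hj))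
    fun j hj => ?_
  have h2 := DFunLike.congr_fun (congrArg (h.coord M) h1) (i, j + 1)
  rw [map_sub, map_smul, Finsupp.sub_apply, Finsupp.smul_apply, coord_act, coord_mulRight, hj,
    smul_zero, map_zero, Finsupp.zero_apply, zero_sub, neg_eq_zero] at h2
  exact (smul_eq_zero.1 h2).resolve_left h.ne_zero

include h in
lemma range_koszul₂ : LinearMap.range (koszul₂ M a b q p) = LinearMap.ker (koszul₁ M k a b) := by
  apply le_antisymm
  · rintro _ ⟨t, rfl⟩
    exact koszul₁_koszul₂ h.rel t
  · rintro ⟨x, y⟩ hxy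
    -- Subtracting a boundary brings the second component into the span of the `b ^ i ⊗ m`. The
    -- coordinates involving `a` then see only `x` and kill it; the pure powers of `b` kill what is
    -- left of `y`.
    obtain ⟨u, hu⟩ := h.exists_sub_mem_pureSpan y
    suffices (x, y) - koszul₂ M a b q p u = 0 from ⟨u, (sub_eq_zero.1 this).symm⟩
    have hker : koszul₁ M k a b ((x, y) - koszul₂ M a b q p u) = 0 := by
      rw [map_sub, koszul₁_koszul₂ h.rel, LinearMap.mem_ker.1 hxy, sub_zero]
    have hy' : ((x, y) - koszul₂ M a b q p u).2 ∈ pureSpan k M b := hu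
    generalize (x, y) - koszul₂ M a b q p u = v at hker hy'
    obtain ⟨x, y⟩ := v
    change y ∈ pureSpan k M b at hy'
    rw [koszul₁_apply] at hker
    obtain ⟨N, hN⟩ := h.exists_bound x
    have hx : x = 0 := by
      refine h.eq_zero_of_coord fun i => eq_zero_of_succ (fun j hj => hN (i, j) (Or.inr hj))
        fun j hj => ?_
      have h2 := DFunLike.congr_fun (congrArg (h.coord M) hker) (i, j + 1)
      rw [map_add, map_sub, map_sub, Finsupp.add_apply, Finsupp.sub_apply, Finsupp.sub_apply,
        coord_act, coord_mulRight, hj, smul_zero, sub_zero,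
        h.coord_pureSpan (mulRight_mem_pureSpan hy'), h.coord_pureSpan (act_mem_pureSpan b hy'),
        sub_zero, add_zero, map_zero, Finsupp.zero_apply] at h2
      exact h2
    subst hx
    rw [map_zero, map_zero, sub_zero, zero_add] at hker
    obtain ⟨N, hN⟩ := h.exists_bound y
    have hy : y = 0 := by
      refine h.eq_zero_of_coord fun i j => ?_
      rcases j with _ | j
      · refine eq_zero_of_succ (f := fun i => h.coord M y (i, 0))
          (fun i hi => hN (i, 0) (Or.inl hi)) (fun i hi => ?_) i
        have h2 := DFunLike.congr_fun (congrArg (h.coord M) hker) (i + 1, 0)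
        rw [map_sub, Finsupp.sub_apply, coord_act, hi, smul_zero, sub_zero,
          h.coord_mulRight_pureSpan hy', map_zero, Finsupp.zero_apply] at h2
        exact h2
      · exact h.coord_pureSpan hy' i j
    rw [hy]
    rfl

include h in
lemma hasProjectiveDimensionLT (M : ModuleCat.{u} S) : HasProjectiveDimensionLT M 3 := by
  let : Module k M := Module.compHom M (algebraMap k S)
  have : IsScalarTower k S M := IsScalarTower.of_algebraMap_smul fun _ _ => rfl
  exact hasProjectiveDimensionLT_three_of_exact (tensorAction k S M) (koszul₁ M k a b)
    (koszul₂ M a b q p) tensorAction_surjective (range_koszul₁ h.adjoin_eq_top) h.range_koszul₂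
    h.koszul₂_injective

include h in
lemma globalDim_le : globalDim S ≤ (2 : ℕ) :=
  iSup_le fun M => (projectiveDimension_le_iff M 2).2 (h.hasProjectiveDimensionLT M)

end IsQuantumPlane

end Koszul

/-! ### Quantum planes are regular of dimension two. -/

section PlaneRegular

open Module MulOpposite Abelian

variable {k : Type*} [Field k] {S : Type u} [Ring S] [Algebra k S] {a b : S} {q p : k}

namespace IsQuantumPlane

variable (h : IsQuantumPlane a b q p)

include h

lemma mul_right_cancel_zero {r : S} (hr : r * a = 0) : r = 0 := by
  refine h.basis.ext_elem fun n => ?_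
  rw [← h.repr_mul_succ r n.1 n.2, hr, map_zero, Finsupp.zero_apply, Finsupp.zero_apply]

lemma repr_span_pow {c : S} (hc : c ∈ Submodule.span k (Set.range fun i : ℕ => b ^ i)) (i j : ℕ) :
    h.basis.repr c (i, j + 1) = 0 := by
  induction hc using Submodule.span_induction with
  | mem x hx =>
    obtain ⟨l, rfl⟩ := hx
    rw [repr_pow, if_neg (by simp)]
  | zero => simp
  | add x y _ _ hx hy => rw [map_add, Finsupp.add_apply, hx, hy, add_zero]
  | smul c x _ hx => rw [map_smul, Finsupp.smul_apply, hx, smul_zero]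

lemma repr_span_pow_mul {c : S} (hc : c ∈ Submodule.span k (Set.range fun i : ℕ => b ^ i)) (i : ℕ) :
    h.basis.repr (c * b) (i + 1, 0) = h.basis.repr c (i, 0) := by
  induction hc using Submodule.span_induction with
  | mem x hx =>
    obtain ⟨l, rfl⟩ := hx
    simp only [← pow_succ, repr_pow]
    simp
  | zero => simp
  | add x y _ _ hx hy => rw [add_mul, map_add, Finsupp.add_apply, hx, hy, map_add, Finsupp.add_apply]
  | smul c x _ hx =>
    rw [smul_mul_assoc, map_smul, Finsupp.smul_apply, hx, map_smul, Finsupp.smul_apply]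

lemma eq_zero_of_span_pow_mul {c : S} (hc : c ∈ Submodule.span k (Set.range fun i : ℕ => b ^ i))
    (h0 : c * b = 0) : c = 0 := by
  refine h.basis.ext_elem fun n => ?_
  obtain ⟨i, j⟩ := n
  rcases j with _ | j
  · rw [← h.repr_span_pow_mul hc, h0, map_zero, Finsupp.zero_apply, Finsupp.zero_apply]
  · rw [h.repr_span_pow hc, map_zero, Finsupp.zero_apply]

omit h in
lemma mul_mem_span_pow {c : S} (hc : c ∈ Submodule.span k (Set.range fun i : ℕ => b ^ i)) :
    c * b ∈ Submodule.span k (Set.range fun i : ℕ => b ^ i) := by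
  have : Submodule.span k (Set.range fun i : ℕ => b ^ i) ≤
      (Submodule.span k (Set.range fun i : ℕ => b ^ i)).comap (LinearMap.mulRight k b) := by
    rw [Submodule.span_le]
    rintro _ ⟨i, rfl⟩
    exact Submodule.subset_span ⟨i + 1, pow_succ _ _⟩
  exact this hc

/-- Division with remainder by `a` on the right: the monomials `b ^ i * a ^ j` either end in `a` or
are powers of `b`. With `eq_zero_of_mul_add` the decomposition is direct. -/
lemma exists_mul_add (s : S) : ∃ r, ∃ c ∈ Submodule.span k (Set.range fun i : ℕ => b ^ i),
    s = r * a + c := by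
  have hs : s ∈ Submodule.span k (Set.range fun n : ℕ × ℕ => b ^ n.1 * a ^ n.2) :=
    h.span_eq_top' ▸ Submodule.mem_top
  induction hs using Submodule.span_induction with
  | mem x hx =>
    obtain ⟨⟨i, j⟩, rfl⟩ := hx
    rcases j with _ | j
    · exact ⟨0, b ^ i, Submodule.subset_span ⟨i, rfl⟩, by simp⟩
    · exact ⟨b ^ i * a ^ j, 0, zero_mem _, by simp [pow_succ, mul_assoc]⟩
  | zero => exact ⟨0, 0, zero_mem _, by simp⟩
  | add x y _ _ hx hy =>
    obtain ⟨r, c, hc, rfl⟩ := hx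
    obtain ⟨r', c', hc', rfl⟩ := hy
    exact ⟨r + r', c + c', add_mem hc hc', by rw [add_mul]; abel⟩
  | smul t x _ hx =>
    obtain ⟨r, c, hc, rfl⟩ := hx
    exact ⟨t • r, t • c, Submodule.smul_mem _ _ hc, by rw [smul_add, smul_mul_assoc]⟩

lemma eq_zero_of_mul_add {r c : S} (hc : c ∈ Submodule.span k (Set.range fun i : ℕ => b ^ i))
    (h0 : r * a + c = 0) : r = 0 ∧ c = 0 := by
  have hr : r = 0 := by
    refine h.basis.ext_elem fun n => ?_
    rw [← h.repr_mul_succ r n.1 n.2, map_zero, Finsupp.zero_apply, eq_neg_of_add_eq_zero_left h0,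
      map_neg, Finsupp.neg_apply, h.repr_span_pow hc, neg_zero]
  refine ⟨hr, ?_⟩
  rwa [hr, zero_mul, zero_add] at h0

lemma mul_left_cancel_zero {r : S} (hr : a * r = 0) : r = 0 := by
  have := h.op.mul_right_cancel_zero (r := op r) (by rw [← MulOpposite.op_mul, hr]; rfl)
  exact MulOpposite.op_injective this

lemma exists_mul_add_left (s : S) : ∃ r, ∃ c ∈ Submodule.span k (Set.range fun i : ℕ => (op b) ^ i),
    s = a * r + unop c := by
  obtain ⟨r, c, hc, hs⟩ := h.op.exists_mul_add (op s)
  exact ⟨unop r, c, hc, congrArg unop hs⟩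

lemma eq_zero_of_mul_add_left {r : S} {c : Sᵐᵒᵖ}
    (hc : c ∈ Submodule.span k (Set.range fun i : ℕ => (op b) ^ i))
    (h0 : a * r + unop c = 0) : r = 0 ∧ c = 0 := by
  have := h.op.eq_zero_of_mul_add (r := op r) hc (congrArg op h0)
  exact ⟨MulOpposite.op_injective this.1, this.2⟩

theorem isLeftGorenstein : IsLeftGorenstein (monomialSpan k a b) 2 := by
  have hcon := h.connected
  have ha1 : a ∈ monomialSpan k a b 1 := by
    simpa using pow_mul_pow_mem_monomialSpan (k := k) a b (i := 1) (j := 0) rfl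
  have hb1 : b ∈ monomialSpan k a b 1 := by
    simpa using pow_mul_pow_mem_monomialSpan (k := k) a b (i := 0) (j := 1) rfl
  have hz : ∀ i, (![a, b] : Fin 2 → S) i ∈ monomialSpan k a b 1 := fun i => by
    fin_cases i
    exacts [ha1, hb1]
  have hgen : Algebra.adjoin k (Set.range ![a, b]) = ⊤ := by
    rw [Matrix.range_cons_cons_empty]
    exact h.adjoin_eq_top
  -- The entries come from writing the relation as `(b - p • a) * a - q • (a * b) = 0`.
  let c : Fin 2 →₀ S := Finsupp.equivFunOnFinite.symm ![b - p • a, -(q • a)]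
  have hc0 : c 0 = b - p • a := rfl
  have hc1 : c 1 = -(q • a) := rfl
  have hcomb : ∀ f : Fin 2 → S, Finsupp.linearCombination S f c =
      (b - p • a) * f 0 - q • (a * f 1) := fun f => by
    rw [linearCombination_eq_sum, Fin.sum_univ_two, hc0, hc1, smul_eq_mul, smul_eq_mul, neg_mul,
      smul_mul_assoc, ← sub_eq_add_neg]
  have hcomb' : ∀ x : Fin 2 →₀ S, Finsupp.linearCombination S ![a, b] x = x 0 * a + x 1 * b :=
    fun x => by
    rw [linearCombination_eq_sum, Fin.sum_univ_two]
    rfl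
  have hcz : (b - p • a) * a - q • (a * b) = 0 := by
    rw [sub_mul, h.rel, smul_mul_assoc]
    abel
  refine isLeftGorenstein_of_resolution_two (z := ![a, b]) (c := c) hcon
    (h.hasProjectiveDimensionLT _)
    (range_linearCombination_eq_augmentationIdeal hcon hz hgen) (le_antisymm ?_ fun x hx => ?_) ?_
    (fun s hs => h.mul_left_cancel_zero (hs 0)) (fun f hf => ?_) fun s => ⟨fun hs => ?_, ?_⟩
  · rintro _ ⟨r, rfl⟩
    rw [LinearMap.mem_ker, LinearMap.toSpanSingleton_apply, map_smul, hcomb]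
    exact (congrArg (r • ·) hcz).trans (smul_zero r)
  · rw [LinearMap.mem_ker, hcomb'] at hx
    -- With `x 1 = r * a + c'` and `a * b = q⁻¹ • ((b - p • a) * a)`, the cycle condition becomes a
    -- multiple of `a` plus `c' * b`, and `c' * b` is again a polynomial in `b`. Both parts vanish;
    -- this gives `c' = 0` and determines `x 0`.
    obtain ⟨r, c', hc', hr⟩ := h.exists_mul_add (x 1)
    have hsub : (x 0 + q⁻¹ • (r * (b - p • a))) * a + c' * b = 0 := by
      have h1 : (q⁻¹ • (r * (b - p • a))) * a = r * (a * b) := by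
        rw [smul_mul_assoc, mul_assoc, sub_eq_zero.1 hcz, mul_smul_comm, smul_smul,
          inv_mul_cancel₀ h.ne_zero, one_smul]
      rw [add_mul, h1, ← hx, hr, add_mul, mul_assoc]
      abel
    obtain ⟨h0, h1⟩ := h.eq_zero_of_mul_add (mul_mem_span_pow hc') hsub
    have h2 := h.eq_zero_of_span_pow_mul hc' h1
    refine ⟨-(q⁻¹ • r), ?_⟩
    ext i
    fin_cases i
    · change -(q⁻¹ • r) * (b - p • a) = x 0
      rw [eq_neg_of_add_eq_zero_left h0, neg_mul, smul_mul_assoc]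
    · change -(q⁻¹ • r) * -(q • a) = x 1
      rw [hr, h2, add_zero, neg_mul_neg, smul_mul_smul_comm, inv_mul_cancel₀ h.ne_zero, one_smul]
  · rw [← LinearMap.ker_eq_bot, LinearMap.ker_eq_bot']
    intro r hr
    have h1 : r * -(q • a) = 0 := DFunLike.congr_fun hr 1
    rw [mul_neg, neg_eq_zero, mul_smul_comm] at h1
    exact h.mul_right_cancel_zero ((smul_eq_zero.1 h1).resolve_left h.ne_zero)
  · rw [hcomb] at hf
    -- The mirror image of the previous argument, with division by `a` on the left, that is, in the
    -- opposite plane.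
    obtain ⟨r, c', hc', hr⟩ := h.exists_mul_add_left (f 0)
    have hsub : a * (q • (b * r) - p • unop c' - q • f 1) + unop (c' * op b) = 0 := by
      rw [← hf, hr, mul_add, ← mul_assoc, sub_eq_zero.1 hcz, unop_mul, unop_op, mul_sub, mul_sub,
        sub_mul, mul_smul_comm, mul_smul_comm, mul_smul_comm, smul_mul_assoc, smul_mul_assoc,
        mul_assoc]
      abel
    obtain ⟨h0, h1⟩ := h.eq_zero_of_mul_add_left (mul_mem_span_pow hc') hsub
    have h2 := h.op.eq_zero_of_span_pow_mul hc' h1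
    refine ⟨r, fun i => ?_⟩
    fin_cases i
    · change f 0 = a * r
      rw [hr, h2, unop_zero, add_zero]
    · change f 1 = b * r
      rw [h2, unop_zero, smul_zero, sub_zero, ← smul_sub] at h0
      exact (sub_eq_zero.1 ((smul_eq_zero.1 h0).resolve_left h.ne_zero)).symm
  · obtain ⟨f, rfl⟩ := exists_sum_mul_of_mem_augmentationIdeal hcon hz hgen hs
    refine ⟨![f 1, -(q⁻¹ • (f 0 + p • f 1))], ?_⟩
    rw [hcomb, Fin.sum_univ_two]
    simp only [Matrix.cons_val_zero, Matrix.cons_val_one, mul_neg, smul_neg, mul_smul_comm,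
      smul_smul, mul_inv_cancel₀ h.ne_zero, one_smul, sub_mul, mul_add, smul_mul_assoc]
    abel
  · rintro ⟨f, rfl⟩
    rw [hcomb]
    have ha := mem_augmentationIdeal_of_degree_one hcon hz 0
    have hb := mem_augmentationIdeal_of_degree_one hcon hz 1
    have hsmul : ∀ (c : k) x, x ∈ augmentationIdeal (monomialSpan k a b) →
        c • x ∈ augmentationIdeal (monomialSpan k a b) := fun c x hx =>
      Submodule.smul_of_tower_mem _ c hx
    exact Submodule.sub_mem _ (mul_mem_augmentationIdeal_right hcon
      (Submodule.sub_mem _ hb (hsmul p _ ha)) _)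
      (hsmul q _ (mul_mem_augmentationIdeal_right hcon ha _))

/-- The Koszul resolution bounds the dimension above; below it, the nonzero `Ext^2` from the trivial
module to `S` is the obstruction. -/
lemma globalDim_eq : globalDim S = (2 : ℕ) := by
  refine le_antisymm h.globalDim_le (not_lt.1 fun hlt => ?_)
  have hle : projectiveDimension (trivialModule (monomialSpan k a b)) ≤ globalDim S :=
    le_iSup (fun M : ModuleCat.{u} S => projectiveDimension M) _
  have : HasProjectiveDimensionLT (trivialModule (monomialSpan k a b)) 2 :=
    (projectiveDimension_lt_iff).1 (hle.trans_lt hlt)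
  obtain ⟨e, -⟩ := h.isLeftGorenstein.one_dimensional
  have hsub : Subsingleton (Ext (trivialModule (monomialSpan k a b)) (ModuleCat.of S S) 2) :=
    HasProjectiveDimensionLT.subsingleton _ 2 2 le_rfl _
  exact one_ne_zero (e.symm.injective.subsingleton.elim (1 : k) 0)

/-- A quantum plane is Artin-Schelter regular of dimension two. -/
theorem isASRegular : IsASRegular (monomialSpan k a b) 2 where
  connected := h.connected
  globalDim_left := h.globalDim_eq
  globalDim_right := h.op.globalDim_eq
  gorenstein_left := h.isLeftGorenstein
  gorenstein_right := by
    rw [h.opGrading_eq]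
    exact h.op.isLeftGorenstein
  finite_component n := inferInstance
  growth := ⟨3, by norm_num, fun n hn => by
    rw [h.finrank_eq]
    nlinarith [Nat.one_le_pow 2 n hn, pow_succ n 2]⟩

end IsQuantumPlane

end PlaneRegular

/-! ### Transfer to the opposite algebra. -/

section Opposite

open Module MulOpposite

variable {k : Type*} [Field k] {R : Type u} [Ring R] [Algebra k R] {𝒜 : ℕ → Submodule k R}

lemma op_mem_opGrading {n : ℕ} {r : R} : op r ∈ opGrading 𝒜 n ↔ r ∈ 𝒜 n := by
  exact Submodule.mem_map_equiv (e := (opLinearEquiv k : R ≃ₗ[k] Rᵐᵒᵖ)) _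

lemma isInternal_opGrading (h : DirectSum.IsInternal 𝒜) : DirectSum.IsInternal (opGrading 𝒜) := by
  rw [DirectSum.isInternal_submodule_iff_iSupIndep_and_iSup_eq_top] at h ⊢
  refine ⟨h.1.map_orderIso (Submodule.orderIsoMapComap (opLinearEquiv k : R ≃ₗ[k] Rᵐᵒᵖ)), ?_⟩
  change ⨆ n, (𝒜 n).map _ = ⊤
  rw [← Submodule.map_iSup, h.2, Submodule.map_top]
  exact LinearEquiv.range _

lemma IsConnectedGraded.op (h : IsConnectedGraded 𝒜) : IsConnectedGraded (opGrading 𝒜) where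
  nontrivial := have := h.nontrivial; inferInstance
  gradedMonoid :=
    { one_mem := op_mem_opGrading.2 h.gradedMonoid.one_mem
      mul_mem := fun {i j} x y hx hy => by
        induction x using MulOpposite.rec' with | _ x =>
        induction y using MulOpposite.rec' with | _ y =>
        rw [op_mem_opGrading] at hx hy
        rw [← MulOpposite.op_mul, op_mem_opGrading, add_comm]
        exact h.gradedMonoid.mul_mem hy hx }
  isInternal := isInternal_opGrading h.isInternal
  zero_eq := by rw [opGrading, h.zero_eq, Submodule.map_op_one]

lemma finrank_opGrading (n : ℕ) : finrank k (opGrading 𝒜 n) = finrank k (𝒜 n) :=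
  LinearEquiv.finrank_map_eq (opLinearEquiv k : R ≃ₗ[k] Rᵐᵒᵖ) (𝒜 n)

lemma IsASRegular.isLeftASRegular_op {d : ℕ} (h : IsASRegular 𝒜 d) :
    IsLeftASRegular (opGrading 𝒜) d where
  connected := h.connected.op
  globalDim_le := h.globalDim_right.le
  gorenstein := h.gorenstein_right
  finite_component n := by
    have := h.finite_component n
    exact Module.Finite.map (𝒜 n) _
  growth := by simpa only [finrank_opGrading] using h.growth

lemma linearIndependent_op {ι : Type*} {z : ι → R} (h : LinearIndependent k z) :
    LinearIndependent k fun i => op (z i) :=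
  h.map' (opLinearEquiv k : R ≃ₗ[k] Rᵐᵒᵖ).toLinearMap (LinearEquiv.ker _)

lemma linearIndependent_of_op {ι : Type*} {z : ι → R}
    (h : LinearIndependent k fun i => op (z i)) : LinearIndependent k z :=
  h.of_comp (opLinearEquiv k : R ≃ₗ[k] Rᵐᵒᵖ).toLinearMap

lemma span_op_eq_top {ι : Type*} {z : ι → R}
    (h : Submodule.span k (Set.range fun i => op (z i)) = ⊤) :
    Submodule.span k (Set.range z) = ⊤ := by
  have h1 := congrArg (Submodule.map (opLinearEquiv k : R ≃ₗ[k] Rᵐᵒᵖ).symm.toLinearMap) h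
  rw [Submodule.map_top, LinearEquiv.range, Submodule.map_span, ← Set.range_comp] at h1
  exact h1

lemma adjoin_op_eq_top {ι : Type*} {z : ι → R} (h : Algebra.adjoin k (Set.range z) = ⊤) :
    Algebra.adjoin k (Set.range fun i => op (z i)) = ⊤ := by
  rw [eq_top_iff]
  rintro x -
  induction x using MulOpposite.rec' with
  | _ x =>
    have hx : x ∈ Algebra.adjoin k (Set.range z) := h ▸ Algebra.mem_top
    induction hx using Algebra.adjoin_induction with
    | mem x hx =>
      obtain ⟨i, rfl⟩ := hx
      exact Algebra.subset_adjoin ⟨i, rfl⟩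
    | algebraMap c => exact Subalgebra.algebraMap_mem _ c
    | add x y _ _ hx hy => exact add_mem hx hy
    | mul x y _ _ hx hy => exact mul_mem hy hx

lemma op_mem_mul {U W : Submodule k R} {x : R} :
    op x ∈ U.map (opLinearEquiv k : R ≃ₗ[k] Rᵐᵒᵖ).toLinearMap *
      W.map (opLinearEquiv k : R ≃ₗ[k] Rᵐᵒᵖ).toLinearMap ↔ x ∈ W * U := by
  rw [← Submodule.map_op_mul]
  exact Submodule.mem_map_equiv (e := (opLinearEquiv k : R ≃ₗ[k] Rᵐᵒᵖ)) _

lemma mul_le_mul_of_op {U W U' W' : Submodule k R}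
    (h : U.map (opLinearEquiv k : R ≃ₗ[k] Rᵐᵒᵖ).toLinearMap *
        W.map (opLinearEquiv k : R ≃ₗ[k] Rᵐᵒᵖ).toLinearMap ≤
      U'.map (opLinearEquiv k : R ≃ₗ[k] Rᵐᵒᵖ).toLinearMap *
        W'.map (opLinearEquiv k : R ≃ₗ[k] Rᵐᵒᵖ).toLinearMap) : W * U ≤ W' * U' :=
  fun _ hx => op_mem_mul.1 (h (op_mem_mul.2 hx))

lemma op_mul_le_mul {U W U' W' : Submodule k R} (h : W * U ≤ W' * U') :
    U.map (opLinearEquiv k : R ≃ₗ[k] Rᵐᵒᵖ).toLinearMap *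
        W.map (opLinearEquiv k : R ≃ₗ[k] Rᵐᵒᵖ).toLinearMap ≤
      U'.map (opLinearEquiv k : R ≃ₗ[k] Rᵐᵒᵖ).toLinearMap *
        W'.map (opLinearEquiv k : R ≃ₗ[k] Rᵐᵒᵖ).toLinearMap := fun x hx => by
  induction x using MulOpposite.rec' with | _ x =>
  exact op_mem_mul.2 (h (op_mem_mul.1 hx))

end Opposite

/-! ### The quotient by two elements of degree one, in low degrees. -/

section Quotient

open Module

variable {k : Type*} [Field k] {B : Type u} [Ring B] [Algebra k B]

/-- The quotient map `B → B / (x₁, x₂)`. -/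
def quotientByPairMk (k : Type*) [Field k] [Algebra k B] (x₁ x₂ : B) :
    B →ₐ[k] QuotientByPair x₁ x₂ :=
  (TwoSidedIdeal.span {x₁, x₂}).ringCon.mkₐ k

lemma quotientByPairMk_surjective (x₁ x₂ : B) :
    Function.Surjective (quotientByPairMk k x₁ x₂) :=
  (TwoSidedIdeal.span {x₁, x₂}).ringCon.mkₐ_surjective

lemma quotientByPairMk_eq_zero_iff {x₁ x₂ b : B} :
    quotientByPairMk k x₁ x₂ b = 0 ↔ b ∈ TwoSidedIdeal.span {x₁, x₂} := by
  rw [← map_zero (quotientByPairMk k x₁ x₂)]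
  exact (RingCon.eq _).trans Iff.rfl

lemma quotientByPairMk_left (x₁ x₂ : B) : quotientByPairMk k x₁ x₂ x₁ = 0 :=
  quotientByPairMk_eq_zero_iff.2 (TwoSidedIdeal.subset_span (by simp))

lemma quotientByPairMk_right (x₁ x₂ : B) : quotientByPairMk k x₁ x₂ x₂ = 0 :=
  quotientByPairMk_eq_zero_iff.2 (TwoSidedIdeal.subset_span (by simp))

lemma quotientByPairMk_of_mem {x₁ x₂ v : B} (hv : v ∈ Submodule.span k {x₁, x₂}) :
    quotientByPairMk k x₁ x₂ v = 0 := by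
  obtain ⟨s, t, rfl⟩ := Submodule.mem_span_pair.1 hv
  rw [map_add, map_smul, map_smul, quotientByPairMk_left, quotientByPairMk_right, smul_zero,
    smul_zero, add_zero]

lemma mem_of_quotientByPairMk_eq_zero {x₁ x₂ b : B} {W : Submodule k B} (h₁ : x₁ ∈ W)
    (h₂ : x₂ ∈ W) (hl : ∀ r, ∀ w ∈ W, r * w ∈ W) (hr : ∀ r, ∀ w ∈ W, w * r ∈ W)
    (hb : quotientByPairMk k x₁ x₂ b = 0) : b ∈ W := by
  replace hb := quotientByPairMk_eq_zero_iff.1 hb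
  induction hb using TwoSidedIdeal.span_induction with
  | mem x hx => rcases hx with rfl | rfl <;> assumption
  | zero => exact zero_mem _
  | add x y _ _ hx hy => exact add_mem hx hy
  | neg x _ hx => exact neg_mem hx
  | left_absorb a x _ hx => exact hl a x hx
  | right_absorb a x _ hx => exact hr a x hx

lemma exists_eq_of_quotientByPairMk_eq_zero {x₁ x₂ b : B}
    (hb : quotientByPairMk k x₁ x₂ b = 0) :
    b ∈ (⊤ : Submodule k B) * Submodule.span k {x₁, x₂} * ⊤ := by
  have hmem : ∀ x ∈ Submodule.span k {x₁, x₂},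
      x ∈ (⊤ : Submodule k B) * Submodule.span k {x₁, x₂} * ⊤ := fun x hx => by
    have := Submodule.mul_mem_mul (Submodule.mul_mem_mul (Submodule.mem_top (x := (1 : B)) (R := k))
      hx) (Submodule.mem_top (x := (1 : B)) (R := k))
    rwa [one_mul, mul_one] at this
  refine mem_of_quotientByPairMk_eq_zero (hmem _ (Submodule.subset_span (by simp)))
    (hmem _ (Submodule.subset_span (by simp))) (fun r w hw => ?_) (fun r w hw => ?_) hb
  · have : r * w ∈ (⊤ : Submodule k B) * (⊤ * Submodule.span k {x₁, x₂} * ⊤) :=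
      Submodule.mul_mem_mul Submodule.mem_top hw
    rw [← mul_assoc, ← mul_assoc] at this
    exact mul_le_mul_left (mul_le_mul_left (le_top (a := (⊤ * ⊤ : Submodule k B))) _) _ this
  · have : w * r ∈ (⊤ * Submodule.span k {x₁, x₂} * ⊤) * (⊤ : Submodule k B) :=
      Submodule.mul_mem_mul hw Submodule.mem_top
    rw [mul_assoc] at this
    exact mul_le_mul_right (le_top (a := (⊤ * ⊤ : Submodule k B))) _ this

variable {ℬ : ℕ → Submodule k B}

/-- The components of degree one and two of the ideal generated by elements of degree one. -/
lemma natComponent_mem_of_mem_top_mul (h : IsConnectedGraded ℬ) {V : Submodule k B}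
    (hV : V ≤ ℬ 1) {b : B} (hb : b ∈ (⊤ : Submodule k B) * V * ⊤) :
    natComponent h.isInternal 1 b ∈ V ∧ natComponent h.isInternal 2 b ∈ V * ℬ 1 ⊔ ℬ 1 * V := by
  have key : (⊤ : Submodule k B) * V * ⊤ ≤ V.comap (natComponent h.isInternal 1) ⊓
      (V * ℬ 1 ⊔ ℬ 1 * V).comap (natComponent h.isInternal 2) := by
    rw [Submodule.mul_le]
    intro x hx s _
    induction hx using Submodule.mul_induction_on' with
    | add x _ y _ hx hy => rw [add_mul]; exact add_mem hx hy
    | mem_mul_mem r _ v hv =>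
      have hv1 : v ∈ intGrading ℬ 1 := intGrading_one (𝒜 := ℬ) ▸ hV hv
      have e (n : ℕ) : natComponent h.isInternal n (r * v * s) = intComponent h n (r * v * s) := by
        rw [intComponent_natCast]
      obtain ⟨F, -, hF⟩ := exists_sum_intComponent h r
      -- In degree one only constant components of `r` and `s` contribute. In degree two one of them
      -- has degree one and the other is constant, which produces the two summands `V * ℬ 1` and `ℬ
      -- 1 * V`.
      have hr1 (n : ℤ) : intComponent h n (r * v * s) =
          ∑ i ∈ F, intComponent h i r * v * intComponent h (n - i - 1) s := by
        conv_lhs => rw [← hF]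
        rw [mul_assoc, Finset.sum_mul, map_sum]
        refine Finset.sum_congr rfl fun i _ => ?_
        rw [intComponent_mul_left h (intComponent_mem h i r), intComponent_mul_left h hv1,
          mul_assoc]
      have hneg {n : ℤ} (hn : n < 0) (r : B) : intComponent h n r = 0 := by
        rw [intComponent_of_neg h hn, LinearMap.zero_apply]
      have hzero (r : B) : ∃ c : k, intComponent h 0 r = algebraMap k B c := by
        obtain ⟨c, hc⟩ := exists_algebraMap_of_mem h (intComponent_mem h 0 r)
        exact ⟨c, hc.symm⟩
      have hone (r : B) : intComponent h 1 r ∈ ℬ 1 := by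
        have := intComponent_mem h 1 r
        rwa [intGrading_one] at this
      refine ⟨?_, ?_⟩
      · rw [SetLike.mem_coe, Submodule.mem_comap, e, hr1]
        refine Submodule.sum_mem _ fun i _ => ?_
        rcases lt_trichotomy i 0 with hi | rfl | hi
        · rw [hneg hi, zero_mul, zero_mul]
          exact zero_mem _
        · obtain ⟨c, hc⟩ := hzero r
          obtain ⟨c', hc'⟩ := hzero s
          norm_num
          rw [hc, hc', ← Algebra.commutes, ← Algebra.smul_def, ← Algebra.smul_def]
          exact V.smul_mem _ (V.smul_mem _ hv)
        · rw [hneg (n := _ - i - 1) (by push_cast; omega), mul_zero]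
          exact zero_mem _
      · rw [SetLike.mem_coe, Submodule.mem_comap, e, hr1]
        refine Submodule.sum_mem _ fun i _ => ?_
        rcases lt_trichotomy i 0 with hi | rfl | hi
        · rw [hneg hi, zero_mul, zero_mul]
          exact zero_mem _
        · obtain ⟨c, hc⟩ := hzero r
          norm_num
          rw [hc, ← Algebra.smul_def]
          exact Submodule.mem_sup_left (Submodule.mul_mem_mul (V.smul_mem _ hv) (hone s))
        · rcases lt_trichotomy i 1 with hi' | rfl | hi'
          · omega
          · obtain ⟨c', hc'⟩ := hzero s
            norm_num
            rw [hc', ← Algebra.commutes, ← Algebra.smul_def, ← smul_mul_assoc]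
            exact Submodule.mem_sup_right (Submodule.mul_mem_mul
              (Submodule.smul_mem _ _ (hone r)) hv)
          · rw [hneg (n := _ - i - 1) (by push_cast; omega), mul_zero]
            exact zero_mem _
  exact key hb

end Quotient

/-! ### Nondegenerate quadratic relations in two variables. -/

section QuadraticForms

open Module

variable {k : Type*} [Field k] {B : Type u} [Ring B] [Algebra k B]

lemma exists_eq_sum_tmul {M : Type*} [AddCommGroup M] [Module k M] {v : Fin 2 → M}
    (hv : ∀ x, ∃ c : Fin 2 → k, x = ∑ i, c i • v i) (f : M ⊗[k] M) :
    ∃ F : Fin 2 → Fin 2 → k, f = ∑ i, ∑ j, F i j • (v i ⊗ₜ[k] v j) := by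
  induction f using TensorProduct.induction_on with
  | zero => exact ⟨0, by simp⟩
  | tmul x y =>
    obtain ⟨c, rfl⟩ := hv x
    obtain ⟨d, rfl⟩ := hv y
    refine ⟨fun i j => c i * d j, ?_⟩
    simp only [TensorProduct.sum_tmul, TensorProduct.tmul_sum, TensorProduct.smul_tmul_smul]
    exact Finset.sum_comm
  | add f g hf hg =>
    obtain ⟨F, rfl⟩ := hf
    obtain ⟨G, rfl⟩ := hg
    exact ⟨F + G, by simp [add_smul, Finset.sum_add_distrib]⟩

/-- In a domain, a quadratic relation between two elements forces their independence and is given by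
a nondegenerate bilinear form. -/
theorem HasQuadraticRelation.exists_matrix [IsDomain B] {x₁ x₂ : B}
    (h : HasQuadraticRelation k x₁ x₂) : LinearIndependent k ![x₁, x₂] ∧
      ∃ F : Matrix (Fin 2) (Fin 2) k, F.det ≠ 0 ∧ F ∈ quadraticRelations k ![x₁, x₂] := by
  obtain ⟨f, hf, hmul⟩ := h
  let u : Fin 2 → Submodule.span k {x₁, x₂} :=
    ![⟨x₁, Submodule.subset_span (by simp)⟩, ⟨x₂, Submodule.subset_span (by simp)⟩]
  have hu : ∀ x, ∃ c : Fin 2 → k, x = ∑ i, c i • u i := fun x => by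
    obtain ⟨s, t, hst⟩ := Submodule.mem_span_pair.1 x.2
    exact ⟨![s, t], Subtype.ext (by simp [u, Fin.sum_univ_two, hst])⟩
  obtain ⟨F, hF⟩ := exists_eq_sum_tmul hu f
  have hF0 : F ≠ 0 := by
    rintro rfl
    exact hf (by simp [hF])
  have hrel : ∑ i, ∑ j, F i j • (![x₁, x₂] i * ![x₁, x₂] j) = 0 := by
    rw [← hmul, hF]
    simp [u, Fin.sum_univ_two, Submodule.mulMap_tmul]
  -- If the elements were dependent, `f` would be a multiple of some `v ⊗ v`, and `v * v` is nonzero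
  -- in a domain unless `v` is.
  have hli : LinearIndependent k ![x₁, x₂] := by
    by_contra hne
    have hv : ∃ v ∈ Submodule.span k {x₁, x₂}, ∃ c d : k, x₁ = c • v ∧ x₂ = d • v := by
      rw [LinearIndependent.pair_iff] at hne
      push Not at hne
      obtain ⟨s, t, hst, hne⟩ := hne
      by_cases hs : s = 0
      · have ht := hne hs
        refine ⟨x₁, Submodule.subset_span (by simp), 1, 0, (one_smul _ _).symm, ?_⟩
        rw [hs, zero_smul, zero_add] at hst
        rw [zero_smul]
        exact (smul_eq_zero.1 hst).resolve_left ht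
      · refine ⟨x₂, Submodule.subset_span (by simp), -(s⁻¹ * t), 1, ?_, (one_smul _ _).symm⟩
        rw [neg_smul, mul_smul, eq_neg_iff_add_eq_zero]
        rw [← smul_right_inj hs, smul_add, smul_smul s, mul_inv_cancel₀ hs, one_smul, hst,
          smul_zero]
    obtain ⟨v, hvV, c, d, hc, hd⟩ := hv
    have e1 : u 0 = c • ⟨v, hvV⟩ := Subtype.ext hc
    have e2 : u 1 = d • ⟨v, hvV⟩ := Subtype.ext hd
    have hfv : f = (∑ i, ∑ j, F i j * (![c, d] i * ![c, d] j)) •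
        ((⟨v, hvV⟩ : Submodule.span k {x₁, x₂}) ⊗ₜ[k] (⟨v, hvV⟩ : Submodule.span k {x₁, x₂})) := by
      rw [hF]
      simp only [Fin.sum_univ_two, e1, e2, Matrix.cons_val_zero, Matrix.cons_val_one,
        TensorProduct.smul_tmul_smul, smul_smul, add_smul]
    rw [hfv, map_smul, Submodule.mulMap_tmul] at hmul
    rcases smul_eq_zero.1 hmul with h0 | h0
    · rw [h0, zero_smul] at hfv
      exact hf hfv
    · have hv0 : v = 0 := mul_self_eq_zero.1 h0
      subst hv0
      refine hf ?_
      rw [hfv]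
      have : (⟨0, hvV⟩ : Submodule.span k {x₁, x₂}) = 0 := rfl
      rw [this, TensorProduct.zero_tmul, smul_zero]
  refine ⟨hli, F, fun hdet => hF0 ?_, mem_quadraticRelations.2 hrel⟩
  replace hdet : F 0 0 * F 1 1 - F 0 1 * F 1 0 = 0 := (Matrix.det_fin_two (Matrix.of F)).symm.trans hdet
  ext a b
  -- A form of determinant zero has rank at most one, so `F a b` times the relation factors into two
  -- linear forms. In a domain one of them is zero, and either has `F a b` among its coefficients.
  have hprod : (∑ i, F i b • ![x₁, x₂] i) * (∑ j, F a j • ![x₁, x₂] j) = 0 := by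
    have key : ∀ a b i j, F i b * F a j = F a b * F i j := by
      simp only [Fin.forall_fin_two]
      and_intros <;>
        first | trivial | ring1 | linear_combination hdet | linear_combination -hdet
    have : (∑ i, F i b • ![x₁, x₂] i) * (∑ j, F a j • ![x₁, x₂] j) = F a b •
        ∑ i, ∑ j, F i j • (![x₁, x₂] i * ![x₁, x₂] j) := by
      simp only [Finset.sum_mul_sum, smul_mul_smul_comm, key a b, Finset.smul_sum, smul_smul]
    rw [this, hrel, smul_zero]
  rcases mul_eq_zero.1 hprod with h0 | h0
  · exact Fintype.linearIndependent_iff.1 hli _ h0 a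
  · exact Fintype.linearIndependent_iff.1 hli _ h0 b

/-- If the square of a plane of dimension two has dimension at most three, there is a quadratic
relation. -/
theorem hasQuadraticRelation_of_finrank_le {x₁ x₂ : B} (hx : LinearIndependent k ![x₁, x₂])
    (h : finrank k (Submodule.span k {x₁, x₂} * Submodule.span k {x₁, x₂} : Submodule k B) ≤ 3) :
    HasQuadraticRelation k x₁ x₂ := by
  have hV : finrank k (Submodule.span k {x₁, x₂}) = 2 := by
    have := finrank_span_eq_card hx
    rwa [Matrix.range_cons_cons_empty, Fintype.card_fin] at this
  have : FiniteDimensional k (Submodule.span k {x₁, x₂}) :=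
    FiniteDimensional.span_of_finite k (by simp)
  by_contra hne
  have hinj : Function.Injective (Submodule.mulMap (Submodule.span k {x₁, x₂})
      (Submodule.span k {x₁, x₂})) := by
    rw [injective_iff_map_eq_zero]
    intro f hf
    by_contra h0
    exact hne ⟨f, h0, hf⟩
  have h1 := LinearMap.finrank_range_of_inj hinj
  rw [Submodule.mulMap_range, finrank_tensorProduct, hV] at h1
  omega

/-- Over an algebraically closed field, a nondegenerate bilinear form on a plane is a multiple of
`x₂ x₁ - q x₁ x₂ - p x₁²` in a suitable basis. -/
theorem exists_normal_form [IsAlgClosed k] {G : Matrix (Fin 2) (Fin 2) k} (hG : G.det ≠ 0)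
    (x₁ x₂ : B) : ∃ y₁ y₂ : B, Submodule.span k {y₁, y₂} = Submodule.span k {x₁, x₂} ∧
      ∃ γ q p : k, γ ≠ 0 ∧ q ≠ 0 ∧ ∑ i, ∑ j, G i j • (![x₁, x₂] i * ![x₁, x₂] j) =
        γ • (y₂ * y₁ - q • (y₁ * y₂) - p • (y₁ * y₁)) := by
  rw [Matrix.det_fin_two] at hG
  by_cases h11 : G 1 1 = 0
  · rw [h11] at hG
    have h01 : G 0 1 ≠ 0 := by
      intro h
      simp [h] at hG
    have h10 : G 1 0 ≠ 0 := by
      intro h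
      simp [h] at hG
    refine ⟨x₁, x₂, rfl, G 1 0, -(G 0 1 / G 1 0), -(G 0 0 / G 1 0), h10,
      neg_ne_zero.2 (div_ne_zero h01 h10), ?_⟩
    simp only [Fin.sum_univ_two, Matrix.cons_val_zero, Matrix.cons_val_one, h11]
    match_scalars <;> field_simp
  -- `t` is chosen so that in the basis `x₂ - t • x₁`, `x₁` the square of the second element has
  -- coefficient zero.
  · obtain ⟨t, ht⟩ := IsAlgClosed.exists_root (Polynomial.C (G 1 1) * Polynomial.X ^ 2 +
      Polynomial.C (G 0 1 + G 1 0) * Polynomial.X + Polynomial.C (G 0 0))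
      (by rw [Polynomial.degree_quadratic h11]; exact two_ne_zero)
    replace ht : G 1 1 * t ^ 2 + (G 0 1 + G 1 0) * t + G 0 0 = 0 := by
      simpa [Polynomial.IsRoot] using ht
    -- By the equation for `t` this product of the two mixed coefficients is minus the determinant
    -- of `G`, so both are nonzero.
    have hm : (G 0 1 + G 1 1 * t) * (G 1 0 + G 1 1 * t) ≠ 0 := by
      intro h0
      exact hG (by linear_combination G 1 1 * ht - h0)
    have h10 := left_ne_zero_of_mul hm
    have h01 := right_ne_zero_of_mul hm
    refine ⟨x₂ - t • x₁, x₁, ?_, G 0 1 + G 1 1 * t, -((G 1 0 + G 1 1 * t) / (G 0 1 + G 1 1 * t)),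
      -(G 1 1 / (G 0 1 + G 1 1 * t)), h10, neg_ne_zero.2 (div_ne_zero h01 h10), ?_⟩
    · refine le_antisymm (Submodule.span_le.2 ?_) (Submodule.span_le.2 ?_) <;>
        rintro _ (rfl | rfl)
      · exact Submodule.mem_span_pair.2 ⟨-t, 1, by simp; abel⟩
      · exact Submodule.mem_span_pair.2 ⟨1, 0, by simp⟩
      · exact Submodule.mem_span_pair.2 ⟨0, 1, by simp⟩
      · exact Submodule.mem_span_pair.2 ⟨1, t, by simp⟩
    · have e : x₂ = (x₂ - t • x₁) + t • x₁ := by abel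
      generalize x₂ - t • x₁ = y at e ⊢
      subst e
      simp only [Fin.sum_univ_two, Matrix.cons_val_zero, Matrix.cons_val_one, add_mul, mul_add,
        smul_mul_assoc, mul_smul_comm]
      match_scalars
      all_goals first | linear_combination ht | field_simp

variable {𝒜 : ℕ → Submodule k B}

/-- A regular algebra of dimension two generated by two elements of degree one has one quadratic
relation, which is nondegenerate. -/
theorem IsLeftASRegular.exists_quadraticRelations_eq (hR : IsLeftASRegular 𝒜 2) {z : Fin 2 → B}
    (hz : ∀ i, z i ∈ 𝒜 1) (hindep : LinearIndependent k z)
    (hgen : Algebra.adjoin k (Set.range z) = ⊤) : ∃ G : Matrix (Fin 2) (Fin 2) k, G.det ≠ 0 ∧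
      G ∈ quadraticRelations k z ∧ ∀ M ∈ quadraticRelations k z, ∃ c : k, M = c • G := by
  have h := hR.connected
  obtain ⟨a, ha, haind, hrel, -⟩ := hR.exists_resolution_two hz hindep hgen
  have hspan := degree_one_eq_span h hz hgen
  have hG : ∀ j, ∃ c : Fin 2 → k, ∑ i, c i • z i = a j := fun j => by
    have := ha j
    rw [hspan] at this
    exact (Submodule.mem_span_range_iff_exists_fun k).1 this
  choose g hg using hG
  -- The columns of this matrix hold the coordinates of the entries `a j` of the last differential,
  -- whose independence is nondegeneracy. A quadratic relation is a multiple `r • a` in the same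
  -- degree as `a`, so only the constant component of `r` matters.
  refine ⟨fun i j => g j i, fun hdet => ?_, ?_, fun M hM => ?_⟩
  · obtain ⟨v, hv, hv0⟩ := Matrix.exists_mulVec_eq_zero_iff.2 hdet
    refine hv (funext fun j => ?_)
    refine Fintype.linearIndependent_iff.1 haind v ?_ j
    calc ∑ j, v j • a j = ∑ j, ∑ i, (v j * g j i) • z i := by
          simp only [← hg, Finset.smul_sum, smul_smul]
      _ = ∑ i, (∑ j, g j i * v j) • z i := by
          rw [Finset.sum_comm]
          simp only [Finset.sum_smul, mul_comm]
      _ = 0 := Finset.sum_eq_zero fun i _ => by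
          have : ∑ j, g j i * v j = 0 := congrFun hv0 i
          rw [this, zero_smul]
  · refine mem_quadraticRelations_iff_sum_mul.2 ?_
    have := (hrel a).2 ⟨1, one_smul _ _⟩
    rw [linearCombination_eq_sum] at this
    simpa only [hg, smul_eq_mul] using this
  · rw [mem_quadraticRelations_iff_sum_mul] at hM
    let x : Fin 2 →₀ B := Finsupp.equivFunOnFinite.symm fun j => ∑ i, M i j • z i
    obtain ⟨r, hr⟩ := (hrel x).1 (by rw [linearCombination_eq_sum]; exact hM)
    obtain ⟨c, hc⟩ := exists_algebraMap_of_mem h (intComponent_mem h 0 r)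
    refine ⟨c, ?_⟩
    ext i j
    have h1 : r * a j = ∑ i, M i j • z i := DFunLike.congr_fun hr j
    have h2 : c • a j = ∑ i, M i j • z i := by
      have haj : a j ∈ intGrading 𝒜 1 := intGrading_one (𝒜 := 𝒜) ▸ ha j
      have h3 := intComponent_mul_right h haj 1 r
      rw [h1, sub_self, ← hc, ← Algebra.smul_def, intComponent_of_mem] at h3
      · exact h3.symm
      · rw [intGrading_one]
        exact Submodule.sum_mem _ fun i _ => Submodule.smul_mem _ _ (hz i)
    have h4 : ∑ i, (M i j - c * g j i) • z i = 0 := by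
      simp only [sub_smul, Finset.sum_sub_distrib, mul_smul, ← Finset.smul_sum, hg, h2, sub_self]
    exact sub_eq_zero.1 (Fintype.linearIndependent_iff.1 hindep _ h4 i)

end QuadraticForms

/-! ### Bases of ordered monomials and commutation rules. -/

section Bases

open Module

variable {k : Type*} [Field k] {B : Type u} [Ring B] [Algebra k B] {ℬ : ℕ → Submodule k B}

/-- Unique expansion with coefficients in `A`, from a basis adapted to a basis of `A`. -/
theorem existsUnique_eq_finsupp_sum {J I A : Type*} [Nonempty J] [AddCommGroup A] [Module k A]
    {φ : J → A →ₗ[k] B} {u : I → A} (hu : Submodule.span k (Set.range u) = ⊤)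
    (hind : LinearIndependent k fun m : J × I => φ m.1 (u m.2))
    (hspan : Submodule.span k (Set.range fun m : J × I => φ m.1 (u m.2)) = ⊤) (b : B) :
    ∃! c : J →₀ A, b = c.sum fun j a => φ j a := by
  obtain ⟨j₀⟩ := ‹Nonempty J›
  have huind : LinearIndependent k u :=
    (hind.comp (fun i => (j₀, i)) fun _ _ h => (Prod.mk.inj h).2).of_comp (φ j₀)
  let bA : Basis I k A := Basis.mk huind hu.ge
  let bB : Basis (J × I) k B := Basis.mk hind hspan.ge
  let e : (J →₀ A) ≃ₗ[k] B := (Finsupp.basis fun _ : J => bA).equiv bB (Equiv.sigmaEquivProd J I)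
  have he : ∀ c, e c = c.sum fun j a => φ j a := by
    have : e.toLinearMap = Finsupp.lsum k φ := by
      refine (Finsupp.basis fun _ : J => bA).ext fun m => ?_
      have h1 : e ((Finsupp.basis fun _ : J => bA) m) = bB (m.1, m.2) :=
        (Finsupp.basis fun _ : J => bA).equiv_apply m bB (Equiv.sigmaEquivProd J I)
      refine h1.trans ?_
      simp [bA, bB]
    intro c
    exact LinearMap.congr_fun this c
  refine ⟨e.symm b, ?_, fun c hc => ?_⟩
  · simp only [← he, LinearEquiv.apply_symm_apply]
  · rw [hc, ← he, LinearEquiv.symm_apply_apply]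

/-- A degree-preserving map commutes with the projections, so by injectivity an element with
homogeneous image is homogeneous. This matches the inherited grading of a subalgebra with its own
grading by monomials. -/
lemma comap_eq_of_mapsTo {A : Type*} [Ring A] [Algebra k A] {𝒜 : ℕ → Submodule k A}
    (hA : DirectSum.IsInternal 𝒜) (hB : DirectSum.IsInternal ℬ) {f : A →ₗ[k] B}
    (hf : Function.Injective f) (h : ∀ n, ∀ a ∈ 𝒜 n, f a ∈ ℬ n) (n : ℕ) :
    (ℬ n).comap f = 𝒜 n := by
  refine le_antisymm (fun a ha => ?_) (h n)
  obtain ⟨s, hs, hsum⟩ := exists_sum_natComponent hA a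
  have h1 : natComponent hB n (f a) = f (natComponent hA n a) := by
    conv_lhs => rw [← hsum]
    rw [map_sum, map_sum, Finset.sum_eq_single n]
    · exact natComponent_of_mem hB (h n _ (natComponent_mem hA n a))
    · exact fun m _ hm => natComponent_of_mem_ne hB (h m _ (natComponent_mem hA m a)) hm
    · intro hn
      rw [hs n hn, map_zero, map_zero]
  rw [natComponent_of_mem hB ha] at h1
  rw [hf h1]
  exact natComponent_mem hA n a

lemma exists_linearIndependent_snoc {n : ℕ} {v : Fin n → B} {U : Submodule k B}
    (hv : ∀ i, v i ∈ U) (hind : LinearIndependent k v) (h : n < finrank k U) :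
    ∃ y ∈ U, LinearIndependent k (Fin.snoc v y : Fin (n + 1) → B) := by
  have h1 : LinearIndependent k fun i => (⟨v i, hv i⟩ : U) := hind.of_comp U.subtype
  obtain ⟨y, hy⟩ := exists_linearIndependent_snoc_of_lt_finrank h1 h
  refine ⟨y, y.2, ?_⟩
  have h2 : (Fin.snoc v y : Fin (n + 1) → B) =
      U.subtype ∘ (Fin.snoc (fun i => (⟨v i, hv i⟩ : U)) y : Fin (n + 1) → U) := by
    ext i
    refine Fin.lastCases ?_ (fun j => ?_) i <;> simp
  rw [h2]
  exact hy.map' U.subtype (Submodule.ker_subtype U)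

lemma span_range_eq_of_card_eq_finrank {n : ℕ} {v : Fin n → B} {U : Submodule k B}
    [Module.Finite k U] (hv : ∀ i, v i ∈ U) (hind : LinearIndependent k v) (h : n = finrank k U) :
    Submodule.span k (Set.range v) = U := by
  refine Submodule.eq_of_le_of_finrank_eq (Submodule.span_le.2 (Set.range_subset_iff.2 hv)) ?_
  rw [finrank_span_eq_card hind, Fintype.card_fin, h]

lemma adjoin_eq_top_of_span_eq {ι ι' : Type*} {z : ι → B} {z' : ι' → B}
    (hgen : Algebra.adjoin k (Set.range z) = ⊤)
    (h : Submodule.span k (Set.range z) ≤ Submodule.span k (Set.range z')) :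
    Algebra.adjoin k (Set.range z') = ⊤ := by
  rw [eq_top_iff, ← hgen]
  refine Algebra.adjoin_le fun x hx => ?_
  exact Algebra.span_le_adjoin k _ (h (Submodule.subset_span hx))

/-- The coefficients of `1 / (1 - t) ^ 4` as the square of `1 / (1 - t) ^ 2`. -/
lemma sum_antidiagonal_succ_mul_succ (n : ℕ) :
    ∑ p ∈ Finset.HasAntidiagonal.antidiagonal n, (p.1 + 1) * (p.2 + 1) = (n + 3).choose 3 := by
  have h1 : ∀ n : ℕ, ∑ p ∈ Finset.HasAntidiagonal.antidiagonal n, (p.1 + 1) = (n + 2).choose 2 := by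
    intro n
    induction n with
    | zero => simp
    | succ n ih =>
      rw [Finset.Nat.sum_antidiagonal_succ']
      rw [ih, Nat.choose_succ_succ (n + 2) 1, Nat.choose_one_right]
  induction n with
  | zero => simp
  | succ n ih =>
    rw [Finset.Nat.sum_antidiagonal_succ']
    have : ∀ p : ℕ × ℕ, (p.1 + 1) * (p.2 + 1 + 1) = (p.1 + 1) * (p.2 + 1) + (p.1 + 1) :=
      fun p => by ring
    simp only [this]
    rw [Finset.sum_add_distrib, ih, h1, Nat.choose_succ_succ (n + 3) 2, Nat.choose_succ_succ (n + 2) 1,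
      Nat.choose_one_right]
    ring

/-- The exponents of the ordered monomials of degree `n` in four variables. -/
def quadExponents (n : ℕ) : Finset ((ℕ × ℕ) × (ℕ × ℕ)) :=
  (Finset.HasAntidiagonal.antidiagonal n).biUnion fun p =>
    Finset.HasAntidiagonal.antidiagonal p.1 ×ˢ Finset.HasAntidiagonal.antidiagonal p.2

lemma mem_quadExponents {n : ℕ} {m : (ℕ × ℕ) × (ℕ × ℕ)} :
    m ∈ quadExponents n ↔ m.1.1 + m.1.2 + (m.2.1 + m.2.2) = n := by
  simp only [quadExponents, Finset.mem_biUnion, Finset.mem_product,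
    Finset.HasAntidiagonal.mem_antidiagonal, Prod.exists]
  constructor
  · rintro ⟨p, q, h, h1, h2⟩
    omega
  · intro h
    exact ⟨_, _, h, rfl, rfl⟩

lemma card_quadExponents_le (n : ℕ) : (quadExponents n).card ≤ (n + 3).choose 3 := by
  rw [← sum_antidiagonal_succ_mul_succ]
  refine Finset.card_biUnion_le.trans (Finset.sum_le_sum fun p _ => ?_)
  rw [Finset.card_product, Finset.Nat.card_antidiagonal, Finset.Nat.card_antidiagonal]

/-- An algebra with the Hilbert series of the polynomial ring in four variables, generated in degree
one by two pairs of elements with suitable commutation relations, has a basis of ordered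
monomials. -/
theorem linearIndependent_and_span_of_commutation (h : DirectSum.IsInternal ℬ)
    (hpow : ∀ n, ℬ n = ℬ 1 ^ n) (hdim : ∀ n, finrank k (ℬ n) = (n + 3).choose 3) {a b c d : B}
    (hE : ℬ 1 = Submodule.span k {a, b} ⊔ Submodule.span k {c, d})
    (hEV : ℬ 1 * Submodule.span k {a, b} ≤ Submodule.span k {a, b} * ℬ 1)
    (hab : b * a ∈ Submodule.span k {a * b, a * a})
    (hcd : d * c ∈ Submodule.span k {c * d, c * c} ⊔ Submodule.span k {a, b} * ℬ 1) :
    LinearIndependent k (fun m : (ℕ × ℕ) × (ℕ × ℕ) =>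
      (a ^ m.2.1 * b ^ m.2.2) * (c ^ m.1.1 * d ^ m.1.2)) ∧
    Submodule.span k (Set.range fun m : (ℕ × ℕ) × (ℕ × ℕ) =>
      (a ^ m.2.1 * b ^ m.2.2) * (c ^ m.1.1 * d ^ m.1.2)) = ⊤ := by
  set w : (ℕ × ℕ) × (ℕ × ℕ) → B := fun m => (a ^ m.2.1 * b ^ m.2.2) * (c ^ m.1.1 * d ^ m.1.2)
    with hw
  have hmem : ∀ x ∈ ({a, b} ∪ {c, d} : Set B), x ∈ ℬ 1 := fun x hx => by
    rw [hE, ← Submodule.span_union]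
    exact Submodule.subset_span hx
  have hwmem : ∀ m, w m ∈ ℬ (m.1.1 + m.1.2 + (m.2.1 + m.2.2)) := fun m => by
    rw [hpow, add_comm (m.1.1 + m.1.2), pow_add, pow_add, pow_add]
    exact Submodule.mul_mem_mul
      (Submodule.mul_mem_mul (Submodule.pow_mem_pow _ (hmem a (by simp)) _)
        (Submodule.pow_mem_pow _ (hmem b (by simp)) _))
      (Submodule.mul_mem_mul (Submodule.pow_mem_pow _ (hmem c (by simp)) _)
        (Submodule.pow_mem_pow _ (hmem d (by simp)) _))
  have hle : ∀ n, ℬ n ≤ Submodule.span k (w '' (quadExponents n : Set _)) := fun n => by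
    rw [hpow]
    refine (pow_le_iSup_mul_monomialSpan hE hEV hcd n).trans (iSup₂_le fun m hm => ?_)
    rw [pow_eq_monomialSpan hab, monomialSpan, monomialSpan, Submodule.span_mul_span]
    refine Submodule.span_mono ?_
    rintro _ ⟨_, ⟨p, hp, rfl⟩, _, ⟨q, hq, rfl⟩, rfl⟩
    refine ⟨(q, p), ?_, rfl⟩
    rw [Finset.mem_coe, mem_quadExponents]
    simp only [Set.mem_ofPred_eq] at hp hq hm
    simp only
    omega
  have hspan : ∀ n, Submodule.span k (w '' (quadExponents n : Set _)) = ℬ n := fun n => by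
    refine le_antisymm (Submodule.span_le.2 ?_) (hle n)
    rintro _ ⟨m, hm, rfl⟩
    rw [Finset.mem_coe, mem_quadExponents] at hm
    exact hm ▸ hwmem m
  -- The ordered monomials of degree `n` span a space of dimension `(n + 3).choose 3` and number no
  -- more than that.
  refine ⟨linearIndependent_of_graded h hwmem fun n => ?_, ?_⟩
  · have hset : {m : (ℕ × ℕ) × (ℕ × ℕ) | m.1.1 + m.1.2 + (m.2.1 + m.2.2) = n} =
        (quadExponents n : Set _) := by
      ext m
      rw [Finset.mem_coe, mem_quadExponents, Set.mem_ofPred_eq]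
    rw [hset]
    refine linearIndepOn_of_card_le_finrank (Finset.finite_toSet _) ?_
    rw [hspan, hdim, Set.ncard_coe_finset]
    exact card_quadExponents_le n
  · rw [eq_top_iff, ← h.submodule_iSup_eq_top]
    exact iSup_le fun n => (hle n).trans (Submodule.span_mono (Set.image_subset_range _ _))

/-- Moving elements past the elements of a subalgebra, checked on generators. -/
lemma commutation_right_of_generators {X : Set B} {y₁ y₂ : B}
    (h : ∀ a ∈ X, ∀ y ∈ ({y₁, y₂} : Set B), ∃ a₁ ∈ Algebra.adjoin k X, ∃ a₂ ∈ Algebra.adjoin k X,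
      ∃ a₀ ∈ Algebra.adjoin k X, y * a = a₁ * y₁ + a₂ * y₂ + a₀) :
    ∀ a ∈ Algebra.adjoin k X, ∀ y ∈ ({y₁, y₂} : Set B), ∃ a₁ ∈ Algebra.adjoin k X,
      ∃ a₂ ∈ Algebra.adjoin k X, ∃ a₀ ∈ Algebra.adjoin k X, y * a = a₁ * y₁ + a₂ * y₂ + a₀ := by
  intro a ha
  induction ha using Algebra.adjoin_induction with
  | mem x hx => exact h x hx
  | algebraMap c =>
    rintro y (rfl | rfl)
    · exact ⟨_, algebraMap_mem _ c, 0, zero_mem _, 0, zero_mem _, by simp [Algebra.commutes]⟩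
    · exact ⟨0, zero_mem _, _, algebraMap_mem _ c, 0, zero_mem _, by simp [Algebra.commutes]⟩
  | add x x' _ _ hx hx' =>
    intro y hy
    obtain ⟨a₁, h₁, a₂, h₂, a₀, h₀, e⟩ := hx y hy
    obtain ⟨a₁', h₁', a₂', h₂', a₀', h₀', e'⟩ := hx' y hy
    refine ⟨_, add_mem h₁ h₁', _, add_mem h₂ h₂', _, add_mem h₀ h₀', ?_⟩
    rw [mul_add, e, e']
    noncomm_ring
  | mul x x' _ hmem' hx hx' =>
    intro y hy
    obtain ⟨a₁, h₁, a₂, h₂, a₀, h₀, e⟩ := hx y hy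
    obtain ⟨b₁, g₁, b₂, g₂, b₀, g₀, f⟩ := hx' y₁ (by simp)
    obtain ⟨c₁, i₁, c₂, i₂, c₀, i₀, g⟩ := hx' y₂ (by simp)
    refine ⟨_, add_mem (mul_mem h₁ g₁) (mul_mem h₂ i₁), _, add_mem (mul_mem h₁ g₂) (mul_mem h₂ i₂),
      _, add_mem (add_mem (mul_mem h₁ g₀) (mul_mem h₂ i₀)) (mul_mem h₀ hmem'), ?_⟩
    rw [← mul_assoc, e, add_mul, add_mul, mul_assoc a₁, mul_assoc a₂, f, g]
    noncomm_ring

lemma commutation_left_of_generators {X : Set B} {y₁ y₂ : B}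
    (h : ∀ a ∈ X, ∀ y ∈ ({y₁, y₂} : Set B), ∃ a₁ ∈ Algebra.adjoin k X, ∃ a₂ ∈ Algebra.adjoin k X,
      ∃ a₀ ∈ Algebra.adjoin k X, a * y = y₁ * a₁ + y₂ * a₂ + a₀) :
    ∀ a ∈ Algebra.adjoin k X, ∀ y ∈ ({y₁, y₂} : Set B), ∃ a₁ ∈ Algebra.adjoin k X,
      ∃ a₂ ∈ Algebra.adjoin k X, ∃ a₀ ∈ Algebra.adjoin k X, a * y = y₁ * a₁ + y₂ * a₂ + a₀ := by
  intro a ha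
  induction ha using Algebra.adjoin_induction with
  | mem x hx => exact h x hx
  | algebraMap c =>
    rintro y (rfl | rfl)
    · exact ⟨_, algebraMap_mem _ c, 0, zero_mem _, 0, zero_mem _, by simp [Algebra.commutes]⟩
    · exact ⟨0, zero_mem _, _, algebraMap_mem _ c, 0, zero_mem _, by simp [Algebra.commutes]⟩
  | add x x' _ _ hx hx' =>
    intro y hy
    obtain ⟨a₁, h₁, a₂, h₂, a₀, h₀, e⟩ := hx y hy
    obtain ⟨a₁', h₁', a₂', h₂', a₀', h₀', e'⟩ := hx' y hy
    refine ⟨_, add_mem h₁ h₁', _, add_mem h₂ h₂', _, add_mem h₀ h₀', ?_⟩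
    rw [add_mul, e, e']
    noncomm_ring
  | mul x x' hmem _ hx hx' =>
    intro y hy
    obtain ⟨a₁, h₁, a₂, h₂, a₀, h₀, e⟩ := hx' y hy
    obtain ⟨b₁, g₁, b₂, g₂, b₀, g₀, f⟩ := hx y₁ (by simp)
    obtain ⟨c₁, i₁, c₂, i₂, c₀, i₀, g⟩ := hx y₂ (by simp)
    refine ⟨_, add_mem (mul_mem g₁ h₁) (mul_mem i₁ h₂), _, add_mem (mul_mem g₂ h₁) (mul_mem i₂ h₂),
      _, add_mem (add_mem (mul_mem g₀ h₁) (mul_mem i₀ h₂)) (mul_mem hmem h₀), ?_⟩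
    rw [mul_assoc, e, mul_add, mul_add, ← mul_assoc x, ← mul_assoc x, f, g]
    noncomm_ring

lemma exists_eq_of_mem_mul_sup {V : Submodule k B} {c d e : B}
    (he : e ∈ V * (V ⊔ Submodule.span k {c, d})) :
    ∃ v ∈ V, ∃ w ∈ V, ∃ t ∈ V * V, e = v * c + w * d + t := by
  rw [Submodule.mul_sup, Submodule.span_insert, Submodule.mul_sup] at he
  obtain ⟨t, ht, f, hf, rfl⟩ := Submodule.mem_sup.1 he
  obtain ⟨f₁, hf₁, f₂, hf₂, rfl⟩ := Submodule.mem_sup.1 hf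
  obtain ⟨v, hv, rfl⟩ := Submodule.mem_mul_span_singleton.1 hf₁
  obtain ⟨w, hw, rfl⟩ := Submodule.mem_mul_span_singleton.1 hf₂
  exact ⟨v, hv, w, hw, t, ht, add_comm _ _⟩

lemma exists_eq_of_mem_sup_mul {V : Submodule k B} {c d e : B}
    (he : e ∈ (V ⊔ Submodule.span k {c, d}) * V) :
    ∃ v ∈ V, ∃ w ∈ V, ∃ t ∈ V * V, e = c * v + d * w + t := by
  rw [Submodule.sup_mul, Submodule.span_insert, Submodule.sup_mul] at he
  obtain ⟨t, ht, f, hf, rfl⟩ := Submodule.mem_sup.1 he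
  obtain ⟨f₁, hf₁, f₂, hf₂, rfl⟩ := Submodule.mem_sup.1 hf
  obtain ⟨v, hv, rfl⟩ := Submodule.mem_span_singleton_mul.1 hf₁
  obtain ⟨w, hw, rfl⟩ := Submodule.mem_span_singleton_mul.1 hf₂
  exact ⟨v, hv, w, hw, t, ht, add_comm _ _⟩

end Bases

/-! ### From commutation rules to a double extension. -/

section Construction

open Module MulOpposite

variable {k : Type*} [Field k] {B : Type u} [Ring B] [Algebra k B] {ℬ : ℕ → Submodule k B}

/-- The elements `a`, `b` of a subalgebra generated by them satisfy the axioms of a quantum plane as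
soon as they do so in the ambient algebra. -/
lemma isQuantumPlane_adjoin {a b : B} {q p : k} (hq : q ≠ 0)
    (hrel : b * a = q • (a * b) + p • (a * a))
    (hind : LinearIndependent k fun m : ℕ × ℕ => a ^ m.1 * b ^ m.2) :
    IsQuantumPlane (⟨a, Algebra.subset_adjoin (by simp)⟩ : Algebra.adjoin k {a, b})
      ⟨b, Algebra.subset_adjoin (by simp)⟩ q p where
  ne_zero := hq
  rel := Subtype.ext hrel
  indep := LinearIndependent.of_comp (Algebra.adjoin k {a, b}).val.toLinearMap hind
  adjoin_eq_top := by
    have := Algebra.adjoin_adjoin_coe_preimage (R := k) (s := ({a, b} : Set B))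
    rw [← this]
    congr 1
    ext x
    simp [Subtype.ext_iff]

/-- Ordered monomials in four elements of degree one and the commutation rules between them give a
double extension of a regular algebra of dimension two. -/
theorem isDoubleExtension_of_commutation (h : IsConnectedGraded ℬ) (hpow : ∀ n, ℬ n = ℬ 1 ^ n)
    (hdim : ∀ n, finrank k (ℬ n) = (n + 3).choose 3) {a b c d : B} {q p q' p' : k}
    (hE : ℬ 1 = Submodule.span k {a, b} ⊔ Submodule.span k {c, d})
    (hcomm : Submodule.span k {a, b} * ℬ 1 = ℬ 1 * Submodule.span k {a, b})
    (hq : q ≠ 0) (hrel : b * a = q • (a * b) + p • (a * a)) (hq' : q' ≠ 0)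
    (hrel' : d * c - q' • (c * d) - p' • (c * c) ∈ Submodule.span k {a, b} * ℬ 1) :
    IsASRegular (subalgebraGrading ℬ (Algebra.adjoin k {a, b})) 2 ∧
      IsDoubleExtension ℬ (Algebra.adjoin k {a, b}) := by
  set V := Submodule.span k {a, b} with hV
  set A := Algebra.adjoin k {a, b} with hA
  have hVB : V ≤ ℬ 1 := hE ▸ le_sup_left
  have hVA : ∀ v ∈ V, v ∈ A := fun v hv => Algebra.span_le_adjoin k _ hv
  have ha : a ∈ ℬ 1 := hVB (Submodule.subset_span (by simp))
  have hb : b ∈ ℬ 1 := hVB (Submodule.subset_span (by simp))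
  have hYB : Submodule.span k {c, d} ≤ ℬ 1 := hE ▸ le_sup_right
  have hc : c ∈ ℬ 1 := hYB (Submodule.subset_span (by simp))
  have hd : d ∈ ℬ 1 := hYB (Submodule.subset_span (by simp))
  have hVV : ∀ t ∈ V * V, t ∈ A ∧ t ∈ ℬ (1 + 1) := fun t ht => by
    refine ⟨?_, ?_⟩
    · have : V * V ≤ Subalgebra.toSubmodule A := Submodule.mul_le.2 fun x hx y hy =>
        A.mul_mem (hVA x hx) (hVA y hy)
      exact this ht
    · rw [hpow, pow_succ, pow_one]
      exact mul_le_mul' hVB hVB ht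
  have hright : ∀ e ∈ V * ℬ 1, ∃ v ∈ V, ∃ w ∈ V, ∃ t ∈ V * V, e = v * c + w * d + t :=
    fun e he => exists_eq_of_mem_mul_sup (hE ▸ he)
  have hleft : ∀ e ∈ V * ℬ 1, ∃ v ∈ V, ∃ w ∈ V, ∃ t ∈ V * V, e = c * v + d * w + t :=
    fun e he => exists_eq_of_mem_sup_mul (by rw [hcomm] at he; exact hE ▸ he)
  have hbasis := linearIndependent_and_span_of_commutation h.isInternal hpow hdim hE hcomm.ge
    (Submodule.mem_span_pair.2 ⟨q, p, hrel.symm⟩) (by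
      rw [← sub_add_cancel (d * c) (q' • (c * d) + p' • (c * c)), ← sub_sub]
      exact add_mem (Submodule.mem_sup_right hrel')
        (Submodule.mem_sup_left (Submodule.mem_span_pair.2 ⟨q', p', rfl⟩)))
  -- The basis of `B` as a right `A`-module comes from the same count in the opposite algebra. There
  -- both relations must be solved for the reversed product, hence the coefficients `q⁻¹` and
  -- `q'⁻¹`.
  have hbasis_op := linearIndependent_and_span_of_commutation (ℬ := opGrading ℬ)
    (isInternal_opGrading h.isInternal)
    (fun n => by rw [opGrading, opGrading, hpow, Submodule.map_op_pow])
    (fun n => by rw [finrank_opGrading, hdim]) (a := op a) (b := op b) (c := op c) (d := op d)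
    (by rw [opGrading, hE, Submodule.map_sup, hV, Submodule.map_span, Submodule.map_span]
        simp [Set.image_pair])
    (by
      have h1 : Submodule.span k {op a, op b} =
          V.map (opLinearEquiv k : B ≃ₗ[k] Bᵐᵒᵖ).toLinearMap := by
        rw [hV, Submodule.map_span]
        simp [Set.image_pair]
      rw [h1]
      exact op_mul_le_mul hcomm.le)
    (by
      refine Submodule.mem_span_pair.2 ⟨q⁻¹, -(q⁻¹ * p), ?_⟩
      rw [← MulOpposite.op_mul, ← MulOpposite.op_mul, ← MulOpposite.op_mul, hrel,
        ← MulOpposite.op_smul, ← MulOpposite.op_smul, ← MulOpposite.op_add, smul_add, smul_smul,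
        smul_smul, inv_mul_cancel₀ hq, one_smul, add_assoc, ← add_smul, add_neg_cancel, zero_smul,
        add_zero])
    (by
      have h1 : Submodule.span k {op a, op b} =
          V.map (opLinearEquiv k : B ≃ₗ[k] Bᵐᵒᵖ).toLinearMap := by
        rw [hV, Submodule.map_span]
        simp [Set.image_pair]
      rw [h1]
      have h2 : op d * op c = (q'⁻¹ • (op c * op d) + (-(q'⁻¹ * p')) • (op c * op c)) +
          op (-(q'⁻¹ • (d * c - q' • (c * d) - p' • (c * c)))) := by
        rw [← MulOpposite.op_mul, ← MulOpposite.op_mul, ← MulOpposite.op_mul,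
          ← MulOpposite.op_smul, ← MulOpposite.op_smul, ← MulOpposite.op_add,
          ← MulOpposite.op_add]
        congr 1
        match_scalars <;> field_simp <;> ring
      rw [h2]
      refine add_mem (Submodule.mem_sup_left (Submodule.mem_span_pair.2 ⟨_, _, rfl⟩))
        (Submodule.mem_sup_right (op_mem_mul.2 ?_))
      rw [← hcomm]
      exact neg_mem (Submodule.smul_mem _ _ hrel'))
  have hplane := isQuantumPlane_adjoin hq hrel (by
    have := hbasis.1.comp (fun m : ℕ × ℕ => (((0, 0), m) : (ℕ × ℕ) × (ℕ × ℕ)))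
      fun _ _ h => (Prod.mk.inj h).2
    simpa [Function.comp_def] using this)
  have hgrading : subalgebraGrading ℬ A = monomialSpan k
      (⟨a, Algebra.subset_adjoin (by simp)⟩ : A) ⟨b, Algebra.subset_adjoin (by simp)⟩ := by
    ext1 n
    refine comap_eq_of_mapsTo hplane.isInternal h.isInternal Subtype.val_injective
      (fun n => ?_) n
    change monomialSpan k _ _ n ≤ (ℬ n).comap A.val.toLinearMap
    refine monomialSpan_le fun i j hij => ?_
    rw [Submodule.mem_comap, ← hij, hpow, pow_add]
    exact Submodule.mul_mem_mul (Submodule.pow_mem_pow _ ha i) (Submodule.pow_mem_pow _ hb j)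
  have hregular : IsASRegular (subalgebraGrading ℬ A) 2 := hgrading ▸ hplane.isASRegular
  have hgenerated : Algebra.adjoin k ((A : Set B) ∪ {c, d}) = ⊤ := by
    rw [eq_top_iff, ← Subalgebra.toSubmodule.le_iff_le, Algebra.top_toSubmodule, ← hbasis.2,
      Submodule.span_le]
    rintro _ ⟨m, rfl⟩
    have h1 : ∀ x ∈ ({a, b} : Set B), x ∈ Algebra.adjoin k ((A : Set B) ∪ {c, d}) := fun x hx =>
      Algebra.subset_adjoin (Or.inl (Algebra.subset_adjoin hx))
    have h2 : ∀ x ∈ ({c, d} : Set B), x ∈ Algebra.adjoin k ((A : Set B) ∪ {c, d}) := fun x hx =>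
      Algebra.subset_adjoin (Or.inr hx)
    change _ ∈ Algebra.adjoin k ((A : Set B) ∪ {c, d})
    exact mul_mem (mul_mem (pow_mem (h1 a (by simp)) _) (pow_mem (h1 b (by simp)) _))
      (mul_mem (pow_mem (h2 c (by simp)) _) (pow_mem (h2 d (by simp)) _))
  have hsq : p' • c ^ 2 ∈ ℬ (1 + 1) := by
    rw [hpow]
    exact Submodule.smul_mem _ _ (Submodule.pow_mem_pow _ hc 2)
  refine ⟨hregular, h, hregular.connected, 1, 1, one_pos, one_pos, c, hc, d, hd,
    ⟨hgenerated, ?_, ?_, ?_⟩, ⟨hgenerated, ?_, ?_, ?_⟩⟩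
  · obtain ⟨v, hv, w, hw, t, ht, he⟩ := hright _ hrel'
    refine ⟨q', p', v, hVA v hv, w, hVA w hw, t, (hVV t ht).1, hsq, hVB hv, hVB hw, (hVV t ht).2,
      ?_⟩
    rw [add_assoc, add_assoc, ← add_assoc (v * c), ← he, pow_two]
    abel
  · exact existsUnique_eq_finsupp_sum (J := ℕ × ℕ)
      (φ := fun n => LinearMap.mulRight k (c ^ n.1 * d ^ n.2) ∘ₗ A.val.toLinearMap)
      hplane.span_eq_top hbasis.1 hbasis.2
  · refine commutation_right_of_generators fun x hx y hy => ?_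
    obtain ⟨v, hv, w, hw, t, ht, he⟩ := hright (y * x) (by
      rw [hcomm]
      exact Submodule.mul_mem_mul (hYB (Submodule.subset_span hy)) (Submodule.subset_span hx))
    exact ⟨v, hVA v hv, w, hVA w hw, t, (hVV t ht).1, he⟩
  -- The left relation is the right one divided by `-q'`, with its error term rewritten from `V * ℬ
  -- 1` as an element of `ℬ 1 * V`.
  · obtain ⟨v, hv, w, hw, t, ht, he⟩ := hleft _
      ((V * ℬ 1).smul_mem (-q'⁻¹) hrel')
    refine ⟨q'⁻¹, -(q'⁻¹ * p'), v, hVA v hv, w, hVA w hw, t, (hVV t ht).1, ?_, hVB hv, hVB hw,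
      (hVV t ht).2, ?_⟩
    · rw [hpow]
      exact Submodule.smul_mem _ _ (Submodule.pow_mem_pow _ hc 2)
    · rw [add_assoc, add_assoc, ← add_assoc (c * v), ← he, pow_two]
      match_scalars <;> field_simp <;> ring
  · refine existsUnique_eq_finsupp_sum (J := ℕ × ℕ)
      (φ := fun n => LinearMap.mulLeft k (d ^ n.1 * c ^ n.2) ∘ₗ A.val.toLinearMap)
      hplane.span_eq_top' ?_ ?_
    · have := linearIndependent_of_op (z := fun m : (ℕ × ℕ) × (ℕ × ℕ) =>
        (d ^ m.1.2 * c ^ m.1.1) * (b ^ m.2.2 * a ^ m.2.1)) hbasis_op.1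
      exact this.comp (Prod.map Prod.swap Prod.swap)
        (Prod.map_injective.2 ⟨Prod.swap_injective, Prod.swap_injective⟩)
    · have := span_op_eq_top (z := fun m : (ℕ × ℕ) × (ℕ × ℕ) =>
        (d ^ m.1.2 * c ^ m.1.1) * (b ^ m.2.2 * a ^ m.2.1)) hbasis_op.2
      rw [← this, ← (Prod.map_surjective.2 ⟨Prod.swap_surjective, Prod.swap_surjective⟩ :
        Function.Surjective (Prod.map Prod.swap Prod.swap :
          (ℕ × ℕ) × (ℕ × ℕ) → (ℕ × ℕ) × (ℕ × ℕ))).range_comp]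
      rfl
  · refine commutation_left_of_generators fun x hx y hy => ?_
    obtain ⟨v, hv, w, hw, t, ht, he⟩ := hleft (x * y)
      (Submodule.mul_mem_mul (Submodule.subset_span hx) (hYB (Submodule.subset_span hy)))
    exact ⟨v, hVA v hv, w, hVA w hw, t, (hVV t ht).1, he⟩

end Construction

/-! ### From a regular quotient to a double extension. -/

section QuotientToExtension

open Module MulOpposite

variable {k : Type*} [Field k] {B : Type u} [Ring B] [Algebra k B] {ℬ : ℕ → Submodule k B}

lemma quadraticEval_split (z : Fin (2 + 2) → B) (M : Fin 4 → Fin 4 → k) :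
    ∑ i, ∑ j, M i j • (z i * z j) =
      ∑ i, ∑ j : Fin 2, M i (Fin.castAdd 2 j) • (z i * z (Fin.castAdd 2 j)) +
      ∑ i : Fin (2 + 2), ∑ j : Fin 2, M i (Fin.natAdd 2 j) • (z i * z (Fin.natAdd 2 j)) := by
  rw [← Finset.sum_add_distrib]
  exact Finset.sum_congr rfl fun i _ =>
    Fin.sum_univ_add fun j : Fin (2 + 2) => M i j • (z i * z j)

/-- The first two variables can be moved to the right if the relations restrict to multiples of a
nondegenerate form in the last two variables. -/
theorem IsLeftASRegular.span_mul_le [IsDomain B] {z : Fin (2 + 2) → B}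
    (hR : IsLeftASRegular ℬ 4)
    (hz : ∀ i, z i ∈ ℬ 1) (hindep : LinearIndependent k z)
    (hgen : Algebra.adjoin k (Set.range z) = ⊤) (w : (Fin 4 → Fin 4 → k) →ₗ[k] k)
    (hw : ∃ N ∈ quadraticRelations k z, w N ≠ 0) {G : Matrix (Fin 2) (Fin 2) k} (hG : G.det ≠ 0)
    (hblock : ∀ M ∈ quadraticRelations k z, ∀ i j : Fin 2,
      M (Fin.natAdd 2 i) (Fin.natAdd 2 j) = w M * G i j) :
    Submodule.span k (Set.range fun i : Fin 2 => z (Fin.castAdd 2 i)) * ℬ 1 ≤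
      ℬ 1 * Submodule.span k (Set.range fun i : Fin 2 => z (Fin.castAdd 2 i)) := by
  have hx : ∀ a : Fin 2, z (Fin.castAdd 2 a) ∈
      Submodule.span k (Set.range fun i : Fin 2 => z (Fin.castAdd 2 i)) :=
    fun a => Submodule.subset_span ⟨a, rfl⟩
  rw [degree_one_eq_span hR.connected hz hgen, Submodule.span_mul_span, Submodule.span_le,
    ← degree_one_eq_span hR.connected hz hgen]
  rintro _ ⟨_, ⟨a, rfl⟩, _, ⟨b, rfl⟩, rfl⟩
  refine Fin.addCases (fun b => ?_) (fun b => ?_) b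
  · exact Submodule.mul_mem_mul (hz _) (hx b)
  · obtain ⟨M, hM, hM'⟩ := hR.exists_quadraticRelation_eq_single hz hindep hgen w hw hG hblock a b
    rw [mem_quadraticRelations, quadraticEval_split] at hM
    have h1 : ∑ i : Fin (2 + 2), ∑ j : Fin 2, M i (Fin.natAdd 2 j) • (z i * z (Fin.natAdd 2 j)) =
        z (Fin.castAdd 2 a) * z (Fin.natAdd 2 b) := by
      simp only [hM']
      rw [Finset.sum_eq_single (Fin.castAdd 2 a), Finset.sum_eq_single b]
      · simp
      · intro j _ hj
        simp [hj]
      · simp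
      · intro i _ hi
        simp [hi]
      · simp
    rw [h1] at hM
    simp only [SetLike.mem_coe]
    rw [← neg_eq_of_add_eq_zero_right hM]
    exact neg_mem (Submodule.sum_mem _ fun i _ => Submodule.sum_mem _ fun j _ =>
      Submodule.smul_mem _ _ (Submodule.mul_mem_mul (hz i) (hx j)))

lemma transpose_mem_quadraticRelations_op {ι : Type*} [Fintype ι] {z : ι → B} {M : ι → ι → k} :
    M ∈ quadraticRelations k (fun i => op (z i)) ↔
      (fun i j => M j i) ∈ quadraticRelations k z := by
  have h1 : ∑ i, ∑ j, M i j • (op (z i) * op (z j)) =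
      opLinearEquiv k (∑ i, ∑ j, M j i • (z i * z j)) := by
    rw [Finset.sum_comm]
    simp only [map_sum, map_smul]
    rfl
  rw [mem_quadraticRelations, mem_quadraticRelations, h1, LinearEquiv.map_eq_zero_iff]

/-- The reverse inclusion is the one-sided result for the opposite algebra, where relations and the
form `G` are transposed. -/
theorem IsASRegular.span_mul_eq [IsDomain B] {z : Fin (2 + 2) → B} (hR : IsASRegular ℬ 4)
    (hz : ∀ i, z i ∈ ℬ 1) (hindep : LinearIndependent k z)
    (hgen : Algebra.adjoin k (Set.range z) = ⊤) (w : (Fin 4 → Fin 4 → k) →ₗ[k] k)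
    (hw : ∃ N ∈ quadraticRelations k z, w N ≠ 0) {G : Matrix (Fin 2) (Fin 2) k} (hG : G.det ≠ 0)
    (hblock : ∀ M ∈ quadraticRelations k z, ∀ i j : Fin 2,
      M (Fin.natAdd 2 i) (Fin.natAdd 2 j) = w M * G i j) :
    Submodule.span k (Set.range fun i : Fin 2 => z (Fin.castAdd 2 i)) * ℬ 1 =
      ℬ 1 * Submodule.span k (Set.range fun i : Fin 2 => z (Fin.castAdd 2 i)) := by
  refine le_antisymm (hR.isLeftASRegular.span_mul_le hz hindep hgen w hw hG hblock) ?_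
  let t : (Fin 4 → Fin 4 → k) →ₗ[k] (Fin 4 → Fin 4 → k) :=
    { toFun := fun M i j => M j i
      map_add' := fun _ _ => rfl
      map_smul' := fun _ _ => rfl }
  have key := hR.isLeftASRegular_op.span_mul_le (z := fun i => op (z i))
    (fun i => op_mem_opGrading.2 (hz i)) (linearIndependent_op hindep) (adjoin_op_eq_top hgen)
    (w ∘ₗ t) (by
      obtain ⟨N, hN, hwN⟩ := hw
      exact ⟨t N, transpose_mem_quadraticRelations_op.2 hN, hwN⟩)
    (G := G.transpose) (by rwa [Matrix.det_transpose])
    fun M hM i j => hblock (t M) (transpose_mem_quadraticRelations_op.1 hM) j i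
  have h1 : Submodule.span k (Set.range fun i : Fin 2 => op (z (Fin.castAdd 2 i))) =
      (Submodule.span k (Set.range fun i : Fin 2 => z (Fin.castAdd 2 i))).map
        (opLinearEquiv k : B ≃ₗ[k] Bᵐᵒᵖ).toLinearMap := by
    rw [Submodule.map_span, ← Set.range_comp]
    rfl
  rw [h1] at key
  exact mul_le_mul_of_op key

/-- A regular algebra of dimension four with a quadratic relation between `x₁` and `x₂` such that
the quotient by `x₁`, `x₂` is regular of dimension two is a double extension. -/
theorem IsASRegular.exists_isDoubleExtension [IsAlgClosed k] [IsDomain B] (hB : IsASRegular ℬ 4)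
    {z : Fin 4 → B} (hz : ∀ i, z i ∈ ℬ 1) (hindep : LinearIndependent k z)
    (hgen : Algebra.adjoin k (Set.range z) = ⊤) {x₁ x₂ : B} (hx₁ : x₁ ∈ ℬ 1) (hx₂ : x₂ ∈ ℬ 1)
    (hrel : HasQuadraticRelation k x₁ x₂) (hC : IsASRegular (quotientGrading k ℬ x₁ x₂) 2) :
    ∃ A : Subalgebra k B, IsASRegular (subalgebraGrading ℬ A) 2 ∧ IsDoubleExtension ℬ A := by
  have hL := hB.isLeftASRegular
  have h := hB.connected
  have hdim := hL.finrank_four hz hindep hgen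
  have hspan := degree_one_eq_span h hz hgen
  have := hL.finite_component 1
  obtain ⟨hxind, F, hF, hFrel⟩ := hrel.exists_matrix
  have hd1 : finrank k (ℬ 1) = 4 := by rw [hdim]; rfl
  have hx : ∀ i, ![x₁, x₂] i ∈ ℬ 1 := by
    simp only [Fin.forall_fin_two]
    exact ⟨hx₁, hx₂⟩
  obtain ⟨y₁, hy₁, hind₁⟩ := exists_linearIndependent_snoc hx hxind (by omega)
  have hx' : ∀ i, (Fin.snoc ![x₁, x₂] y₁ : Fin 3 → B) i ∈ ℬ 1 := fun i => by
    refine Fin.lastCases ?_ (fun j => ?_) i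
    · rwa [Fin.snoc_last]
    · rw [Fin.snoc_castSucc]
      exact hx j
  obtain ⟨y₂, hy₂, hind₂⟩ := exists_linearIndependent_snoc hx' hind₁ (by omega)
  set z' : Fin (2 + 2) → B := ![x₁, x₂, y₁, y₂] with hz'
  have hz'ind : LinearIndependent k z' := by
    convert hind₂ using 1
    ext i
    fin_cases i <;> rfl
  have hz'mem : ∀ i, z' i ∈ ℬ 1 := by
    intro i
    fin_cases i <;> assumption
  have hz'span : Submodule.span k (Set.range z') = ℬ 1 :=
    span_range_eq_of_card_eq_finrank hz'mem hz'ind hd1.symm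
  have hz'gen : Algebra.adjoin k (Set.range z') = ⊤ :=
    adjoin_eq_top_of_span_eq hgen (by rw [← hspan, hz'span])
  set V := Submodule.span k {x₁, x₂} with hV
  have hVB : V ≤ ℬ 1 := Submodule.span_le.2 (by rintro _ (rfl | rfl) <;> assumption)
  have hE : ℬ 1 = V ⊔ Submodule.span k {y₁, y₂} := by
    rw [← hz'span, hV, ← Submodule.span_union]
    congr 1
    rw [hz']
    simp only [Matrix.range_cons, Matrix.range_empty, Set.union_empty]
    ext x
    simp
    tauto
  have hVrange : Submodule.span k (Set.range fun i : Fin 2 => z' (Fin.castAdd 2 i)) = V := by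
    rw [hV, ← Matrix.range_cons_cons_empty x₁ x₂ ![]]
    congr 2
    ext i
    fin_cases i <;> rfl
  set π := quotientByPairMk k x₁ x₂ with hπ
  have hker : ∀ b, π b = 0 → natComponent h.isInternal 1 b ∈ V ∧
      natComponent h.isInternal 2 b ∈ V * ℬ 1 ⊔ ℬ 1 * V := fun b hb =>
    natComponent_mem_of_mem_top_mul h hVB (exists_eq_of_quotientByPairMk_eq_zero hb)
  have hπx : ∀ i : Fin 2, π (z' (Fin.castAdd 2 i)) = 0 := fun i => by
    fin_cases i
    · exact quotientByPairMk_left x₁ x₂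
    · exact quotientByPairMk_right x₁ x₂
  have hπind : LinearIndependent k fun i : Fin 2 => π (z' (Fin.natAdd 2 i)) := by
    rw [Fintype.linearIndependent_iff]
    intro g hg
    have h1 : π (∑ i, g i • z' (Fin.natAdd 2 i)) = 0 := by
      rw [map_sum, ← hg]
      simp only [map_smul]
    have h2 := (hker _ h1).1
    rw [natComponent_of_mem _ (Submodule.sum_mem _ fun i _ => Submodule.smul_mem _ _ (hz'mem _)),
      ← hVrange] at h2
    obtain ⟨c, hc⟩ := (Submodule.mem_span_range_iff_exists_fun k).1 h2
    have h3 := Fintype.linearIndependent_iff.1 hz'ind (Fin.addCases (fun i => -c i) g) (by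
      rw [Fin.sum_univ_add]
      simp only [Fin.addCases_left, Fin.addCases_right, neg_smul, Finset.sum_neg_distrib, hc]
      exact neg_add_cancel _)
    intro i
    have h4 := h3 (Fin.natAdd 2 i)
    rwa [Fin.addCases_right] at h4
  have hπgen : Algebra.adjoin k (Set.range fun i : Fin 2 => π (z' (Fin.natAdd 2 i))) = ⊤ := by
    have h1 : (Algebra.adjoin k (Set.range z')).map π = ⊤ := by
      rw [hz'gen, Algebra.map_top]
      exact (AlgHom.range_eq_top _).2 (quotientByPairMk_surjective x₁ x₂)
    rw [AlgHom.map_adjoin] at h1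
    rw [eq_top_iff, ← h1]
    refine Algebra.adjoin_le ?_
    rintro _ ⟨_, ⟨i, rfl⟩, rfl⟩
    refine Fin.addCases (fun i => ?_) (fun i => ?_) i
    · rw [SetLike.mem_coe]
      erw [hπx]
      exact zero_mem _
    · exact Algebra.subset_adjoin ⟨i, rfl⟩
  obtain ⟨G, hG, hGrel, hGuniq⟩ := hC.isLeftASRegular.exists_quadraticRelations_eq
    (fun i => Submodule.mem_map_of_mem (hz'mem (Fin.natAdd 2 i))) hπind hπgen
  obtain ⟨i₀, j₀, hij⟩ : ∃ i j, G i j ≠ 0 := by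
    by_contra! h0
    have : G = 0 := Matrix.ext h0
    exact hG (by rw [this, Matrix.det_zero])
  -- The block of a relation is some multiple of `G`; dividing one entry by a nonzero entry of `G`
  -- makes that multiple a linear functional.
  let w : (Fin 4 → Fin 4 → k) →ₗ[k] k := (G i₀ j₀)⁻¹ •
    (LinearMap.proj (Fin.natAdd 2 j₀ : Fin (2 + 2)) ∘ₗ
      (LinearMap.proj (Fin.natAdd 2 i₀ : Fin (2 + 2)) : (Fin 4 → Fin 4 → k) →ₗ[k] (Fin 4 → k)))
  have hwapp : ∀ M, w M = (G i₀ j₀)⁻¹ *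
      M (Fin.natAdd 2 i₀ : Fin (2 + 2)) (Fin.natAdd 2 j₀ : Fin (2 + 2)) := fun M => rfl
  have hblock : ∀ M ∈ quadraticRelations k z', ∀ i j : Fin 2,
      M (Fin.natAdd 2 i) (Fin.natAdd 2 j) = w M * G i j := by
    intro M hM
    have h1 : (fun i j : Fin 2 => M (Fin.natAdd 2 i) (Fin.natAdd 2 j)) ∈
        quadraticRelations k fun i : Fin 2 => π (z' (Fin.natAdd 2 i)) := by
      rw [mem_quadraticRelations] at hM ⊢
      have h2 := congrArg π hM
      simp only [map_sum, map_smul, map_mul, map_zero] at h2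
      simp only [Fin.sum_univ_add, hπx, zero_mul, mul_zero, smul_zero, Finset.sum_const_zero,
        zero_add] at h2
      exact h2
    obtain ⟨c, hc⟩ := hGuniq _ h1
    have h2 : ∀ i j : Fin 2, M (Fin.natAdd 2 i) (Fin.natAdd 2 j) = c * G i j := fun i j =>
      congrFun (congrFun hc i) j
    intro i j
    rw [hwapp, h2, h2]
    field_simp
  set g : B := ∑ i, ∑ j, G i j • (z' (Fin.natAdd 2 i) * z' (Fin.natAdd 2 j)) with hg
  have hgmem : g ∈ V * ℬ 1 ⊔ ℬ 1 * V := by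
    have h1 : π g = 0 := by
      rw [hg]
      simp only [map_sum, map_smul, map_mul]
      exact mem_quadraticRelations.1 hGrel
    have h2 := (hker g h1).2
    rwa [natComponent_of_mem] at h2
    rw [degree_succ_eq_mul h hz'mem hz'gen]
    exact Submodule.sum_mem _ fun i _ => Submodule.sum_mem _ fun j _ => Submodule.smul_mem _ _
      (Submodule.mul_mem_mul (hz'mem _) (hz'mem _))
  -- The relation of the quotient holds in `B` modulo `V * ℬ 1 + ℬ 1 * V`, whose elements are
  -- represented by tensors on which `w` vanishes. The difference of the two representatives of `g`
  -- is a relation of `B` with value `1`.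
  have hw : ∃ N ∈ quadraticRelations k z', w N ≠ 0 := by
    have hsub : V * ℬ 1 ⊔ ℬ 1 * V ≤ (LinearMap.ker w).map (quadraticEval k z') := by
      have hsingle : ∀ i j : Fin (2 + 2), quadraticEval k z' (Pi.single i (Pi.single j 1)) =
          z' i * z' j := fun i j => by
        rw [quadraticEval_apply, Finset.sum_eq_single i, Finset.sum_eq_single j]
        · simp
        · intro b _ hb
          simp [hb]
        · simp
        · intro b _ hb
          simp [hb]
        · simp
      rw [← hz'span, ← hVrange, Submodule.span_mul_span, Submodule.span_mul_span, sup_le_iff,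
        Submodule.span_le, Submodule.span_le]
      constructor
      · rintro _ ⟨_, ⟨i, rfl⟩, _, ⟨j, rfl⟩, rfl⟩
        refine ⟨_, ?_, hsingle _ _⟩
        rw [SetLike.mem_coe, LinearMap.mem_ker, hwapp]
        have : (Fin.natAdd 2 i₀ : Fin (2 + 2)) ≠ Fin.castAdd 2 i := by
          simp [Fin.ext_iff]; omega
        rw [Pi.single_eq_of_ne this]
        simp
      · rintro _ ⟨_, ⟨i, rfl⟩, _, ⟨j, rfl⟩, rfl⟩
        refine ⟨_, ?_, hsingle _ _⟩
        rw [SetLike.mem_coe, LinearMap.mem_ker, hwapp]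
        have : (Fin.natAdd 2 j₀ : Fin (2 + 2)) ≠ Fin.castAdd 2 j := by
          simp [Fin.ext_iff]; omega
        by_cases hi : (Fin.natAdd 2 i₀ : Fin (2 + 2)) = i
        · subst hi
          rw [Pi.single_eq_same, Pi.single_eq_of_ne this, mul_zero]
        · rw [Pi.single_eq_of_ne hi]
          simp
    obtain ⟨N, hN, hNg⟩ := hsub hgmem
    let M : Fin (2 + 2) → Fin (2 + 2) → k := Fin.addCases (motive := fun _ => Fin (2 + 2) → k)
      (fun _ _ => 0) fun i => Fin.addCases (motive := fun _ => k) (fun _ => 0) (G i)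
    have hM₁ : ∀ i j, M (Fin.castAdd 2 i) j = 0 := fun i j =>
      congrFun (Fin.addCases_left (motive := fun _ => Fin (2 + 2) → k) i) j
    have hM₂ : ∀ i j, M (Fin.natAdd 2 i) (Fin.castAdd 2 j) = 0 := fun i j =>
      (congrFun (Fin.addCases_right (motive := fun _ => Fin (2 + 2) → k) i) _).trans
        (Fin.addCases_left (motive := fun _ => k) j)
    have hM₃ : ∀ i j, M (Fin.natAdd 2 i) (Fin.natAdd 2 j) = G i j := fun i j =>
      (congrFun (Fin.addCases_right (motive := fun _ => Fin (2 + 2) → k) i) _).trans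
        (Fin.addCases_right (motive := fun _ => k) j)
    have hM : quadraticEval k z' M = g := by
      rw [quadraticEval_apply, hg]
      clear_value M
      simp only [Fin.sum_univ_add, hM₁, hM₂, hM₃, zero_smul, Finset.sum_const_zero, zero_add]
    refine ⟨M - N, ?_, ?_⟩
    · rw [quadraticRelations, LinearMap.mem_ker, map_sub, hM, hNg, sub_self]
    · have hwM : w M = 1 := by
        rw [hwapp]
        exact (congrArg _ (hM₃ i₀ j₀)).trans (inv_mul_cancel₀ hij)
      rw [map_sub, LinearMap.mem_ker.1 hN, sub_zero, hwM]
      exact one_ne_zero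
  have hcomm : V * ℬ 1 = ℬ 1 * V := by
    have := hB.span_mul_eq hz'mem hz'ind hz'gen w hw hG hblock
    rwa [hVrange] at this
  obtain ⟨a, b, hab, γ, q, p, hγ, hq, hnf⟩ := exists_normal_form hF x₁ x₂
  obtain ⟨c, d, hcd, γ', q', p', hγ', hq', hnf'⟩ := exists_normal_form hG y₁ y₂
  have hpow := degree_eq_pow h hz hgen
  refine ⟨_, isDoubleExtension_of_commutation (a := a) (b := b) (c := c) (d := d) (p := p)
    (p' := p') h hpow hdim (by rw [hab, hcd, hE]) (by rw [hab, hcomm]) hq ?_ hq' ?_⟩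
  · rw [mem_quadraticRelations.1 hFrel] at hnf
    have := (smul_eq_zero.1 hnf.symm).resolve_left hγ
    rwa [sub_sub, sub_eq_zero] at this
  · have h1 : g = γ' • (d * c - q' • (c * d) - p' • (c * c)) := by
      rw [← hnf', hg]
      simp [Fin.sum_univ_two, hz']
    -- Normality of `V` collapses the two error spaces into `V * ℬ 1`, as the construction requires.
    rw [← hcomm, sup_idem, h1] at hgmem
    rw [hab]
    exact (Submodule.smul_mem_iff _ hγ').1 hgmem

end QuotientToExtension

/-! ### Free modules over a graded subalgebra. -/

section LeftBasis

open Module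

variable {k : Type*} [Field k] {B : Type u} [Ring B] [Algebra k B] {ℬ : ℕ → Submodule k B}
variable {A : Subalgebra k B} {J : Type*} {w : J → B}

/-- The isomorphism `A^(J) ≃ B` of a free left `A`-module `B` with basis `w`. -/
def leftBasisEquiv (hw : ∀ b : B, ∃! c : J →₀ A, b = c.sum fun j a => (a : B) * w j) :
    (J →₀ A) ≃ₗ[k] B :=
  LinearEquiv.ofBijective
    (Finsupp.lsum k fun j => LinearMap.mulRight k (w j) ∘ₗ A.val.toLinearMap)
    ⟨fun c c' h => by
      obtain ⟨c₀, -, h₀⟩ := hw (c.sum fun j a => (a : B) * w j)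
      exact (h₀ c rfl).trans (h₀ c' h).symm,
    fun b => by
      obtain ⟨c₀, h₀, -⟩ := hw b
      exact ⟨c₀, h₀.symm⟩⟩

variable (hw : ∀ b : B, ∃! c : J →₀ A, b = c.sum fun j a => (a : B) * w j)

lemma leftBasisEquiv_apply (c : J →₀ A) :
    leftBasisEquiv hw c = c.sum fun j a => (a : B) * w j := rfl

lemma leftBasisEquiv_single (j : J) (a : A) :
    leftBasisEquiv hw (Finsupp.single j a) = (a : B) * w j := by
  rw [leftBasisEquiv_apply, Finsupp.sum_single_index]
  simp

/-- The coefficient of `w j` in the expansion of an element of `B`. -/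
def leftCoeff (j : J) : B →ₗ[k] A := Finsupp.lapply j ∘ₗ (leftBasisEquiv hw).symm.toLinearMap

lemma leftCoeff_apply (j : J) (b : B) : leftCoeff hw j b = (leftBasisEquiv hw).symm b j := rfl

lemma leftCoeff_mul_same (j : J) (a : A) : leftCoeff hw j (a * w j) = a := by
  rw [leftCoeff_apply, ← leftBasisEquiv_single hw, LinearEquiv.symm_apply_apply,
    Finsupp.single_eq_same]

lemma leftCoeff_mul_of_ne {i j : J} (hij : i ≠ j) (a : A) : leftCoeff hw i (a * w j) = 0 := by
  rw [leftCoeff_apply, ← leftBasisEquiv_single hw, LinearEquiv.symm_apply_apply,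
    Finsupp.single_eq_of_ne hij]

lemma exists_eq_sum_leftCoeff (b : B) : ∃ s : Finset J,
    (∀ j, leftCoeff hw j b ≠ 0 → j ∈ s) ∧ b = ∑ j ∈ s, (leftCoeff hw j b : B) * w j := by
  refine ⟨((leftBasisEquiv hw).symm b).support, fun j hj => Finsupp.mem_support_iff.2 hj, ?_⟩
  conv_lhs => rw [← (leftBasisEquiv hw).apply_symm_apply b]
  rfl

lemma leftCoeff_mul (j : J) (a : A) (b : B) :
    leftCoeff hw j (a * b) = a * leftCoeff hw j b := by
  classical
  obtain ⟨s, hs, hb⟩ := exists_eq_sum_leftCoeff hw b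
  have h1 : (a : B) * b = ∑ i ∈ s, ((a * leftCoeff hw i b : A) : B) * w i := by
    conv_lhs => rw [hb]
    rw [Finset.mul_sum]
    exact Finset.sum_congr rfl fun i _ => (mul_assoc _ _ _).symm
  rw [h1, map_sum]
  by_cases hj : j ∈ s
  · rw [Finset.sum_eq_single_of_mem j hj fun i _ hij => leftCoeff_mul_of_ne hw hij.symm _,
      leftCoeff_mul_same]
  · rw [Finset.sum_eq_zero fun i hi => leftCoeff_mul_of_ne hw (by rintro rfl; exact hj hi) _]
    have : leftCoeff hw j b = 0 := by
      by_contra h0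
      exact hj (hs j h0)
    rw [this, mul_zero]

lemma natComponent_mem_of_isInternal (h : DirectSum.IsInternal ℬ)
    (hA : DirectSum.IsInternal (subalgebraGrading ℬ A)) {a : B} (ha : a ∈ A) (n : ℕ) :
    natComponent h n a ∈ A := by
  obtain ⟨s, hs, hsum⟩ := exists_sum_natComponent hA ⟨a, ha⟩
  have h1 : a = ∑ m ∈ s, ((natComponent hA m ⟨a, ha⟩ : A) : B) := by
    have := congrArg A.val hsum
    rw [map_sum] at this
    exact this.symm
  have h2 : ∀ m, ((natComponent hA m ⟨a, ha⟩ : A) : B) ∈ ℬ m := fun m => natComponent_mem hA m _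
  rw [h1, map_sum]
  refine sum_mem fun m _ => ?_
  by_cases hm : m = n
  · subst hm
    rw [natComponent_of_mem h (h2 m)]
    exact Subtype.property _
  · rw [natComponent_of_mem_ne h (h2 m) hm]
    exact zero_mem _

lemma intComponent_mem_of_isInternal (h : IsConnectedGraded ℬ)
    (hA : DirectSum.IsInternal (subalgebraGrading ℬ A)) {a : B} (ha : a ∈ A) (n : ℤ) :
    intComponent h n a ∈ A := by
  by_cases hn : 0 ≤ n
  · lift n to ℕ using hn
    rw [intComponent_natCast]
    exact natComponent_mem_of_isInternal h.isInternal hA ha n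
  · rw [intComponent_of_neg h (not_le.1 hn)]
    exact zero_mem _

variable {deg : J → ℕ}

/-- The coefficients of a homogeneous element are homogeneous. -/
theorem leftCoeff_mem_intGrading (h : IsConnectedGraded ℬ)
    (hA : DirectSum.IsInternal (subalgebraGrading ℬ A)) (hdeg : ∀ j, w j ∈ ℬ (deg j)) {m : ℕ}
    {b : B} (hb : b ∈ ℬ m) (j : J) : (leftCoeff hw j b : B) ∈ intGrading ℬ (m - deg j) := by
  classical
  obtain ⟨s, hs, hbs⟩ := exists_eq_sum_leftCoeff hw b
  -- Replacing each coefficient by its component of the expected degree still expands `b`, so by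
  -- uniqueness nothing was removed.
  let a : J → A := fun i => ⟨intComponent h (m - deg i) (leftCoeff hw i b),
    intComponent_mem_of_isInternal h hA (Subtype.property _) _⟩
  have h1 : b = ∑ i ∈ s, (a i : B) * w i := by
    have h2 : intComponent h m b = b := intComponent_of_mem h (by rwa [intGrading_natCast])
    rw [← h2]
    conv_lhs => rw [hbs]
    rw [map_sum]
    refine Finset.sum_congr rfl fun i _ => ?_
    rw [intComponent_mul_right h (i := deg i) (by rw [intGrading_natCast]; exact hdeg i)]
  by_cases hj : j ∈ s
  · have h2 : leftCoeff hw j b = a j := by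
      conv_lhs => rw [h1]
      rw [map_sum, Finset.sum_eq_single_of_mem j hj
        fun i _ hij => leftCoeff_mul_of_ne hw hij.symm _, leftCoeff_mul_same]
    rw [h2]
    exact intComponent_mem h _ _
  · have : leftCoeff hw j b = 0 := by
      by_contra h0
      exact hj (hs j h0)
    rw [this]
    exact zero_mem _

/-- The dimensions of the components of a free graded module over a graded subalgebra. -/
theorem finrank_eq_sum_of_leftBasis
    (hw : ∀ b : B, ∃! c : J →₀ A, b = c.sum fun j a => (a : B) * w j) (h : IsConnectedGraded ℬ)
    (hA : DirectSum.IsInternal (subalgebraGrading ℬ A)) (hfin : ∀ n, Module.Finite k (ℬ n))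
    (hdeg : ∀ j, w j ∈ ℬ (deg j)) (m : ℕ) (t : Finset J) (ht : ∀ j, j ∈ t ↔ deg j ≤ m) :
    finrank k (ℬ m) =
      ∑ j ∈ t, finrank k (ℬ (m - deg j) ⊓ Subalgebra.toSubmodule A : Submodule k B) := by
  classical
  have := h.gradedMonoid
  let X : t → Submodule k B := fun j => ℬ (m - deg j) ⊓ Subalgebra.toSubmodule A
  let Ψ : (∀ j : t, X j) →ₗ[k] B :=
    ∑ j : t, LinearMap.mulRight k (w j) ∘ₗ (X j).subtype ∘ₗ LinearMap.proj j
  have hΨ : ∀ x, Ψ x = ∑ j : t, (x j : B) * w j := fun x => by simp [Ψ]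
  have hcoeff : ∀ x (j : t), (leftCoeff hw j (Ψ x) : B) = x j := fun x j => by
    have h1 : Ψ x = ∑ i : t, ((⟨x i, (x i).2.2⟩ : A) : B) * w i := hΨ x
    rw [h1, map_sum, Finset.sum_eq_single_of_mem j (Finset.mem_univ j)
      fun i _ hij => leftCoeff_mul_of_ne hw (fun h0 => hij (Subtype.ext h0.symm)) _,
      leftCoeff_mul_same]
  have hinj : Function.Injective Ψ := fun x x' hxx => by
    ext j
    rw [← hcoeff, ← hcoeff, hxx]
  have hrange : LinearMap.range Ψ = ℬ m := by
    apply le_antisymm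
    · rintro _ ⟨x, rfl⟩
      rw [hΨ]
      refine Submodule.sum_mem _ fun j _ => ?_
      have h1 := SetLike.GradedMul.mul_mem (x j).2.1 (hdeg j)
      rwa [Nat.sub_add_cancel ((ht j).1 j.2)] at h1
    · intro b hb
      have hmem := leftCoeff_mem_intGrading hw h hA hdeg hb
      refine ⟨fun j => ⟨leftCoeff hw j b, ?_, Subtype.property _⟩, ?_⟩
      · have h1 := hmem j
        rwa [← Nat.cast_sub ((ht j).1 j.2), intGrading_natCast] at h1
      · obtain ⟨s, hs, hbs⟩ := exists_eq_sum_leftCoeff hw b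
        rw [hΨ]
        conv_rhs => rw [hbs]
        rw [Finset.sum_coe_sort t fun j => (leftCoeff hw j b : B) * w j]
        have hzero : ∀ j, leftCoeff hw j b = 0 → (leftCoeff hw j b : B) * w j = 0 :=
          fun j hj => by rw [hj, ZeroMemClass.coe_zero, zero_mul]
        rw [Finset.sum_subset (Finset.subset_union_left (s₁ := t) (s₂ := s)) fun j _ hj => ?_,
          Finset.sum_subset (Finset.subset_union_right (s₁ := t) (s₂ := s)) fun j _ hj => ?_]
        · by_contra h0
          exact hj (hs j fun h1 => h0 (hzero j h1))
        · have h1 := hmem j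
          rw [intGrading_of_neg (by have := (ht j).not.1 hj; omega), Submodule.mem_bot] at h1
          rw [h1, zero_mul]
  have hXfin : ∀ j, Module.Finite k (X j) := fun j => by
    have := hfin (m - deg j)
    exact Submodule.finiteDimensional_inf_left _ _
  rw [← hrange, LinearMap.finrank_range_of_inj hinj, Module.finrank_pi_fintype,
    Finset.sum_coe_sort t fun j =>
      finrank k (ℬ (m - deg j) ⊓ Subalgebra.toSubmodule A : Submodule k B)]

end LeftBasis

/-! ### Excluding a single adjoined element of degree one. -/

section Degrees

open Module

variable {k : Type*} [Field k] {B : Type u} [Ring B] [Algebra k B] {ℬ : ℕ → Submodule k B}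
variable {A : Subalgebra k B} {J : Type*} {w : J → B} {deg : J → ℕ}

lemma eq_sum_leftCoeff_of_mem (hw : ∀ b : B, ∃! c : J →₀ A, b = c.sum fun j a => (a : B) * w j)
    (h : IsConnectedGraded ℬ)
    (hA : DirectSum.IsInternal (subalgebraGrading ℬ A)) (hdeg : ∀ j, w j ∈ ℬ (deg j)) {m : ℕ}
    {b : B} (hb : b ∈ ℬ m) (t : Finset J) (ht : ∀ j, j ∈ t ↔ deg j ≤ m) :
    (∀ j ∈ t, (leftCoeff hw j b : B) ∈ ℬ (m - deg j)) ∧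
      b = ∑ j ∈ t, (leftCoeff hw j b : B) * w j := by
  classical
  have hmem := leftCoeff_mem_intGrading hw h hA hdeg hb
  refine ⟨fun j hj => ?_, ?_⟩
  · have h1 := hmem j
    rwa [← Nat.cast_sub ((ht j).1 hj), intGrading_natCast] at h1
  · obtain ⟨s, hs, hbs⟩ := exists_eq_sum_leftCoeff hw b
    conv_lhs => rw [hbs]
    have hzero : ∀ j, leftCoeff hw j b = 0 → (leftCoeff hw j b : B) * w j = 0 :=
      fun j hj => by rw [hj, ZeroMemClass.coe_zero, zero_mul]
    rw [Finset.sum_subset (Finset.subset_union_left (s₁ := t) (s₂ := s)) fun j _ hj => ?_,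
      Finset.sum_subset (Finset.subset_union_right (s₁ := t) (s₂ := s)) fun j _ hj => ?_]
    · by_contra h0
      exact hj (hs j fun h1 => h0 (hzero j h1))
    · have h1 := hmem j
      rw [intGrading_of_neg (by have := (ht j).not.1 hj; omega), Submodule.mem_bot] at h1
      rw [h1, zero_mul]

lemma leftCoeff_self (hw : ∀ b : B, ∃! c : J →₀ A, b = c.sum fun j a => (a : B) * w j) (j : J) :
    leftCoeff hw j (w j) = 1 := by
  have := leftCoeff_mul_same hw j 1
  rwa [OneMemClass.coe_one, one_mul] at this

lemma notMem_of_leftBasis [Nontrivial B]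
    (hw : ∀ b : B, ∃! c : J →₀ A, b = c.sum fun j a => (a : B) * w j) {j₀ j : J}
    (h0 : w j₀ = 1) (hj : j ≠ j₀) : w j ∉ A := fun h => by
  have h1 := leftCoeff_mul_of_ne hw hj ⟨w j, h⟩
  rw [h0, mul_one] at h1
  have h2 := (leftCoeff_self hw j).symm.trans h1
  exact one_ne_zero (congrArg Subtype.val h2)

lemma mul_mem_span_of_mem_zero (h : IsConnectedGraded ℬ) {c y : B} (hc : c ∈ ℬ 0) :
    c * y ∈ Submodule.span k {y} := by
  rw [h.zero_eq] at hc
  obtain ⟨s, rfl⟩ := Submodule.mem_one.1 hc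
  rw [← Algebra.smul_def]
  exact Submodule.smul_mem _ _ (Submodule.mem_span_singleton_self y)

lemma mul_self_le_of_le (h : IsConnectedGraded ℬ) {U : Submodule k B}
    (hU : U ≤ ℬ 1 ⊓ Subalgebra.toSubmodule A) :
    U * U ≤ ℬ 2 ⊓ Subalgebra.toSubmodule A := Submodule.mul_le.2 fun x hx y hy => by
  have := h.gradedMonoid
  exact ⟨SetLike.GradedMul.mul_mem (hU hx).1 (hU hy).1, A.mul_mem (hU hx).2 (hU hy).2⟩

theorem IsLeftASRegular.six_le_finrank_mul_self_of_finrank_eq [IsAlgClosed k] [IsDomain B]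
    (hR : IsLeftASRegular ℬ 4) {z : Fin 4 → B} (hz : ∀ i, z i ∈ ℬ 1)
    (hindep : LinearIndependent k z) (hgen : Algebra.adjoin k (Set.range z) = ⊤)
    {U : Submodule k B} (hU : U ≤ ℬ 1) (hU3 : finrank k U = 3) :
    6 ≤ finrank k (U * U : Submodule k B) := by
  have hfin1 := hR.finite_component 1
  have hfin : Module.Finite k U := Submodule.finiteDimensional_of_le hU
  have hd1 : finrank k (ℬ 1) = 4 := by rw [hR.finrank_four hz hindep hgen]; rfl
  let b := Module.finBasisOfFinrankEq k U hU3
  have hb : LinearIndependent k fun i => (b i : B) :=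
    b.linearIndependent.map' U.subtype (Submodule.ker_subtype U)
  obtain ⟨y, hy, hby⟩ := exists_linearIndependent_snoc (fun i => hU (b i).2) hb (by omega)
  set z' : Fin 4 → B := Fin.snoc (fun i => (b i : B)) y with hz'
  have hz'0 : ∀ i : Fin 3, z' i.castSucc = b i := fun i => by
    rw [hz']
    exact Fin.snoc_castSucc (α := fun _ => B) _ _ _
  have hz'1 : z' (Fin.last 3) = y := by
    rw [hz']
    exact Fin.snoc_last (α := fun _ => B) _ _
  have hz'mem : ∀ i, z' i ∈ ℬ 1 := fun i => by
    refine Fin.lastCases ?_ (fun j => ?_) i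
    · rwa [hz'1]
    · rw [hz'0]
      exact hU (b j).2
  have hz'span := span_range_eq_of_card_eq_finrank hz'mem hby hd1.symm
  refine hR.six_le_finrank_mul_self hz'mem hby (adjoin_eq_top_of_span_eq hgen ?_) ?_
  · rw [hz'span, degree_one_eq_span hR.connected hz hgen]
  · simp only [hz'0]
    exact (span_range_eq_of_card_eq_finrank (fun i => (b i).2) hb hU3.symm).symm

/-- If `y U ⊆ U y + U²`, then the algebra generated by `U` and `y` is spanned over a subalgebra
containing `U` by the powers of `y`. -/
theorem mul_span_pow_eq_top {z : J → B} (hgen : Algebra.adjoin k (Set.range z) = ⊤)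
    {U : Submodule k B} {y : B} (hU : U ≤ Subalgebra.toSubmodule A)
    (hz : ∀ i, z i ∈ U ⊔ Submodule.span k {y})
    (hcomm : Submodule.span k {y} * U ≤ U * Submodule.span k {y} ⊔ U * U) :
    Subalgebra.toSubmodule A * Submodule.span k (Set.range fun i : ℕ => y ^ i) = ⊤ := by
  set D := 1 ⊔ Submodule.span k {y} with hD
  have h1D : (1 : Submodule k B) ≤ D := le_sup_left
  have hyD : Submodule.span k {y} ≤ D := le_sup_right
  -- With `D = k + k y`, this lets a factor of `U` pass to the left through `D ^ n` until `A`
  -- absorbs it. The union of the spaces `A * D ^ n` is then stable under right multiplication by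
  -- all generators, hence everything.
  have hDU : D * U ≤ U * D ⊔ U * U := by
    rw [hD, Submodule.sup_mul, one_mul]
    refine sup_le ?_ (hcomm.trans (sup_le_sup_right (mul_le_mul_right hyD U) _))
    exact le_sup_of_le_left (by simpa using mul_le_mul_right h1D U)
  have hAU : Subalgebra.toSubmodule A * U ≤ Subalgebra.toSubmodule A :=
    Submodule.mul_le.2 fun x hx u hu => A.mul_mem hx (hU hu)
  have hstep : ∀ n, Subalgebra.toSubmodule A * D ^ n * U ≤ Subalgebra.toSubmodule A * D ^ n := by
    intro n
    induction n with
    | zero => simpa using hAU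
    | succ n ih =>
      rw [pow_succ, mul_assoc, mul_assoc (D ^ n)]
      refine (mul_le_mul_right (mul_le_mul_right hDU _) _).trans ?_
      rw [Submodule.mul_sup, Submodule.mul_sup, sup_le_iff]
      constructor
      · rw [← mul_assoc, ← mul_assoc, ← mul_assoc]
        exact mul_le_mul_left ih D
      · rw [← mul_assoc, ← mul_assoc, ← mul_assoc]
        refine (mul_le_mul_left ih U).trans (ih.trans ?_)
        simpa using mul_le_mul_right h1D (Subalgebra.toSubmodule A * D ^ n)
  have hS : ⨆ n, Subalgebra.toSubmodule A * D ^ n = ⊤ := by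
    have hU' : ∀ x ∈ ⨆ n, Subalgebra.toSubmodule A * D ^ n, ∀ u ∈ U ⊔ Submodule.span k {y},
        x * u ∈ ⨆ n, Subalgebra.toSubmodule A * D ^ n := by
      intro x hx u hu
      have h1 : (⨆ n, Subalgebra.toSubmodule A * D ^ n) * (U ⊔ Submodule.span k {y}) ≤
          ⨆ n, Subalgebra.toSubmodule A * D ^ n := by
        rw [Submodule.iSup_mul]
        refine iSup_le fun n => ?_
        rw [Submodule.mul_sup, sup_le_iff]
        refine ⟨(hstep n).trans (le_iSup (fun n => Subalgebra.toSubmodule A * D ^ n) n),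
          le_trans ?_ (le_iSup (fun n => Subalgebra.toSubmodule A * D ^ n) (n + 1))⟩
        rw [pow_succ, ← mul_assoc]
        exact mul_le_mul_right hyD _
      exact h1 (Submodule.mul_mem_mul hx hu)
    rw [eq_top_iff]
    rintro b -
    have h1 : (1 : B) ∈ ⨆ n, Subalgebra.toSubmodule A * D ^ n :=
      Submodule.mem_iSup_of_mem 0 (by simp)
    have h2 : ∀ x ∈ ⨆ n, Subalgebra.toSubmodule A * D ^ n,
        x * b ∈ ⨆ n, Subalgebra.toSubmodule A * D ^ n := by
      have hb : b ∈ Algebra.adjoin k (Set.range z) := hgen ▸ Algebra.mem_top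
      induction hb using Algebra.adjoin_induction with
      | mem b hb =>
        obtain ⟨i, rfl⟩ := hb
        exact fun x hx => hU' x hx _ (hz i)
      | algebraMap c =>
        intro x hx
        rw [← Algebra.commutes, ← Algebra.smul_def]
        exact Submodule.smul_mem _ _ hx
      | add b b' _ _ hb hb' =>
        intro x hx
        rw [mul_add]
        exact add_mem (hb x hx) (hb' x hx)
      | mul b b' _ _ hb hb' =>
        intro x hx
        rw [← mul_assoc]
        exact hb' _ (hb x hx)
    simpa using h2 1 h1
  rw [eq_top_iff, ← hS]
  refine iSup_le fun n => mul_le_mul_right ?_ _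
  induction n with
  | zero =>
    rw [pow_zero, Submodule.one_le]
    exact Submodule.subset_span ⟨0, pow_zero y⟩
  | succ n ih =>
    rw [pow_succ]
    refine (mul_le_mul_left ih D).trans ?_
    rw [hD, Submodule.mul_sup, mul_one, Submodule.span_mul_span, sup_le_iff, Submodule.span_le,
      Submodule.span_le]
    refine ⟨Submodule.subset_span, ?_⟩
    rintro _ ⟨_, ⟨i, rfl⟩, y', hy', rfl⟩
    rw [Set.mem_singleton_iff.1 hy']
    exact Submodule.subset_span ⟨i + 1, pow_succ y i⟩

/-- There is no double extension with exactly one of the new generators in degree one. -/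
theorem IsLeftASRegular.false_of_degrees [IsAlgClosed k] [IsDomain B]
    (hR : IsLeftASRegular ℬ 4) {z : Fin 4 → B} (hz : ∀ i, z i ∈ ℬ 1)
    (hindep : LinearIndependent k z) (hgen : Algebra.adjoin k (Set.range z) = ⊤)
    (hA : DirectSum.IsInternal (subalgebraGrading ℬ A))
    (hw : ∀ b : B, ∃! c : J →₀ A, b = c.sum fun j a => (a : B) * w j)
    (hdeg : ∀ j, w j ∈ ℬ (deg j)) {j₀ j₁ j₂ j' : J} {y : B}
    (h0 : w j₀ = 1) (h1 : w j₁ = y) (hpow : ∀ i, ∃ j, j ≠ j' ∧ w j = y ^ i)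
    (hj01 : j₀ ≠ j₁) (hj02 : j₀ ≠ j₂) (hj12 : j₁ ≠ j₂) (hj0 : j₀ ≠ j') (hj1 : j₁ ≠ j')
    (hj2 : j₂ ≠ j') (hd0 : deg j₀ = 0) (hd1 : deg j₁ = 1) (hd2 : deg j₂ = 2)
    (hd' : 2 ≤ deg j') (hd : ∀ j, deg j ≤ 2 → j = j₀ ∨ j = j₁ ∨ j = j₂ ∨ j = j')
    (hcomm : ∀ a ∈ A, ∃ a₁ ∈ A, ∃ a' ∈ A, ∃ a₀ ∈ A, y * a = a₁ * w j₁ + a' * w j' + a₀) :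
    False := by
  classical
  have h := hR.connected
  have := h.gradedMonoid
  have hdim := hR.finrank_four hz hindep hgen
  have hf := finrank_eq_sum_of_leftBasis hw h hA hR.finite_component hdeg
  have hA0 : finrank k (ℬ 0 ⊓ Subalgebra.toSubmodule A : Submodule k B) = 1 := by
    have : ℬ 0 ≤ Subalgebra.toSubmodule A := by
      rw [h.zero_eq, Submodule.one_le]
      exact A.one_mem
    rw [inf_eq_left.2 this, hdim]
    rfl
  have ht1 : ∀ j, j ∈ ({j₀, j₁} : Finset J) ↔ deg j ≤ 1 := fun j => by
    rw [Finset.mem_insert, Finset.mem_singleton]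
    constructor
    · rintro (rfl | rfl) <;> omega
    · intro hj
      rcases hd j (by omega) with rfl | rfl | rfl | rfl
      · exact Or.inl rfl
      · exact Or.inr rfl
      · omega
      · omega
  set U := ℬ 1 ⊓ Subalgebra.toSubmodule A with hUdef
  have hU3 : finrank k U = 3 := by
    have e := hf 1 _ ht1
    rw [Finset.sum_pair hj01, hd0, hd1, Nat.sub_self, hA0, hdim] at e
    have : (1 + 3).choose 3 = 4 := rfl
    change _ = finrank k U + 1 at e
    omega
  have h6 : 6 ≤ finrank k (U * U : Submodule k B) :=
    hR.six_le_finrank_mul_self_of_finrank_eq hz hindep hgen inf_le_left hU3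
  have hUU : U * U ≤ ℬ 2 ⊓ Subalgebra.toSubmodule A := mul_self_le_of_le h le_rfl
  have hfin2 := hR.finite_component 2
  have hfin2' : Module.Finite k (ℬ 2 ⊓ Subalgebra.toSubmodule A : Submodule k B) :=
    Submodule.finiteDimensional_inf_left _ _
  have h6' := h6.trans (Submodule.finrank_mono hUU)
  have hten : (2 + 3).choose 3 = 10 := rfl
  -- If `w j'` has degree two, degree two gives `10 = dim A₂ + 3 + 1 + 1`, so `dim A₂ = 5`, contrary
  -- to `dim A₂ ≥ dim U² ≥ 6`.
  rcases hd'.eq_or_lt with hd' | hd'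
  · have e := hf 2 {j₀, j₁, j₂, j'} fun j => by
      simp only [Finset.mem_insert, Finset.mem_singleton]
      refine ⟨?_, hd j⟩
      rintro (rfl | rfl | rfl | rfl) <;> omega
    rw [Finset.sum_insert (by simp [hj01, hj02, hj0]), Finset.sum_insert (by simp [hj12, hj1]),
      Finset.sum_pair hj2, hd0, hd1, hd2, ← hd', Nat.sub_self, hA0, hdim] at e
    change _ = _ + (finrank k U + _) at e
    rw [Nat.sub_zero] at e
    omega
  · have ht2 : ∀ j, j ∈ ({j₀, j₁, j₂} : Finset J) ↔ deg j ≤ 2 := fun j => by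
      simp only [Finset.mem_insert, Finset.mem_singleton]
      constructor
      · rintro (rfl | rfl | rfl) <;> omega
      · intro hj
        rcases hd j hj with h | h | h | rfl
        · exact Or.inl h
        · exact Or.inr (Or.inl h)
        · exact Or.inr (Or.inr h)
        · omega
    have e := hf 2 _ ht2
    rw [Finset.sum_insert (by simp [hj01, hj02]), Finset.sum_pair hj12, hd0, hd1, hd2,
      Nat.sub_self, hA0, hdim, Nat.sub_zero] at e
    change _ = _ + (finrank k U + _) at e
    -- Now `10 = dim A₂ + 3 + 1`, so `A₂` has dimension six and equals `U²`.
    have hUU' : U * U = ℬ 2 ⊓ Subalgebra.toSubmodule A :=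
      Submodule.eq_of_le_of_finrank_le hUU (by omega)
    have hy1 : y ∈ ℬ 1 := by
      have := hdeg j₁
      rwa [h1, hd1] at this
    -- It follows that `B` is spanned over `A` by the powers of `y`. No power of `y` involves the
    -- basis element `w j'`, which therefore could not be reached.
    have htop := mul_span_pow_eq_top (A := A) (U := U) (y := y) hgen inf_le_right (fun i => ?_) ?_
    · have hker : Subalgebra.toSubmodule A * Submodule.span k (Set.range fun i : ℕ => y ^ i) ≤
          LinearMap.ker (leftCoeff hw j') := Submodule.mul_le.2 fun a ha q hq => by
        rw [LinearMap.mem_ker, leftCoeff_mul hw j' ⟨a, ha⟩]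
        have : Submodule.span k (Set.range fun i : ℕ => y ^ i) ≤
            LinearMap.ker (leftCoeff hw j') := Submodule.span_le.2 (by
          rintro _ ⟨i, rfl⟩
          obtain ⟨j, hj, hji⟩ := hpow i
          have := leftCoeff_mul_of_ne hw hj.symm 1
          rwa [OneMemClass.coe_one, one_mul, hji] at this)
        rw [LinearMap.mem_ker.1 (this hq), mul_zero]
      have h2 := (leftCoeff_self hw j').symm.trans
        (LinearMap.mem_ker.1 (hker (htop ▸ Submodule.mem_top (x := w j'))))
      exact one_ne_zero (congrArg Subtype.val h2)
    · obtain ⟨hc, he⟩ := eq_sum_leftCoeff_of_mem hw h hA hdeg (hz i) _ ht1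
      rw [Finset.sum_pair hj01, h0, h1, mul_one] at he
      have h2 := hc j₀ (by simp)
      have h3 := hc j₁ (by simp)
      rw [hd0] at h2
      rw [hd1] at h3
      rw [he]
      exact add_mem (Submodule.mem_sup_left ⟨h2, Subtype.property _⟩)
        (Submodule.mem_sup_right (mul_mem_span_of_mem_zero h h3))
    · refine Submodule.mul_le.2 fun y' hy' a ha => ?_
      obtain ⟨s, rfl⟩ := Submodule.mem_span_singleton.1 hy'
      rw [smul_mul_assoc]
      refine Submodule.smul_mem _ _ ?_
      have hya : y * a ∈ ℬ 2 := SetLike.GradedMul.mul_mem hy1 ha.1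
      obtain ⟨hc, he⟩ := eq_sum_leftCoeff_of_mem hw h hA hdeg hya _ ht2
      -- The commutation rule involves only `w j₁`, `w j'` and `1`, so `w j₂` does not occur and `y
      -- * a` lies in `U * y + U²`.
      have hzero : leftCoeff hw j₂ (y * a) = 0 := by
        obtain ⟨a₁, ha₁, a', ha', a₀, ha₀, e⟩ := hcomm a ha.2
        rw [e, map_add, map_add]
        have e1 := leftCoeff_mul_of_ne hw hj12.symm ⟨a₁, ha₁⟩
        have e2 := leftCoeff_mul_of_ne hw hj2 ⟨a', ha'⟩
        have e3 := leftCoeff_mul_of_ne hw hj02.symm ⟨a₀, ha₀⟩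
        rw [h0, mul_one] at e3
        rw [e1, e2, e3, add_zero, add_zero]
      rw [Finset.sum_insert (by simp [hj01, hj02]), Finset.sum_pair hj12, hzero,
        ZeroMemClass.coe_zero, zero_mul, add_zero, h0, mul_one, h1] at he
      have h2 := hc j₀ (by simp)
      have h3 := hc j₁ (by simp)
      rw [hd0] at h2
      rw [hd1] at h3
      rw [he]
      refine add_mem (Submodule.mem_sup_right ?_) (Submodule.mem_sup_left
        (Submodule.mul_mem_mul ⟨h3, Subtype.property _⟩ (Submodule.mem_span_singleton_self y)))
      rw [hUU']
      exact ⟨h2, Subtype.property _⟩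

end Degrees

/-! ### From a double extension to a regular quotient. -/

section ExtensionToQuotient

open Module

variable {k : Type*} [Field k] {B : Type u} [Ring B] [Algebra k B] {ℬ : ℕ → Submodule k B}
variable {A : Subalgebra k B}

/-- The coefficients in the commutation rule of a double extension are homogeneous. -/
lemma exists_commutation_of_mem {y₁ y₂ : B} (h : IsConnectedGraded ℬ)
    (hA : DirectSum.IsInternal (subalgebraGrading ℬ A)) (hy₁ : y₁ ∈ ℬ 1) (hy₂ : y₂ ∈ ℬ 1)
    (R : IsRightDoubleExtension ℬ A 1 1 y₁ y₂) {y a : B} (hy : y ∈ ({y₁, y₂} : Set B))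
    (ha : a ∈ ℬ 1 ⊓ Subalgebra.toSubmodule A) :
    ∃ a₁ ∈ ℬ 1 ⊓ Subalgebra.toSubmodule A, ∃ a₂ ∈ ℬ 1 ⊓ Subalgebra.toSubmodule A,
      ∃ a₀ ∈ ℬ 2 ⊓ Subalgebra.toSubmodule A, y * a = a₁ * y₁ + a₂ * y₂ + a₀ := by
  have := h.gradedMonoid
  obtain ⟨a₁, ha₁, a₂, ha₂, a₀, ha₀, e⟩ := R.commutation a ha.2 y hy
  have hyB : y ∈ ℬ 1 := by rcases hy with rfl | rfl <;> assumption
  refine ⟨natComponent h.isInternal 1 a₁, ⟨natComponent_mem _ _ _,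
    natComponent_mem_of_isInternal h.isInternal hA ha₁ 1⟩, natComponent h.isInternal 1 a₂,
    ⟨natComponent_mem _ _ _, natComponent_mem_of_isInternal h.isInternal hA ha₂ 1⟩,
    natComponent h.isInternal 2 a₀, ⟨natComponent_mem _ _ _,
    natComponent_mem_of_isInternal h.isInternal hA ha₀ 2⟩, ?_⟩
  have key : ∀ c, ∀ y ∈ ℬ 1, intComponent h 2 (c * y) = natComponent h.isInternal 1 c * y :=
    fun c y hy => by
      rw [← intComponent_natCast h]
      exact intComponent_mul_right h (i := 1) (by rwa [intGrading_one]) 2 c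
  have e' := congrArg (intComponent h 2) e
  rw [map_add, map_add, key _ _ hy₁, key _ _ hy₂, intComponent_of_mem h (r := y * a) (by
    rw [intGrading_two]
    exact SetLike.GradedMul.mul_mem hyB ha.1)] at e'
  rw [e', ← intComponent_natCast h 2]
  rfl

lemma mul_top_isTwoSided {z : Fin 4 → B} (hgen : Algebra.adjoin k (Set.range z) = ⊤)
    {V : Submodule k B} (hz : ∀ i, Submodule.span k {z i} * V ≤ V * ⊤) (r : B) :
    ∀ w ∈ V * (⊤ : Submodule k B), r * w ∈ V * (⊤ : Submodule k B) := by
  have hr : r ∈ Algebra.adjoin k (Set.range z) := hgen ▸ Algebra.mem_top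
  induction hr using Algebra.adjoin_induction with
  | mem r hr =>
    obtain ⟨i, rfl⟩ := hr
    intro w hw
    have h1 : z i * w ∈ Submodule.span k {z i} * (V * ⊤) :=
      Submodule.mul_mem_mul (Submodule.mem_span_singleton_self _) hw
    rw [← mul_assoc] at h1
    have h2 := mul_le_mul_left (hz i) ⊤ h1
    rw [mul_assoc] at h2
    exact mul_le_mul_right (le_top (a := (⊤ * ⊤ : Submodule k B))) _ h2
  | algebraMap c =>
    intro w hw
    rw [← Algebra.smul_def]
    exact Submodule.smul_mem _ _ hw
  | add b b' _ _ hb hb' =>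
    intro x hx
    rw [add_mul]
    exact add_mem (hb x hx) (hb' x hx)
  | mul b b' _ _ hb hb' =>
    intro x hx
    rw [mul_assoc]
    exact hb _ (hb' x hx)

lemma adjoin_quotientByPairMk_eq_top {z : Fin 4 → B}
    (hgen : Algebra.adjoin k (Set.range z) = ⊤) {x₁ x₂ y₁ y₂ : B}
    (hz : ∀ i, z i ∈ Submodule.span k {x₁, x₂} ⊔ Submodule.span k {y₁, y₂}) :
    Algebra.adjoin k {quotientByPairMk k x₁ x₂ y₁, quotientByPairMk k x₁ x₂ y₂} = ⊤ := by
  have h1 : (Algebra.adjoin k (Set.range z)).map (quotientByPairMk k x₁ x₂) = ⊤ := by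
    rw [hgen, Algebra.map_top]
    exact (AlgHom.range_eq_top _).2 (quotientByPairMk_surjective x₁ x₂)
  rw [AlgHom.map_adjoin] at h1
  rw [eq_top_iff, ← h1]
  refine Algebra.adjoin_le ?_
  rintro _ ⟨_, ⟨i, rfl⟩, rfl⟩
  obtain ⟨v, hv, y, hy, e⟩ := Submodule.mem_sup.1 (hz i)
  rw [← e, map_add, quotientByPairMk_of_mem hv, zero_add]
  obtain ⟨s, t, rfl⟩ := Submodule.mem_span_pair.1 hy
  rw [map_add, map_smul, map_smul]
  exact Subalgebra.add_mem _ (Subalgebra.smul_mem _ (Algebra.subset_adjoin (by simp)) _)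
    (Subalgebra.smul_mem _ (Algebra.subset_adjoin (by simp)) _)

/-- A double extension by two elements of degree one has a quadratic relation in the degree one
part of the subalgebra, and the quotient by that part is regular of dimension two. -/
theorem IsASRegular.exists_isASRegular_quotient [IsAlgClosed k] [IsDomain B]
    (hB : IsASRegular ℬ 4) {z : Fin 4 → B} (hz : ∀ i, z i ∈ ℬ 1) (hindep : LinearIndependent k z)
    (hgen : Algebra.adjoin k (Set.range z) = ⊤)
    (hA : DirectSum.IsInternal (subalgebraGrading ℬ A)) {y₁ y₂ : B} (hy₁ : y₁ ∈ ℬ 1)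
    (hy₂ : y₂ ∈ ℬ 1) (R : IsRightDoubleExtension ℬ A 1 1 y₁ y₂)
    (L : IsLeftDoubleExtension ℬ A 1 1 y₁ y₂) :
    ∃ x₁ ∈ ℬ 1, ∃ x₂ ∈ ℬ 1, HasQuadraticRelation k x₁ x₂ ∧
      IsASRegular (quotientGrading k ℬ x₁ x₂) 2 := by
  have hL := hB.isLeftASRegular
  have h := hB.connected
  have := h.gradedMonoid
  have hdim := hL.finrank_four hz hindep hgen
  have hpow := degree_eq_pow h hz hgen
  let w : ℕ × ℕ → B := fun n => y₁ ^ n.1 * y₂ ^ n.2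
  have hw : ∀ b : B, ∃! c : ℕ × ℕ →₀ A, b = c.sum fun j a => (a : B) * w j := R.basis
  have hdeg : ∀ n : ℕ × ℕ, w n ∈ ℬ (n.1 + n.2) := fun n => by
    rw [hpow, pow_add]
    exact Submodule.mul_mem_mul (Submodule.pow_mem_pow _ hy₁ _) (Submodule.pow_mem_pow _ hy₂ _)
  have hf := finrank_eq_sum_of_leftBasis hw h hA hL.finite_component hdeg
  have hA0 : finrank k (ℬ 0 ⊓ Subalgebra.toSubmodule A : Submodule k B) = 1 := by
    have : ℬ 0 ≤ Subalgebra.toSubmodule A := by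
      rw [h.zero_eq, Submodule.one_le]
      exact A.one_mem
    rw [inf_eq_left.2 this, hdim]
    rfl
  have ht1 : ∀ j, j ∈ ({(0, 0), (1, 0), (0, 1)} : Finset (ℕ × ℕ)) ↔ j.1 + j.2 ≤ 1 := by
    rintro ⟨i, j⟩
    simp only [Finset.mem_insert, Finset.mem_singleton, Prod.mk.injEq]
    omega
  have ht2 : ∀ j, j ∈ ({(0, 0), (1, 0), (0, 1), (2, 0), (1, 1), (0, 2)} : Finset (ℕ × ℕ)) ↔
      j.1 + j.2 ≤ 2 := by
    rintro ⟨i, j⟩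
    simp only [Finset.mem_insert, Finset.mem_singleton, Prod.mk.injEq]
    omega
  set V := ℬ 1 ⊓ Subalgebra.toSubmodule A with hV
  have hV2 : finrank k V = 2 := by
    have e := hf 1 _ ht1
    rw [hdim] at e
    simp [hA0] at e
    exact e
  -- Degree two of the free module reads `10 = dim A₂ + 2 + 2 + 1 + 1 + 1`.
  have hA2 : finrank k (ℬ 2 ⊓ Subalgebra.toSubmodule A : Submodule k B) = 3 := by
    have e := hf 2 _ ht2
    rw [hdim, Finset.sum_insert (by simp), Finset.sum_insert (by simp),
      Finset.sum_insert (by simp), Finset.sum_insert (by simp), Finset.sum_pair (by simp)] at e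
    change 10 = _ + (finrank k V + (finrank k V +
      (finrank k (ℬ 0 ⊓ Subalgebra.toSubmodule A : Submodule k B) +
      (finrank k (ℬ 0 ⊓ Subalgebra.toSubmodule A : Submodule k B) +
      finrank k (ℬ 0 ⊓ Subalgebra.toSubmodule A : Submodule k B))))) at e
    rw [hA0, hV2] at e
    exact (Nat.add_right_cancel (m := 7) e).symm
  have hVB : V ≤ ℬ 1 := inf_le_left
  have hfin1 := hL.finite_component 1
  have hfin2 := hL.finite_component 2
  have hVfin : Module.Finite k V := Submodule.finiteDimensional_of_le hVB
  have hA2fin : Module.Finite k (ℬ 2 ⊓ Subalgebra.toSubmodule A : Submodule k B) :=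
    Submodule.finiteDimensional_inf_left _ _
  let b := Module.finBasisOfFinrankEq k V hV2
  obtain ⟨x₁, x₂, hxind, hxV⟩ : ∃ x₁ x₂ : B, LinearIndependent k ![x₁, x₂] ∧
      Submodule.span k {x₁, x₂} = V := by
    have hb : LinearIndependent k fun i => (b i : B) :=
      b.linearIndependent.map' V.subtype (Submodule.ker_subtype V)
    have hb' : (fun i => (b i : B)) = ![(b 0 : B), (b 1 : B)] := by
      ext i
      fin_cases i <;> rfl
    have hspan := span_range_eq_of_card_eq_finrank (fun i => (b i).2) hb hV2.symm
    rw [hb'] at hb hspan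
    exact ⟨b 0, b 1, hb, by
      rwa [Matrix.range_cons_cons_empty] at hspan⟩
  have hx₁ : x₁ ∈ V := hxV ▸ Submodule.subset_span (by simp)
  have hx₂ : x₂ ∈ V := hxV ▸ Submodule.subset_span (by simp)
  -- The pencil bound gives `dim V² ≥ 3 = dim A₂`. So `V` generates `A` in degree two, and `V ⊗ V`,
  -- of dimension four, has a relation.
  have hVV : V * V = ℬ 2 ⊓ Subalgebra.toSubmodule A := by
    refine Submodule.eq_of_le_of_finrank_le (mul_self_le_of_le h le_rfl) ?_
    have hVne : V ≠ ⊥ := by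
      intro h0
      rw [h0, finrank_bot] at hV2
      omega
    have : FiniteDimensional k (V * V : Submodule k B) :=
      Submodule.finiteDimensional_of_le (mul_self_le_of_le h le_rfl)
    have := finrank_add_one_le_of_mul_mem (W := V * V) hxind hVne
      (fun v hv => Submodule.mul_mem_mul hx₁ hv) (fun v hv => Submodule.mul_mem_mul hx₂ hv)
    omega
  have hquad : HasQuadraticRelation k x₁ x₂ :=
    hasQuadraticRelation_of_finrank_le hxind (by rw [hxV, hVV, hA2])
  refine ⟨x₁, hVB hx₁, x₂, hVB hx₂, hquad, ?_⟩
  have hE : ℬ 1 = V ⊔ Submodule.span k {y₁, y₂} := by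
    refine le_antisymm (fun e he => ?_) (sup_le hVB (Submodule.span_le.2 ?_))
    · obtain ⟨hc, hs⟩ := eq_sum_leftCoeff_of_mem hw h hA hdeg he _ ht1
      rw [Finset.sum_insert (by simp), Finset.sum_pair (by simp)] at hs
      have h0 := hc (0, 0) (by simp)
      have h1 := mul_mem_span_of_mem_zero h (y := y₁) (hc (1, 0) (by simp))
      have h2 := mul_mem_span_of_mem_zero h (y := y₂) (hc (0, 1) (by simp))
      have hw0 : w (0, 0) = 1 := by simp [w]
      have hw1 : w (1, 0) = y₁ := by simp [w]
      have hw2 : w (0, 1) = y₂ := by simp [w]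
      rw [hw0, hw1, hw2, mul_one] at hs
      rw [hs]
      exact add_mem (Submodule.mem_sup_left ⟨h0, Subtype.property _⟩)
        (Submodule.mem_sup_right (add_mem (Submodule.span_mono (by simp) h1)
          (Submodule.span_mono (by simp) h2)))
    · rintro _ (rfl | rfl) <;> assumption
  have hyV : ∀ y ∈ ({y₁, y₂} : Set B), ∀ v ∈ V, y * v ∈ V * (⊤ : Submodule k B) := by
    intro y hy v hv
    obtain ⟨a₁, ha₁, a₂, ha₂, a₀, ha₀, e⟩ := exists_commutation_of_mem h hA hy₁ hy₂ R hy hv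
    rw [e]
    rw [← hVV] at ha₀
    exact add_mem (add_mem (Submodule.mul_mem_mul ha₁ Submodule.mem_top)
      (Submodule.mul_mem_mul ha₂ Submodule.mem_top)) ((mul_le_mul_right le_top V : V * V ≤ V * ⊤) ha₀)
  have hBV : ℬ 1 * V ≤ V * ⊤ := by
    rw [hE, Submodule.sup_mul, sup_le_iff]
    refine ⟨mul_le_mul_right le_top _, Submodule.mul_le.2 fun y hy v hv => ?_⟩
    obtain ⟨s, t, rfl⟩ := Submodule.mem_span_pair.1 hy
    rw [add_mul, smul_mul_assoc, smul_mul_assoc]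
    exact add_mem (Submodule.smul_mem _ _ (hyV y₁ (by simp) v hv))
      (Submodule.smul_mem _ _ (hyV y₂ (by simp) v hv))
  have htwo := mul_top_isTwoSided hgen (V := V) fun i => (mul_le_mul_left
    ((Submodule.span_singleton_le_iff_mem _ _).2 (hz i)) V).trans hBV
  -- The commutation rule moves `V` to the left past all generators, so `V * B` is the whole
  -- two-sided ideal.
  have hker : ∀ r, quotientByPairMk k x₁ x₂ r = 0 → r ∈ V * (⊤ : Submodule k B) := by
    have h1 : ∀ x ∈ V, x ∈ V * (⊤ : Submodule k B) := fun x hx => by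
      simpa using Submodule.mul_mem_mul hx (Submodule.mem_top (x := (1 : B)) (R := k))
    refine fun r hr => mem_of_quotientByPairMk_eq_zero (h1 _ hx₁) (h1 _ hx₂) htwo
      (fun r w hw => ?_) hr
    have h2 := Submodule.mul_mem_mul hw (Submodule.mem_top (x := r) (R := k))
    rw [mul_assoc] at h2
    exact mul_le_mul_right (le_top (a := (⊤ * ⊤ : Submodule k B))) _ h2
  -- Coefficients of elements of `V * B` begin in degree one, so a scalar combination of the
  -- monomials `y₁ ^ i * y₂ ^ j` in the ideal is trivial.
  have hcoeff : ∀ r ∈ V * (⊤ : Submodule k B), ∀ j,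
      intComponent h 0 (leftCoeff hw j r : B) = 0 := by
    intro r hr j
    induction hr using Submodule.mul_induction_on' with
    | mem_mul_mem v hv s _ =>
      have h1 := leftCoeff_mul hw j ⟨v, hv.2⟩ s
      rw [h1, MulMemClass.coe_mul, intComponent_mul_left h (i := 1)
        (by rw [intGrading_one]; exact hv.1), intComponent_of_neg h (by norm_num),
        LinearMap.zero_apply, mul_zero]
    | add r _ s _ hr hs => rw [map_add, AddMemClass.coe_add, map_add, hr, hs, add_zero]
  have hindepC : LinearIndependent k fun m : ℕ × ℕ =>
      quotientByPairMk k x₁ x₂ y₁ ^ m.1 * quotientByPairMk k x₁ x₂ y₂ ^ m.2 := by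
    rw [linearIndependent_iff']
    intro s g hg i hi
    have h1 : quotientByPairMk k x₁ x₂ (∑ m ∈ s, g m • w m) = 0 := by
      rw [← hg, map_sum]
      refine Finset.sum_congr rfl fun m _ => ?_
      rw [map_smul, map_mul, map_pow, map_pow]
    have h2 := hcoeff _ (hker _ h1) i
    have h3 : leftCoeff hw i (∑ m ∈ s, g m • w m) = algebraMap k A (g i) := by
      have h4 : ∀ m, g m • w m = (algebraMap k A (g m) : A) * w m := fun m => Algebra.smul_def _ _
      simp only [h4]
      rw [map_sum, Finset.sum_eq_single_of_mem i hi
        fun m _ hm => leftCoeff_mul_of_ne hw hm.symm _, leftCoeff_mul_same]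
    rw [h3] at h2
    have h5 : intComponent h 0 (algebraMap k B (g i)) = algebraMap k B (g i) :=
      intComponent_of_mem h (by
        rw [intGrading_zero, h.zero_eq]
        exact Submodule.mem_one.2 ⟨_, rfl⟩)
    have h6 : algebraMap k B (g i) = 0 := h5.symm.trans h2
    exact (map_eq_zero_iff _ (algebraMap k B).injective).1 h6
  have hgenC := adjoin_quotientByPairMk_eq_top hgen (x₁ := x₁) (x₂ := x₂) (y₁ := y₁) (y₂ := y₂)
    fun i => by rw [hxV, ← hE]; exact hz i
  have hπV : ∀ v ∈ V, quotientByPairMk k x₁ x₂ v = 0 := fun v hv =>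
    quotientByPairMk_of_mem (hxV.symm ▸ hv)
  have hπVV : ∀ v ∈ ℬ (1 + 1), v ∈ A → quotientByPairMk k x₁ x₂ v = 0 := fun v hv hvA => by
    have h1 : v ∈ V * V := by
      rw [hVV]
      exact ⟨hv, hvA⟩
    have h2 : V * V ≤ LinearMap.ker (quotientByPairMk k x₁ x₂).toLinearMap :=
      Submodule.mul_le.2 fun x hx y hy => by
        rw [LinearMap.mem_ker, AlgHom.toLinearMap_apply, map_mul, hπV x hx, zero_mul]
    exact h2 h1
  obtain ⟨q, p, τ₁, hτ₁, τ₂, hτ₂, τ₀, hτ₀, -, hd₁, hd₂, hd₀, hrel⟩ := R.relation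
  obtain ⟨q', p', σ₁, hσ₁, σ₂, hσ₂, σ₀, hσ₀, -, he₁, he₂, he₀, hrel'⟩ := L.relation
  have hrelC := congrArg (quotientByPairMk k x₁ x₂) hrel
  simp only [map_add, map_smul, map_mul, map_pow, hπV _ ⟨hd₁, hτ₁⟩, hπV _ ⟨hd₂, hτ₂⟩,
    hπVV _ hd₀ hτ₀, zero_mul, add_zero] at hrelC
  have hrelC' := congrArg (quotientByPairMk k x₁ x₂) hrel'
  simp only [map_add, map_smul, map_mul, map_pow, hπV _ ⟨he₁, hσ₁⟩, hπV _ ⟨he₂, hσ₂⟩,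
    hπVV _ he₀ hσ₀, mul_zero, add_zero] at hrelC'
  -- If `q = 0`, the right relation makes `y₂ * y₁` a multiple of `y₁ ^ 2` in the quotient, and the
  -- left relation then does the same for `y₁ * y₂`, against independence of the monomials.
  have hq : q ≠ 0 := by
    rintro rfl
    rw [zero_smul, zero_add] at hrelC
    rw [hrelC, smul_smul, ← add_smul] at hrelC'
    have h1 := hindepC.comp ![((1, 1) : ℕ × ℕ), (2, 0)] (by decide)
    have h2 := Fintype.linearIndependent_iff.1 h1 ![1, -(q' * p + p')] (by
      simp only [Fin.sum_univ_two, Function.comp_apply, Matrix.cons_val_zero,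
        Matrix.cons_val_one, pow_one, pow_zero, mul_one, one_smul, neg_smul]
      rw [hrelC']
      exact add_neg_cancel _) 0
    exact one_ne_zero h2
  have hplane : IsQuantumPlane (quotientByPairMk k x₁ x₂ y₁) (quotientByPairMk k x₁ x₂ y₂) q p :=
    ⟨hq, by rw [hrelC, pow_two], hindepC, hgenC⟩
  have hgrading : quotientGrading k ℬ x₁ x₂ = monomialSpan k (quotientByPairMk k x₁ x₂ y₁)
      (quotientByPairMk k x₁ x₂ y₂) := by
    ext1 n
    rw [← pow_eq_monomialSpan hplane.mul_mem_span]
    change (ℬ n).map (quotientByPairMk k x₁ x₂).toLinearMap = _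
    have h1 : (ℬ 1).map (quotientByPairMk k x₁ x₂).toLinearMap =
        Submodule.span k {quotientByPairMk k x₁ x₂ y₁, quotientByPairMk k x₁ x₂ y₂} := by
      rw [hE, Submodule.map_sup, Submodule.map_span, Set.image_pair]
      have h2 : V.map (quotientByPairMk k x₁ x₂).toLinearMap = ⊥ := by
        rw [eq_bot_iff]
        rintro _ ⟨v, hv, rfl⟩
        exact hπV v hv
      rw [h2, bot_sup_eq]
      rfl
    rw [hpow, Submodule.map_pow, h1]
  exact hgrading ▸ hplane.isASRegular

/-- A double extension of a regular algebra of dimension four is an extension by two elements of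
degree one. -/
theorem IsLeftASRegular.degrees_eq_one [IsAlgClosed k] [IsDomain B] (hR : IsLeftASRegular ℬ 4)
    {z : Fin 4 → B} (hz : ∀ i, z i ∈ ℬ 1) (hindep : LinearIndependent k z)
    (hgen : Algebra.adjoin k (Set.range z) = ⊤)
    (hA : DirectSum.IsInternal (subalgebraGrading ℬ A)) {d₁ d₂ : ℕ} (hd₁ : 0 < d₁) (hd₂ : 0 < d₂)
    {y₁ y₂ : B} (hy₁ : y₁ ∈ ℬ d₁) (hy₂ : y₂ ∈ ℬ d₂)
    (R : IsRightDoubleExtension ℬ A d₁ d₂ y₁ y₂) : d₁ = 1 ∧ d₂ = 1 := by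
  have h := hR.connected
  have := h.gradedMonoid
  let w : ℕ × ℕ → B := fun n => y₁ ^ n.1 * y₂ ^ n.2
  let deg : ℕ × ℕ → ℕ := fun n => n.1 * d₁ + n.2 * d₂
  have hw : ∀ b : B, ∃! c : ℕ × ℕ →₀ A, b = c.sum fun j a => (a : B) * w j := R.basis
  have hdeg : ∀ n, w n ∈ ℬ (deg n) := fun n => by
    have e1 := SetLike.pow_mem_graded n.1 hy₁
    have e2 := SetLike.pow_mem_graded n.2 hy₂
    exact SetLike.GradedMul.mul_mem e1 e2
  have hw0 : w (0, 0) = 1 := by simp [w]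
  have hw1 : w (1, 0) = y₁ := by simp [w]
  have hw2 : w (0, 1) = y₂ := by simp [w]
  rcases eq_or_ne d₁ 1 with h1 | h1
  · refine ⟨h1, ?_⟩
    by_contra h2
    subst h1
    refine hR.false_of_degrees hz hindep hgen hA hw hdeg (j₀ := (0, 0)) (j₁ := (1, 0))
      (j₂ := (2, 0)) (j' := (0, 1)) hw0 hw1 (fun i => ⟨(i, 0), by simp, by simp [w]⟩) (by simp)
      (by simp) (by simp) (by simp) (by simp) (by simp) (by simp [deg]) (by simp [deg])
      (by simp [deg]) (by simp only [deg]; omega) ?_ ?_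
    · rintro ⟨i, j⟩ hij
      simp only [deg, mul_one] at hij
      have hj : j < 2 := by
        by_contra hj
        have : 2 * 2 ≤ j * d₂ := Nat.mul_le_mul (by omega) (by omega)
        omega
      simp only [Prod.mk.injEq]
      interval_cases j <;> omega
    · intro a ha
      obtain ⟨a₁, ha₁, a₂, ha₂, a₀, ha₀, e⟩ := R.commutation a ha y₁ (by simp)
      exact ⟨a₁, ha₁, a₂, ha₂, a₀, ha₀, by rw [hw1, hw2, e]⟩
  · exfalso
    rcases eq_or_ne d₂ 1 with h2 | h2
    · subst h2
      refine hR.false_of_degrees hz hindep hgen hA hw hdeg (j₀ := (0, 0)) (j₁ := (0, 1))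
        (j₂ := (0, 2)) (j' := (1, 0)) hw0 hw2 (fun i => ⟨(0, i), by simp, by simp [w]⟩) (by simp)
        (by simp) (by simp) (by simp) (by simp) (by simp) (by simp [deg]) (by simp [deg])
        (by simp [deg]) (by simp only [deg]; omega) ?_ ?_
      · rintro ⟨i, j⟩ hij
        simp only [deg, mul_one] at hij
        have hi : i < 2 := by
          by_contra hi
          have : 2 * 2 ≤ i * d₁ := Nat.mul_le_mul (by omega) (by omega)
          omega
        simp only [Prod.mk.injEq]
        interval_cases i <;> omega
      · intro a ha
        obtain ⟨a₁, ha₁, a₂, ha₂, a₀, ha₀, e⟩ := R.commutation a ha y₂ (by simp)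
        exact ⟨a₂, ha₂, a₁, ha₁, a₀, ha₀, by rw [hw1, hw2, e, add_comm (a₁ * y₁)]⟩
    · have ht : ∀ j, j ∈ ({(0, 0)} : Finset (ℕ × ℕ)) ↔ deg j ≤ 1 := by
        rintro ⟨i, j⟩
        simp only [Finset.mem_singleton, Prod.mk.injEq, deg]
        constructor
        · rintro ⟨rfl, rfl⟩
          simp
        · intro hij
          constructor
          · by_contra hi
            have : 1 * 2 ≤ i * d₁ := Nat.mul_le_mul (by omega) (by omega)
            omega
          · by_contra hj
            have : 1 * 2 ≤ j * d₂ := Nat.mul_le_mul (by omega) (by omega)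
            omega
      -- With both adjoined elements in degree at least two, degree one of `B` lies in `A`. Then `A`
      -- is all of `B`, although `y₁` is a basis element other than `1`.
      have hzA : ∀ i, z i ∈ A := fun i => by
        obtain ⟨-, he⟩ := eq_sum_leftCoeff_of_mem hw h hA hdeg (hz i) _ ht
        rw [Finset.sum_singleton, hw0, mul_one] at he
        rw [he]
        exact Subtype.property _
      have htop : A = ⊤ := by
        rw [eq_top_iff, ← hgen]
        exact Algebra.adjoin_le (Set.range_subset_iff.2 hzA)
      exact notMem_of_leftBasis hw (j₀ := (0, 0)) (j := (1, 0)) hw0 (by simp)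
        (htop ▸ Algebra.mem_top)

end ExtensionToQuotient

end

theorem proposition0p3 {k : Type*} [Field k] [IsAlgClosed k]
    {B : Type*} [Ring B] [IsDomain B] [Algebra k B] (ℬ : ℕ → Submodule k B)
    (hB : IsASRegular ℬ 4)
    (z : Fin 4 → B) (hz_deg : ∀ i, z i ∈ ℬ 1) (hz_indep : LinearIndependent k z)
    (hz_gen : Algebra.adjoin k (Set.range z) = ⊤) :
    List.TFAE [
      ∃ A : Subalgebra k B, IsDoubleExtension ℬ A,
      ∃ A : Subalgebra k B, IsASRegular (subalgebraGrading ℬ A) 2 ∧ IsDoubleExtension ℬ A,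
      ∃ x₁ ∈ ℬ 1, ∃ x₂ ∈ ℬ 1, HasQuadraticRelation k x₁ x₂ ∧
        IsASRegular (quotientGrading k ℬ x₁ x₂) 2] := by
  tfae_have 1 → 3 := by
    rintro ⟨A, -, hA, d₁, d₂, hd₁, hd₂, y₁, hy₁, y₂, hy₂, hR, hL⟩
    obtain ⟨rfl, rfl⟩ := hB.isLeftASRegular.degrees_eq_one hz_deg hz_indep hz_gen hA.isInternal
      hd₁ hd₂ hy₁ hy₂ hR
    exact hB.exists_isASRegular_quotient hz_deg hz_indep hz_gen hA.isInternal hy₁ hy₂ hR hL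
  tfae_have 3 → 2 := by
    rintro ⟨x₁, hx₁, x₂, hx₂, hrel, hC⟩
    exact hB.exists_isDoubleExtension hz_deg hz_indep hz_gen hx₁ hx₂ hrel hC
  tfae_have 2 → 1 := fun ⟨A, _, hA⟩ => ⟨A, hA⟩
  tfae_finish
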